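/- **Setting.** Let $d\ge 2$ and let $\Omega\subset\mathbb R^d$ be a nonempty bounded open set with $\mathcal C^1$ boundary, outward unit normal $n(x)$ and surface measure $\pi$ on $\partial\Omega$. Let $m$ be a $\sigma$-finite nonnegative Borel measure on $\mathbb R^d$, invariant under the orthogonal group, with support $V$, such that $0\in V$, $m(\{0\})=0$ and $m(V\cap B(0,r))>0$ for all $r>0$. Put $\Gamma_\pm=\{(x,v)\in\partial\Omega\times V:\ \pm v\cdot n(x)>0\}$, $d\mu_\pm=|v\cdot n(x)|\,\pi(dx)\otimes m(dv)$ on $\Gamma_\pm$, let $L^1_\pm=L^1(\Gamma_\pm,d\mu_\pm)$ be the complex $L^1$ spaces, and let $\tau_-(x,v)=\inf\{s>0:\ x-sv\notin\Omega\}$. For $\lambda\in\overline{\mathbb C}_+=\{\mathrm{Re}\,\lambda\ge0\}$ let $\mathsf M_\lambda:L^1_-\to L^1_+$ be the bounded operator $$\mathsf M_\lambda u(x,v)=e^{-\lambda\tau_-(x,v)}\,u(x-\tau_-(x,v)v,v),\qquad (x,v)\in\Gamma_+ .$$ Let $\mathsf H:L^1_+\to L^1_-$ be a bounded operator of the form $\mathsf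 H\psi(x,v)=\int_{v'\cdot n(x)>0}k(x,v,v')\psi(x,v')\,|v'\cdot n(x)|\,m(dv')$, $(x,v)\in\Gamma_-$, with a nonnegative measurable kernel $k$ such that $\int_{v\cdot n(x)<0}k(x,v,v')|v\cdot n(x)|\,m(dv)=1$ for a.e. $(x,v')\in\Gamma_+$. Assume: 1. there is an integer $n\ge0$ such that $\mathsf H$ is bounded from $L^1_+$ into $L^1(\Gamma_-,\max(1,|v|^{-n-1})d\mu_-)$; 2. $\mathsf H\mathsf M_0\mathsf H:L^1_+\to L^1_-$ is weakly compact; 3. $\mathsf M_0\mathsf H$ is irreducible on $L^1_+$; 4. there are $\mathsf p\in\mathbb N$ and $C>0$ with $\int_{\mathbb R}\|(\mathsf M_{\varepsilon+i\eta}\mathsf H)^{\mathsf p}\|_{\mathscr B(L^1_+)}\,d\eta\le C$ for all $\varepsilon\ge0$. The algebraic multiplicity of an isolated point $z$ of the spectrum $\mathfrak S(T)$ of a bounded operator $T$ is the dimension of the range of the spectral projection $\frac1{2i\pi}\oint_{|w-z|=r}(w-T)^{-1}dw$ ($r>0$ small). **Statement.** (a) For every $\lambda\in\overline{\mathbb C}_+$,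 $$\mathfrak S(\mathsf M_\lambda\mathsf H)=\{0\}\cup\{\nu_j(\lambda):\ j\in\mathbb N_\lambda\},\qquad \mathbb N_\lambda\subset\mathbb N,$$ where the $\nu_j(\lambda)$ are pairwise distinct and nonzero, each is an isolated eigenvalue of $\mathsf M_\lambda\mathsf H$ of finite algebraic multiplicity, and $0$ is their only possible accumulation point. If $\lambda\ne0$, then $|\nu_j(\lambda)|<1$ for all $j\in\mathbb N_\lambda$. (b) There is $\varphi_0\in L^1_+$ with $\varphi_0>0$ a.e., $\mathsf M_0\mathsf H\varphi_0=\varphi_0$ and $\int_{\Gamma_+}\varphi_0\,d\mu_+=1$, and there are $\epsilon>0$ and $\delta_0>0$ such that, for all $\lambda\in\overline{\mathbb C}_+$ with $|\lambda|\le\delta_0$, $$\mathfrak S(\mathsf M_\lambda\mathsf H)\cap\{z\in\mathbb C:\ |z-1|<\epsilon\}=\{\nu(\lambda)\},$$ where $\nu(\lambda)$ is an algebraically simple (multiplicity one) eigenvalue of $\mathsf M_\lambda\mathsf H$. There are an eigenfunction $\varphi_\lambda\in L^1_+$ of $\mathsf M_\lambda\mathsf H$ and an eigenfunction $\varphi_\lambda^\star\in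 L^\infty(\Gamma_+,d\mu_+)$ of the dual operator $(\mathsf M_\lambda\mathsf H)^\star$ associated with $\nu(\lambda)$ such that, as $\lambda\to0$ in $\overline{\mathbb C}_+$, $$\nu(\lambda)\to1,\qquad \|\varphi_\lambda-\varphi_0\|_{L^1_+}\to0,\qquad \|\varphi^\star_\lambda-\mathbf 1_{\Gamma_+}\|_{L^\infty(\Gamma_+,d\mu_+)}\to0 .$$ (c) Let $\delta>0$ be such that $\mathscr C_\delta=\{\lambda:\ 0\le\mathrm{Re}\,\lambda\le\delta,\ |\mathrm{Im}\,\lambda|\le\delta\}\subset\{|\lambda|<\delta_0\}$. Then $\nu$ is differentiable on $\mathscr C_\delta$ (relative to $\mathscr C_\delta$), and the limit of $\nu'(\lambda)$ as $\lambda\to0$ in $\mathscr C_\delta$ exists, with $$\nu'(0)=\lim_{\lambda\to0}\nu'(\lambda)=-\int_{\Gamma_+}\tau_-(x,v)\,\varphi_0(x,v)\,d\mu_+(x,v)<0,$$ the integral being finite. -/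

import Mathlib

open MeasureTheory Filter Topology Set
open scoped ENNReal NNReal RealInnerProductSpace

noncomputable section

namespace Kinetic

/-- The Euclidean space `ℝ^d`. -/
abbrev E (d : ℕ) : Type := EuclideanSpace ℝ (Fin d)

/-! ### The spatial domain -/

/-- `ρ` is a `C¹` function near `x` with nonzero gradient at `x`, and `Ω = {ρ < 0}` near `x`. -/
def IsDefiningFunctionAt {d : ℕ} (Ω : Set (E d)) (x : E d) (ρ : E d → ℝ) : Prop :=
  ContDiffAt ℝ 1 ρ x ∧ gradient ρ x ≠ 0 ∧ ∀ᶠ y in 𝓝 x, (y ∈ Ω ↔ ρ y < 0)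

/-- The boundary of `Ω` is of class `C¹` (with `Ω` locally on one side of it). -/
def HasC1Boundary {d : ℕ} (Ω : Set (E d)) : Prop :=
  ∀ x ∈ frontier Ω, ∃ ρ : E d → ℝ, IsDefiningFunctionAt Ω x ρ

open Classical in
/-- The outward unit normal `n(x)` at `x ∈ ∂Ω`: the normalised gradient of a local defining
function (it does not depend on the defining function); it is `0` where there is none. -/
def outerNormal {d : ℕ} (Ω : Set (E d)) (x : E d) : E d :=
  if h : x ∈ frontier Ω ∧ ∃ ρ : E d → ℝ, IsDefiningFunctionAt Ω x ρ then
    (‖gradient h.2.choose x‖⁻¹ : ℝ) • gradient h.2.choose x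
  else 0

/-- The travel time `τ₋(x, v) = inf {s > 0 : x - s v ∉ Ω}`. -/
def tauMinus {d : ℕ} (Ω : Set (E d)) (p : E d × E d) : ℝ :=
  sInf {s : ℝ | 0 < s ∧ p.1 - s • p.2 ∉ Ω}

/-! ### The phase space and its boundary; the velocity space is `V = m.support` -/

/-- The standing assumptions on the phase space `Ω × V`, where `V` is the support of `m`. -/
structure PhaseSpace {d : ℕ} (Ω : Set (E d)) (m : Measure (E d)) : Prop where
  two_le : 2 ≤ d
  isOpen : IsOpen Ω
  nonempty : Ω.Nonempty
  isBounded : Bornology.IsBounded Ω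
  boundary : HasC1Boundary Ω
  orthogonally_invariant : ∀ R : E d ≃ₗᵢ[ℝ] E d, m.map R = m
  zero_mem : (0 : E d) ∈ m.support
  measure_zero : m {0} = 0
  measure_ball_pos : ∀ r : ℝ, 0 < r → 0 < m (m.support ∩ Metric.ball 0 r)

/-- `Γ₊ = {(x, v) ∈ ∂Ω × V : v · n(x) > 0}`. -/
def GammaPlus {d : ℕ} (Ω : Set (E d)) (m : Measure (E d)) : Set (E d × E d) :=
  {p | p.1 ∈ frontier Ω ∧ p.2 ∈ m.support ∧ 0 < ⟪p.2, outerNormal Ω p.1⟫}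

/-- `Γ₋ = {(x, v) ∈ ∂Ω × V : v · n(x) < 0}`. -/
def GammaMinus {d : ℕ} (Ω : Set (E d)) (m : Measure (E d)) : Set (E d × E d) :=
  {p | p.1 ∈ frontier Ω ∧ p.2 ∈ m.support ∧ ⟪p.2, outerNormal Ω p.1⟫ < 0}

/-- The measure `|v · n(x)| π(dx) ⊗ m(dv)` on `∂Ω × ℝ^d`, where `π` is the surface measure
on `∂Ω`, i.e. the `(d-1)`-dimensional Hausdorff measure normalised as Lebesgue measure. -/
def boundaryMeasure {d : ℕ} (Ω : Set (E d)) (m : Measure (E d)) : Measure (E d × E d) :=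
  (((μHE[d - 1] : Measure (E d)).restrict (frontier Ω)).prod m).withDensity
    (fun p => ENNReal.ofReal |⟪p.2, outerNormal Ω p.1⟫|)

/-- The measure `μ₊` carried by `Γ₊`. -/
def muPlus {d : ℕ} (Ω : Set (E d)) (m : Measure (E d)) : Measure (E d × E d) :=
  (boundaryMeasure Ω m).restrict (GammaPlus Ω m)

/-- The measure `μ₋` carried by `Γ₋`. -/
def muMinus {d : ℕ} (Ω : Set (E d)) (m : Measure (E d)) : Measure (E d × E d) :=
  (boundaryMeasure Ω m).restrict (GammaMinus Ω m)

/-- The complex trace space `L¹₊ = L¹(Γ₊, dμ₊)`. -/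
abbrev L1plus {d : ℕ} (Ω : Set (E d)) (m : Measure (E d)) := Lp ℂ 1 (muPlus Ω m)

/-- The complex trace space `L¹₋ = L¹(Γ₋, dμ₋)`. -/
abbrev L1minus {d : ℕ} (Ω : Set (E d)) (m : Measure (E d)) := Lp ℂ 1 (muMinus Ω m)

/-- The dual space `L^∞(Γ₊, dμ₊)` of `L¹₊`. -/
abbrev LinfPlus {d : ℕ} (Ω : Set (E d)) (m : Measure (E d)) := Lp ℂ ∞ (muPlus Ω m)

/-- The constant function `1` in `L^∞(Γ₊, dμ₊)`. -/
def onePlus {d : ℕ} (Ω : Set (E d)) (m : Measure (E d)) : LinfPlus Ω m :=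
  (memLp_top_const (1 : ℂ)).toLp (fun _ => (1 : ℂ))

/-- The duality bracket `⟨ψ, g⟩ = ∫ ψ g dμ₊` between `L¹₊` and `L^∞(Γ₊, dμ₊)`. -/
def bracket {d : ℕ} {Ω : Set (E d)} {m : Measure (E d)} (ψ : L1plus Ω m) (g : LinfPlus Ω m) : ℂ :=
  ∫ p, ψ p * g p ∂(muPlus Ω m)

/-! ### The operators `M_λ` and `H` -/

/-- The bounded operator `M : L¹₋ → L¹₊` acts as
`M u (x, v) = exp (-l τ₋(x, v)) u (x - τ₋(x, v) v, v)` on `Γ₊`. -/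
def IsFlightOperator {d : ℕ} (Ω : Set (E d)) (m : Measure (E d)) (l : ℂ)
    (M : L1minus Ω m →L[ℂ] L1plus Ω m) : Prop :=
  ∀ u : L1minus Ω m, ∀ᵐ p ∂(muPlus Ω m),
    M u p = Complex.exp (-(l * (tauMinus Ω p : ℂ))) * u (p.1 - tauMinus Ω p • p.2, p.2)

open Classical in
/-- The operator `M_l : L¹₋ → L¹₊`: the bounded operator given by the formula
`M_l u (x, v) = exp (-l τ₋(x, v)) u (x - τ₋(x, v) v, v)`. At most one bounded operator satisfies
the formula; it exists for `Re l ≥ 0`, and the value `0` is a convention for the case that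
the formula does not define a bounded operator. -/
def flight {d : ℕ} (Ω : Set (E d)) (m : Measure (E d)) (l : ℂ) :
    L1minus Ω m →L[ℂ] L1plus Ω m :=
  if h : ∃ M : L1minus Ω m →L[ℂ] L1plus Ω m, IsFlightOperator Ω m l M then h.choose else 0

/-- The bounded operator `M_l H` on `L¹₊`. -/
def MH {d : ℕ} {Ω : Set (E d)} {m : Measure (E d)} (H : L1plus Ω m →L[ℂ] L1minus Ω m) (l : ℂ) :
    L1plus Ω m →L[ℂ] L1plus Ω m :=
  (flight Ω m l).comp H

/-- `H` is a (nonnegative, stochastic) diffuse boundary operator: it is given by a nonnegative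
measurable kernel `k` through
`H ψ (x, v) = ∫_{v' · n(x) > 0} k (x, v, v') ψ (x, v') |v' · n(x)| m(dv')`, `(x, v) ∈ Γ₋`,
with `∫_{v · n(x) < 0} k (x, v, v') |v · n(x)| m(dv) = 1` for almost every `(x, v') ∈ Γ₊`. -/
def IsDiffuse {d : ℕ} {Ω : Set (E d)} {m : Measure (E d)}
    (H : L1plus Ω m →L[ℂ] L1minus Ω m) : Prop :=
  ∃ k : E d → E d → E d → ℝ,
    Measurable (fun q : E d × E d × E d => k q.1 q.2.1 q.2.2) ∧
    (∀ x v v', 0 ≤ k x v v') ∧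
    (∀ᵐ p ∂(muPlus Ω m),
      ∫⁻ v in {v | (p.1, v) ∈ GammaMinus Ω m},
        ENNReal.ofReal (k p.1 v p.2 * |⟪v, outerNormal Ω p.1⟫|) ∂m = 1) ∧
    ∀ ψ : L1plus Ω m, ∀ᵐ p ∂(muMinus Ω m),
      H ψ p = ∫ v' in {v' | (p.1, v') ∈ GammaPlus Ω m},
        (k p.1 p.2 v' : ℂ) * ψ (p.1, v') * ((|⟪v', outerNormal Ω p.1⟫| : ℝ) : ℂ) ∂m

/-- `H` maps `L¹₊` boundedly into `Y⁻_s = L¹(Γ₋, max(1, |v|^{-s}) dμ₋)`. -/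
def MapsBoundedlyToY {d : ℕ} {Ω : Set (E d)} {m : Measure (E d)}
    (H : L1plus Ω m →L[ℂ] L1minus Ω m) (s : ℕ) : Prop :=
  ∃ C : ℝ≥0, ∀ ψ : L1plus Ω m,
    ∫⁻ p, ENNReal.ofReal (max 1 ((‖p.2‖ ^ s)⁻¹)) * ‖H ψ p‖ₑ ∂(muMinus Ω m) ≤ C * ‖ψ‖ₑ

/-- A bounded operator is weakly compact if the image of the closed unit ball has a compact
closure in the weak topology. -/
def IsWeaklyCompact {X Y : Type*} [NormedAddCommGroup X] [NormedSpace ℂ X]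
    [NormedAddCommGroup Y] [NormedSpace ℂ Y] (T : X →L[ℂ] Y) : Prop :=
  IsCompact (closure ((fun x => toWeakSpace ℂ Y (T x)) '' Metric.closedBall (0 : X) 1))

/-- Irreducibility of a (nonnegative) operator on `L¹(μ)`: the only invariant closed ideals
`{ψ : ψ = 0 a.e. outside A}` are the trivial ones. -/
def IsIrreducible {α : Type*} [MeasurableSpace α] {μ : Measure α}
    (T : Lp ℂ 1 μ →L[ℂ] Lp ℂ 1 μ) : Prop :=
  ∀ A : Set α, MeasurableSet A →
    (∀ ψ : Lp ℂ 1 μ, (∀ᵐ p ∂μ, p ∉ A → ψ p = 0) → ∀ᵐ p ∂μ, p ∉ A → T ψ p = 0) →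
    μ A = 0 ∨ μ Aᶜ = 0

/-- The standing assumptions on the boundary operator `H`. -/
structure BoundaryAssumptions {d : ℕ} {Ω : Set (E d)} {m : Measure (E d)}
    (H : L1plus Ω m →L[ℂ] L1minus Ω m) : Prop where
  diffuse : IsDiffuse H
  gain : ∃ n : ℕ, MapsBoundedlyToY H (n + 1)
  weakly_compact : IsWeaklyCompact (H.comp (MH H 0))
  irreducible : IsIrreducible (MH H 0)
  power_integrable : ∃ (N : ℕ) (C : ℝ≥0), ∀ ε : ℝ, 0 ≤ ε →
    ∫⁻ η : ℝ, ‖(MH H ((ε : ℂ) + (η : ℂ) * Complex.I)) ^ N‖ₑ ≤ C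

/-! ### Spectral notions -/

/-- `z` is an eigenvalue of the bounded operator `T`. -/
def IsEigenvalue {X : Type*} [NormedAddCommGroup X] [NormedSpace ℂ X]
    (T : X →L[ℂ] X) (z : ℂ) : Prop :=
  ∃ x : X, x ≠ 0 ∧ T x = z • x

/-- The Riesz projection `(2πi)⁻¹ ∮_{|w - z| = r} (w - T)⁻¹ dw`. -/
def rieszProjection {X : Type*} [NormedAddCommGroup X] [NormedSpace ℂ X]
    (T : X →L[ℂ] X) (z : ℂ) (r : ℝ) : X →L[ℂ] X :=
  ((2 * Real.pi * Complex.I : ℂ)⁻¹) • ∮ w in C(z, r), resolvent T w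

/-- `z` is an isolated point of the spectrum of `T`, of finite algebraic multiplicity `n`: the
range of the spectral projection of `T` at `z` has dimension `n`. -/
def IsIsolatedOfAlgMult {X : Type*} [NormedAddCommGroup X] [NormedSpace ℂ X]
    (T : X →L[ℂ] X) (z : ℂ) (n : ℕ) : Prop :=
  ∃ r : ℝ, 0 < r ∧ spectrum ℂ T ∩ Metric.closedBall z r = {z} ∧
    FiniteDimensional ℂ (LinearMap.range (rieszProjection T z r).toLinearMap) ∧
    Module.finrank ℂ (LinearMap.range (rieszProjection T z r).toLinearMap) = n

/-- The closed right half-plane. -/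
def closedRHP : Set ℂ := {l | 0 ≤ l.re}

/-- The rectangle `{l : 0 ≤ Re l ≤ δ, |Im l| ≤ δ}`. -/
def rect (δ : ℝ) : Set ℂ := {l | 0 ≤ l.re ∧ l.re ≤ δ ∧ |l.im| ≤ δ}

end Kinetic

end

noncomputable section

namespace Kinetic

section

/-! ### Basic facts on complex `L¹` spaces -/

section L1

variable {X : Type*} [MeasurableSpace X] {μ : Measure X}

/-! The operators $T_\lambda=\mathsf M_\lambda\mathsf H$ have the form $e^{-\lambda\tau_-}T_0$,
where $T_0$ is positive, preserves the integral and is irreducible. The spectral statements follow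
from this form and three further facts: $T_0^2$ maps the unit ball to an equi-integrable set,
$\tau_-T_0$ is bounded on $L^1$, and a power of $T_{i\eta}$ is norm integrable in $\eta$.
`IsTransportFamily` records these properties; the proof consists of the spectral theory of such
families and of their verification for $\mathsf M_\lambda\mathsf H$.

Compactness. Since $|T_\lambda\psi|\le T_0|\psi|$, every $T_\lambda^2$ is equi-integrable, and a
product of two equi-integrable operators is compact (`IsEquiIntegrable.isCompactOperator_comp`).
Indeed, the composition of $S$ with averaging over finer and finer partitions has kernels which form
a uniformly integrable martingale, so that $S$ is approximated by finite rank operators uniformly on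
order intervals, and the other factor sends the unit ball close to an order interval. Hence
$T_\lambda^4$ is compact, and Riesz theory gives isolated eigenvalues of finite multiplicity. The
point $0$ is in the spectrum because slow particles provide non-negligible sets of arbitrarily small
measure, on which the square of an invertible operator cannot be equi-integrable.

Peripheral eigenvalues. If $T_\lambda\psi=z\psi$ with $|z|\ge1$, then $|\psi|\le T_0|\psi|$, with
equality by conservation of mass, and $|\psi|>0$ by irreducibility. For $\mathrm{Re}\,\lambda>0$ the
damping factor contradicts this. For $\lambda=i\eta\ne0$, Wielandt's argument shows that
multiplication by the phase of $\psi$ intertwines $e^{-i\eta\tau_-}T_0$ with $zT_0$, so that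
$T_{ik\eta}$ has the unimodular eigenvalue $z^k$ for every $k\in\mathbb N$. The norm of the power
then stays above $1/2$ on infinitely many disjoint intervals of equal length, which contradicts its
integrability (`IsTransportFamily.no_peripheral`).

Perturbation. Write $T_\lambda=S_\lambda+\ell\otimes\varphi_0$ with $\ell$ the integral. Then $1$ is
not in the spectrum of $S_0$, and the eigenvalues of $T_\lambda$ near $1$ are the zeros of
$1-\ell((w-S_\lambda)^{-1}\varphi_0)$, a function so close to $w-1$ that it has exactly one zero,
which is simple (`exists_eigenvalue_near_one`). The eigenvectors $(w-S_\lambda)^{-1}\varphi_0$ and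
$\ell\circ(w-S_\lambda)^{-1}$ depend continuously on $\lambda$. Pairing $T_\lambda\varphi_\lambda$
with the left eigenvector at another parameter expresses the increments of $\nu$ through those of
$T$, which are differentiated by dominated convergence.

Geometry. That $\mathsf M_0$ preserves mass means that the ballistic map carries $\mu_+$ to $\mu_-$
(`PhaseSpace.measurePreserving_ballistic`). For a fixed velocity $v$, the flux through a small
nontangential piece of the boundary is $|v|$ times the area of its projection along $v$, up to a
factor arbitrarily close to $1$, because a $\mathcal C^1$ surface is almost flat at small scales. A
point and its exit point have the same projection, and the tangency points project to a null set
(`HasC1Boundary.measure_shadow_grazing`). Finally, weak compactness of $\mathsf H\mathsf M_0\mathsf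
H$ yields equi-integrability (`IsWeaklyCompact.equiIntegrable_comp`), and the bound on $\tau_-T_0$
comes from $\tau_-\le\mathrm{diam}/|v|$ and the gain of $|v|^{-n-1}$. -/

lemma L1_norm_eq (ψ : Lp ℂ 1 μ) : ‖ψ‖ = ∫ p, ‖ψ p‖ ∂μ := L1.norm_eq_integral_norm ψ

lemma L1_integrable (ψ : Lp ℂ 1 μ) : Integrable ψ μ := L1.integrable_coeFn ψ

/-- The element of `L¹` given by an integrable function (and `0` if it is not integrable). -/
def ofFun (μ : Measure X) (f : X → ℂ) : Lp ℂ 1 μ :=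
  open Classical in if h : Integrable f μ then h.toL1 f else 0

lemma coeFn_ofFun {f : X → ℂ} (h : Integrable f μ) : ofFun μ f =ᵐ[μ] f := by
  rw [ofFun, dif_pos h]; exact h.coeFn_toL1

lemma norm_ofFun {f : X → ℂ} (h : Integrable f μ) : ‖ofFun μ f‖ = ∫ p, ‖f p‖ ∂μ := by
  rw [L1_norm_eq]
  exact integral_congr_ae ((coeFn_ofFun h).mono fun p hp => by simp only [hp])

lemma L1_norm_le_of_ae_le {ψ φ : Lp ℂ 1 μ} (h : ∀ᵐ p ∂μ, ‖ψ p‖ ≤ ‖φ p‖) : ‖ψ‖ ≤ ‖φ‖ := by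
  rw [L1_norm_eq, L1_norm_eq]
  exact integral_mono_ae (L1_integrable ψ).norm (L1_integrable φ).norm h

lemma L1_norm_sub_eq (ψ φ : Lp ℂ 1 μ) : ‖ψ - φ‖ = ∫ p, ‖ψ p - φ p‖ ∂μ := by
  rw [L1_norm_eq]
  exact integral_congr_ae ((Lp.coeFn_sub ψ φ).mono fun p hp => by simp only [hp, Pi.sub_apply])

/-- The integral as a continuous linear functional on `L¹`. -/
def integralCLM (μ : Measure X) : Lp ℂ 1 μ →L[ℂ] ℂ :=
  LinearMap.mkContinuous
    { toFun := fun ψ => ∫ p, ψ p ∂μ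
      map_add' := fun ψ φ => by
        rw [← integral_add (L1_integrable ψ) (L1_integrable φ)]
        exact integral_congr_ae (Lp.coeFn_add ψ φ)
      map_smul' := fun c ψ => by
        rw [RingHom.id_apply, ← integral_smul]
        exact integral_congr_ae (Lp.coeFn_smul c ψ) } 1
    (fun ψ => by
      rw [one_mul, L1_norm_eq]
      exact norm_integral_le_integral_norm _)

@[simp] lemma integralCLM_apply (ψ : Lp ℂ 1 μ) : integralCLM μ ψ = ∫ p, ψ p ∂μ := rfl

/-- Multiplication of `L¹` functions by a bounded measurable function. -/
def mulCLM (μ : Measure X) (b : X → ℂ) (hb : AEStronglyMeasurable b μ) (C : ℝ)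
    (hC : ∀ᵐ p ∂μ, ‖b p‖ ≤ C) : Lp ℂ 1 μ →L[ℂ] Lp ℂ 1 μ :=
  LinearMap.mkContinuous
    { toFun := fun ψ => ((L1_integrable ψ).bdd_mul hb hC).toL1 (fun p => b p * ψ p)
      map_add' := fun ψ φ => by
        apply Lp.ext
        filter_upwards [((L1_integrable (ψ + φ)).bdd_mul hb hC).coeFn_toL1,
          Lp.coeFn_add (((L1_integrable ψ).bdd_mul hb hC).toL1 (fun p => b p * ψ p))
            (((L1_integrable φ).bdd_mul hb hC).toL1 (fun p => b p * φ p)),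
          ((L1_integrable ψ).bdd_mul hb hC).coeFn_toL1,
          ((L1_integrable φ).bdd_mul hb hC).coeFn_toL1, Lp.coeFn_add ψ φ] with p h1 h2 h3 h4 h5
        rw [h1, h2, Pi.add_apply, h3, h4, h5, Pi.add_apply, mul_add]
      map_smul' := fun c ψ => by
        apply Lp.ext
        filter_upwards [((L1_integrable (c • ψ)).bdd_mul hb hC).coeFn_toL1,
          Lp.coeFn_smul c (((L1_integrable ψ).bdd_mul hb hC).toL1 (fun p => b p * ψ p)),
          ((L1_integrable ψ).bdd_mul hb hC).coeFn_toL1, Lp.coeFn_smul c ψ] with p h1 h2 h3 h5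
        rw [h1, RingHom.id_apply, h2, Pi.smul_apply, h3, h5, Pi.smul_apply, smul_eq_mul,
          smul_eq_mul]
        ring } C
    (fun ψ => by
      rw [L1_norm_eq, L1_norm_eq, ← integral_const_mul]
      apply integral_mono_ae (L1_integrable _).norm ((L1_integrable ψ).norm.const_mul C)
      filter_upwards [((L1_integrable ψ).bdd_mul hb hC).coeFn_toL1, hC] with p h1 h2
      change ‖(((L1_integrable ψ).bdd_mul hb hC).toL1 (fun p => b p * ψ p)) p‖ ≤ _
      rw [h1, norm_mul]
      gcongr)

lemma coeFn_mulCLM {b : X → ℂ} (hb : AEStronglyMeasurable b μ) {C : ℝ}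
    (hC : ∀ᵐ p ∂μ, ‖b p‖ ≤ C) (ψ : Lp ℂ 1 μ) :
    mulCLM μ b hb C hC ψ =ᵐ[μ] fun p => b p * ψ p :=
  ((L1_integrable ψ).bdd_mul hb hC).coeFn_toL1

/-- `f_n ψ → ψ` in `L¹` when `f_n → 1` boundedly and pointwise. -/
lemma tendsto_L1_of_dominated {ψ : Lp ℂ 1 μ} {F : ℕ → Lp ℂ 1 μ} {b : X → ℝ}
    (hb : Integrable b μ) (hF : ∀ n, ∀ᵐ p ∂μ, ‖F n p - ψ p‖ ≤ b p)
    (hlim : ∀ᵐ p ∂μ, Tendsto (fun n => F n p) atTop (𝓝 (ψ p))) :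
    Tendsto F atTop (𝓝 ψ) := by
  rw [tendsto_iff_norm_sub_tendsto_zero]
  simp_rw [L1_norm_sub_eq]
  have := tendsto_integral_of_dominated_convergence (μ := μ)
    (F := fun n p => ‖F n p - ψ p‖) (f := fun _ => 0) b
    (fun n => ((L1_integrable (F n)).sub (L1_integrable ψ)).norm.aestronglyMeasurable) hb
    (fun n => (hF n).mono fun p hp => by simpa using hp)
    (hlim.mono fun p hp => by
      rw [← tendsto_iff_norm_sub_tendsto_zero]; exact hp)
  simpa using this

/-- Every `L¹` function is the limit of its truncations at multiples of a positive weight. -/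
lemma exists_seq_orderBounded (w : X → ℝ) (hw : ∀ p, 0 < w p)
    (hwm : AEStronglyMeasurable w μ) (ψ : Lp ℂ 1 μ) :
    ∃ F : ℕ → Lp ℂ 1 μ, Tendsto F atTop (𝓝 ψ) ∧
      (∀ n, ∀ᵐ p ∂μ, ‖F n p‖ ≤ n * w p) ∧ ∀ n, ∀ᵐ p ∂μ, F n p = ψ p ∨ F n p = 0 := by
  classical
  set A : ℕ → Set X := fun n => {p | ‖ψ p‖ ≤ n * w p} with hA
  have hAm : ∀ n, NullMeasurableSet (A n) μ := fun n =>
    nullMeasurableSet_le (Lp.aestronglyMeasurable ψ).norm.aemeasurable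
      (hwm.aemeasurable.const_mul _)
  have hint : ∀ n, Integrable ((A n).indicator ψ) μ := fun n =>
    (L1_integrable ψ).indicator₀ (hAm n)
  refine ⟨fun n => ofFun μ ((A n).indicator ψ), ?_, fun n => ?_, fun n => ?_⟩
  · have hall : ∀ᵐ p ∂μ, ∀ n, ofFun μ ((A n).indicator ψ) p = (A n).indicator ψ p :=
      ae_all_iff.2 fun n => coeFn_ofFun (hint n)
    refine tendsto_L1_of_dominated (L1_integrable ψ).norm (fun n => ?_) ?_
    · filter_upwards [hall] with p hp
      rw [hp n]
      by_cases h : p ∈ A n <;> simp [h]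
    · filter_upwards [hall] with p hp
      obtain ⟨N, hN⟩ := exists_nat_ge (‖ψ p‖ / w p)
      refine tendsto_const_nhds.congr' ?_
      filter_upwards [eventually_ge_atTop N] with n hn
      rw [hp n, indicator_of_mem]
      rw [div_le_iff₀ (hw p)] at hN
      exact hN.trans (by have := hw p; gcongr)
  · filter_upwards [coeFn_ofFun (hint n)] with p hp
    rw [hp]
    by_cases h : p ∈ A n
    · rw [indicator_of_mem h]; exact h
    · rw [indicator_of_notMem h, norm_zero]
      exact mul_nonneg n.cast_nonneg (hw p).le
  · filter_upwards [coeFn_ofFun (hint n)] with p hp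
    rw [hp]
    by_cases h : p ∈ A n <;> simp [h]

/-- Such a weight replaces a σ-finite measure by a finite one with the same null sets; smallness of
sets and order intervals are measured with it throughout. -/
lemma exists_weight (μ : Measure X) [SigmaFinite μ] :
    ∃ w : X → ℝ, (∀ p, 0 < w p) ∧ Measurable w ∧ Integrable w μ := by
  obtain ⟨g, hg0, hgm, hgl⟩ := exists_pos_lintegral_lt_of_sigmaFinite μ (ε := 1) one_ne_zero
  refine ⟨fun p => g p, fun p => by exact_mod_cast hg0 p, hgm.coe_nnreal_real,
    hgm.coe_nnreal_real.aestronglyMeasurable, ?_⟩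
  refine lt_of_le_of_lt (lintegral_mono fun p => ?_) (hgl.trans ENNReal.one_lt_top)
  simp

/-! ### The dual of `L¹` -/

/-- Every continuous functional on `L¹` of a `σ`-finite measure is given by an `L^∞` function. -/
theorem exists_Linf_of_dual [SigmaFinite μ] (l : Lp ℂ 1 μ →L[ℂ] ℂ) :
    ∃ g : Lp ℂ ∞ μ, (∀ ψ : Lp ℂ 1 μ, l ψ = ∫ p, ψ p * g p ∂μ) ∧ ‖g‖ ≤ ‖l‖ := by
  obtain ⟨w, hw0, hwm, hwi⟩ := exists_weight μ
  -- Multiplication by $\sqrt w$ maps $L^2$ into $L^1$, so the functional pulls back to $L^2$, where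
  -- it is an inner product with some $y$; the density sought is $\bar y/\sqrt w$.
  set s : X → ℂ := fun p => (Real.sqrt (w p) : ℂ) with hs
  have hsm : Measurable s := Complex.measurable_ofReal.comp hwm.sqrt
  have hs0 : ∀ p, s p ≠ 0 := fun p => by
    simpa [hs] using (Real.sqrt_pos.2 (hw0 p)).ne'
  have hss : ∀ p, s p * s p = (w p : ℂ) := fun p => by
    rw [hs]; dsimp only; rw [← Complex.ofReal_mul, Real.mul_self_sqrt (hw0 p).le]
  have hsL : MemLp s 2 μ := by
    rw [← memLp_norm_iff hsm.aestronglyMeasurable, memLp_two_iff_integrable_sq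
      hsm.norm.aestronglyMeasurable]
    refine hwi.congr (ae_of_all _ fun p => ?_)
    simp only [hs, Complex.norm_real, Real.norm_eq_abs, sq_abs]
    exact (Real.sq_sqrt (hw0 p).le).symm
  have hmul : ∀ f : Lp ℂ 2 μ, Integrable (fun p => f p * s p) μ := fun f =>
    MemLp.integrable_mul (Lp.memLp f) hsL
  -- the embedding of `L²` into `L¹`
  have hbound : ∀ f : Lp ℂ 2 μ, ‖ofFun μ (fun p => f p * s p)‖ ≤ ‖hsL.toLp s‖ * ‖f‖ := by
    intro f
    rw [norm_ofFun (hmul f)]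
    have h1 := integral_mul_norm_le_Lp_mul_Lq (μ := μ) (f := f) (g := s) (p := 2) (q := 2)
      Real.HolderConjugate.two_two (by simpa using Lp.memLp f) (by simpa using hsL)
    rw [Lp.norm_toLp, Lp.norm_def]
    have hA : ∀ {F : X → ℂ}, MemLp F 2 μ →
        (eLpNorm F 2 μ).toReal = (∫ a, ‖F a‖ ^ (2:ℝ) ∂μ) ^ (1 / 2 : ℝ) := by
      intro F hF
      have h3 := hF.eLpNorm_eq_integral_rpow_norm two_ne_zero ENNReal.ofNat_ne_top
      rw [h3, ENNReal.toReal_ofReal (by positivity)]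
      norm_num
    rw [hA hsL, hA (Lp.memLp f), mul_comm]
    simp only [norm_mul]
    exact h1
  let J : Lp ℂ 2 μ →L[ℂ] Lp ℂ 1 μ := LinearMap.mkContinuous
    { toFun := fun f => ofFun μ (fun p => f p * s p)
      map_add' := fun f g => by
        apply Lp.ext
        filter_upwards [coeFn_ofFun (hmul (f + g)), coeFn_ofFun (hmul f), coeFn_ofFun (hmul g),
          Lp.coeFn_add (ofFun μ (fun p => f p * s p)) (ofFun μ (fun p => g p * s p)),
          Lp.coeFn_add f g] with p h1 h2 h3 h4 h5
        rw [h1, h4, Pi.add_apply, h2, h3, h5, Pi.add_apply, add_mul]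
      map_smul' := fun c f => by
        apply Lp.ext
        filter_upwards [coeFn_ofFun (hmul (c • f)), coeFn_ofFun (hmul f),
          Lp.coeFn_smul c (ofFun μ (fun p => f p * s p)), Lp.coeFn_smul c f] with p h1 h2 h4 h5
        rw [h1, RingHom.id_apply, h4, Pi.smul_apply, h2, h5, Pi.smul_apply, smul_mul_assoc] }
    ‖hsL.toLp s‖ hbound
  set y : Lp ℂ 2 μ := (InnerProductSpace.toDual ℂ (Lp ℂ 2 μ)).symm (l.comp J) with hy
  have hy1 : ∀ f : Lp ℂ 2 μ, l (ofFun μ (fun p => f p * s p)) = ∫ p, starRingEnd ℂ (y p) * f p ∂μ := by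
    intro f
    have h1 : inner ℂ y f = (l.comp J) f := by
      rw [hy, InnerProductSpace.toDual_symm_apply]
    rw [L2.inner_def] at h1
    change l (J f) = _
    rw [← ContinuousLinearMap.comp_apply, ← h1]
    refine integral_congr_ae (ae_of_all _ fun p => ?_)
    simp [mul_comm]
  set g : X → ℂ := fun p => starRingEnd ℂ (y p) / s p with hg
  have hgm : AEStronglyMeasurable g μ := by
    have : AEMeasurable (fun p => starRingEnd ℂ (y p)) μ :=
      Complex.continuous_conj.measurable.comp_aemeasurable
        (Lp.aestronglyMeasurable y).aemeasurable
    exact (this.div hsm.aemeasurable).aestronglyMeasurable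
  -- the representation for functions dominated by the weight
  have hrep : ∀ ψ : Lp ℂ 1 μ, ∀ c : ℝ, (∀ᵐ p ∂μ, ‖ψ p‖ ≤ c * w p) →
      l ψ = ∫ p, ψ p * g p ∂μ := by
    intro ψ c hc
    have hm : AEStronglyMeasurable (fun p => ψ p / s p) μ :=
      ((Lp.aestronglyMeasurable ψ).aemeasurable.div hsm.aemeasurable).aestronglyMeasurable
    have hf : MemLp (fun p => ψ p / s p) 2 μ := by
      refine MemLp.of_le_mul hsL hm (c := c) ?_
      filter_upwards [hc] with p hp
      rw [norm_div, div_le_iff₀ (norm_pos_iff.2 (hs0 p)), mul_assoc, ← norm_mul, hss p]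
      simpa [abs_of_pos (hw0 p)] using hp
    have h1 : ψ = ofFun μ (fun p => (hf.toLp _) p * s p) := by
      apply Lp.ext
      filter_upwards [coeFn_ofFun (hmul (hf.toLp _)), hf.coeFn_toLp] with p h1 h2
      rw [h1, h2, div_mul_cancel₀ _ (hs0 p)]
    rw [h1, hy1, ← h1]
    refine integral_congr_ae ?_
    filter_upwards [hf.coeFn_toLp] with p h2
    rw [h2, hg]
    have := hs0 p
    field_simp
  -- the bound on `g`
  have hgb : ∀ᵐ p ∂μ, ‖g p‖ ≤ ‖l‖ := by
    set sg : X → ℂ := fun p => if g p = 0 then 0 else starRingEnd ℂ (g p) / (‖g p‖ : ℂ) with hsg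
    obtain ⟨g', hg'm, hg'e⟩ := hgm
    -- Testing the functional on this phase times $w1_A$ gives $\int_A w|g'|\le\|l\|\int_A w$ for
    -- all $A$. Where $g'$ vanishes the quotient is $0/0=0$, which is harmless.
    set sg' : X → ℂ := fun p => starRingEnd ℂ (g' p) / (‖g' p‖ : ℂ) with hsg'
    have hsgm : Measurable sg' := by
      have h1 := hg'm.measurable
      exact (Complex.continuous_conj.measurable.comp h1).div
        (Complex.measurable_ofReal.comp h1.norm)
    have hsgb : ∀ p, ‖sg' p‖ ≤ 1 := fun p => by
      rw [hsg']; dsimp only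
      rw [norm_div]; simp only [RCLike.norm_conj, Complex.norm_real, norm_norm]
      exact div_self_le_one _
    have hsgg : ∀ p, sg' p * g' p = (‖g' p‖ : ℂ) := fun p => by
      rw [hsg']; dsimp only
      by_cases h : g' p = 0
      · simp [h]
      · have : (‖g' p‖ : ℂ) ≠ 0 := by simpa using h
        rw [div_mul_eq_mul_div, div_eq_iff this, mul_comm, Complex.mul_conj,
          Complex.normSq_eq_norm_sq]
        push_cast; ring
    have hwg : Integrable (fun p => w p * ‖g' p‖) μ := by
      have : Integrable (fun p => starRingEnd ℂ (y p) * s p) μ := by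
        have h2 : MemLp (fun p => star (y p)) 2 μ := (Lp.memLp y).star
        exact MemLp.integrable_mul h2 hsL
      refine this.norm.congr ?_
      filter_upwards [hg'e] with p hp
      rw [← hp, hg]; dsimp only
      rw [norm_mul, norm_div]
      have h1 : ‖s p‖ * ‖s p‖ = w p := by rw [← norm_mul, hss]; simp [abs_of_pos (hw0 p)]
      have h2 := norm_ne_zero_iff.2 (hs0 p)
      rw [← h1]; field_simp
    have key : ∀ᵐ p ∂μ, w p * ‖g' p‖ ≤ ‖l‖ * w p := by
      refine ae_le_of_forall_setIntegral_le hwg (hwi.const_mul _) fun A hA _ => ?_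
      set f : X → ℂ := A.indicator fun p => sg' p * w p with hf
      have hfn : ∀ p, ‖f p‖ ≤ w p := fun p => by
        rw [hf]
        by_cases h : p ∈ A
        · rw [indicator_of_mem h, norm_mul]
          have := hsgb p
          simp only [Complex.norm_real, Real.norm_eq_abs, abs_of_pos (hw0 p)]
          nlinarith [hw0 p]
        · rw [indicator_of_notMem h, norm_zero]; exact (hw0 p).le
      have hfm : Measurable f :=
        (hsgm.mul (Complex.measurable_ofReal.comp hwm)).indicator hA
      have hfi : Integrable f μ := hwi.mono' hfm.aestronglyMeasurable (ae_of_all _ hfn)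
      have h1 := hrep (ofFun μ f) 1 (by
        filter_upwards [coeFn_ofFun hfi] with p hp
        rw [hp, one_mul]; exact hfn p)
      have h2 : ∫ p, (ofFun μ f) p * g p ∂μ = ((∫ p in A, w p * ‖g' p‖ ∂μ : ℝ) : ℂ) := by
        rw [← integral_complex_ofReal, ← integral_indicator hA]
        refine integral_congr_ae ?_
        filter_upwards [coeFn_ofFun hfi, hg'e] with p hp hp'
        rw [hp, hp', hf]
        by_cases h : p ∈ A
        · rw [indicator_of_mem h, indicator_of_mem h, mul_assoc, mul_comm (w p : ℂ), ← mul_assoc,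
            hsgg]
          push_cast; ring
        · rw [indicator_of_notMem h, indicator_of_notMem h, zero_mul]
      have h3 := l.le_opNorm (ofFun μ f)
      rw [h1, h2, Complex.norm_real, norm_ofFun hfi] at h3
      refine (le_abs_self _).trans (h3.trans ?_)
      rw [integral_const_mul]
      gcongr
      rw [← integral_indicator hA]
      refine integral_mono hfi.norm (hwi.indicator hA) fun p => ?_
      by_cases h : p ∈ A
      · rw [indicator_of_mem h]; exact hfn p
      · simp [hf, h]
    filter_upwards [key, hg'e] with p hp hp'
    rw [hp']
    nlinarith [hw0 p, norm_nonneg (g' p)]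
  have hgL : MemLp g ∞ μ := memLp_top_of_bound hgm _ hgb
  refine ⟨hgL.toLp g, fun ψ => ?_, ?_⟩
  · have hint : ∀ ψ : Lp ℂ 1 μ, Integrable (fun p => g p * ψ p) μ := fun ψ =>
      (L1_integrable ψ).bdd_mul hgm hgb
    have h1 : ∫ p, ψ p * (hgL.toLp g) p ∂μ = integralCLM μ (mulCLM μ g hgm _ hgb ψ) := by
      rw [integralCLM_apply]
      refine integral_congr_ae ?_
      filter_upwards [hgL.coeFn_toLp, coeFn_mulCLM hgm hgb ψ] with p h1 h2
      rw [h1, h2, mul_comm]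
    rw [h1]
    -- Functions dominated by a multiple of the weight are dense, and both sides are continuous now
    -- that $g$ is known to be bounded.
    obtain ⟨F, hF, hFb, -⟩ := exists_seq_orderBounded w hw0 hwm.aestronglyMeasurable ψ
    refine tendsto_nhds_unique ((l.continuous.tendsto _).comp hF) ?_
    refine ((((integralCLM μ).comp (mulCLM μ g hgm _ hgb)).continuous.tendsto _).comp hF).congr ?_
    intro n
    simp only [Function.comp_apply]
    rw [hrep (F n) n (hFb n), ContinuousLinearMap.comp_apply, integralCLM_apply]
    refine integral_congr_ae ?_
    filter_upwards [coeFn_mulCLM hgm hgb (F n)] with p h2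
    rw [h2, mul_comm]
  · rw [Lp.norm_toLp]
    refine ENNReal.toReal_le_of_le_ofReal (norm_nonneg _) ?_
    rw [eLpNorm_exponent_top]
    refine eLpNormEssSup_le_of_ae_bound hgb

end L1

end

/-! ### Equi-integrable operators and averages over finite partitions -/

section

section EquiIntegrable

open MeasurableSpace ProbabilityTheory

variable {X : Type*} [MeasurableSpace X] {μ : Measure X}

/-- The measure `w μ` for a real weight `w`. -/
def weighted (μ : Measure X) (w : X → ℝ) : Measure X :=
  μ.withDensity fun p => ENNReal.ofReal (w p)

/-- A strictly positive, measurable and integrable weight. -/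
structure IsWeight (μ : Measure X) (w : X → ℝ) : Prop where
  pos : ∀ p, 0 < w p
  meas : Measurable w
  int : Integrable w μ

/-- The operator `S` sends the unit ball of `L¹` to an equi-integrable set. -/
def IsEquiIntegrable (w : X → ℝ) (S : Lp ℂ 1 μ →L[ℂ] Lp ℂ 1 μ) : Prop :=
  ∀ η : ℝ, 0 < η → ∃ δ : ℝ, 0 < δ ∧ ∀ B, MeasurableSet B →
    weighted μ w B ≤ ENNReal.ofReal δ → ∀ ψ, ∫ p in B, ‖S ψ p‖ ∂μ ≤ η * ‖ψ‖

variable {w : X → ℝ}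

lemma IsWeight.isFiniteMeasure (hw : IsWeight μ w) : IsFiniteMeasure (weighted μ w) :=
  isFiniteMeasure_withDensity_ofReal hw.int.2

lemma weighted_apply_eq (hw : IsWeight μ w) {A : Set X} (hA : MeasurableSet A) :
    weighted μ w A = ENNReal.ofReal (∫ p in A, w p ∂μ) := by
  rw [weighted, withDensity_apply _ hA, ofReal_integral_eq_lintegral_ofReal hw.int.integrableOn
    (ae_of_all _ fun p => (hw.pos p).le)]

lemma weighted_real_eq (hw : IsWeight μ w) {A : Set X} (hA : MeasurableSet A) :
    (weighted μ w).real A = ∫ p in A, w p ∂μ := by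
  rw [Measure.real, weighted_apply_eq hw hA,
    ENNReal.toReal_ofReal (integral_nonneg fun p => (hw.pos p).le)]

lemma absolutelyContinuous_weighted (hw : IsWeight μ w) : μ ≪ weighted μ w :=
  withDensity_absolutelyContinuous' hw.meas.ennreal_ofReal.aemeasurable
    (ae_of_all _ fun p => by simpa using hw.pos p)

lemma weighted_absolutelyContinuous : weighted μ w ≪ μ := withDensity_absolutelyContinuous _ _

lemma integral_weighted {F : Type*} [NormedAddCommGroup F] [NormedSpace ℝ F]
    (hw : IsWeight μ w) (g : X → F) : ∫ p, g p ∂(weighted μ w) = ∫ p, w p • g p ∂μ := by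
  have := integral_withDensity_eq_integral_smul (μ := μ) hw.meas.real_toNNReal g
  refine this.trans (integral_congr_ae (ae_of_all _ fun p => ?_))
  simp only [NNReal.smul_def, Real.coe_toNNReal _ (hw.pos p).le]

lemma setIntegral_weighted {F : Type*} [NormedAddCommGroup F] [NormedSpace ℝ F]
    (hw : IsWeight μ w) (g : X → F) {B : Set X} (hB : MeasurableSet B) :
    ∫ p in B, g p ∂(weighted μ w) = ∫ p in B, w p • g p ∂μ := by
  rw [← integral_indicator hB, ← integral_indicator hB, integral_weighted hw]
  congr 1; ext p
  by_cases h : p ∈ B <;> simp [h]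

lemma integrable_weighted_iff {F : Type*} [NormedAddCommGroup F] [NormedSpace ℝ F]
    (hw : IsWeight μ w) {g : X → F} :
    Integrable g (weighted μ w) ↔ Integrable (fun p => w p • g p) μ := by
  rw [weighted, integrable_withDensity_iff_integrable_smul' hw.meas.ennreal_ofReal
    (ae_of_all _ fun p => ENNReal.ofReal_lt_top)]
  simp only [ENNReal.toReal_ofReal (hw.pos _).le]

lemma integrable_div_weight (hw : IsWeight μ w) (ψ : Lp ℂ 1 μ) :
    Integrable (fun p => ψ p / w p) (weighted μ w) := by
  rw [integrable_weighted_iff hw]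
  refine (L1_integrable ψ).congr (ae_of_all _ fun p => ?_)
  have : (w p : ℂ) ≠ 0 := by exact_mod_cast (hw.pos p).ne'
  simp only [Complex.real_smul]; field_simp

lemma setIntegral_div_weight (hw : IsWeight μ w) (ψ : Lp ℂ 1 μ) {B : Set X}
    (hB : MeasurableSet B) :
    ∫ p in B, ψ p / w p ∂(weighted μ w) = ∫ p in B, ψ p ∂μ := by
  rw [setIntegral_weighted hw _ hB]
  congr 1; ext p
  have : (w p : ℂ) ≠ 0 := by exact_mod_cast (hw.pos p).ne'
  simp only [Complex.real_smul]; field_simp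

lemma integral_norm_div_weight (hw : IsWeight μ w) (ψ : Lp ℂ 1 μ) :
    ∫ p, ‖ψ p / w p‖ ∂(weighted μ w) = ‖ψ‖ := by
  rw [integral_weighted hw, L1_norm_eq]
  congr 1; ext p
  have := (hw.pos p).ne'
  simp only [norm_div, Complex.norm_real, Real.norm_eq_abs, abs_of_pos (hw.pos p), smul_eq_mul]
  field_simp

/-- The function `w 1_A` as an element of `L¹`. -/
def wInd (μ : Measure X) (w : X → ℝ) (A : Set X) : Lp ℂ 1 μ :=
  ofFun μ (A.indicator fun p => (w p : ℂ))

lemma IsWeight.integrable_indicator (hw : IsWeight μ w) {A : Set X} (hA : MeasurableSet A) :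
    Integrable (A.indicator fun p => (w p : ℂ)) μ := hw.int.ofReal.indicator hA

lemma coeFn_wInd (hw : IsWeight μ w) {A : Set X} (hA : MeasurableSet A) :
    wInd μ w A =ᵐ[μ] A.indicator fun p => (w p : ℂ) := coeFn_ofFun (hw.integrable_indicator hA)

lemma norm_wInd (hw : IsWeight μ w) {A : Set X} (hA : MeasurableSet A) :
    ‖wInd μ w A‖ = (weighted μ w).real A := by
  rw [wInd, norm_ofFun (hw.integrable_indicator hA), weighted_real_eq hw hA,
    ← integral_indicator hA]
  congr 1; ext p
  by_cases h : p ∈ A <;> simp [h, abs_of_pos (hw.pos p)]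

/-- The function `w 1_A` normalised in `L¹` (and `0` if `A` is negligible). -/
def normInd (μ : Measure X) (w : X → ℝ) (A : Set X) : Lp ℂ 1 μ :=
  (((weighted μ w).real A)⁻¹ : ℂ) • wInd μ w A

lemma norm_normInd_le (hw : IsWeight μ w) {A : Set X} (hA : MeasurableSet A) :
    ‖normInd μ w A‖ ≤ 1 := by
  rw [normInd, norm_smul, norm_wInd hw hA, norm_inv, Complex.norm_real, Real.norm_eq_abs,
    abs_of_nonneg measureReal_nonneg]
  exact inv_mul_le_one

lemma setIntegral_wInd (hw : IsWeight μ w) {A B : Set X} (hA : MeasurableSet A)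
    (hB : MeasurableSet B) :
    ∫ p in B, wInd μ w A p ∂μ = ((weighted μ w).real (A ∩ B) : ℂ) := by
  rw [integral_congr_ae (ae_restrict_of_ae (coeFn_wInd hw hA)), weighted_real_eq hw (hA.inter hB),
    setIntegral_indicator hA, inter_comm, ← integral_complex_ofReal]

section Partition

variable [CountablyGenerated X]

/-- The atoms of the `n`-th finite partition. -/
def atoms (X : Type*) [MeasurableSpace X] [CountablyGenerated X] (n : ℕ) : Finset (Set X) :=
  (finite_countablePartition X n).toFinset

lemma mem_atoms {n : ℕ} {A : Set X} : A ∈ atoms X n ↔ A ∈ countablePartition X n := by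
  simp [atoms]

lemma measurableSet_of_mem_atoms {n : ℕ} {A : Set X} (hA : A ∈ atoms X n) : MeasurableSet A :=
  measurableSet_countablePartition n (mem_atoms.1 hA)

lemma sum_atoms_indicator {F : Type*} [AddCommMonoid F] (n : ℕ) (f : Set X → F) (q : X) :
    ∑ A ∈ atoms X n, A.indicator (fun _ => f A) q = f (countablePartitionSet n q) := by
  rw [Finset.sum_eq_single (countablePartitionSet n q)]
  · rw [indicator_of_mem (mem_countablePartitionSet n q)]
  · intro A hA hne
    refine indicator_of_notMem (fun h => hne ?_) _
    exact (countablePartitionSet_of_mem (mem_atoms.1 hA) h).symm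
  · intro h
    exact absurd (mem_atoms.2 (countablePartitionSet_mem n q)) h

/-- Sets of the $n$-th finite σ-algebra are unions of atoms of the $n$-th partition. -/
lemma countablePartitionSet_subset {n : ℕ} {A : Set X}
    (hA : MeasurableSet[countableFiltration X n] A) {q : X} (hq : q ∈ A) :
    countablePartitionSet n q ⊆ A := by
  obtain ⟨S, hS, rfl⟩ := (measurableSet_generateFrom_countablePartition_iff n A).1 hA
  obtain ⟨s, hs, hqs⟩ := hq
  rw [countablePartitionSet_of_mem (hS hs) hqs]
  exact subset_sUnion_of_mem hs

/-- The conditional expectation on the `n`-th partition, as an operator on `L¹(μ)`. -/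
def partAvg (μ : Measure X) (w : X → ℝ) (n : ℕ) (ψ : Lp ℂ 1 μ) : Lp ℂ 1 μ :=
  ∑ A ∈ atoms X n, (∫ p in A, ψ p ∂μ) • normInd μ w A

lemma partAvg_add (n : ℕ) (ψ φ : Lp ℂ 1 μ) :
    partAvg μ w n (ψ + φ) = partAvg μ w n ψ + partAvg μ w n φ := by
  rw [partAvg, partAvg, partAvg, ← Finset.sum_add_distrib]
  refine Finset.sum_congr rfl fun A _ => ?_
  rw [← add_smul, ← integral_add (L1_integrable ψ).integrableOn (L1_integrable φ).integrableOn]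
  congr 1
  exact integral_congr_ae (ae_restrict_of_ae (Lp.coeFn_add ψ φ))

lemma partAvg_smul (n : ℕ) (c : ℂ) (ψ : Lp ℂ 1 μ) :
    partAvg μ w n (c • ψ) = c • partAvg μ w n ψ := by
  rw [partAvg, partAvg, Finset.smul_sum]
  refine Finset.sum_congr rfl fun A _ => ?_
  rw [smul_smul, ← integral_const_mul]
  congr 1
  exact integral_congr_ae (ae_restrict_of_ae (Lp.coeFn_smul c ψ))

lemma sum_setIntegral_atoms {F : Type*} [NormedAddCommGroup F] [NormedSpace ℝ F]
    {f : X → F} (hf : Integrable f μ) (n : ℕ) :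
    ∑ A ∈ atoms X n, ∫ p in A, f p ∂μ = ∫ p, f p ∂μ := by
  have h1 : ∀ p, f p = ∑ A ∈ atoms X n, A.indicator f p := fun p => by
    have := sum_atoms_indicator n (fun _ : Set X => f p) p
    rw [← this]
    refine Finset.sum_congr rfl fun A _ => ?_
    by_cases h : p ∈ A <;> simp [h]
  conv_rhs => rw [integral_congr_ae (ae_of_all _ h1)]
  rw [integral_finsetSum _ fun A hA => hf.indicator (measurableSet_of_mem_atoms hA)]
  exact Finset.sum_congr rfl fun A hA => (integral_indicator (measurableSet_of_mem_atoms hA)).symm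

lemma norm_partAvg_le (hw : IsWeight μ w) (n : ℕ) (ψ : Lp ℂ 1 μ) :
    ‖partAvg μ w n ψ‖ ≤ ‖ψ‖ := by
  refine (norm_sum_le _ _).trans ?_
  rw [L1_norm_eq, ← sum_setIntegral_atoms (L1_integrable ψ).norm n]
  refine Finset.sum_le_sum fun A hA => ?_
  rw [norm_smul]
  have h1 := norm_normInd_le hw (measurableSet_of_mem_atoms hA)
  have h2 : ‖∫ p in A, ψ p ∂μ‖ ≤ ∫ p in A, ‖ψ p‖ ∂μ := norm_integral_le_integral_norm _
  calc _ ≤ ‖∫ p in A, ψ p ∂μ‖ * 1 := by gcongr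
    _ ≤ _ := by rwa [mul_one]

/-- Sets of the `n`-th σ-algebra are preserved by the `n`-th averaging. -/
lemma partAvg_wInd (hw : IsWeight μ w) {n : ℕ} {A : Set X}
    (hA : MeasurableSet[countableFiltration X n] A) :
    partAvg μ w n (wInd μ w A) = wInd μ w A := by
  have := hw.isFiniteMeasure
  have hAm : MeasurableSet A := (countableFiltration X).le n A hA
  apply Lp.ext
  have h1 : ∀ᵐ p ∂μ, partAvg μ w n (wInd μ w A) p = ∑ B ∈ atoms X n,
      (∫ p in B, wInd μ w A p ∂μ) * ((((weighted μ w).real B)⁻¹ : ℂ) *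
        B.indicator (fun p => (w p : ℂ)) p) := by
    have hs : partAvg μ w n (wInd μ w A) =ᵐ[μ] ∑ B ∈ atoms X n,
      (((∫ p in B, wInd μ w A p ∂μ) • normInd μ w B : Lp ℂ 1 μ) : X → ℂ) := by
      rw [partAvg]; exact Lp.coeFn_finsetSum _ _
    have hB : ∀ᵐ p ∂μ, ∀ B ∈ atoms X n,
        (((∫ p in B, wInd μ w A p ∂μ) • normInd μ w B : Lp ℂ 1 μ) : X → ℂ) p =
        (∫ p in B, wInd μ w A p ∂μ) * ((((weighted μ w).real B)⁻¹ : ℂ) *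
        B.indicator (fun p => (w p : ℂ)) p) := by
      rw [Finset.eventually_all]
      intro B hB
      filter_upwards [Lp.coeFn_smul (∫ p in B, wInd μ w A p ∂μ) (normInd μ w B),
        Lp.coeFn_smul (((weighted μ w).real B)⁻¹ : ℂ) (wInd μ w B),
        coeFn_wInd hw (measurableSet_of_mem_atoms hB)] with p h1 h2 h3
      rw [h1, Pi.smul_apply, normInd, h2, Pi.smul_apply, h3, smul_eq_mul, smul_eq_mul]
    filter_upwards [hs, hB] with p h1 h2
    rw [h1, Finset.sum_apply]
    exact Finset.sum_congr rfl fun B hB => h2 B hB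
  -- On a negligible atom the normalised indicator is $0$ because $0^{-1}=0$, so the computation
  -- fails there; almost no point lies in such an atom.
  have h2 : ∀ᵐ p ∂μ, ∀ B ∈ atoms X n, (weighted μ w).real B = 0 → p ∉ B := by
    rw [Finset.eventually_all]
    intro B hB
    by_cases h0 : (weighted μ w).real B = 0
    · rw [measureReal_eq_zero_iff] at h0
      filter_upwards [measure_eq_zero_iff_ae_notMem.1 (absolutelyContinuous_weighted hw h0)]
        with p hp _ using hp
    · exact ae_of_all _ fun p h => absurd h h0
  filter_upwards [h1, h2, coeFn_wInd hw hAm] with p h1 h2 h3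
  rw [h1, h3]
  have h4 : ∀ B ∈ atoms X n, (∫ p in B, wInd μ w A p ∂μ) * ((((weighted μ w).real B)⁻¹ : ℂ) *
        B.indicator (fun p => (w p : ℂ)) p) = B.indicator (fun _ => (∫ p in B, wInd μ w A p ∂μ) *
        ((((weighted μ w).real B)⁻¹ : ℂ) * w p)) p := fun B hB => by
    by_cases h : p ∈ B <;> simp [h]
  rw [Finset.sum_congr rfl h4, sum_atoms_indicator n (fun B => (∫ p in B, wInd μ w A p ∂μ) *
        ((((weighted μ w).real B)⁻¹ : ℂ) * w p)) p,
    setIntegral_wInd hw hAm (measurableSet_countablePartitionSet n p)]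
  have hne : (weighted μ w).real (countablePartitionSet n p) ≠ 0 := fun h0 =>
    h2 _ (mem_atoms.2 (countablePartitionSet_mem n p)) h0 (mem_countablePartitionSet n p)
  by_cases hp : p ∈ A
  · rw [inter_eq_right.2 (countablePartitionSet_subset hA hp), indicator_of_mem hp]
    have : ((weighted μ w).real (countablePartitionSet n p) : ℂ) ≠ 0 := by exact_mod_cast hne
    field_simp
  · have : A ∩ countablePartitionSet n p = ∅ := by
      have := countablePartitionSet_subset hA.compl hp
      rw [← disjoint_iff_inter_eq_empty, disjoint_comm]
      exact disjoint_left.2 fun x hx => this hx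
    rw [this, indicator_of_notMem hp]
    simp

/-- The averages over finer and finer partitions converge strongly to the identity. -/
lemma partAvg_tendsto [SigmaFinite μ] (hw : IsWeight μ w) (ψ : Lp ℂ 1 μ) :
    Tendsto (fun n => partAvg μ w n ψ) atTop (𝓝 ψ) := by
  have := hw.isFiniteMeasure
  -- the closed subspace of convergence
  let V : Submodule ℂ (Lp ℂ 1 μ) :=
    { carrier := {ψ | Tendsto (fun n => partAvg μ w n ψ) atTop (𝓝 ψ)}
      add_mem' := fun {ψ φ} h1 h2 => by
        simp only [mem_ofPred_eq, partAvg_add] at *; exact h1.add h2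
      zero_mem' := by
        have : ∀ n, partAvg μ w n (0 : Lp ℂ 1 μ) = 0 := fun n => by
          simpa using partAvg_smul (w := w) n (0 : ℂ) (0 : Lp ℂ 1 μ)
        simp only [mem_ofPred_eq, this]; exact tendsto_const_nhds
      smul_mem' := fun c ψ h => by
        simp only [mem_ofPred_eq, partAvg_smul] at *; exact h.const_smul c }
  have hVc : IsClosed (V : Set (Lp ℂ 1 μ)) := by
    rw [← isSeqClosed_iff_isClosed]
    intro F φ hF hlim
    change Tendsto _ _ _
    rw [Metric.tendsto_atTop]
    intro ε hε
    obtain ⟨k, hk⟩ := (Metric.tendsto_atTop.1 hlim (ε / 3) (by positivity))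
    have hk := hk k le_rfl
    obtain ⟨N, hN⟩ := Metric.tendsto_atTop.1 (hF k) (ε / 3) (by positivity)
    refine ⟨N, fun n hn => ?_⟩
    have h1 := hN n hn
    rw [dist_eq_norm] at *
    have h2 : partAvg μ w n φ - φ = partAvg μ w n (φ - F k) + (partAvg μ w n (F k) - F k)
        + (F k - φ) := by
      have : partAvg μ w n φ = partAvg μ w n (φ - F k) + partAvg μ w n (F k) := by
        rw [← partAvg_add, sub_add_cancel]
      rw [this]; abel
    have h3 := norm_partAvg_le hw n (φ - F k)
    rw [norm_sub_rev] at h3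
    rw [h2]
    refine (norm_add₃_le).trans_lt ?_
    linarith
  have hgen : ∀ n, ∀ A, MeasurableSet[countableFiltration X n] A → wInd μ w A ∈ V := by
    intro n A hA
    refine tendsto_const_nhds.congr' ?_
    filter_upwards [eventually_ge_atTop n] with m hm
    exact (partAvg_wInd hw ((countableFiltration X).mono hm A hA)).symm
  by_contra hψ
  change ψ ∉ V at hψ
  -- Density of the convergence subspace by duality: a functional vanishing on it is given by a
  -- bounded $g$ with $\int_A wg=0$ for all sets of all levels, hence for all measurable sets, hence
  -- $g=0$.
  obtain ⟨f, u, hf1, hf2⟩ := RCLike.geometric_hahn_banach_closed_point (𝕜 := ℂ)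
    (s := (V : Set (Lp ℂ 1 μ))) (x := ψ) (V.restrictScalars ℝ).convex hVc hψ
  have hu : 0 < u := by simpa using hf1 0 V.zero_mem
  -- A functional bounded above on a subspace vanishes on it: a vector with nonzero value could be
  -- rescaled to have the forbidden value $u$.
  have hf0 : ∀ a ∈ V, f a = 0 := by
    intro a ha
    by_contra hne
    have := hf1 (((u : ℂ) / f a) • a) (V.smul_mem _ ha)
    rw [map_smul, smul_eq_mul, div_mul_cancel₀ _ hne] at this
    simp at this
  obtain ⟨g, hg, -⟩ := exists_Linf_of_dual f
  have hgi : Integrable (fun p => (w p : ℂ) * g p) μ := by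
    have h1 : ∀ᵐ p ∂μ, ‖g p‖ ≤ ‖g‖ := by
      filter_upwards [ae_le_eLpNormEssSup (f := g) (μ := μ)] with p hp
      rw [Lp.norm_def, eLpNorm_exponent_top, ← toReal_enorm]
      exact ENNReal.toReal_mono (by
        rw [← eLpNorm_exponent_top]; exact Lp.eLpNorm_ne_top g) hp
    have := hw.int.ofReal (𝕜 := ℂ) |>.bdd_mul (Lp.aestronglyMeasurable g) h1
    exact this.congr (ae_of_all _ fun p => mul_comm _ _)
  have hset : ∀ A, MeasurableSet A → f (wInd μ w A) = ∫ p in A, (w p : ℂ) * g p ∂μ := by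
    intro A hA
    rw [hg, ← integral_indicator hA]
    refine integral_congr_ae ?_
    filter_upwards [coeFn_wInd hw hA] with p hp
    rw [hp]
    by_cases h : p ∈ A <;> simp [h]
  -- The sets of all levels form a π-system generating the σ-algebra. Complements are handled
  -- through the integral over the whole space, which is zero because `univ` already belongs to
  -- level 0.
  have hzero : ∀ A, MeasurableSet A → ∫ p in A, (w p : ℂ) * g p ∂μ = 0 := by
    have hπ : IsPiSystem (⋃ n, {A | MeasurableSet[countableFiltration X n] A}) := by
      refine isPiSystem_iUnion_of_monotone _ (fun n => ?_) fun n m hnm A hA =>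
        (countableFiltration X).mono hnm A hA
      exact @MeasurableSpace.isPiSystem_measurableSet X (countableFiltration X n)
    have huniv : ∫ p, (w p : ℂ) * g p ∂μ = 0 := by
      rw [← setIntegral_univ, ← hset _ MeasurableSet.univ]
      exact hf0 _ (hgen 0 _ MeasurableSet.univ)
    refine induction_on_inter (C := fun A _ => ∫ p in A, (w p : ℂ) * g p ∂μ = 0) (s := _) ?_ hπ
      (by simp) ?_ ?_ ?_
    · conv_lhs => rw [← iSup_countableFiltration X]
      exact (MeasurableSpace.generateFrom_iUnion_measurableSet _).symm
    · intro A hA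
      obtain ⟨n, hn⟩ := mem_iUnion.1 hA
      rw [← hset A ((countableFiltration X).le n A hn)]
      exact hf0 _ (hgen n A hn)
    · intro A hA h0
      have := integral_add_compl hA hgi
      rw [h0, huniv, zero_add] at this; exact this
    · intro F hd hF h0
      have := hasSum_integral_iUnion hF hd hgi.integrableOn
      simp only [h0] at this
      exact this.unique hasSum_zero
  have hae : ∀ᵐ p ∂μ, (w p : ℂ) * g p = 0 :=
    hgi.ae_eq_zero_of_forall_setIntegral_eq_zero fun A hA _ => hzero A hA
  have : f ψ = 0 := by
    rw [hg]
    refine (integral_congr_ae ?_).trans (integral_zero X ℂ)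
    filter_upwards [hae] with p hp
    have h1 : (w p : ℂ) ≠ 0 := by exact_mod_cast (hw.pos p).ne'
    simp [(mul_eq_zero.1 hp).resolve_left h1]
  rw [this] at hf2
  simp at hf2
  linarith

end Partition

end EquiIntegrable

end

/-! ### Martingale kernels and compactness of products of equi-integrable operators -/

section

section EquiIntegrable

open MeasurableSpace ProbabilityTheory

variable {X : Type*} [MeasurableSpace X] {μ : Measure X} {w : X → ℝ}

/-- If `S` is equi-integrable, then uniformly on the unit ball the part of `S ψ` where it is large
compared with the weight is small. -/
lemma IsEquiIntegrable.exists_truncation (hw : IsWeight μ w) {S : Lp ℂ 1 μ →L[ℂ] Lp ℂ 1 μ}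
    (hS : IsEquiIntegrable w S) {η : ℝ} (hη : 0 < η) :
    ∃ C : ℝ, 0 < C ∧ ∀ ψ, ‖ψ‖ ≤ 1 → ∀ C' ≥ C,
      ∫ p in {p | C' * w p ≤ ‖S ψ p‖}, ‖S ψ p‖ ∂μ ≤ η := by
  obtain ⟨δ, hδ, h⟩ := hS η hη
  -- Chebyshev's inequality: $\|S\psi\|\le\|S\|+1$ on the unit ball, so the set where $|S\psi|\ge
  -- C'w$ has weighted measure at most $(\|S\|+1)/C'\le\delta$.
  refine ⟨(‖S‖ + 1) / δ, by positivity, fun ψ hψ C' hC' => ?_⟩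
  have hC0 : 0 < C' := lt_of_lt_of_le (by positivity) hC'
  have hm : MeasurableSet {p | C' * w p ≤ ‖S ψ p‖} :=
    measurableSet_le (hw.meas.const_mul _) (Lp.stronglyMeasurable (S ψ)).measurable.norm
  refine (h _ hm ?_ ψ).trans (by nlinarith [norm_nonneg ψ])
  rw [weighted_apply_eq hw hm]
  apply ENNReal.ofReal_le_ofReal
  have h1 : C' * ∫ p in {p | C' * w p ≤ ‖S ψ p‖}, w p ∂μ ≤ ‖S ψ‖ := by
    rw [← integral_const_mul, L1_norm_eq]
    refine (setIntegral_mono_on (hw.int.const_mul C').integrableOn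
      (L1_integrable (S ψ)).norm.integrableOn hm fun p hp => hp).trans ?_
    exact setIntegral_le_integral (L1_integrable (S ψ)).norm (ae_of_all _ fun p => norm_nonneg _)
  have h2 : ‖S ψ‖ ≤ ‖S‖ + 1 := by
    have := S.le_opNorm ψ
    nlinarith [norm_nonneg S]
  have h3 : ‖S‖ + 1 ≤ C' * δ := by rwa [ge_iff_le, div_le_iff₀ hδ] at hC'
  have h4 : C' * ∫ p in {p | C' * w p ≤ ‖S ψ p‖}, w p ∂μ ≤ C' * δ := by linarith
  exact le_of_mul_le_mul_left h4 hC0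

variable [CountablyGenerated X]

/-- The image under `S` of the normalised indicator of the atom containing `q`. -/
def atomImage (μ : Measure X) (w : X → ℝ) (S : Lp ℂ 1 μ →L[ℂ] Lp ℂ 1 μ) (n : ℕ) (q : X) :
    Lp ℂ 1 μ := S (normInd μ w (countablePartitionSet n q))

/-- The approximate integral kernels of the operator `S`, with respect to the weighted measure. -/
def approxKernel (μ : Measure X) (w : X → ℝ) (S : Lp ℂ 1 μ →L[ℂ] Lp ℂ 1 μ) (n : ℕ)
    (z : X × X) : ℂ := atomImage μ w S n z.1 z.2 / w z.2

variable {S : Lp ℂ 1 μ →L[ℂ] Lp ℂ 1 μ}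

lemma atomImage_eq (n : ℕ) (q : X) : atomImage μ w S n q =
    ∑ A ∈ atoms X n, A.indicator (fun _ => S (normInd μ w A)) q :=
  (sum_atoms_indicator n (fun A => S (normInd μ w A)) q).symm

lemma approxKernel_eq (n : ℕ) (z : X × X) : approxKernel μ w S n z =
    ∑ A ∈ atoms X n, A.indicator (fun _ => (1 : ℂ)) z.1 * (S (normInd μ w A) z.2 / w z.2) := by
  rw [approxKernel, atomImage, ← sum_atoms_indicator n
    (fun A => S (normInd μ w A) z.2 / w z.2) z.1]
  refine Finset.sum_congr rfl fun A _ => ?_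
  by_cases h : z.1 ∈ A <;> simp [h]

/-- The filtration on `X × X` generated by the partitions of the first variable. -/
def fstFiltration (X : Type*) [m : MeasurableSpace X] [CountablyGenerated X] :
    Filtration ℕ (inferInstance : MeasurableSpace (X × X)) where
  seq n := @Prod.instMeasurableSpace X X (countableFiltration X n) m
  mono' _ _ h := sup_le_sup (MeasurableSpace.comap_mono ((countableFiltration X).mono h)) le_rfl
  le' n := sup_le_sup (MeasurableSpace.comap_mono ((countableFiltration X).le n)) le_rfl

lemma measurable_approxKernel (hw : IsWeight μ w) (n : ℕ) :
    Measurable[fstFiltration X n] (approxKernel μ w S n) := by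
  have : approxKernel μ w S n = fun z => ∑ A ∈ atoms X n,
      A.indicator (fun _ => (1 : ℂ)) z.1 * (S (normInd μ w A) z.2 / w z.2) :=
    funext fun z => approxKernel_eq n z
  rw [this]
  refine @Finset.measurable_fun_sum _ _ _ _ _ _ (fstFiltration X n) _ _ fun A hA => ?_
  refine Measurable.mul ?_ ?_
  · have h1 : Measurable[countableFiltration X n] (A.indicator (fun _ => (1 : ℂ))) :=
      (@measurable_const _ _ _ (countableFiltration X n) _).indicator
        (measurableSet_countableFiltration_of_mem n (mem_atoms.1 hA))
    exact @Measurable.comp _ _ _ (fstFiltration X n) (countableFiltration X n) _ _ _ h1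
      (@measurable_fst _ _ (countableFiltration X n) _)
  · have h1 : Measurable (fun p => S (normInd μ w A) p / (w p : ℂ)) :=
      (Lp.stronglyMeasurable _).measurable.div (Complex.measurable_ofReal.comp hw.meas)
    exact @Measurable.comp _ _ _ (fstFiltration X n) _ _ _ _ h1
      (@measurable_snd _ _ (countableFiltration X n) _)

lemma integrable_approxKernel (hw : IsWeight μ w) (n : ℕ) :
    Integrable (approxKernel μ w S n) ((weighted μ w).prod (weighted μ w)) := by
  have := hw.isFiniteMeasure
  have h : approxKernel μ w S n = fun z => ∑ A ∈ atoms X n,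
      A.indicator (fun _ => (1 : ℂ)) z.1 * (S (normInd μ w A) z.2 / w z.2) :=
    funext fun z => approxKernel_eq n z
  rw [h]
  refine integrable_finsetSum _ fun A hA => ?_
  exact ((integrable_const (1 : ℂ)).indicator (measurableSet_of_mem_atoms hA)).mul_prod
    (integrable_div_weight hw _)

/-- The kernel depends on its first variable only through the atom containing it, so integration
over $A$ produces the weights of $A\cap C$, which are the coefficients of the average of $w1_A$. -/
lemma setIntegral_approxKernel (hw : IsWeight μ w) (n : ℕ) {A B : Set X}
    (hA : MeasurableSet A) (hB : MeasurableSet B) :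
    ∫ z in A ×ˢ B, approxKernel μ w S n z ∂((weighted μ w).prod (weighted μ w)) =
      ∫ p in B, S (partAvg μ w n (wInd μ w A)) p ∂μ := by
  have := hw.isFiniteMeasure
  have h1 : ∫ z in A ×ˢ B, approxKernel μ w S n z ∂((weighted μ w).prod (weighted μ w)) =
      ∑ C ∈ atoms X n, ((weighted μ w).real (A ∩ C) : ℂ) *
        ∫ p in B, S (normInd μ w C) p ∂μ := by
    simp only [approxKernel_eq]
    rw [← Measure.prod_restrict, integral_finsetSum]
    · refine Finset.sum_congr rfl fun C hC => ?_
      rw [integral_prod_mul (fun q => C.indicator (fun _ => (1 : ℂ)) q)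
        (fun p => S (normInd μ w C) p / (w p : ℂ)), setIntegral_div_weight hw _ hB,
        setIntegral_indicator (measurableSet_of_mem_atoms hC)]
      simp
    · intro C hC
      exact ((integrable_const (1 : ℂ)).indicator (measurableSet_of_mem_atoms hC)).mul_prod
        (integrable_div_weight hw _).restrict
  have h2 : S (partAvg μ w n (wInd μ w A)) = ∑ C ∈ atoms X n,
      ((weighted μ w).real (A ∩ C) : ℂ) • S (normInd μ w C) := by
    rw [partAvg, map_sum]
    refine Finset.sum_congr rfl fun C hC => ?_
    rw [map_smul, setIntegral_wInd hw hA (measurableSet_of_mem_atoms hC)]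
  rw [h1, h2]
  have h3 : ∀ φ : Lp ℂ 1 μ, ∫ p in B, φ p ∂μ = integralCLM μ
      (mulCLM μ (B.indicator fun _ => (1 : ℂ)) ((measurable_const.indicator hB).aestronglyMeasurable) 1
        (ae_of_all _ fun p => by by_cases h : p ∈ B <;> simp [h]) φ) := by
    intro φ
    rw [integralCLM_apply, ← integral_indicator hB]
    refine integral_congr_ae ?_
    filter_upwards [coeFn_mulCLM (μ := μ) ((measurable_const (a := (1 : ℂ))).indicator hB).aestronglyMeasurable
      (C := 1) (ae_of_all _ fun p => by by_cases h : p ∈ B <;> simp [h]) φ] with p hp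
    rw [hp]
    by_cases h : p ∈ B <;> simp [h]
  rw [h3, map_sum, map_sum]
  refine Finset.sum_congr rfl fun C _ => ?_
  rw [map_smul, map_smul, ← h3, smul_eq_mul]

/-- For $A$ in the $n$-th σ-algebra all averages of level at least $n$ fix $w1_A$, so the kernels of
levels $n$ and $m\ge n$ have the same integral over $A\times B$; these rectangles generate the
$n$-th σ-algebra of the product. The real functional $L$, later the real or imaginary part, reduces
matters to real martingales. -/
lemma martingale_approxKernel (hw : IsWeight μ w) (L : ℂ →L[ℝ] ℝ) :
    Martingale (fun n z => L (approxKernel μ w S n z)) (fstFiltration X)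
      ((weighted μ w).prod (weighted μ w)) := by
  have := hw.isFiniteMeasure
  refine ⟨fun n => (L.measurable.comp (measurable_approxKernel hw n)).stronglyMeasurable,
    fun n m hnm => ?_⟩
  set Q := (weighted μ w).prod (weighted μ w)
  have hint : ∀ n, Integrable (fun z => L (approxKernel μ w S n z)) Q := fun n =>
    L.integrable_comp (integrable_approxKernel hw n)
  symm
  refine ae_eq_condExp_of_forall_setIntegral_eq ((fstFiltration X).le n) (hint m)
    (fun s _ _ => (hint n).integrableOn) ?_
    (L.measurable.comp (measurable_approxKernel hw n)).stronglyMeasurable.aestronglyMeasurable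
  have hrect : ∀ A B, MeasurableSet[countableFiltration X n] A → MeasurableSet B →
      ∫ z in A ×ˢ B, L (approxKernel μ w S n z) ∂Q = ∫ z in A ×ˢ B, L (approxKernel μ w S m z) ∂Q := by
    intro A B hA hB
    have hA' := (countableFiltration X).le n A hA
    rw [L.integral_comp_comm (integrable_approxKernel hw n).integrableOn,
      L.integral_comp_comm (integrable_approxKernel hw m).integrableOn,
      setIntegral_approxKernel hw n hA' hB, setIntegral_approxKernel hw m hA' hB,
      partAvg_wInd hw hA, partAvg_wInd hw ((countableFiltration X).mono hnm A hA)]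
  have huniv : ∫ z, L (approxKernel μ w S n z) ∂Q = ∫ z, L (approxKernel μ w S m z) ∂Q := by
    have := hrect univ univ (@MeasurableSet.univ _ (countableFiltration X n)) MeasurableSet.univ
    rwa [univ_prod_univ, setIntegral_univ, setIntegral_univ] at this
  have hle := (fstFiltration X).le n
  intro s hs _
  refine @MeasurableSpace.induction_on_inter (X × X) (fstFiltration X n)
    (fun s _ => ∫ z in s, L (approxKernel μ w S n z) ∂Q = ∫ z in s, L (approxKernel μ w S m z) ∂Q)
    _ (@generateFrom_prod X X (countableFiltration X n) _).symm
    (@isPiSystem_prod X X (countableFiltration X n) _) ?_ ?_ ?_ ?_ s hs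
  · simp
  · rintro t ⟨A, hA, B, hB, rfl⟩
    exact hrect A B hA hB
  · intro t ht h
    have h1 := integral_add_compl (hle _ ht) (hint n)
    have h2 := integral_add_compl (hle _ ht) (hint m)
    linarith
  · intro F hd hF h
    have h1 := hasSum_integral_iUnion (fun i => hle _ (hF i)) hd (hint n).integrableOn
    have h2 := hasSum_integral_iUnion (fun i => hle _ (hF i)) hd (hint m).integrableOn
    simp only [h] at h1
    exact h1.unique h2

lemma norm_atomImage_sub (hw : IsWeight μ w) (m n : ℕ) (q : X) :
    ‖atomImage μ w S m q - atomImage μ w S n q‖ =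
      ∫ p, ‖approxKernel μ w S m (q, p) - approxKernel μ w S n (q, p)‖ ∂(weighted μ w) := by
  rw [← integral_norm_div_weight hw]
  refine integral_congr_ae ?_
  filter_upwards [weighted_absolutelyContinuous.ae_le
    (Lp.coeFn_sub (atomImage μ w S m q) (atomImage μ w S n q))] with p hp
  rw [hp, Pi.sub_apply, approxKernel, approxKernel, sub_div]

/-- Each section of each kernel is $S\psi/w$ with $\|\psi\|\le1$, so the truncation bound for $S$
applies uniformly in the level and in the first variable; integrating over the latter costs only the
total mass. -/
lemma uniformIntegrable_approxKernel (hw : IsWeight μ w) (hS : IsEquiIntegrable w S) :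
    UniformIntegrable (fun n => approxKernel μ w S n) 1
      ((weighted μ w).prod (weighted μ w)) := by
  have := hw.isFiniteMeasure
  refine uniformIntegrable_of le_rfl ENNReal.one_ne_top
    (fun n => (integrable_approxKernel hw n).aestronglyMeasurable) fun ε hε => ?_
  set M : ℝ := (weighted μ w).real univ
  have hM : 0 ≤ M := measureReal_nonneg
  obtain ⟨C, hC0, hC⟩ := hS.exists_truncation hw (η := ε / (M + 1)) (by positivity)
  refine ⟨C.toNNReal, fun n => ?_⟩
  have hmk : Measurable (approxKernel μ w S n) :=
    (measurable_approxKernel hw n).mono ((fstFiltration X).le n) le_rfl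
  set D : Set (X × X) := {z | C.toNNReal ≤ ‖approxKernel μ w S n z‖₊} with hD
  have hDm : MeasurableSet D := measurableSet_le measurable_const hmk.nnnorm
  have hint : Integrable (D.indicator (approxKernel μ w S n))
      ((weighted μ w).prod (weighted μ w)) := (integrable_approxKernel hw n).indicator hDm
  rw [eLpNorm_one_eq_lintegral_enorm, ← ofReal_integral_norm_eq_lintegral_enorm hint]
  apply ENNReal.ofReal_le_ofReal
  rw [integral_prod _ hint.norm]
  have hfib : ∀ q, ∫ p, ‖D.indicator (approxKernel μ w S n) (q, p)‖ ∂(weighted μ w) ≤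
      ε / (M + 1) := by
    intro q
    set A := countablePartitionSet n q
    have h1 := hC (normInd μ w A) (norm_normInd_le hw (measurableSet_countablePartitionSet n q)) C
      le_rfl
    have hBm : MeasurableSet {p | C * w p ≤ ‖S (normInd μ w A) p‖} :=
      measurableSet_le (hw.meas.const_mul _) (Lp.stronglyMeasurable (S _)).measurable.norm
    refine le_trans (le_of_eq ?_) h1
    rw [integral_weighted hw, ← integral_indicator hBm]
    congr 1; ext p
    have hwp := hw.pos p
    have hk : ‖approxKernel μ w S n (q, p)‖ = ‖S (normInd μ w A) p‖ / w p := by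
      rw [approxKernel, norm_div]
      simp [abs_of_pos hwp, atomImage, A]
    have hiff : (q, p) ∈ D ↔ p ∈ {p | C * w p ≤ ‖S (normInd μ w A) p‖} := by
      rw [hD, mem_ofPred_eq, mem_ofPred_eq, ← NNReal.coe_le_coe, coe_nnnorm,
        Real.coe_toNNReal _ hC0.le, hk, le_div_iff₀ hwp]
    by_cases hp : (q, p) ∈ D
    · rw [indicator_of_mem hp, indicator_of_mem (hiff.1 hp), hk, smul_eq_mul]
      field_simp
    · rw [indicator_of_notMem hp, indicator_of_notMem (fun h => hp (hiff.2 h))]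
      simp
  calc _ ≤ ∫ _, ε / (M + 1) ∂(weighted μ w) := by
        refine integral_mono hint.norm.integral_prod_left (integrable_const _) fun q => hfib q
    _ = M * (ε / (M + 1)) := by rw [integral_const, smul_eq_mul]
    _ ≤ ε := by
        rw [mul_div_assoc', div_le_iff₀ (by positivity)]; nlinarith

/-- The $L^1$ bound gives almost sure convergence by Doob's theorem, and uniform integrability
upgrades it to $L^1$ convergence by Vitali's theorem. -/
lemma exists_tendsto_eLpNorm_of_submartingale {Y : Type*} [MeasurableSpace Y] {Q : Measure Y}
    [IsFiniteMeasure Q] {ℱ : Filtration ℕ ‹MeasurableSpace Y›} {f : ℕ → Y → ℝ}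
    (hf : Submartingale f ℱ Q) (hu : UniformIntegrable f 1 Q) :
    ∃ u, AEStronglyMeasurable u Q ∧ Tendsto (fun n => eLpNorm (f n - u) 1 Q) atTop (𝓝 0) := by
  obtain ⟨R, hR⟩ := hu.2.2
  obtain ⟨u, hum, hlim⟩ := exists_stronglyMeasurable_limit_of_tendsto_ae hu.1
    (hf.exists_ae_tendsto_of_bdd hR)
  refine ⟨u, hum.aestronglyMeasurable, tendsto_Lp_finite_of_tendstoInMeasure le_rfl
    ENNReal.one_ne_top hu.1 ⟨hum.aestronglyMeasurable, ?_⟩ hu.2.1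
    (tendstoInMeasure_of_tendsto_ae hu.1 hlim)⟩
  refine (Lp.eLpNorm_lim_le_liminf_eLpNorm hu.1 u hlim).trans_lt
    (lt_of_le_of_lt ?_ (ENNReal.coe_lt_top : (R : ℝ≥0∞) < ∞))
  simp_rw [liminf_eq, eventually_atTop]
  exact sSup_le fun b ⟨a, ha⟩ => (ha a le_rfl).trans (hR _)

lemma cauchy_approxKernel (hw : IsWeight μ w) (hS : IsEquiIntegrable w S) {η : ℝ} (hη : 0 < η) :
    ∃ N, ∀ m ≥ N, ∀ n ≥ N, ∫ z, ‖approxKernel μ w S m z - approxKernel μ w S n z‖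
      ∂((weighted μ w).prod (weighted μ w)) ≤ η := by
  have := hw.isFiniteMeasure
  set Q := (weighted μ w).prod (weighted μ w)
  have hpart : ∀ L : ℂ →L[ℝ] ℝ, (∀ z, |L z| ≤ ‖z‖) → ∃ N, ∀ m ≥ N, ∀ n ≥ N,
      ∫ z, |L (approxKernel μ w S m z) - L (approxKernel μ w S n z)| ∂Q ≤ η / 2 := by
    intro L hL
    have hint : ∀ n, Integrable (fun z => L (approxKernel μ w S n z)) Q := fun n =>
      L.integrable_comp (integrable_approxKernel hw n)
    have hu := uniformIntegrable_approxKernel (S := S) hw hS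
    have hUI : UniformIntegrable (fun n z => L (approxKernel μ w S n z)) 1 Q := by
      refine ⟨fun n => (hint n).aestronglyMeasurable, fun ε hε => ?_, ?_⟩
      · obtain ⟨δ, hδ, h⟩ := hu.2.1 hε
        refine ⟨δ, hδ, fun n s hs hs' => (eLpNorm_mono fun z => ?_).trans (h n s hs hs')⟩
        by_cases hz : z ∈ s
        · simpa [hz] using hL _
        · simp [hz]
      · obtain ⟨C, hC⟩ := hu.2.2
        exact ⟨C, fun n => (eLpNorm_mono fun z => by simpa using hL _).trans (hC n)⟩
    obtain ⟨u, hum, hlim⟩ := exists_tendsto_eLpNorm_of_submartingale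
      (martingale_approxKernel (S := S) hw L).submartingale hUI
    have hev : ∀ᶠ n in atTop, eLpNorm ((fun z => L (approxKernel μ w S n z)) - u) 1 Q <
        ENNReal.ofReal (η / 4) :=
      hlim.eventually_lt_const (by simpa using hη)
    obtain ⟨N, hN⟩ := eventually_atTop.1 hev
    refine ⟨N, fun m hm n hn => ?_⟩
    have h1 : eLpNorm ((fun z => L (approxKernel μ w S m z)) - (fun z => L (approxKernel μ w S n z)))
        1 Q ≤ ENNReal.ofReal (η / 2) := by
      have e1 : (fun z => L (approxKernel μ w S m z)) - (fun z => L (approxKernel μ w S n z)) =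
        ((fun z => L (approxKernel μ w S m z)) - u) - ((fun z => L (approxKernel μ w S n z)) - u) := by
        abel
      rw [e1]
      refine (eLpNorm_sub_le ((hint m).aestronglyMeasurable.sub hum)
        ((hint n).aestronglyMeasurable.sub hum) le_rfl).trans ?_
      refine (add_le_add (hN m hm).le (hN n hn).le).trans ?_
      rw [← ENNReal.ofReal_add (by positivity) (by positivity)]
      apply ENNReal.ofReal_le_ofReal; linarith
    rw [eLpNorm_one_eq_lintegral_enorm, ← ofReal_integral_norm_eq_lintegral_enorm
      ((hint m).sub (hint n))] at h1
    exact (ENNReal.ofReal_le_ofReal_iff (by positivity)).1 h1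
  obtain ⟨N₁, h₁⟩ := hpart Complex.reCLM Complex.abs_re_le_norm
  obtain ⟨N₂, h₂⟩ := hpart Complex.imCLM Complex.abs_im_le_norm
  refine ⟨max N₁ N₂, fun m hm n hn => ?_⟩
  have hi := fun n => integrable_approxKernel (S := S) hw n
  have e1 := h₁ m ((le_max_left _ _).trans hm) n ((le_max_left _ _).trans hn)
  have e2 := h₂ m ((le_max_right _ _).trans hm) n ((le_max_right _ _).trans hn)
  have hre := fun n => Complex.reCLM.integrable_comp (hi n)
  have him := fun n => Complex.imCLM.integrable_comp (hi n)
  calc _ ≤ ∫ z, (|Complex.reCLM (approxKernel μ w S m z) - Complex.reCLM (approxKernel μ w S n z)| +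
        |Complex.imCLM (approxKernel μ w S m z) - Complex.imCLM (approxKernel μ w S n z)|) ∂Q := by
        refine integral_mono ((hi m).sub (hi n)).norm
          (((hre m).sub (hre n)).abs.add ((him m).sub (him n)).abs) fun z => ?_
        refine (Complex.norm_le_abs_re_add_abs_im _).trans (le_of_eq ?_)
        simp
    _ ≤ η := by
        have := integral_add ((hre m).sub (hre n)).abs ((him m).sub (him n)).abs
        simp only [Pi.sub_apply] at this
        rw [this]
        linarith

lemma comp_partAvg_eq_integral (n : ℕ) (ψ : Lp ℂ 1 μ) :
    Integrable (fun q => ψ q • atomImage μ w S n q) μ ∧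
      S (partAvg μ w n ψ) = ∫ q, ψ q • atomImage μ w S n q ∂μ := by
  have h1 : ∀ q, ψ q • atomImage μ w S n q =
      ∑ A ∈ atoms X n, A.indicator (fun q => ψ q) q • S (normInd μ w A) := fun q => by
    rw [atomImage_eq, Finset.smul_sum]
    refine Finset.sum_congr rfl fun A _ => ?_
    by_cases h : q ∈ A <;> simp [h]
  have h2 : ∀ A ∈ atoms X n, Integrable (fun q => A.indicator (fun q => ψ q) q •
      S (normInd μ w A)) μ := fun A hA =>
    ((L1_integrable ψ).indicator (measurableSet_of_mem_atoms hA)).smul_const _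
  simp only [h1]
  refine ⟨integrable_finsetSum _ h2, ?_⟩
  rw [integral_finsetSum _ h2, partAvg, map_sum]
  refine Finset.sum_congr rfl fun A hA => ?_
  rw [map_smul, integral_smul_const, integral_indicator (measurableSet_of_mem_atoms hA)]

/-- An equi-integrable operator is uniformly approximated by finite rank operators on order
intervals. -/
lemma IsEquiIntegrable.exists_approx [SigmaFinite μ] (hw : IsWeight μ w)
    (hS : IsEquiIntegrable w S) {η : ℝ} (hη : 0 < η) :
    ∃ n, ∀ ψ : Lp ℂ 1 μ, ∀ C : ℝ, 0 ≤ C → (∀ᵐ p ∂μ, ‖ψ p‖ ≤ C * w p) →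
      ‖S ψ - S (partAvg μ w n ψ)‖ ≤ C * η := by
  have := hw.isFiniteMeasure
  obtain ⟨N, hN⟩ := cauchy_approxKernel hw hS hη
  refine ⟨N, fun ψ C hC0 hC => ?_⟩
  -- By strong convergence of the averages it is enough to compare level $N$ with later levels $m$.
  -- For $|\psi|\le Cw$ that difference is at most $C$ times the $L^1$ distance of the two kernels.
  have hlim : Tendsto (fun m => ‖S (partAvg μ w m ψ) - S (partAvg μ w N ψ)‖) atTop
      (𝓝 ‖S ψ - S (partAvg μ w N ψ)‖) :=
    (((S.continuous.tendsto _).comp (partAvg_tendsto hw ψ)).sub_const _).norm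
  refine le_of_tendsto hlim ?_
  filter_upwards [eventually_ge_atTop N] with m hm
  obtain ⟨i1, e1⟩ := comp_partAvg_eq_integral (S := S) (w := w) m ψ
  obtain ⟨i2, e2⟩ := comp_partAvg_eq_integral (S := S) (w := w) N ψ
  rw [e1, e2, ← integral_sub i1 i2]
  have hQ : Integrable (fun z => ‖approxKernel μ w S m z - approxKernel μ w S N z‖)
      ((weighted μ w).prod (weighted μ w)) :=
    ((integrable_approxKernel hw m).sub (integrable_approxKernel hw N)).norm
  have hφ : Integrable (fun q => ‖atomImage μ w S m q - atomImage μ w S N q‖) (weighted μ w) := by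
    simp only [norm_atomImage_sub hw]
    exact hQ.integral_prod_left
  calc _ ≤ ∫ q, ‖ψ q • atomImage μ w S m q - ψ q • atomImage μ w S N q‖ ∂μ :=
        norm_integral_le_integral_norm _
    _ ≤ ∫ q, C * (w q • ‖atomImage μ w S m q - atomImage μ w S N q‖) ∂μ := by
        refine integral_mono_ae (i1.sub i2).norm
          (((integrable_weighted_iff hw).1 hφ).const_mul C) ?_
        filter_upwards [hC] with q hq
        rw [← smul_sub, norm_smul, smul_eq_mul, ← mul_assoc]
        gcongr
    _ = C * ∫ z, ‖approxKernel μ w S m z - approxKernel μ w S N z‖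
          ∂((weighted μ w).prod (weighted μ w)) := by
        rw [integral_const_mul, ← integral_weighted hw, integral_prod _ hQ]
        simp only [norm_atomImage_sub hw]
    _ ≤ C * η := by gcongr; exact hN m hm N le_rfl

/-- The product of two equi-integrable operators is compact. -/
theorem IsEquiIntegrable.isCompactOperator_comp [SigmaFinite μ] (hw : IsWeight μ w)
    {S' : Lp ℂ 1 μ →L[ℂ] Lp ℂ 1 μ}
    (hS : IsEquiIntegrable w S) (hS' : IsEquiIntegrable w S') :
    IsCompactOperator (S.comp S') := by
  refine (isCompactOperator_iff_isCompact_closure_image_closedBall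
    ((S.comp S' : Lp ℂ 1 μ →L[ℂ] Lp ℂ 1 μ) : Lp ℂ 1 μ →ₗ[ℂ] Lp ℂ 1 μ) (zero_lt_one)).2 ?_
  refine TotallyBounded.isCompact_of_isClosed (TotallyBounded.closure ?_) isClosed_closure
  rw [Metric.totallyBounded_iff]
  intro ε hε
  -- Three errors of size $\varepsilon/4$: cutting $S'\psi$ to the order interval $|g|\le Cw$,
  -- replacing $S$ there by the finite rank operator $S\circ$`partAvg`, and a finite net of a
  -- bounded set in its range.
  obtain ⟨C, hC0, hC⟩ := hS'.exists_truncation hw (η := ε / (4 * (‖S‖ + 1))) (by positivity)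
  obtain ⟨n, hn⟩ := hS.exists_approx hw (η := ε / (4 * C)) (by positivity)
  -- a bounded set in a finite dimensional space
  set W : Submodule ℂ (Lp ℂ 1 μ) :=
    Submodule.span ℂ ((fun A => S (normInd μ w A)) '' (atoms X n : Set (Set X))) with hW
  have hWfin : FiniteDimensional ℂ W :=
    FiniteDimensional.span_of_finite ℂ ((atoms X n).finite_toSet.image _)
  set R : ℝ := ‖S‖ * (‖S'‖ + 1) with hR
  have hcomp : TotallyBounded ((Subtype.val : W → Lp ℂ 1 μ) '' Metric.closedBall 0 R) := by
    have : ProperSpace W := FiniteDimensional.proper ℂ W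
    exact ((isCompact_closedBall (0 : W) R).image continuous_subtype_val).totallyBounded
  obtain ⟨t, htf, ht⟩ := Metric.totallyBounded_iff.1 hcomp (ε / 4) (by positivity)
  refine ⟨t, htf, ?_⟩
  rintro _ ⟨ψ, hψ, rfl⟩
  rw [mem_closedBall_zero_iff] at hψ
  set B : Set X := {p | C * w p ≤ ‖S' ψ p‖}
  have hBm : MeasurableSet B :=
    measurableSet_le (hw.meas.const_mul _) (Lp.stronglyMeasurable (S' _)).measurable.norm
  have hgi : Integrable (Bᶜ.indicator (S' ψ)) μ := (L1_integrable _).indicator hBm.compl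
  set g : Lp ℂ 1 μ := ofFun μ (Bᶜ.indicator (S' ψ)) with hg
  have hgb : ∀ᵐ p ∂μ, ‖g p‖ ≤ C * w p := by
    filter_upwards [coeFn_ofFun hgi] with p hp
    rw [hg, hp]
    by_cases h : p ∈ B
    · have : p ∉ Bᶜ := fun h' => h' h
      rw [indicator_of_notMem this, norm_zero]
      exact mul_nonneg hC0.le (hw.pos p).le
    · rw [indicator_of_mem h]
      exact (not_le.1 h).le
  have hgn : ‖g‖ ≤ ‖S'‖ + 1 := by
    have h1 : ‖g‖ ≤ ‖S' ψ‖ := L1_norm_le_of_ae_le (by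
      filter_upwards [coeFn_ofFun hgi] with p hp
      rw [hg, hp]; exact norm_indicator_le_norm_self _ _)
    have := S'.le_opNorm ψ
    nlinarith [norm_nonneg S']
  have hdiff : ‖S' ψ - g‖ ≤ ε / (4 * (‖S‖ + 1)) := by
    refine le_trans (le_of_eq ?_) (hC ψ hψ C le_rfl)
    rw [L1_norm_sub_eq, ← integral_indicator hBm]
    refine integral_congr_ae ?_
    filter_upwards [coeFn_ofFun hgi] with p hp
    rw [hg, hp]
    by_cases h : p ∈ B
    · have : p ∉ Bᶜ := fun h' => h' h
      rw [indicator_of_notMem this, indicator_of_mem (s := {p | C * w p ≤ ‖S' ψ p‖}) h, sub_zero]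
    · rw [indicator_of_mem (s := Bᶜ) h, indicator_of_notMem (s := {p | C * w p ≤ ‖S' ψ p‖}) h,
        sub_self, norm_zero]
  have h1 := hn g C hC0.le hgb
  have hmem : S (partAvg μ w n g) ∈ W := by
    rw [partAvg, map_sum]
    refine W.sum_mem fun A hA => ?_
    rw [map_smul]
    exact W.smul_mem _ (Submodule.subset_span ⟨A, hA, rfl⟩)
  have hmemt : S (partAvg μ w n g) ∈ (Subtype.val : W → Lp ℂ 1 μ) '' Metric.closedBall 0 R := by
    refine ⟨⟨_, hmem⟩, ?_, rfl⟩
    rw [mem_closedBall_zero_iff]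
    change ‖S (partAvg μ w n g)‖ ≤ R
    refine (S.le_opNorm _).trans ?_
    rw [hR]
    gcongr
    exact (norm_partAvg_le hw n g).trans hgn
  obtain ⟨y, hy, hyd⟩ := mem_iUnion₂.1 (ht hmemt)
  refine mem_iUnion₂.2 ⟨y, hy, ?_⟩
  rw [Metric.mem_ball, dist_eq_norm] at hyd ⊢
  have h2 : ‖S (S' ψ - g)‖ ≤ ε / 4 := by
    refine (S.le_opNorm _).trans ?_
    calc ‖S‖ * ‖S' ψ - g‖ ≤ (‖S‖ + 1) * (ε / (4 * (‖S‖ + 1))) := by gcongr; linarith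
      _ = ε / 4 := by field_simp
  have h3 : C * (ε / (4 * C)) = ε / 4 := by field_simp
  rw [h3] at h1
  have h4 : (S.comp S') ψ - y = S (S' ψ - g) + (S g - S (partAvg μ w n g)) +
      (S (partAvg μ w n g) - y) := by
    rw [map_sub, ContinuousLinearMap.comp_apply]; abel
  change ‖(S.comp S') ψ - y‖ < ε
  rw [h4]
  refine norm_add₃_le.trans_lt ?_
  linarith

end EquiIntegrable

end

section

/-! ### Circle integrals of resolvents -/

section Resolvent

variable {A : Type*} [NormedRing A] [NormedAlgebra ℂ A] [CompleteSpace A]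

lemma circleIntegral_swap {F : Type*} [NormedAddCommGroup F] [NormedSpace ℂ F]
    {z : ℂ} {r R : ℝ} (hr : 0 ≤ r) (hR : 0 ≤ R) {f : ℂ → ℂ → F}
    (hf : ContinuousOn (Function.uncurry f) (Metric.sphere z r ×ˢ Metric.sphere z R)) :
    (∮ a in C(z, r), ∮ b in C(z, R), f a b) = ∮ b in C(z, R), ∮ a in C(z, r), f a b := by
  simp only [circleIntegral, ← intervalIntegral.integral_smul]
  rw [intervalIntegral_intervalIntegral_swap]
  · congr 1; ext θ; congr 1; ext θ'
    rw [smul_comm]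
  · refine IntegrableOn.mono_set (t := Icc 0 (2 * Real.pi) ×ˢ Icc 0 (2 * Real.pi)) ?_ ?_
    · refine ContinuousOn.integrableOn_compact (isCompact_Icc.prod isCompact_Icc) ?_
      have hc : Continuous fun p : ℝ × ℝ => (circleMap z r p.1, circleMap z R p.2) := by
        fun_prop
      have h1 : Continuous fun p : ℝ × ℝ => f (circleMap z r p.1) (circleMap z R p.2) :=
        hf.comp_continuous hc fun p =>
          ⟨circleMap_mem_sphere z hr p.1, circleMap_mem_sphere z hR p.2⟩
      simp only [deriv_circleMap]
      refine Continuous.continuousOn ?_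
      change Continuous fun p : ℝ × ℝ => (circleMap 0 r p.1 * Complex.I) •
        (circleMap 0 R p.2 * Complex.I) • f (circleMap z r p.1) (circleMap z R p.2)
      have h2 : Continuous fun p : ℝ × ℝ => circleMap 0 r p.1 * Complex.I := by fun_prop
      have h3 : Continuous fun p : ℝ × ℝ => circleMap 0 R p.2 * Complex.I := by fun_prop
      exact h2.smul (h3.smul h1)
    · rw [uIoc_of_le Real.two_pi_pos.le]
      exact prod_mono Ioc_subset_Icc_self Ioc_subset_Icc_self

lemma circleIntegral_clm {F G : Type*} [NormedAddCommGroup F] [NormedSpace ℂ F] [CompleteSpace F]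
    [NormedAddCommGroup G] [NormedSpace ℂ G] [CompleteSpace G]
    (L : F →L[ℂ] G) {f : ℂ → F} {z : ℂ} {r : ℝ} (hf : CircleIntegrable f z r) :
    (∮ w in C(z, r), L (f w)) = L (∮ w in C(z, r), f w) := by
  simp only [circleIntegral]
  rw [← L.intervalIntegral_comp_comm hf.out]
  simp only [map_smul]

omit [CompleteSpace A] in
lemma resolvent_mul_sub {a : A} {w : ℂ} (hw : w ∈ resolventSet ℂ a) :
    resolvent a w * (algebraMap ℂ A w - a) = 1 := by
  rw [spectrum.resolvent_eq hw]; exact hw.unit.inv_mul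

omit [CompleteSpace A] in
lemma sub_mul_resolvent {a : A} {w : ℂ} (hw : w ∈ resolventSet ℂ a) :
    (algebraMap ℂ A w - a) * resolvent a w = 1 := by
  rw [spectrum.resolvent_eq hw]; exact hw.unit.mul_inv

omit [CompleteSpace A] in
lemma resolvent_eq_of_inverse {a b : A} {w : ℂ} (h1 : (algebraMap ℂ A w - a) * b = 1)
    (h2 : b * (algebraMap ℂ A w - a) = 1) : w ∈ resolventSet ℂ a ∧ resolvent a w = b := by
  have hw : w ∈ resolventSet ℂ a := ⟨⟨_, b, h1, h2⟩, rfl⟩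
  refine ⟨hw, ?_⟩
  calc resolvent a w = resolvent a w * ((algebraMap ℂ A w - a) * b) := by rw [h1, mul_one]
    _ = b := by rw [← mul_assoc, resolvent_mul_sub hw, one_mul]

lemma differentiableAt_resolvent {a : A} {w : ℂ} (hw : w ∈ resolventSet ℂ a) :
    DifferentiableAt ℂ (resolvent a) w :=
  (spectrum.hasDerivAt_resolvent_const_left hw).differentiableAt

omit [CompleteSpace A] in
/-- The first resolvent identity. -/
lemma resolvent_mul_resolvent {a : A} {v w : ℂ} (hv : v ∈ resolventSet ℂ a)
    (hw : w ∈ resolventSet ℂ a) :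
    (w - v) • (resolvent a v * resolvent a w) = resolvent a v - resolvent a w := by
  have h1 : resolvent a v - resolvent a w = resolvent a v *
      ((algebraMap ℂ A w - a) - (algebraMap ℂ A v - a)) * resolvent a w := by
    rw [mul_sub, sub_mul, mul_assoc, sub_mul_resolvent hw, resolvent_mul_sub hv, mul_one, one_mul]
  rw [h1, sub_sub_sub_cancel_right, ← map_sub, Algebra.algebraMap_eq_smul_one,
    mul_smul_comm, mul_one, smul_mul_assoc]

lemma riesz_circle_eq {a : A} {z : ℂ} {r R : ℝ} (hr : 0 < r) (hrR : r ≤ R)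
    (h : spectrum ℂ a ∩ Metric.closedBall z R ⊆ {z}) :
    (∮ w in C(z, R), resolvent a w) = ∮ w in C(z, r), resolvent a w := by
  have hmem : ∀ w ∈ Metric.closedBall z R \ Metric.ball z r, w ∈ resolventSet ℂ a := by
    intro w hw
    by_contra hn
    have : w = z := h ⟨hn, hw.1⟩
    exact hw.2 (this ▸ Metric.mem_ball_self hr)
  refine Complex.circleIntegral_eq_of_differentiable_on_annulus_off_countable hr hrR
    countable_empty (fun w hw => ?_) fun w hw => ?_
  · exact (differentiableAt_resolvent (hmem w hw)).continuousAt.continuousWithinAt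
  · refine differentiableAt_resolvent (hmem w ⟨Metric.ball_subset_closedBall hw.1.1, fun hn => ?_⟩)
    exact hw.1.2 (Metric.ball_subset_closedBall hn)

/-- The Riesz integral is idempotent. -/
lemma riesz_idempotent {a : A} {z : ℂ} {R : ℝ} (hR : 0 < R)
    (h : spectrum ℂ a ∩ Metric.closedBall z R ⊆ {z}) :
    (((2 * Real.pi * Complex.I : ℂ)⁻¹) • ∮ w in C(z, R), resolvent a w) *
      (((2 * Real.pi * Complex.I : ℂ)⁻¹) • ∮ w in C(z, R), resolvent a w) =
      ((2 * Real.pi * Complex.I : ℂ)⁻¹) • ∮ w in C(z, R), resolvent a w := by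
  -- The two factors are written over circles of different radii, so that the resolvent identity can
  -- be divided by $w-v$.
  set r := R / 2 with hr
  have hr0 : 0 < r := by positivity
  have hrR : r < R := by rw [hr]; linarith
  have hmem : ∀ w ∈ Metric.closedBall z R \ Metric.ball z r, w ∈ resolventSet ℂ a := by
    intro w hw
    by_contra hn
    have : w = z := h ⟨hn, hw.1⟩
    exact hw.2 (this ▸ Metric.mem_ball_self hr0)
  have hsr : ∀ w ∈ Metric.sphere z r, w ∈ resolventSet ℂ a := fun w hw =>
    hmem w ⟨Metric.closedBall_subset_closedBall hrR.le (Metric.sphere_subset_closedBall hw),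
      fun hn => by rw [Metric.mem_ball] at hn; rw [Metric.mem_sphere] at hw; linarith⟩
  have hsR : ∀ w ∈ Metric.sphere z R, w ∈ resolventSet ℂ a := fun w hw =>
    hmem w ⟨Metric.sphere_subset_closedBall hw,
      fun hn => by rw [Metric.mem_ball] at hn; rw [Metric.mem_sphere] at hw; linarith⟩
  have hcr : ContinuousOn (resolvent a) (Metric.sphere z r) := fun w hw =>
    (differentiableAt_resolvent (hsr w hw)).continuousAt.continuousWithinAt
  have hcR : ContinuousOn (resolvent a) (Metric.sphere z R) := fun w hw =>
    (differentiableAt_resolvent (hsR w hw)).continuousAt.continuousWithinAt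
  have hir := hcr.circleIntegrable hr0.le
  have hiR := hcR.circleIntegrable hR.le
  have hne : ∀ v ∈ Metric.sphere z r, ∀ w ∈ Metric.sphere z R, w - v ≠ 0 := by
    intro v hv w hw h0
    rw [sub_eq_zero] at h0
    rw [Metric.mem_sphere] at hv hw
    rw [h0, hv] at hw; linarith
  set P := ∮ w in C(z, R), resolvent a w with hP
  have hPr : P = ∮ w in C(z, r), resolvent a w := riesz_circle_eq hr0 hrR.le h
  have hprod : P * P = (2 * Real.pi * Complex.I : ℂ) • P := by
    have e1 : P * P = ∮ v in C(z, r), ∮ w in C(z, R), resolvent a v * resolvent a w := by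
      have h1 := circleIntegral_clm ((ContinuousLinearMap.mul ℂ A).flip P) hir
      simp only [ContinuousLinearMap.flip_apply, ContinuousLinearMap.mul_apply'] at h1
      rw [← hPr] at h1
      rw [← h1]
      refine circleIntegral.integral_congr hr0.le fun v hv => ?_
      have h2 := circleIntegral_clm (ContinuousLinearMap.mul ℂ A (resolvent a v)) hiR
      simp only [ContinuousLinearMap.mul_apply'] at h2
      exact h2.symm
    -- Resolvent identity divided by $w-v$; as $v$ lies inside the outer circle, the term with the
    -- resolvent at $v$ picks up the winding number $2\pi i$.
    have e2 : ∀ v ∈ Metric.sphere z r, (∮ w in C(z, R), resolvent a v * resolvent a w) =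
        (2 * Real.pi * Complex.I : ℂ) • resolvent a v -
          ∮ w in C(z, R), (w - v)⁻¹ • resolvent a w := by
      intro v hv
      have hci : ContinuousOn (fun w : ℂ => (w - v)⁻¹) (Metric.sphere z R) :=
        (continuousOn_id.sub continuousOn_const).inv₀ fun w hw => hne v hv w hw
      have h1 : (∮ w in C(z, R), resolvent a v * resolvent a w) =
          ∮ w in C(z, R), ((w - v)⁻¹ • resolvent a v - (w - v)⁻¹ • resolvent a w) := by
        refine circleIntegral.integral_congr hR.le fun w hw => ?_
        rw [← smul_sub, ← resolvent_mul_resolvent (hsr v hv) (hsR w hw), smul_smul,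
          inv_mul_cancel₀ (hne v hv w hw), one_smul]
      rw [h1, circleIntegral.integral_sub, circleIntegral.integral_smul_const,
        circleIntegral.integral_sub_inv_of_mem_ball]
      · rw [Metric.mem_ball]; rw [Metric.mem_sphere] at hv; linarith
      · exact (hci.smul continuousOn_const).circleIntegrable hR.le
      · exact (hci.smul hcR).circleIntegrable hR.le
    have hc2 : ContinuousOn (Function.uncurry fun (v w : ℂ) => (w - v)⁻¹ • resolvent a w)
        (Metric.sphere z r ×ˢ Metric.sphere z R) := by
      have h1 : ContinuousOn (fun p : ℂ × ℂ => (p.2 - p.1)⁻¹)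
          (Metric.sphere z r ×ˢ Metric.sphere z R) :=
        (continuousOn_snd.sub continuousOn_fst).inv₀ fun p hp => hne p.1 hp.1 p.2 hp.2
      exact h1.smul (hcR.comp continuousOn_snd fun p hp => hp.2)
    -- After exchanging the integrals, $v\mapsto(w-v)^{-1}$ is holomorphic in the inner disc because
    -- $w$ lies outside it.
    have e3 : (∮ v in C(z, r), ∮ w in C(z, R), (w - v)⁻¹ • resolvent a w) = 0 := by
      rw [circleIntegral_swap hr0.le hR.le hc2]
      have : ∀ w ∈ Metric.sphere z R, (∮ v in C(z, r), (w - v)⁻¹ • resolvent a w) = 0 := by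
        intro w hw
        rw [circleIntegral.integral_smul_const]
        have h0 : (∮ v in C(z, r), (w - v)⁻¹) = 0 := by
          refine Complex.circleIntegral_eq_zero_of_differentiable_on_off_countable hr0.le
            countable_empty (fun v hv => ?_) fun v hv => ?_
          · have hne' : w - v ≠ 0 := by
              intro h0
              rw [sub_eq_zero] at h0
              rw [Metric.mem_closedBall, ← h0] at hv
              rw [Metric.mem_sphere] at hw; linarith
            exact ((continuousAt_const.sub continuousAt_id).inv₀ hne').continuousWithinAt
          · have hne' : w - v ≠ 0 := by
              intro h0
              rw [sub_eq_zero] at h0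
              have hv := hv.1
              rw [Metric.mem_ball, ← h0] at hv
              rw [Metric.mem_sphere] at hw; linarith
            exact (differentiableAt_const w |>.sub differentiableAt_id).inv hne'
        rw [h0, zero_smul]
      rw [circleIntegral.integral_congr hR.le this]
      simp [circleIntegral]
    rw [e1, circleIntegral.integral_congr hr0.le e2, circleIntegral.integral_sub, e3, sub_zero,
      circleIntegral.integral_smul, ← hPr]
    · exact (hcr.const_smul (2 * Real.pi * Complex.I : ℂ)).circleIntegrable hr0.le
    · have h1 : ContinuousOn (fun v => (2 * Real.pi * Complex.I : ℂ) • resolvent a v -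
          ∮ w in C(z, R), resolvent a v * resolvent a w) (Metric.sphere z r) := by
        have h2 : ∀ v : ℂ, (∮ w in C(z, R), resolvent a v * resolvent a w) = resolvent a v * P := by
          intro v
          have h2 := circleIntegral_clm (ContinuousLinearMap.mul ℂ A (resolvent a v)) hiR
          simpa only [ContinuousLinearMap.mul_apply'] using h2
        simp only [h2]
        exact (hcr.const_smul _).sub (hcr.mul continuousOn_const)
      refine ContinuousOn.circleIntegrable hr0.le (h1.congr fun v hv => ?_)
      change _ = _ - _
      rw [e2 v hv, sub_sub_cancel]
  have hpi : (2 * Real.pi * Complex.I : ℂ) ≠ 0 := Complex.two_pi_I_ne_zero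
  rw [smul_mul_smul_comm, hprod, smul_smul]
  congr 1
  field_simp

end Resolvent

/-! ### Operators with a compact power -/

section PowerCompact

variable {Y : Type*} [NormedAddCommGroup Y] [NormedSpace ℂ Y]

lemma isEigenvalue_iff {T : Y →L[ℂ] Y} {z : ℂ} :
    IsEigenvalue T z ↔ Module.End.HasEigenvalue (T : Module.End ℂ Y) z := by
  constructor
  · rintro ⟨x, hx, h⟩
    exact Module.End.hasEigenvalue_of_hasEigenvector
      (Module.End.hasEigenvector_iff.2 ⟨Module.End.mem_eigenspace_iff.2 h, hx⟩)
  · intro h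
    obtain ⟨x, hx⟩ := h.exists_hasEigenvector
    exact ⟨x, hx.2, hx.apply_eq_smul⟩

lemma pow_apply_of_eigen {T : Y →L[ℂ] Y} {z : ℂ} {x : Y} (h : T x = z • x) (n : ℕ) :
    (T ^ n) x = z ^ n • x := by
  induction n with
  | zero => simp
  | succ n ih => rw [pow_succ', mul_apply_eq_comp, ih, map_smul, h, smul_smul, pow_succ]

/-- The eigenvalues of a power compact operator only accumulate at `0`. -/
lemma finite_eigenvalues {T : Y →L[ℂ] Y} {k : ℕ} (hk : IsCompactOperator (T ^ k)) {r : ℝ}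
    (hr : 0 < r) : {z : ℂ | r ≤ ‖z‖ ∧ IsEigenvalue T z}.Finite := by
  by_contra hinf
  rw [← Set.Infinite] at hinf
  set μ : ℕ → ℂ := fun n => (hinf.natEmbedding _ n : ℂ)
  have hμinj : Function.Injective μ := Subtype.val_injective.comp (hinf.natEmbedding _).injective
  have hμ : ∀ n, r ≤ ‖μ n‖ ∧ IsEigenvalue T (μ n) := fun n => (hinf.natEmbedding _ n).2
  choose x hx0 hx using fun n => (hμ n).2
  have hli : LinearIndependent ℂ x :=
    Module.End.eigenvectors_linearIndependent' (T : Module.End ℂ Y) μ hμinj x fun n =>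
      Module.End.hasEigenvector_iff.2 ⟨Module.End.mem_eigenspace_iff.2 (hx n), hx0 n⟩
  let V : ℕ → Submodule ℂ Y := fun n => Submodule.span ℂ (x '' Iio n)
  have hVfin : ∀ n, FiniteDimensional ℂ (V n) := fun n =>
    FiniteDimensional.span_of_finite ℂ ((finite_Iio n).image x)
  have hVmono : Monotone V := fun a b hab => Submodule.span_mono (image_mono (Iio_subset_Iio hab))
  have hVT : ∀ n, ∀ y ∈ V n, (T ^ k) y ∈ V n := by
    intro n y hy
    have : V n ≤ (V n).comap ((T ^ k : Y →L[ℂ] Y) : Y →ₗ[ℂ] Y) := by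
      refine Submodule.span_le.2 ?_
      rintro _ ⟨i, hi, rfl⟩
      change (T ^ k) (x i) ∈ V n
      rw [pow_apply_of_eigen (hx i)]
      exact (V n).smul_mem _ (Submodule.subset_span ⟨i, hi, rfl⟩)
    exact this hy
  have hVs : ∀ n, ∀ y ∈ V (n + 1), (T ^ k) y - μ n ^ k • y ∈ V n := by
    intro n y hy
    have : V (n + 1) ≤ (V n).comap ((T ^ k - μ n ^ k • (1 : Y →L[ℂ] Y) : Y →L[ℂ] Y) : Y →ₗ[ℂ] Y) := by
      refine Submodule.span_le.2 ?_
      rintro _ ⟨i, hi, rfl⟩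
      change (T ^ k) (x i) - μ n ^ k • x i ∈ V n
      rw [pow_apply_of_eigen (hx i), ← sub_smul]
      rcases (Nat.lt_succ_iff.1 hi).lt_or_eq with h | h
      · exact (V n).smul_mem _ (Submodule.subset_span ⟨i, h, rfl⟩)
      · rw [h, sub_self, zero_smul]; exact (V n).zero_mem
    exact this hy
  -- F. Riesz's argument: `V` is a strictly increasing chain of invariant subspaces, and `T ^ k - μ
  -- n ^ k` maps `V (n + 1)` into `V n`. Almost orthogonal unit vectors in the successive steps then
  -- have images at mutual distance at least $r^k/2$, against compactness.
  have hy : ∀ n, ∃ y ∈ V (n + 1), ‖y‖ = 1 ∧ ∀ v ∈ V n, 1 / 2 ≤ ‖y - v‖ := by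
    intro n
    have hc : IsClosed (((V n).comap (V (n + 1)).subtype : Submodule ℂ (V (n + 1))) :
        Set (V (n + 1))) := Submodule.closed_of_finiteDimensional _
    have hxn : x n ∈ V (n + 1) := Submodule.subset_span ⟨n, Nat.lt_succ_self n, rfl⟩
    have hne : ∃ y : V (n + 1), y ∉ (V n).comap (V (n + 1)).subtype := by
      refine ⟨⟨x n, hxn⟩, fun hmem => ?_⟩
      have : x n ∈ Submodule.span ℂ (x '' Iio n) := hmem
      exact hli.notMem_span_image (s := Iio n) (x := n) (by simp) this
    obtain ⟨y, -, hy1, hy2⟩ := riesz_lemma_of_lt_one hc hne (r := 1 / 2) (by norm_num)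
    refine ⟨y, y.2, hy1, fun v hv => ?_⟩
    exact hy2 ⟨v, hVmono (Nat.le_succ n) hv⟩ hv
  choose y hyV hy1 hy2 using hy
  obtain ⟨K, hK, hKs⟩ := hk.image_closedBall_subset_compact
    (f := ((T ^ k : Y →L[ℂ] Y) : Y →ₗ[ℂ] Y)) 1
  obtain ⟨u, -, ψ, hψ, hlim⟩ := hK.tendsto_subseq (x := fun n => (T ^ k) (y n))
    fun n => hKs ⟨y n, by simp [hy1], rfl⟩
  have hsep : ∀ m n, m < n → r ^ k / 2 ≤ ‖(T ^ k) (y n) - (T ^ k) (y m)‖ := by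
    intro m n hmn
    have hμ0 : μ n ^ k ≠ 0 := pow_ne_zero _ (norm_pos_iff.1 (hr.trans_le (hμ n).1))
    set v : Y := (μ n ^ k)⁻¹ • ((T ^ k) (y m) - ((T ^ k) (y n) - μ n ^ k • y n))
    have hv : v ∈ V n := by
      refine (V n).smul_mem _ ((V n).sub_mem ?_ (hVs n _ (hyV n)))
      exact hVT n _ (hVmono hmn (hyV m))
    have h1 : (T ^ k) (y n) - (T ^ k) (y m) = μ n ^ k • (y n - v) := by
      rw [smul_sub, smul_inv_smul₀ hμ0]; abel
    rw [h1, norm_smul, norm_pow]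
    have := hy2 n v hv
    have h3 : r ^ k ≤ ‖μ n‖ ^ k := pow_le_pow_left₀ hr.le (hμ n).1 k
    have h4 : 0 < r ^ k := by positivity
    nlinarith
  have hcs := hlim.cauchySeq
  rw [Metric.cauchySeq_iff'] at hcs
  obtain ⟨N, hN⟩ := hcs (r ^ k / 2) (by positivity)
  have h1 := hN (N + 1) (Nat.le_succ N)
  have h2 := hsep (ψ N) (ψ (N + 1)) (hψ (Nat.lt_succ_self N))
  rw [dist_eq_norm] at h1
  simp only [Function.comp_apply] at h1
  linarith

/-- Apply the factors $T-a$ to the vector one at a time: the first factor that sends a nonzero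
vector to zero exhibits an eigenvector. -/
lemma exists_root_of_aeval_apply_eq_zero {T : Y →L[ℂ] Y} (s : Multiset ℂ) :
    ∀ x : Y, x ≠ 0 → (Polynomial.aeval T (s.map fun a => Polynomial.X - Polynomial.C a).prod) x = 0 →
      ∃ a ∈ s, IsEigenvalue T a := by
  induction s using Multiset.induction_on with
  | empty => intro x hx h; simp at h; exact absurd h hx
  | cons a s ih =>
    intro x hx h
    rw [Multiset.map_cons, Multiset.prod_cons, map_mul, mul_apply_eq_comp] at h
    by_cases h0 : (Polynomial.aeval T (s.map fun a => Polynomial.X - Polynomial.C a).prod) x = 0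
    · obtain ⟨b, hb, hb'⟩ := ih x hx h0
      exact ⟨b, Multiset.mem_cons_of_mem hb, hb'⟩
    · refine ⟨a, Multiset.mem_cons_self a s, _, h0, ?_⟩
      rw [map_sub, Polynomial.aeval_X, Polynomial.aeval_C, sub_apply,
        sub_eq_zero] at h
      rw [h, Algebra.algebraMap_eq_smul_one]
      simp

lemma exists_root_eigenvalue {T : Y →L[ℂ] Y} {n : ℕ} (hn : n ≠ 0) {c : ℂ}
    (h : IsEigenvalue (T ^ n) c) : ∃ a, a ^ n = c ∧ IsEigenvalue T a := by
  obtain ⟨x, hx, hTx⟩ := h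
  set p : Polynomial ℂ := Polynomial.X ^ n - Polynomial.C c with hp
  have hs : p.Splits := IsAlgClosed.splits p
  have hpm : p.Monic := Polynomial.monic_X_pow_sub_C c hn
  obtain ⟨a, ha, hea⟩ := exists_root_of_aeval_apply_eq_zero (T := T) p.roots x hx (by
    rw [← hs.eq_prod_roots_of_monic hpm, hp, map_sub, map_pow, Polynomial.aeval_X,
      Polynomial.aeval_C, sub_apply, hTx, Algebra.algebraMap_eq_smul_one]
    simp)
  refine ⟨a, ?_, hea⟩
  have := Polynomial.isRoot_of_mem_roots ha
  rw [Polynomial.IsRoot, hp] at this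
  simpa [sub_eq_zero] using this

lemma IsCompactOperator.pow_of_le {T : Y →L[ℂ] Y} {k n : ℕ} (hk : IsCompactOperator (T ^ k))
    (hkn : k ≤ n) : IsCompactOperator (T ^ n) := by
  have : T ^ n = (T ^ k).comp (T ^ (n - k)) := by
    rw [← ContinuousLinearMap.mul_def, ← pow_add, Nat.add_sub_cancel' hkn]
  rw [this]
  exact hk.comp_clm _

variable [CompleteSpace Y]

/-- The nonzero spectrum of a power compact operator consists of eigenvalues. -/
lemma isEigenvalue_of_mem_spectrum {T : Y →L[ℂ] Y} {k : ℕ} (hk : IsCompactOperator (T ^ k))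
    {z : ℂ} (hz : z ∈ spectrum ℂ T) (hz0 : z ≠ 0) : IsEigenvalue T z := by
  have hF := finite_eigenvalues hk (norm_pos_iff.2 hz0)
  set F := hF.toFinset
  -- For compact $T^n$ the point $z^n$ is an eigenvalue, which only gives an eigenvalue $a$ of $T$
  -- with $a^n=z^n$. There are finitely many candidates $a$, and $N$ is a multiple of every finite
  -- order of a quotient $a/z$. With $n=1+kN$ the order of $a/z$ divides both $n$ and $kN$, so
  -- $a=z$.
  set N : ℕ := ∏ a ∈ F, if orderOf (a / z) = 0 then 1 else orderOf (a / z) with hN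
  have hN1 : 1 ≤ N := Finset.one_le_prod' fun a _ => by split_ifs <;> omega
  set n := 1 + k * N with hn
  have hkn : k ≤ n := by rw [hn]; nlinarith
  have hc := IsCompactOperator.pow_of_le hk hkn
  have hzn : z ^ n ∈ spectrum ℂ (T ^ n) := spectrum.pow_mem_pow T n hz
  have hev : IsEigenvalue (T ^ n) (z ^ n) := by
    rw [isEigenvalue_iff]
    exact (IsCompactOperator.hasEigenvalue_iff_mem_spectrum hc (pow_ne_zero n hz0)).2 hzn
  obtain ⟨a, ha, hea⟩ := exists_root_eigenvalue (by omega) hev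
  have hnorm : ‖a‖ = ‖z‖ := by
    have := congrArg norm ha
    rw [norm_pow, norm_pow] at this
    exact (pow_left_inj₀ (norm_nonneg _) (norm_nonneg _) (by omega)).1 this
  have haF : a ∈ F := by
    rw [Set.Finite.mem_toFinset]; exact ⟨hnorm.ge, hea⟩
  have h1 : (a / z) ^ n = 1 := by rw [div_pow, ha, div_self (pow_ne_zero n hz0)]
  have h2 : orderOf (a / z) ∣ n := orderOf_dvd_of_pow_eq_one h1
  have h3 : orderOf (a / z) ≠ 0 := by
    rw [orderOf_ne_zero_iff, isOfFinOrder_iff_pow_eq_one]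
    exact ⟨n, by omega, h1⟩
  have h4 : orderOf (a / z) ∣ N := by
    have := Finset.dvd_prod_of_mem (fun a => if orderOf (a / z) = 0 then 1 else orderOf (a / z)) haF
    simpa [h3] using this
  have h5 : orderOf (a / z) ∣ 1 := by
    rw [hn] at h2
    exact (Nat.dvd_add_left (h4.mul_left k)).1 h2
  have h6 : a / z = 1 := by
    rw [← orderOf_eq_one_iff]; exact Nat.dvd_one.1 h5
  rw [div_eq_one_iff_eq hz0] at h6
  rw [← h6]; exact hea

lemma finite_spectrum_of_norm_ge {T : Y →L[ℂ] Y} {k : ℕ} (hk : IsCompactOperator (T ^ k)) {r : ℝ}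
    (hr : 0 < r) : {z : ℂ | r ≤ ‖z‖ ∧ z ∈ spectrum ℂ T}.Finite :=
  (finite_eigenvalues hk hr).subset fun _ hz =>
    ⟨hz.1, isEigenvalue_of_mem_spectrum hk hz.2 (norm_pos_iff.1 (hr.trans_le hz.1))⟩

/-- Each nonzero point of the spectrum of a power compact operator is isolated, with finite
algebraic multiplicity. -/
lemma exists_isIsolatedOfAlgMult {T : Y →L[ℂ] Y} {k : ℕ} (hk : IsCompactOperator (T ^ k))
    {z : ℂ} (hz : z ∈ spectrum ℂ T) (hz0 : z ≠ 0) : ∃ n, IsIsolatedOfAlgMult T z n := by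
  have hzn : 0 < ‖z‖ := norm_pos_iff.2 hz0
  have hF := finite_spectrum_of_norm_ge hk (r := ‖z‖ / 2) (by positivity)
  set F := {v : ℂ | ‖z‖ / 2 ≤ ‖v‖ ∧ v ∈ spectrum ℂ T} \ {z}
  have hFc : IsClosed F := (hF.subset sdiff_subset).isClosed
  have hnF : Fᶜ ∈ 𝓝 z := hFc.isOpen_compl.mem_nhds fun h => h.2 rfl
  obtain ⟨ρ, hρ, hball⟩ := Metric.mem_nhds_iff.1 hnF
  set r := min (ρ / 2) (‖z‖ / 2) with hr
  have hr0 : 0 < r := by positivity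
  have hnorm : ∀ v ∈ Metric.closedBall z r, ‖z‖ / 2 ≤ ‖v‖ := by
    intro v hv
    rw [Metric.mem_closedBall, dist_eq_norm] at hv
    have h1 : ‖z‖ ≤ ‖v‖ + ‖v - z‖ := by
      have := norm_sub_le v (v - z); simpa using this
    have : r ≤ ‖z‖ / 2 := min_le_right _ _
    linarith
  have hiso : spectrum ℂ T ∩ Metric.closedBall z r = {z} := by
    refine Subset.antisymm (fun v hv => ?_) ?_
    · by_contra hne
      have : v ∈ Fᶜ := hball (by
        rw [Metric.mem_ball]
        have h1 : dist v z ≤ r := hv.2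
        have : r ≤ ρ / 2 := min_le_left _ _
        linarith)
      exact this ⟨⟨hnorm v hv.2, hv.1⟩, hne⟩
    · rw [singleton_subset_iff]; exact ⟨hz, Metric.mem_closedBall_self hr0.le⟩
  refine ⟨_, r, hr0, hiso, ?_, rfl⟩
  set P := rieszProjection T z r with hP
  have hidem : P * P = P := riesz_idempotent hr0 hiso.subset
  -- compactness
  have hcomp : IsCompactOperator P := by
    have hres : ∀ w ∈ Metric.sphere z r, w ∈ resolventSet ℂ T := by
      intro w hw
      by_contra hn
      have : w = z := hiso.subset ⟨hn, Metric.sphere_subset_closedBall hw⟩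
      rw [this, Metric.mem_sphere, dist_self] at hw
      linarith
    have hne0 : ∀ w ∈ Metric.closedBall z r, w ≠ 0 := fun w hw h0 => by
      have := hnorm w hw
      rw [h0, norm_zero] at this; linarith
    -- The factorisation $w^k-T^k=G(w)(w-T)$ splits the resolvent into $w^{-k}G(w)$, which is
    -- holomorphic in the disc and integrates to zero, and a part with the compact left factor
    -- $T^k$. Hence the projection is compact.
    set G : ℂ → Y →L[ℂ] Y := fun w => ∑ j ∈ Finset.range k, w ^ j • T ^ (k - 1 - j) with hG
    have hRG : ∀ w ∈ Metric.sphere z r, resolvent T w =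
        (w ^ k)⁻¹ • G w + T ^ k * ((w ^ k)⁻¹ • resolvent T w) := by
      intro w hw
      have hwk : w ^ k ≠ 0 := pow_ne_zero k (hne0 w (Metric.sphere_subset_closedBall hw))
      have hcomm : Commute (algebraMap ℂ (Y →L[ℂ] Y) w) T := Algebra.commutes w T
      have h1 := hcomm.geom_sum₂_mul k
      have h2 : ∑ j ∈ Finset.range k, (algebraMap ℂ (Y →L[ℂ] Y) w) ^ j * T ^ (k - 1 - j) = G w := by
        rw [hG]
        refine Finset.sum_congr rfl fun j _ => ?_
        rw [← map_pow, Algebra.algebraMap_eq_smul_one, smul_mul_assoc, one_mul]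
      rw [h2] at h1
      have h3 := congrArg (· * resolvent T w) h1
      simp only [mul_assoc, sub_mul_resolvent (hres w hw), mul_one] at h3
      rw [sub_mul, ← map_pow, Algebra.algebraMap_eq_smul_one, smul_mul_assoc, one_mul] at h3
      rw [mul_smul_comm, ← smul_add, h3, sub_add_cancel, smul_smul, inv_mul_cancel₀ hwk, one_smul]
    have hcR : ContinuousOn (resolvent T) (Metric.sphere z r) := fun w hw =>
      (differentiableAt_resolvent (hres w hw)).continuousAt.continuousWithinAt
    have hdG : ∀ w ∈ Metric.closedBall z r, DifferentiableAt ℂ (fun w => (w ^ k)⁻¹ • G w) w := by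
      intro w hw
      have hwk : w ^ k ≠ 0 := pow_ne_zero k (hne0 w hw)
      refine DifferentiableAt.fun_smul ?_ ?_
      · exact DifferentiableAt.fun_inv (differentiableAt_pow k) hwk
      · exact DifferentiableAt.fun_sum fun j _ => (differentiableAt_pow j).smul_const _
    have hck : ContinuousOn (fun w => (w ^ k)⁻¹ • resolvent T w) (Metric.sphere z r) := by
      refine ContinuousOn.fun_smul ?_ hcR
      exact (continuousOn_id.pow k).inv₀ fun w hw =>
        pow_ne_zero k (hne0 w (Metric.sphere_subset_closedBall hw))
    have hck' : ContinuousOn (fun w => T ^ k * ((w ^ k)⁻¹ • resolvent T w)) (Metric.sphere z r) :=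
      continuousOn_const.mul hck
    have hGc : ContinuousOn (fun w => (w ^ k)⁻¹ • G w) (Metric.closedBall z r) := fun w hw =>
      (hdG w hw).continuousAt.continuousWithinAt
    have hint : (∮ w in C(z, r), resolvent T w) =
        T ^ k * ∮ w in C(z, r), (w ^ k)⁻¹ • resolvent T w := by
      rw [circleIntegral.integral_congr hr0.le hRG, circleIntegral.integral_add
        ((hGc.mono Metric.sphere_subset_closedBall).circleIntegrable hr0.le)
        (hck'.circleIntegrable hr0.le),
        Complex.circleIntegral_eq_zero_of_differentiable_on_off_countable hr0.le countable_empty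
          hGc fun w hw => hdG w (Metric.ball_subset_closedBall hw.1), zero_add]
      have h2 := circleIntegral_clm (ContinuousLinearMap.mul ℂ (Y →L[ℂ] Y) (T ^ k))
        (hck.circleIntegrable hr0.le)
      simpa only [ContinuousLinearMap.mul_apply'] using h2
    rw [hP, rieszProjection, hint, ← mul_smul_comm]
    exact hk.comp_clm _
  -- a compact projection has finite rank
  have hfix : ∀ y ∈ LinearMap.range P.toLinearMap, P y = y := by
    rintro _ ⟨x, rfl⟩
    exact congrArg (fun Q : Y →L[ℂ] Y => Q x) hidem
  refine FiniteDimensional.of_isCompactOperator_id (𝕜 := ℂ) ?_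
  have hclosed : IsClosed (LinearMap.range P.toLinearMap : Set Y) := by
    have : (LinearMap.range P.toLinearMap : Set Y) = {y | P y = y} := by
      ext y
      exact ⟨fun h => hfix y h, fun h => ⟨y, h⟩⟩
    rw [this]
    exact isClosed_eq P.continuous continuous_id
  have h1 := IsCompactOperator.restrict (f := P.toLinearMap) hcomp
    (V := LinearMap.range P.toLinearMap) (fun v _ => ⟨v, rfl⟩) hclosed
  have h2 : (id : LinearMap.range P.toLinearMap → LinearMap.range P.toLinearMap) =
      P.toLinearMap.restrict (p := LinearMap.range P.toLinearMap)
        (q := LinearMap.range P.toLinearMap) (fun v _ => ⟨v, rfl⟩) :=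
    funext fun v => Subtype.ext (hfix v v.2).symm
  rw [h2]
  exact h1

end PowerCompact

end

section

/-! ### Rank one perturbations -/

section RankOne

lemma continuousAt_resolvent {A : Type*} [NormedRing A] [NormedAlgebra ℂ A] [CompleteSpace A]
    {a : A} {w : ℂ} (hw : w ∈ resolventSet ℂ a) :
    ContinuousAt (fun p : A × ℂ => resolvent p.1 p.2) (a, w) := by
  have h1 : ContinuousAt (fun p : A × ℂ => algebraMap ℂ A p.2 - p.1) (a, w) := by
    have : Continuous fun p : A × ℂ => algebraMap ℂ A p.2 - p.1 :=
      ((algebraMapCLM ℂ A).continuous.comp continuous_snd).sub continuous_fst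
    exact this.continuousAt
  have h2 : ContinuousAt Ring.inverse (algebraMap ℂ A w - a) := by
    obtain ⟨u, hu⟩ := hw
    rw [← hu]
    exact NormedRing.inverse_continuousAt u
  exact ContinuousAt.comp (f := fun p : A × ℂ => algebraMap ℂ A p.2 - p.1) (x := (a, w)) h2 h1

lemma eventually_mem_resolventSet {A : Type*} [NormedRing A] [NormedAlgebra ℂ A] [CompleteSpace A]
    {a : A} {w : ℂ} (hw : w ∈ resolventSet ℂ a) :
    ∀ᶠ p in 𝓝 (a, w), p.2 ∈ resolventSet ℂ p.1 := by
  have h1 : ContinuousAt (fun p : A × ℂ => algebraMap ℂ A p.2 - p.1) (a, w) := by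
    have : Continuous fun p : A × ℂ => algebraMap ℂ A p.2 - p.1 :=
      ((algebraMapCLM ℂ A).continuous.comp continuous_snd).sub continuous_fst
    exact this.continuousAt
  exact h1.eventually (Units.isOpen.mem_nhds hw)

/-- A function which is close to the identity, in the Lipschitz sense, has a zero. -/
lemma exists_zero_of_lipschitz {f : ℂ → ℂ} {ρ : ℝ} (hρ : 0 < ρ)
    (hlip : ∀ w w' : ℂ, ‖w - 1‖ < ρ → ‖w' - 1‖ < ρ →
      ‖(w' - f w') - (w - f w)‖ ≤ 1 / 2 * ‖w' - w‖) (hf1 : ‖f 1‖ < ρ / 4) :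
    ∃ ν : ℂ, ‖ν - 1‖ ≤ ρ / 2 ∧ f ν = 0 := by
  have h11 : ‖(1 : ℂ) - 1‖ < ρ := by simpa using hρ
  -- The map $w\mapsto w-f(w)$ is a contraction of the ball of radius $\rho/2$: it moves the centre
  -- by less than $\rho/4$, and $\frac12\cdot\frac\rho2+\frac\rho4=\frac\rho2$.
  have hmaps : MapsTo (fun w => w - f w) (Metric.closedBall (1 : ℂ) (ρ / 2))
      (Metric.closedBall 1 (ρ / 2)) := by
    intro w hw
    rw [Metric.mem_closedBall, dist_eq_norm] at hw ⊢
    have h2 := hlip 1 w h11 (by linarith)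
    have h3 : w - f w - 1 = ((w - f w) - (1 - f 1)) - f 1 := by ring
    rw [h3]
    refine (norm_sub_le _ _).trans ?_
    have : ‖f 1‖ < ρ / 4 := hf1
    linarith
  have hcontr : ContractingWith (1 / 2)
      (hmaps.restrict (fun w => w - f w) (Metric.closedBall (1 : ℂ) (ρ / 2)) _) := by
    refine ⟨by norm_num, LipschitzWith.of_dist_le_mul fun a b => ?_⟩
    have ha := a.2
    have hb := b.2
    rw [Metric.mem_closedBall, dist_eq_norm] at ha hb
    rw [Subtype.dist_eq, Subtype.dist_eq, dist_eq_norm, dist_eq_norm]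
    have := hlip b a (by linarith) (by linarith)
    simpa using this
  obtain ⟨y, hy, hfix, -⟩ := hcontr.exists_fixedPoint' (x := (1 : ℂ))
    (Metric.isClosed_closedBall.isComplete) hmaps (Metric.mem_closedBall_self (by positivity))
    (edist_ne_top _ _)
  rw [Metric.mem_closedBall, dist_eq_norm] at hy
  refine ⟨y, hy, ?_⟩
  have : y - f y = y := hfix
  linear_combination -this

variable {Y : Type*} [NormedAddCommGroup Y] [NormedSpace ℂ Y]

lemma resolvent_apply_sub {S : Y →L[ℂ] Y} {w : ℂ} (hw : w ∈ resolventSet ℂ S) (x : Y) :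
    resolvent S w (w • x - S x) = x := by
  have := congrArg (fun Q : Y →L[ℂ] Y => Q x) (resolvent_mul_sub hw)
  simpa [Algebra.algebraMap_eq_smul_one] using this

lemma sub_apply_resolvent {S : Y →L[ℂ] Y} {w : ℂ} (hw : w ∈ resolventSet ℂ S) (x : Y) :
    w • resolvent S w x - S (resolvent S w x) = x := by
  have := congrArg (fun Q : Y →L[ℂ] Y => Q x) (sub_mul_resolvent hw)
  simpa [Algebra.algebraMap_eq_smul_one] using this

lemma resolvent_sub_apply {S : Y →L[ℂ] Y} {v w : ℂ} (hv : v ∈ resolventSet ℂ S)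
    (hw : w ∈ resolventSet ℂ S) (x : Y) :
    (w - v) • resolvent S v (resolvent S w x) = resolvent S v x - resolvent S w x := by
  have := congrArg (fun Q : Y →L[ℂ] Y => Q x) (resolvent_mul_resolvent hv hw)
  simpa using this

lemma IsEigenvalue.mem_spectrum {T : Y →L[ℂ] Y} {z : ℂ} (h : IsEigenvalue T z) :
    z ∈ spectrum ℂ T := by
  obtain ⟨x, hx, hT⟩ := h
  by_contra hz
  rw [spectrum.notMem_iff] at hz
  have := resolvent_apply_sub (S := T) (w := z) hz x
  rw [hT, sub_self, map_zero] at this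
  exact hx this.symm

variable {S : Y →L[ℂ] Y} {φ : Y} {ℓ : Y →L[ℂ] ℂ} {w : ℂ}

/-- The resolvent of a rank one perturbation. -/
lemma resolvent_rankOne (hw : w ∈ resolventSet ℂ S) (hf : ℓ (resolvent S w φ) ≠ 1) :
    w ∈ resolventSet ℂ (S + ℓ.smulRight φ) ∧
      resolvent (S + ℓ.smulRight φ) w = resolvent S w +
        (1 - ℓ (resolvent S w φ))⁻¹ • (ℓ.comp (resolvent S w)).smulRight (resolvent S w φ) := by
  set B := resolvent S w
  have hne : 1 - ℓ (B φ) ≠ 0 := sub_ne_zero.2 (Ne.symm hf)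
  have key : 1 + (1 - ℓ (B φ))⁻¹ * ℓ (B φ) = (1 - ℓ (B φ))⁻¹ := by field_simp; ring
  refine resolvent_eq_of_inverse ?_ ?_
  · ext x
    have h3 : S (B x) = w • B x - x := by
      rw [sub_eq_iff_eq_add.1 (sub_apply_resolvent hw x)]; abel
    have h4 : S (B φ) = w • B φ - φ := by
      rw [sub_eq_iff_eq_add.1 (sub_apply_resolvent hw φ)]; abel
    simp only [Algebra.algebraMap_eq_smul_one, mul_apply_eq_comp, sub_apply, smul_apply,
      one_apply_eq_self, add_apply, ContinuousLinearMap.smulRight_apply,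
      ContinuousLinearMap.comp_apply, map_add, map_smul, h3, h4]
    have : (1 - ℓ (B φ))⁻¹ * ℓ (B x) * ℓ (B φ) = (1 - ℓ (B φ))⁻¹ * ℓ (B x) - ℓ (B x) := by
      field_simp; ring
    match_scalars <;> first | ring1 | (linear_combination this) | (linear_combination -this)
  · ext x
    have h1 := resolvent_apply_sub hw x
    have h3 : B (S x) = w • B x - x := by
      rw [map_sub, map_smul] at h1
      rw [sub_eq_iff_eq_add.1 h1]; abel
    simp only [Algebra.algebraMap_eq_smul_one, mul_apply_eq_comp, sub_apply, smul_apply,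
      one_apply_eq_self, add_apply, ContinuousLinearMap.smulRight_apply,
      ContinuousLinearMap.comp_apply, map_add, map_sub, map_smul, h3, smul_eq_mul]
    have : (1 - ℓ (B φ))⁻¹ * ℓ x * ℓ (B φ) = (1 - ℓ (B φ))⁻¹ * ℓ x - ℓ x := by
      field_simp; ring
    match_scalars <;> first | ring1 | (linear_combination this) | (linear_combination -this)

lemma rankOne_eigen (hw : w ∈ resolventSet ℂ S) (hf : ℓ (resolvent S w φ) = 1) :
    (S + ℓ.smulRight φ) (resolvent S w φ) = w • resolvent S w φ := by
  have h2 := sub_apply_resolvent hw φ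
  rw [add_apply, ContinuousLinearMap.smulRight_apply, hf, one_smul]
  rw [sub_eq_iff_eq_add.1 h2, add_comm]

/-- The same scalar equation yields a left eigenvector, $\ell\circ(w-S)^{-1}$; no separate theory of
the adjoint is needed. -/
lemma rankOne_dual_eigen (hw : w ∈ resolventSet ℂ S) (hf : ℓ (resolvent S w φ) = 1) (x : Y) :
    ℓ (resolvent S w ((S + ℓ.smulRight φ) x)) = w * ℓ (resolvent S w x) := by
  have h1 := congrArg ℓ (resolvent_apply_sub hw x)
  rw [map_sub, map_sub, map_smul, map_smul, smul_eq_mul] at h1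
  rw [add_apply, ContinuousLinearMap.smulRight_apply, map_add, map_smul, map_add, map_smul, hf,
    smul_eq_mul, mul_one, ← h1]
  ring

variable [CompleteSpace Y]

/-- A zero `ν` of `w ↦ 1 - ℓ ((w - S)⁻¹ φ)` which is simple is a simple eigenvalue of the rank one
perturbation. -/
lemma rankOne_isIsolated {ν : ℂ} {r : ℝ} (hr : 0 < r)
    (hS : ∀ w ∈ Metric.closedBall ν r, w ∈ resolventSet ℂ S)
    (hν : ℓ (resolvent S ν φ) = 1)
    (hg : ∀ w ∈ Metric.closedBall ν r, ℓ (resolvent S ν (resolvent S w φ)) ≠ 0) :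
    spectrum ℂ (S + ℓ.smulRight φ) ∩ Metric.closedBall ν r = {ν} ∧
      IsIsolatedOfAlgMult (S + ℓ.smulRight φ) ν 1 := by
  have hνr := hS ν (Metric.mem_closedBall_self hr.le)
  -- The resolvent identity splits off the zero at $\nu$ with a cofactor that does not vanish on the
  -- disc. So $\nu$ is the only spectral point there and a simple pole of the resolvent.
  have hf : ∀ w ∈ Metric.closedBall ν r, 1 - ℓ (resolvent S w φ) =
      (w - ν) * ℓ (resolvent S ν (resolvent S w φ)) := by
    intro w hw
    rw [← smul_eq_mul, ← map_smul, resolvent_sub_apply hνr (hS w hw), map_sub, hν]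
  have hne : ∀ w ∈ Metric.closedBall ν r, w ≠ ν → ℓ (resolvent S w φ) ≠ 1 := by
    intro w hw hwν h1
    have := hf w hw
    rw [h1, sub_self] at this
    exact mul_ne_zero (sub_ne_zero.2 hwν) (hg w hw) this.symm
  have hφ : resolvent S ν φ ≠ 0 := fun h0 => by rw [h0, map_zero] at hν; exact zero_ne_one hν
  have hspec : spectrum ℂ (S + ℓ.smulRight φ) ∩ Metric.closedBall ν r = {ν} := by
    refine Subset.antisymm (fun w hw => ?_) ?_
    · by_contra hwν
      exact hw.1 (resolvent_rankOne (hS w hw.2) (hne w hw.2 hwν)).1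
    · rw [singleton_subset_iff]
      exact ⟨IsEigenvalue.mem_spectrum ⟨_, hφ, rankOne_eigen hνr hν⟩,
        Metric.mem_closedBall_self hr.le⟩
  refine ⟨hspec, r, hr, hspec, ?_⟩
  -- The resolvent is a holomorphic function plus $(w-\nu)^{-1}Q(w)$ with $Q$ holomorphic, so by
  -- Cauchy's formula the Riesz projection is $Q(\nu)$, of rank one.
  set Q : ℂ → Y →L[ℂ] Y := fun w => (ℓ (resolvent S ν (resolvent S w φ)))⁻¹ •
    (ℓ.comp (resolvent S w)).smulRight (resolvent S w φ) with hQ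
  have hdB : ∀ w ∈ Metric.closedBall ν r, DifferentiableAt ℂ (resolvent S) w := fun w hw =>
    differentiableAt_resolvent (hS w hw)
  have hdQ : ∀ w ∈ Metric.closedBall ν r, DifferentiableAt ℂ Q w := by
    intro w hw
    have h1 : DifferentiableAt ℂ (fun w => resolvent S w φ) w :=
      (hdB w hw).clm_apply (differentiableAt_const φ)
    have h2 : DifferentiableAt ℂ (fun w => ℓ (resolvent S ν (resolvent S w φ))) w :=
      (ℓ.comp (resolvent S ν)).differentiableAt.comp w h1
    have h3 : DifferentiableAt ℂ (fun w => ℓ.comp (resolvent S w)) w :=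
      (differentiableAt_const ℓ).clm_comp (hdB w hw)
    refine DifferentiableAt.fun_smul (DifferentiableAt.fun_inv h2 (hg w hw)) ?_
    have h4 := ((ContinuousLinearMap.smulRightL ℂ Y Y).differentiableAt.comp w h3).clm_apply h1
    exact h4
  have hres : ∀ w ∈ Metric.sphere ν r, resolvent (S + ℓ.smulRight φ) w =
      resolvent S w + (w - ν)⁻¹ • Q w := by
    intro w hw
    have hw' := Metric.sphere_subset_closedBall hw
    have hwν : w ≠ ν := by
      rintro rfl
      rw [Metric.mem_sphere, dist_self] at hw; linarith
    rw [(resolvent_rankOne (hS w hw') (hne w hw' hwν)).2, hf w hw', mul_inv, hQ, smul_smul]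
  have hproj : rieszProjection (S + ℓ.smulRight φ) ν r = Q ν := by
    have hcB : ContinuousOn (resolvent S) (Metric.closedBall ν r) := fun w hw =>
      (hdB w hw).continuousAt.continuousWithinAt
    have hcQ : ContinuousOn Q (Metric.closedBall ν r) := fun w hw =>
      (hdQ w hw).continuousAt.continuousWithinAt
    have hcQ' : ContinuousOn (fun w => (w - ν)⁻¹ • Q w) (Metric.sphere ν r) := by
      refine ContinuousOn.fun_smul ((continuousOn_id.sub continuousOn_const).inv₀ ?_)
        (hcQ.mono Metric.sphere_subset_closedBall)
      intro w hw h0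
      have h0 : w - ν = 0 := h0
      rw [sub_eq_zero] at h0
      rw [h0, Metric.mem_sphere, dist_self] at hw; linarith
    rw [rieszProjection, circleIntegral.integral_congr hr.le hres, circleIntegral.integral_add
      ((hcB.mono Metric.sphere_subset_closedBall).circleIntegrable hr.le)
      (hcQ'.circleIntegrable hr.le),
      Complex.circleIntegral_eq_zero_of_differentiable_on_off_countable hr.le countable_empty
        hcB fun w hw => hdB w (Metric.ball_subset_closedBall hw.1), zero_add,
      Complex.circleIntegral_sub_inv_smul_of_differentiable_on_off_countable countable_empty
        (Metric.mem_ball_self hr) hcQ fun w hw => hdQ w (Metric.ball_subset_closedBall hw.1),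
      smul_smul, inv_mul_cancel₀ Complex.two_pi_I_ne_zero, one_smul]
  have hrange : LinearMap.range (Q ν).toLinearMap = Submodule.span ℂ {resolvent S ν φ} := by
    have hgν := hg ν (Metric.mem_closedBall_self hr.le)
    refine le_antisymm ?_ ?_
    · rintro _ ⟨x, rfl⟩
      rw [Submodule.mem_span_singleton]
      exact ⟨_, (smul_smul _ (ℓ (resolvent S ν x)) (resolvent S ν φ)).symm⟩
    · rw [Submodule.span_singleton_le_iff_mem]
      refine ⟨resolvent S ν φ, ?_⟩
      change (ℓ (resolvent S ν (resolvent S ν φ)))⁻¹ • ℓ (resolvent S ν (resolvent S ν φ)) •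
        resolvent S ν φ = _
      rw [smul_smul, inv_mul_cancel₀ hgν, one_smul]
  rw [hproj, hrange]
  exact ⟨inferInstance, finrank_span_singleton hφ⟩

/-- By the resolvent identity the difference quotients of $f(w)=1-\ell((w-S)^{-1}\varphi)$ are the
numbers controlled by `hg`. Being within $1/2$ of $1$, they make $w-f(w)$ a contraction, which gives
the zero; being nonzero, they make it unique and simple. -/
lemma exists_simple_eigenvalue {ρ : ℝ} (hρ : 0 < ρ)
    (hres : ∀ w : ℂ, ‖w - 1‖ < ρ → w ∈ resolventSet ℂ S)
    (hg : ∀ w w' : ℂ, ‖w - 1‖ < ρ → ‖w' - 1‖ < ρ →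
      ‖ℓ (resolvent S w (resolvent S w' φ)) - 1‖ ≤ 1 / 2)
    (hf1 : ‖1 - ℓ (resolvent S (1 : ℂ) φ)‖ < ρ / 4) :
    ∃ ν : ℂ, ‖ν - 1‖ < ρ ∧ ‖ν - 1‖ ≤ 2 * ‖1 - ℓ (resolvent S (1 : ℂ) φ)‖ ∧
      ℓ (resolvent S ν φ) = 1 ∧ spectrum ℂ (S + ℓ.smulRight φ) ∩ {z | ‖z - 1‖ < ρ} = {ν} ∧
      IsIsolatedOfAlgMult (S + ℓ.smulRight φ) ν 1 := by
  set f : ℂ → ℂ := fun w => 1 - ℓ (resolvent S w φ) with hfdef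
  have hff : ∀ w w' : ℂ, ‖w - 1‖ < ρ → ‖w' - 1‖ < ρ →
      f w' - f w = (w' - w) * ℓ (resolvent S w (resolvent S w' φ)) := by
    intro w w' hw hw'
    rw [← smul_eq_mul, ← map_smul, resolvent_sub_apply (hres w hw) (hres w' hw'), map_sub]
    simp only [hfdef]; ring
  have hlip : ∀ w w' : ℂ, ‖w - 1‖ < ρ → ‖w' - 1‖ < ρ →
      ‖(w' - f w') - (w - f w)‖ ≤ 1 / 2 * ‖w' - w‖ := by
    intro w w' hw hw'
    have : (w' - f w') - (w - f w) =
        (w' - w) * (1 - ℓ (resolvent S w (resolvent S w' φ))) := by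
      rw [mul_sub, mul_one, ← hff w w' hw hw']; ring
    rw [this, norm_mul, mul_comm, norm_sub_rev]
    gcongr
    exact hg w w' hw hw'
  have h11 : ‖(1 : ℂ) - 1‖ < ρ := by simpa using hρ
  obtain ⟨ν, hν1, hν0⟩ := exists_zero_of_lipschitz hρ hlip hf1
  have hνρ : ‖ν - 1‖ < ρ := by linarith
  have hνf : ℓ (resolvent S ν φ) = 1 := by
    have : 1 - ℓ (resolvent S ν φ) = 0 := hν0
    linear_combination -this
  have hgne : ∀ w : ℂ, ‖w - 1‖ < ρ → ℓ (resolvent S ν (resolvent S w φ)) ≠ 0 := by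
    intro w hw h0
    have := hg ν w hνρ hw
    rw [h0] at this; norm_num at this
  obtain ⟨hsp, hiso⟩ := rankOne_isIsolated (S := S) (φ := φ) (ℓ := ℓ) (ν := ν) (r := ρ / 4)
    (by positivity)
    (fun w hw => hres w (by
      rw [Metric.mem_closedBall, dist_eq_norm] at hw
      have := norm_add_le (w - ν) (ν - 1)
      rw [sub_add_sub_cancel] at this; linarith)) hνf
    (fun w hw => hgne w (by
      rw [Metric.mem_closedBall, dist_eq_norm] at hw
      have := norm_add_le (w - ν) (ν - 1)
      rw [sub_add_sub_cancel] at this; linarith))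
  refine ⟨ν, hνρ, ?_, hνf, ?_, hiso⟩
  · have h2 := hlip ν 1 hνρ h11
    rw [hν0, sub_zero] at h2
    have h3 : ν - 1 = -((1 - f 1) - ν) - f 1 := by ring
    have h4 : ‖ν - 1‖ ≤ ‖(1 - f 1) - ν‖ + ‖f 1‖ := by
      conv_lhs => rw [h3]
      refine (norm_sub_le _ _).trans ?_
      rw [norm_neg]
    rw [norm_sub_rev 1 ν] at h2
    change _ ≤ 2 * ‖f 1‖
    linarith
  · refine Subset.antisymm (fun w hw => ?_) ?_
    · by_contra hwν
      refine hw.1 (resolvent_rankOne (hres w hw.2) fun h => ?_).1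
      have h2 := hff ν w hνρ hw.2
      have h3 : f w = 0 := by simp only [hfdef]; rw [h, sub_self]
      rw [h3, hν0, sub_zero] at h2
      exact mul_ne_zero (sub_ne_zero.2 hwν) (hgne w hw.2) h2.symm
    · rw [singleton_subset_iff]
      exact ⟨(hsp.symm.subset rfl).1, hνρ⟩

/-- Stability of a simple eigenvalue `1` of `S₀ + ℓ ⊗ φ`. -/
lemma exists_eigenvalue_near_one {S₀ : Y →L[ℂ] Y} (h1 : (1 : ℂ) ∈ resolventSet ℂ S₀)
    (hφ : S₀ φ = 0) (hn : ℓ φ = 1) :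
    ∃ ε > 0, ∃ δ > 0, ∃ K : ℝ,
      (∀ S : Y →L[ℂ] Y, ‖S - S₀‖ ≤ δ → ∀ w : ℂ, ‖w - 1‖ < ε →
        w ∈ resolventSet ℂ S ∧ ‖resolvent S w‖ ≤ K) ∧
      (∀ S S' : Y →L[ℂ] Y, ‖S - S₀‖ ≤ δ → ‖S' - S₀‖ ≤ δ → ∀ w w' : ℂ, ‖w - 1‖ < ε →
        ‖w' - 1‖ < ε → ‖ℓ (resolvent S w (resolvent S' w' φ)) - 1‖ ≤ 1 / 2) ∧
      ∀ S : Y →L[ℂ] Y, ‖S - S₀‖ ≤ δ → ∃ ν : ℂ, ‖ν - 1‖ < ε ∧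
        ‖ν - 1‖ ≤ 2 * ‖1 - ℓ (resolvent S (1 : ℂ) φ)‖ ∧ ℓ (resolvent S ν φ) = 1 ∧
        spectrum ℂ (S + ℓ.smulRight φ) ∩ {z | ‖z - 1‖ < ε} = {ν} ∧
        IsIsolatedOfAlgMult (S + ℓ.smulRight φ) ν 1 := by
  -- At the base point the controlled quantities have the exact values $\ell(\varphi)=1$ and
  -- $1-\ell(\varphi)=0$; all the bounds follow by joint continuity of the resolvent in operator and
  -- spectral parameter.
  have hB1 : resolvent S₀ (1 : ℂ) φ = φ := by
    have := resolvent_apply_sub h1 φ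
    rwa [hφ, sub_zero, one_smul] at this
  have hc := continuousAt_resolvent h1
  have hcφ : ContinuousAt (fun p : (Y →L[ℂ] Y) × ℂ => resolvent p.1 p.2 φ) (S₀, 1) :=
    hc.clm_apply continuousAt_const
  have hcg : ContinuousAt (fun q : ((Y →L[ℂ] Y) × ℂ) × ((Y →L[ℂ] Y) × ℂ) =>
      ℓ (resolvent q.1.1 q.1.2 (resolvent q.2.1 q.2.2 φ))) ((S₀, 1), (S₀, 1)) := by
    refine ℓ.continuous.continuousAt.comp ?_
    refine ContinuousAt.clm_apply ?_ ?_
    · exact hc.comp_of_eq continuousAt_fst rfl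
    · exact hcφ.comp_of_eq continuousAt_snd rfl
  have e1 := eventually_mem_resolventSet h1
  have e2 : ∀ᶠ p in 𝓝 (S₀, (1 : ℂ)), ‖resolvent p.1 p.2‖ < ‖resolvent S₀ (1 : ℂ)‖ + 1 :=
    hc.norm.eventually (gt_mem_nhds (lt_add_one _))
  have e3 : ∀ᶠ q : ((Y →L[ℂ] Y) × ℂ) × ((Y →L[ℂ] Y) × ℂ) in 𝓝 ((S₀, (1 : ℂ)), (S₀, (1 : ℂ))),
      ‖ℓ (resolvent q.1.1 q.1.2 (resolvent q.2.1 q.2.2 φ)) - 1‖ < 1 / 2 :=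
    (hcg.sub (continuousAt_const (y := (1 : ℂ)))).norm.eventually (gt_mem_nhds (by simp [hB1, hn]))
  obtain ⟨ρ₁, hρ₁, h₁⟩ := Metric.eventually_nhds_iff.1 (e1.and e2)
  obtain ⟨ρ₂, hρ₂, h₂⟩ := Metric.eventually_nhds_iff.1 e3
  set ρ := min ρ₁ ρ₂ with hρdef
  have hρ : 0 < ρ := lt_min hρ₁ hρ₂
  have hdist : ∀ (S : Y →L[ℂ] Y) (w : ℂ), ‖S - S₀‖ < ρ → ‖w - 1‖ < ρ →
      dist (S, w) (S₀, (1 : ℂ)) < ρ := by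
    intro S w hS hw
    rw [Prod.dist_eq, max_lt_iff, dist_eq_norm, dist_eq_norm]
    exact ⟨hS, hw⟩
  have hb : ∀ (S : Y →L[ℂ] Y) (w : ℂ), ‖S - S₀‖ < ρ → ‖w - 1‖ < ρ →
      w ∈ resolventSet ℂ S ∧ ‖resolvent S w‖ ≤ ‖resolvent S₀ (1 : ℂ)‖ + 1 := by
    intro S w hS hw
    have h := h₁ ((hdist S w hS hw).trans_le (min_le_left _ _))
    exact ⟨h.1, h.2.le⟩
  have hg : ∀ (S S' : Y →L[ℂ] Y) (w w' : ℂ), ‖S - S₀‖ < ρ → ‖S' - S₀‖ < ρ → ‖w - 1‖ < ρ →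
      ‖w' - 1‖ < ρ → ‖ℓ (resolvent S w (resolvent S' w' φ)) - 1‖ ≤ 1 / 2 := by
    intro S S' w w' hS hS' hw hw'
    have h : dist ((S, w), (S', w')) ((S₀, (1 : ℂ)), (S₀, (1 : ℂ))) < ρ₂ := by
      rw [Prod.dist_eq, max_lt_iff]
      exact ⟨(hdist S w hS hw).trans_le (min_le_right _ _),
        (hdist S' w' hS' hw').trans_le (min_le_right _ _)⟩
    exact (h₂ h).le
  obtain ⟨g, hgdef⟩ : ∃ g : (Y →L[ℂ] Y) → ℂ → ℂ, ∀ S w, g S w = 1 - ℓ (resolvent S w φ) :=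
    ⟨_, fun S w => rfl⟩
  have e4 : ∀ᶠ p : (Y →L[ℂ] Y) × ℂ in 𝓝 (S₀, (1 : ℂ)), ‖g p.1 p.2‖ < ρ / 4 := by
    simp only [hgdef]
    have h6 : Tendsto (fun p : (Y →L[ℂ] Y) × ℂ => 1 - ℓ (resolvent p.1 p.2 φ)) (𝓝 (S₀, (1 : ℂ)))
        (𝓝 (1 - ℓ (resolvent S₀ (1 : ℂ) φ))) :=
      tendsto_const_nhds.sub ((ℓ.continuous.tendsto _).comp hcφ)
    rw [hB1, hn, sub_self] at h6
    have := h6.norm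
    rw [norm_zero] at this
    exact this.eventually (gt_mem_nhds (by positivity))
  obtain ⟨ρ', hρ', h₃⟩ := Metric.eventually_nhds_iff.1 e4
  have hb' : ∀ S : Y →L[ℂ] Y, ‖S - S₀‖ < ρ' → ‖1 - ℓ (resolvent S (1 : ℂ) φ)‖ < ρ / 4 := by
    intro S hS
    have h : dist (S, (1 : ℂ)) (S₀, (1 : ℂ)) < ρ' := by
      rw [Prod.dist_eq, max_lt_iff, dist_eq_norm, dist_self]
      exact ⟨hS, hρ'⟩
    rw [← hgdef]
    exact h₃ h
  have hδ : 0 < min ρ ρ' := lt_min hρ hρ'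
  have hδρ : ∀ S : Y →L[ℂ] Y, ‖S - S₀‖ ≤ min ρ ρ' / 2 → ‖S - S₀‖ < ρ ∧ ‖S - S₀‖ < ρ' :=
    fun S hS => ⟨by linarith [min_le_left ρ ρ'], by linarith [min_le_right ρ ρ']⟩
  refine ⟨ρ, hρ, min ρ ρ' / 2, by positivity, ‖resolvent S₀ (1 : ℂ)‖ + 1, ?_, ?_, ?_⟩
  · intro S hS w hw
    exact hb S w (hδρ S hS).1 hw
  · intro S S' hS hS' w w' hw hw'
    exact hg S S' w w' (hδρ S hS).1 (hδρ S' hS').1 hw hw'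
  · intro S hS
    have hSρ := (hδρ S hS).1
    exact exists_simple_eigenvalue hρ (fun w hw => (hb S w hSρ hw).1)
      (fun w w' hw hw' => hg S S w w' hSρ hSρ hw hw')
      (hb' S (hδρ S hS).2)

end RankOne

end

section

/-! ### Stochastic operators on `L¹` -/

section Positive

variable {X : Type*} [MeasurableSpace X] {μ : Measure X}

/-- Nonnegativity in the complex space `L¹`. -/
def IsNonneg (ψ : Lp ℂ 1 μ) : Prop := ∀ᵐ p ∂μ, ψ p = (‖ψ p‖ : ℂ)

/-- The modulus of an element of `L¹`. -/
def modulus (ψ : Lp ℂ 1 μ) : Lp ℂ 1 μ := ofFun μ fun p => (‖ψ p‖ : ℂ)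

lemma coeFn_modulus (ψ : Lp ℂ 1 μ) : modulus ψ =ᵐ[μ] fun p => (‖ψ p‖ : ℂ) :=
  coeFn_ofFun (L1_integrable ψ).norm.ofReal

lemma norm_coeFn_modulus (ψ : Lp ℂ 1 μ) : ∀ᵐ p ∂μ, ‖modulus ψ p‖ = ‖ψ p‖ :=
  (coeFn_modulus ψ).mono fun p hp => by rw [hp]; simp

lemma isNonneg_modulus (ψ : Lp ℂ 1 μ) : IsNonneg (modulus ψ) := by
  filter_upwards [coeFn_modulus ψ, norm_coeFn_modulus ψ] with p h1 h2
  rw [h2, h1]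

lemma L1_norm_congr {ψ φ : Lp ℂ 1 μ} (h : ∀ᵐ p ∂μ, ‖ψ p‖ = ‖φ p‖) : ‖ψ‖ = ‖φ‖ :=
  le_antisymm (L1_norm_le_of_ae_le (h.mono fun _ hp => hp.le))
    (L1_norm_le_of_ae_le (h.mono fun _ hp => hp.ge))

lemma norm_modulus (ψ : Lp ℂ 1 μ) : ‖modulus ψ‖ = ‖ψ‖ := L1_norm_congr (norm_coeFn_modulus ψ)

lemma IsNonneg.integral_eq {ψ : Lp ℂ 1 μ} (h : IsNonneg ψ) : integralCLM μ ψ = (‖ψ‖ : ℂ) := by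
  rw [integralCLM_apply, L1_norm_eq, ← integral_complex_ofReal]
  exact integral_congr_ae h

lemma isNonneg_ofFun {f : X → ℝ} (hf : Integrable f μ) (h0 : ∀ᵐ p ∂μ, 0 ≤ f p) :
    IsNonneg (ofFun μ fun p => (f p : ℂ)) := by
  have hf' : Integrable (fun p => (f p : ℂ)) μ := hf.ofReal
  filter_upwards [coeFn_ofFun hf', h0] with p h1 h2
  rw [h1]
  simp [abs_of_nonneg h2]

/-- The nonnegative function $|b|-|a|$ has integral zero. This is how conservation of mass turns
inequalities into equalities. -/
lemma IsNonneg.eq_of_le {a b : Lp ℂ 1 μ} (ha : IsNonneg a) (hb : IsNonneg b)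
    (hab : ∀ᵐ p ∂μ, ‖a p‖ ≤ ‖b p‖) (hn : ‖b‖ ≤ ‖a‖) : a = b := by
  have h1 : ∫ p, (‖b p‖ - ‖a p‖) ∂μ = 0 := by
    rw [integral_sub (L1_integrable b).norm (L1_integrable a).norm, ← L1_norm_eq, ← L1_norm_eq]
    linarith [L1_norm_le_of_ae_le hab]
  have h2 := (integral_eq_zero_iff_of_nonneg_ae (hab.mono fun p hp => sub_nonneg.2 hp)
    ((L1_integrable b).norm.sub (L1_integrable a).norm)).1 h1
  apply Lp.ext
  filter_upwards [ha, hb, h2] with p h3 h4 h5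
  have h5 : ‖b p‖ - ‖a p‖ = 0 := h5
  rw [h3, h4, sub_eq_zero.1 h5]

lemma ae_eq_zero_of_tendsto {F : ℕ → Lp ℂ 1 μ} {ψ : Lp ℂ 1 μ} (hF : Tendsto F atTop (𝓝 ψ))
    {P : X → Prop} (h : ∀ n, ∀ᵐ p ∂μ, P p → F n p = 0) : ∀ᵐ p ∂μ, P p → ψ p = 0 := by
  obtain ⟨ns, -, hns⟩ := (tendstoInMeasure_of_tendsto_Lp hF).exists_seq_tendsto_ae
  filter_upwards [hns, ae_all_iff.2 h] with p h1 h2 hp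
  refine tendsto_nhds_unique h1 ?_
  simp only [h2 _ hp]
  exact tendsto_const_nhds

/-- A positive operator which preserves the integral. -/
structure IsStochastic (T : Lp ℂ 1 μ →L[ℂ] Lp ℂ 1 μ) : Prop where
  nonneg : ∀ φ, IsNonneg φ → IsNonneg (T φ)
  dom : ∀ ψ φ, IsNonneg φ → (∀ᵐ p ∂μ, ‖ψ p‖ ≤ ‖φ p‖) → ∀ᵐ p ∂μ, ‖T ψ p‖ ≤ ‖T φ p‖
  mass : ∀ ψ, integralCLM μ (T ψ) = integralCLM μ ψ

variable {T : Lp ℂ 1 μ →L[ℂ] Lp ℂ 1 μ}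

lemma IsStochastic.norm_nonneg_eq (hT : IsStochastic T) {φ : Lp ℂ 1 μ} (h : IsNonneg φ) :
    ‖T φ‖ = ‖φ‖ := by
  have := hT.mass φ
  rw [h.integral_eq, (hT.nonneg φ h).integral_eq] at this
  exact_mod_cast this

lemma IsStochastic.le_modulus (hT : IsStochastic T) (ψ : Lp ℂ 1 μ) :
    ∀ᵐ p ∂μ, ‖T ψ p‖ ≤ ‖T (modulus ψ) p‖ :=
  hT.dom ψ _ (isNonneg_modulus ψ) ((norm_coeFn_modulus ψ).mono fun _ hp => hp.ge)

lemma IsStochastic.norm_apply_le (hT : IsStochastic T) (ψ : Lp ℂ 1 μ) : ‖T ψ‖ ≤ ‖ψ‖ := by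
  have := L1_norm_le_of_ae_le (hT.le_modulus ψ)
  rwa [hT.norm_nonneg_eq (isNonneg_modulus ψ), norm_modulus] at this

/-- An element whose modulus does not exceed the modulus of its image has a fixed modulus. -/
lemma IsStochastic.modulus_fixed (hT : IsStochastic T) {ψ : Lp ℂ 1 μ}
    (h : ∀ᵐ p ∂μ, ‖ψ p‖ ≤ ‖T (modulus ψ) p‖) : T (modulus ψ) = modulus ψ := by
  refine (IsNonneg.eq_of_le (isNonneg_modulus ψ) (hT.nonneg _ (isNonneg_modulus ψ)) ?_ ?_).symm
  · filter_upwards [h, norm_coeFn_modulus ψ] with p h1 h2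
    rwa [h2]
  · rw [hT.norm_nonneg_eq (isNonneg_modulus ψ)]

/-- Truncate at multiples of $|\varphi|$, replaced by $1$ where $\varphi$ vanishes so that the
weight is positive; there the truncations vanish because $\psi$ does. -/
lemma exists_seq_le_nonneg {φ : Lp ℂ 1 μ} {ψ : Lp ℂ 1 μ} (h : ∀ᵐ p ∂μ, φ p = 0 → ψ p = 0) :
    ∃ F : ℕ → Lp ℂ 1 μ, Tendsto F atTop (𝓝 ψ) ∧
      (∀ n : ℕ, ∀ᵐ p ∂μ, ‖F n p‖ ≤ n * ‖φ p‖) ∧ ∀ n, ∀ᵐ p ∂μ, F n p = ψ p ∨ F n p = 0 := by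
  classical
  have hm : AEStronglyMeasurable (fun p => if ‖φ p‖ = 0 then (1 : ℝ) else ‖φ p‖) μ := by
    have h1 := (Lp.stronglyMeasurable φ).measurable.norm
    exact (Measurable.ite (h1 (measurableSet_singleton 0)) measurable_const h1).aestronglyMeasurable
  obtain ⟨F, hF, hFn, hFz⟩ := exists_seq_orderBounded
    (fun p => if ‖φ p‖ = 0 then (1 : ℝ) else ‖φ p‖)
    (fun p => by
      split_ifs with h0
      · exact one_pos
      · exact lt_of_le_of_ne (norm_nonneg _) (Ne.symm h0)) hm ψ
  refine ⟨F, hF, fun n => ?_, hFz⟩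
  filter_upwards [hFn n, hFz n, h] with p h1 h2 h3
  by_cases h0 : ‖φ p‖ = 0
  · have : F n p = 0 := by
      rcases h2 with h2 | h2
      · rw [h2]; exact h3 (norm_eq_zero.1 h0)
      · exact h2
    rw [this, h0]; simp
  · rwa [if_neg h0] at h1

/-- For an irreducible operator the support of a nonzero subinvariant element is everything. -/
lemma IsStochastic.ne_zero_of_irreducible (hT : IsStochastic T) (hirr : IsIrreducible T)
    {φ : Lp ℂ 1 μ} (hφ : IsNonneg φ) (h0 : φ ≠ 0) (hz : ∀ᵐ p ∂μ, φ p = 0 → T φ p = 0) :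
    ∀ᵐ p ∂μ, φ p ≠ 0 := by
  have hA : MeasurableSet {p | φ p ≠ 0} :=
    ((Lp.stronglyMeasurable φ).measurable (measurableSet_singleton 0)).compl
  -- The functions supported where $\varphi\ne0$ form an invariant ideal: such a $\psi$ is a limit
  -- of functions dominated by $n\varphi$, whose images are dominated by $nT\varphi$.
  have hinv : ∀ ψ : Lp ℂ 1 μ, (∀ᵐ p ∂μ, p ∉ {p | φ p ≠ 0} → ψ p = 0) →
      ∀ᵐ p ∂μ, p ∉ {p | φ p ≠ 0} → T ψ p = 0 := by
    intro ψ hψ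
    obtain ⟨F, hF, hFn, -⟩ := exists_seq_le_nonneg (φ := φ) (ψ := ψ)
      (hψ.mono fun p hp h => hp (not_not.2 h))
    refine ae_eq_zero_of_tendsto ((T.continuous.tendsto ψ).comp hF) fun n => ?_
    have hn : IsNonneg ((n : ℂ) • φ) := by
      filter_upwards [hφ, Lp.coeFn_smul (n : ℂ) φ] with p h1 h2
      rw [h2, Pi.smul_apply, smul_eq_mul, norm_mul]
      push_cast
      rw [← h1]; simp
    have h1 := hT.dom (F n) ((n : ℂ) • φ) hn (by
      filter_upwards [hFn n, Lp.coeFn_smul (n : ℂ) φ] with p h1 h2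
      rw [h2, Pi.smul_apply, norm_smul]; simpa using h1)
    rw [map_smul] at h1
    filter_upwards [h1, Lp.coeFn_smul (n : ℂ) (T φ), hz] with p h1 h2 h3 h4
    rw [h2, Pi.smul_apply, h3 (not_not.1 h4), smul_zero, norm_zero] at h1
    exact norm_le_zero_iff.1 h1
  rcases hirr _ hA hinv with h | h
  · exfalso
    apply h0
    apply Lp.ext
    have : ∀ᵐ p ∂μ, ¬ (φ p ≠ 0) := measure_eq_zero_iff_ae_notMem.1 h
    filter_upwards [this, Lp.coeFn_zero ℂ 1 μ] with p h1 h2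
    rw [not_not.1 h1, h2]; rfl
  · have : ∀ᵐ p ∂μ, p ∉ {p | φ p ≠ 0}ᶜ := measure_eq_zero_iff_ae_notMem.1 h
    filter_upwards [this] with p h1
    exact not_not.1 h1

/-- Real elements of `L¹`. -/
def IsRe (ψ : Lp ℂ 1 μ) : Prop := ∀ᵐ p ∂μ, ψ p = ((ψ p).re : ℂ)

/-- The element of `L¹` given by the positive part of the real part. -/
def posP (ψ : Lp ℂ 1 μ) : Lp ℂ 1 μ := ofFun μ fun p => ((max (ψ p).re 0 : ℝ) : ℂ)

lemma integrable_posP (ψ : Lp ℂ 1 μ) : Integrable (fun p => max (ψ p).re 0) μ :=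
  (L1_integrable ψ).re.pos_part

lemma coeFn_posP (ψ : Lp ℂ 1 μ) : posP ψ =ᵐ[μ] fun p => ((max (ψ p).re 0 : ℝ) : ℂ) :=
  coeFn_ofFun (integrable_posP ψ).ofReal

lemma isNonneg_posP (ψ : Lp ℂ 1 μ) : IsNonneg (posP ψ) :=
  isNonneg_ofFun (integrable_posP ψ) (ae_of_all _ fun _ => le_max_right _ _)

lemma IsNonneg.re_eq {ψ : Lp ℂ 1 μ} (h : IsNonneg ψ) : ∀ᵐ p ∂μ, (ψ p).re = ‖ψ p‖ :=
  h.mono fun p hp => by conv_lhs => rw [hp]; simp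

lemma IsNonneg.isRe {ψ : Lp ℂ 1 μ} (h : IsNonneg ψ) : IsRe ψ := by
  filter_upwards [h, h.re_eq] with p h1 h2
  rw [h2]; exact h1

/-- Every element of `L¹` is a combination of four nonnegative elements. -/
lemma eq_comb_posP (ψ : Lp ℂ 1 μ) :
    ψ = (posP ψ - posP (-ψ)) + Complex.I • (posP (-(Complex.I • ψ)) - posP (Complex.I • ψ)) := by
  apply Lp.ext
  filter_upwards [Lp.coeFn_add (posP ψ - posP (-ψ))
      (Complex.I • (posP (-(Complex.I • ψ)) - posP (Complex.I • ψ))),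
    Lp.coeFn_sub (posP ψ) (posP (-ψ)), Lp.coeFn_smul Complex.I
      (posP (-(Complex.I • ψ)) - posP (Complex.I • ψ)),
    Lp.coeFn_sub (posP (-(Complex.I • ψ))) (posP (Complex.I • ψ)),
    coeFn_posP ψ, coeFn_posP (-ψ), coeFn_posP (-(Complex.I • ψ)), coeFn_posP (Complex.I • ψ),
    Lp.coeFn_neg ψ, Lp.coeFn_neg (Complex.I • ψ), Lp.coeFn_smul Complex.I ψ]
    with p h1 h2 h3 h4 h5 h6 h7 h8 h9 h10 h11
  rw [h1, Pi.add_apply, h2, h3, Pi.smul_apply, Pi.sub_apply, h4, Pi.sub_apply, h5, h6, h7, h8, h9,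
    h10, Pi.neg_apply, Pi.neg_apply, h11, Pi.smul_apply]
  apply Complex.ext
  · simp only [smul_eq_mul, Complex.add_re, Complex.sub_re, Complex.ofReal_re, Complex.neg_re,
      Complex.mul_re, Complex.I_re, Complex.I_im, Complex.sub_im, Complex.ofReal_im]
    rcases le_total (ψ p).re 0 with h | h
    · rw [max_eq_right h, max_eq_left (neg_nonneg.2 h)]; ring
    · rw [max_eq_left h, max_eq_right (neg_nonpos.2 h)]; ring
  · simp only [smul_eq_mul, Complex.add_im, Complex.sub_im, Complex.ofReal_im, Complex.neg_re,
      Complex.mul_im, Complex.mul_re, Complex.I_re, Complex.I_im, Complex.sub_re, Complex.ofReal_re]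
    rcases le_total (ψ p).im 0 with h | h
    · rw [max_eq_right (by linarith), max_eq_left (by linarith)]; ring
    · rw [max_eq_left (by linarith), max_eq_right (by linarith)]; ring

lemma ext_of_nonneg {F : Type*} [NormedAddCommGroup F] [NormedSpace ℂ F]
    {A B : Lp ℂ 1 μ →L[ℂ] F} (h : ∀ ψ, IsNonneg ψ → A ψ = B ψ) : A = B := by
  ext ψ
  rw [eq_comb_posP ψ]
  simp only [map_add, map_sub, map_smul, h _ (isNonneg_posP _)]

/-- Operators which agree on the order interval `[0, φ]` agree, if `φ` is strictly positive. -/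
lemma ext_of_nonneg_le {F : Type*} [NormedAddCommGroup F] [NormedSpace ℂ F] {φ : Lp ℂ 1 μ}
    (hφ : ∀ᵐ p ∂μ, φ p ≠ 0) {A B : Lp ℂ 1 μ →L[ℂ] F}
    (h : ∀ ψ, IsNonneg ψ → (∀ᵐ p ∂μ, ‖ψ p‖ ≤ ‖φ p‖) → A ψ = B ψ) : A = B := by
  refine ext_of_nonneg fun ψ hψ => ?_
  obtain ⟨G, hG, hGn, hGz⟩ := exists_seq_le_nonneg (φ := φ) (ψ := ψ)
    (hφ.mono fun p hp h => absurd h hp)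
  refine tendsto_nhds_unique ((A.continuous.tendsto ψ).comp hG) ?_
  refine ((B.continuous.tendsto ψ).comp hG).congr fun n => ?_
  simp only [Function.comp_apply]
  -- Scaling by $1/(n+1)$ rather than $1/n$ also covers the truncation at level $0$.
  have key := h (((n : ℂ) + 1)⁻¹ • G n) ?_ ?_
  · rw [map_smul, map_smul] at key
    have hn : ((n : ℂ) + 1)⁻¹ ≠ 0 := inv_ne_zero (Nat.cast_add_one_ne_zero n)
    exact (smul_right_injective F hn key).symm
  · filter_upwards [hψ, hGz n, Lp.coeFn_smul ((n : ℂ) + 1)⁻¹ (G n)] with p h1 h2 h3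
    rw [h3, Pi.smul_apply, smul_eq_mul]
    rcases h2 with h2 | h2
    · rw [h2, norm_mul]
      push_cast
      rw [← h1, norm_inv]
      have : ‖(n : ℂ) + 1‖ = (n : ℝ) + 1 := by
        have := Complex.norm_natCast (n + 1); push_cast at this; exact this
      rw [this]; push_cast; rfl
    · rw [h2]; simp
  · filter_upwards [hGn n, Lp.coeFn_smul ((n : ℂ) + 1)⁻¹ (G n)] with p h1 h3
    rw [h3, Pi.smul_apply, norm_smul, norm_inv]
    have : ‖(n : ℂ) + 1‖ = (n : ℝ) + 1 := by
      have := Complex.norm_natCast (n + 1); push_cast at this; exact this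
    rw [this, inv_mul_le_iff₀ (by positivity)]
    exact h1.trans (mul_le_mul_of_nonneg_right (by linarith) (norm_nonneg _))

lemma IsStochastic.map_isRe (hT : IsStochastic T) {u : Lp ℂ 1 μ} (hu : IsRe u) :
    IsRe (T u) ∧ ∀ᵐ p ∂μ, (T u p).re ≤ ‖T (posP u) p‖ := by
  have h1 : u = posP u - posP (-u) := by
    apply Lp.ext
    filter_upwards [hu, Lp.coeFn_sub (posP u) (posP (-u)), coeFn_posP u, coeFn_posP (-u),
      Lp.coeFn_neg u] with p h1 h2 h3 h4 h5
    rw [h2, Pi.sub_apply, h3, h4, h5, Pi.neg_apply, ← Complex.ofReal_sub]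
    conv_lhs => rw [h1]
    congr 1
    rw [Complex.neg_re]
    rcases le_total (u p).re 0 with h | h
    · rw [max_eq_right h, max_eq_left (neg_nonneg.2 h)]; ring
    · rw [max_eq_left h, max_eq_right (neg_nonpos.2 h)]; ring
  have h2 : T u = T (posP u) - T (posP (-u)) := by rw [← map_sub, ← h1]
  have ha := hT.nonneg _ (isNonneg_posP u)
  have hb := hT.nonneg _ (isNonneg_posP (-u))
  rw [h2]
  constructor
  · filter_upwards [ha.isRe, hb.isRe, Lp.coeFn_sub (T (posP u)) (T (posP (-u)))] with p h3 h4 h5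
    rw [h5, Pi.sub_apply, Complex.sub_re, Complex.ofReal_sub, ← h3, ← h4]
  · filter_upwards [ha.re_eq, hb.re_eq, Lp.coeFn_sub (T (posP u)) (T (posP (-u)))] with p h3 h4 h5
    rw [h5, Pi.sub_apply, Complex.sub_re, h3, h4]
    linarith [norm_nonneg (T (posP (-u)) p)]

/-- From $u=Tu\le Tu^+$ one gets $u^+\le Tu^+$, with equality by conservation of mass. By
irreducibility $u^+$ is zero or strictly positive, so $u$ has constant sign, and its zero integral
makes it vanish. -/
lemma IsStochastic.eq_zero_of_fixed_isRe (hT : IsStochastic T) (hirr : IsIrreducible T)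
    {u : Lp ℂ 1 μ} (hu : IsRe u) (hfix : T u = u) (hint : integralCLM μ u = 0) : u = 0 := by
  have hpos : T (posP u) = posP u := by
    refine (IsNonneg.eq_of_le (isNonneg_posP u) (hT.nonneg _ (isNonneg_posP u)) ?_
      (hT.norm_nonneg_eq (isNonneg_posP u)).le).symm
    have := (hT.map_isRe hu).2
    rw [hfix] at this
    filter_upwards [this, coeFn_posP u] with p h1 h2
    rw [h2, Complex.norm_real, Real.norm_of_nonneg (le_max_right _ _)]
    exact max_le h1 (norm_nonneg _)
  by_cases h0 : posP u = 0
  · have hn : IsNonneg (-u) := by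
      have : ∀ᵐ p ∂μ, posP u p = 0 := by rw [h0]; exact Lp.coeFn_zero ℂ 1 μ
      filter_upwards [this, coeFn_posP u, hu, Lp.coeFn_neg u] with p h1 h2 h3 h4
      rw [h1] at h2
      have h5 : max (u p).re 0 = 0 := by exact_mod_cast h2.symm
      have h6 : (u p).re ≤ 0 := by rw [← h5]; exact le_max_left _ _
      rw [h4, Pi.neg_apply, norm_neg]
      rw [h3]
      rw [Complex.norm_real, Real.norm_of_nonpos h6]
      push_cast; rfl
    have := hn.integral_eq
    rw [map_neg, hint, neg_zero, norm_neg] at this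
    exact norm_eq_zero.1 (by exact_mod_cast this.symm)
  · have hne := hT.ne_zero_of_irreducible hirr (isNonneg_posP u) h0
      (by rw [hpos]; exact ae_of_all _ fun _ h => h)
    have hn : IsNonneg u := by
      filter_upwards [hne, coeFn_posP u, hu] with p h1 h2 h3
      have h6 : 0 ≤ (u p).re := by
        by_contra hc
        push Not at hc
        rw [h2, max_eq_right hc.le] at h1
        exact h1 (by simp)
      rw [h3, Complex.norm_real, Real.norm_of_nonneg h6]
    have := hn.integral_eq
    rw [hint] at this
    exact norm_eq_zero.1 (by exact_mod_cast this.symm)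

/-- The fixed space of an irreducible stochastic operator is at most one dimensional. -/
lemma IsStochastic.eq_zero_of_fixed (hT : IsStochastic T) (hirr : IsIrreducible T)
    {ψ : Lp ℂ 1 μ} (hfix : T ψ = ψ) (hint : integralCLM μ ψ = 0) : ψ = 0 := by
  set a := posP ψ - posP (-ψ) with ha
  set b := posP (-(Complex.I • ψ)) - posP (Complex.I • ψ) with hb
  have hψ : ψ = a + Complex.I • b := eq_comb_posP ψ
  have hsub : ∀ f g : Lp ℂ 1 μ, IsRe f → IsRe g → IsRe (f - g) := by
    intro f g hf hg
    filter_upwards [hf, hg, Lp.coeFn_sub f g] with p h1 h2 h3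
    rw [h3, Pi.sub_apply, Complex.sub_re, Complex.ofReal_sub, ← h1, ← h2]
  have hra : IsRe a := hsub _ _ (isNonneg_posP _).isRe (isNonneg_posP _).isRe
  have hrb : IsRe b := hsub _ _ (isNonneg_posP _).isRe (isNonneg_posP _).isRe
  have hTψ : T a + Complex.I • T b = a + Complex.I • b := by
    rw [← map_smul, ← map_add, ← hψ, hfix]
  have hab : T a = a ∧ T b = b := by
    have h1 : ∀ᵐ p ∂μ, T a p = a p ∧ T b p = b p := by
      have e1 := Lp.coeFn_add (T a) (Complex.I • T b)
      rw [hTψ] at e1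
      filter_upwards [e1, Lp.coeFn_add a (Complex.I • b), Lp.coeFn_smul Complex.I (T b),
        Lp.coeFn_smul Complex.I b, hra, hrb, (hT.map_isRe hra).1, (hT.map_isRe hrb).1]
        with p h1 h2 h3 h4 h5 h6 h7 h8
      rw [h2, Pi.add_apply, Pi.add_apply, h3, h4, Pi.smul_apply, Pi.smul_apply, h5, h6, h7, h8] at h1
      have hre := congrArg Complex.re h1
      have him := congrArg Complex.im h1
      simp at hre him
      rw [h5, h6, h7, h8, hre, him]
      simp
    exact ⟨Lp.ext (h1.mono fun _ h => h.1), Lp.ext (h1.mono fun _ h => h.2)⟩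
  have hreal : ∀ f : Lp ℂ 1 μ, IsRe f → (integralCLM μ f).im = 0 := by
    intro f hf
    rw [integralCLM_apply, integral_congr_ae hf, integral_complex_ofReal, Complex.ofReal_im]
  rw [hψ, map_add, map_smul] at hint
  have h1 : (integralCLM μ a).re = 0 := by
    have := congrArg Complex.re hint
    rwa [Complex.add_re, smul_eq_mul, Complex.mul_re, Complex.I_re, Complex.I_im, hreal b hrb,
      zero_mul, one_mul, sub_zero, add_zero] at this
  have h2 : (integralCLM μ b).re = 0 := by
    have := congrArg Complex.im hint
    rwa [Complex.add_im, smul_eq_mul, Complex.mul_im, Complex.I_re, Complex.I_im, hreal a hra,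
      zero_mul, one_mul, zero_add, zero_add] at this
  have ha0 := hT.eq_zero_of_fixed_isRe hirr hra hab.1 (Complex.ext h1 (hreal a hra))
  have hb0 := hT.eq_zero_of_fixed_isRe hirr hrb hab.2 (Complex.ext h2 (hreal b hrb))
  rw [hψ, ha0, hb0, smul_zero, add_zero]

/-- A power compact irreducible stochastic operator has a strictly positive fixed element. -/
lemma IsStochastic.exists_fixed [SigmaFinite μ] (hT : IsStochastic T) (hirr : IsIrreducible T)
    (hμ : μ ≠ 0) {k : ℕ} (hk : IsCompactOperator (T ^ k)) :
    ∃ φ : Lp ℂ 1 μ, IsNonneg φ ∧ (∀ᵐ p ∂μ, φ p ≠ 0) ∧ T φ = φ ∧ integralCLM μ φ = 1 := by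
  -- The range of $1-T$ consists of functions of integral zero, so it misses the strictly positive
  -- weight.
  have h1 : (1 : ℂ) ∈ spectrum ℂ T := by
    by_contra hn
    rw [spectrum.notMem_iff] at hn
    obtain ⟨w, hw0, hwm, hwi⟩ := exists_weight μ
    have hpos : IsNonneg (ofFun μ fun p => (w p : ℂ)) :=
      isNonneg_ofFun hwi (ae_of_all _ fun p => (hw0 p).le)
    have h2 := sub_apply_resolvent (S := T) (w := 1) hn (ofFun μ fun p => (w p : ℂ))
    have h3 := congrArg (integralCLM μ) h2
    rw [one_smul, map_sub, hT.mass, sub_self, hpos.integral_eq] at h3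
    have h4 : ‖ofFun μ fun p => (w p : ℂ)‖ = 0 := by exact_mod_cast h3.symm
    have hwi' : Integrable (fun p => (w p : ℂ)) μ := hwi.ofReal
    rw [norm_ofFun hwi'] at h4
    have h5 := (integral_eq_zero_iff_of_nonneg (fun p => norm_nonneg _) hwi'.norm).1 h4
    have : ∀ᵐ p ∂μ, False := by
      filter_upwards [h5] with p hp
      have : w p = 0 := by simpa using hp
      exact (hw0 p).ne' this
    rw [ae_iff] at this
    exact hμ (Measure.measure_univ_eq_zero.1 (by simpa using this))
  obtain ⟨ψ, hψ0, hψ⟩ := isEigenvalue_of_mem_spectrum hk h1 one_ne_zero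
  rw [one_smul] at hψ
  have hfix : T (modulus ψ) = modulus ψ := hT.modulus_fixed (by
    have := hT.le_modulus ψ
    rwa [hψ] at this)
  have hn0 : ‖modulus ψ‖ ≠ 0 := by rw [norm_modulus]; exact norm_ne_zero_iff.2 hψ0
  have hne := hT.ne_zero_of_irreducible hirr (isNonneg_modulus ψ) (norm_ne_zero_iff.1 hn0)
    (by rw [hfix]; exact ae_of_all _ fun _ h => h)
  set c : ℂ := ((‖modulus ψ‖⁻¹ : ℝ) : ℂ) with hc
  have hc0 : c ≠ 0 := by rw [hc]; exact_mod_cast inv_ne_zero hn0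
  refine ⟨c • modulus ψ, ?_, ?_, ?_, ?_⟩
  · filter_upwards [isNonneg_modulus ψ, Lp.coeFn_smul c (modulus ψ)] with p h2 h3
    rw [h3, Pi.smul_apply, smul_eq_mul, norm_mul]
    push_cast
    rw [← h2, hc, Complex.norm_real, Real.norm_of_nonneg (by positivity)]
  · filter_upwards [hne, Lp.coeFn_smul c (modulus ψ)] with p h2 h3
    rw [h3, Pi.smul_apply]
    exact smul_ne_zero hc0 h2
  · rw [map_smul, hfix]
  · rw [map_smul, (isNonneg_modulus ψ).integral_eq, hc, smul_eq_mul, ← Complex.ofReal_mul,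
      inv_mul_cancel₀ hn0, Complex.ofReal_one]

/-- `1` is not in the spectrum of `T - φ ⊗ ∫`. -/
lemma IsStochastic.one_mem_resolventSet (hT : IsStochastic T) (hirr : IsIrreducible T)
    {k : ℕ} (hk0 : k ≠ 0) (hk : IsCompactOperator (T ^ k)) {φ : Lp ℂ 1 μ} (hfix : T φ = φ)
    (hφ : integralCLM μ φ = 1) :
    (1 : ℂ) ∈ resolventSet ℂ (T - (integralCLM μ).smulRight φ) := by
  set P := (integralCLM μ).smulRight φ with hP
  have hTP : T * P = P := by
    ext1 ψ
    change T (integralCLM μ ψ • φ) = integralCLM μ ψ • φ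
    rw [map_smul, hfix]
  have hPT : P * T = P := by
    ext1 ψ
    change integralCLM μ (T ψ) • φ = integralCLM μ ψ • φ
    rw [hT.mass]
  have hPP : P * P = P := by
    ext1 ψ
    change integralCLM μ (integralCLM μ ψ • φ) • φ = integralCLM μ ψ • φ
    rw [map_smul, hφ, smul_eq_mul, mul_one]
  -- As $TP=PT=P^2=P$, the operator $T-P$ is again power compact, so $1$ could only be an
  -- eigenvalue. An eigenvector would have integral zero, be fixed by $T$, and hence vanish.
  have hpow : ∀ n, (T - P) ^ (n + 1) = T ^ (n + 1) - P := by
    intro n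
    induction n with
    | zero => simp
    | succ n ih =>
      have hTn : T ^ (n + 1) * P = P := by
        clear ih
        induction n with
        | zero => simpa using hTP
        | succ n ih => rw [pow_succ, mul_assoc, hTP, ih]
      rw [pow_succ, ih, sub_mul, mul_sub, mul_sub, hTn, hPT, hPP, sub_self, sub_zero, ← pow_succ]
  have hPc : IsCompactOperator P := by
    have h1 : IsCompactOperator (id : ℂ → ℂ) :=
      (isCompactOperator_id_iff_finiteDimensional (𝕜 := ℂ)).2 inferInstance
    exact (h1.clm_comp (ContinuousLinearMap.toSpanSingleton ℂ φ)).comp_clm (integralCLM μ)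
  have hc : IsCompactOperator ((T - P) ^ k) := by
    obtain ⟨n, rfl⟩ := Nat.exists_eq_succ_of_ne_zero hk0
    rw [hpow]
    exact hk.sub hPc
  by_contra hn
  obtain ⟨ψ, hψ0, hψ⟩ := isEigenvalue_of_mem_spectrum hc hn one_ne_zero
  rw [one_smul] at hψ
  have h1 : integralCLM μ ψ = 0 := by
    have := congrArg (integralCLM μ) hψ
    rw [sub_apply, map_sub, hT.mass, hP, ContinuousLinearMap.smulRight_apply, map_smul, hφ,
      smul_eq_mul, mul_one, sub_self] at this
    exact this.symm
  have h2 : T ψ = ψ := by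
    rw [sub_apply, hP, ContinuousLinearMap.smulRight_apply, h1, zero_smul, sub_zero] at hψ
    exact hψ
  exact hψ0 (hT.eq_zero_of_fixed hirr h2 h1)

end Positive

end

section

/-! ### Families `e^{-l τ} T` -/

section Family

variable {X : Type*} [MeasurableSpace X] {μ : Measure X}

/-- The family `T l = e^{-l τ} T 0`, where `T 0` is a stochastic irreducible operator with
equi-integrable square. -/
structure IsTransportFamily (μ : Measure X) (w τ : X → ℝ)
    (T : ℂ → Lp ℂ 1 μ →L[ℂ] Lp ℂ 1 μ) : Prop where
  weight : IsWeight μ w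
  tau_meas : AEMeasurable τ μ
  tau_pos : ∀ᵐ p ∂μ, 0 < τ p
  formula : ∀ l : ℂ, 0 ≤ l.re → ∀ ψ, ∀ᵐ p ∂μ, T l ψ p = Complex.exp (-(l * (τ p : ℂ))) * T 0 ψ p
  stoch : IsStochastic (T 0)
  irr : IsIrreducible (T 0)
  gain : ∃ C : ℝ, 0 ≤ C ∧ ∀ ψ, Integrable (fun p => τ p * ‖T 0 ψ p‖) μ ∧
    ∫ p, τ p * ‖T 0 ψ p‖ ∂μ ≤ C * ‖ψ‖
  equi : IsEquiIntegrable w ((T 0).comp (T 0))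
  power : ∃ (N : ℕ) (C : ℝ≥0), ∀ ε : ℝ, 0 ≤ ε →
    ∫⁻ η : ℝ, ‖(T ((ε : ℂ) + (η : ℂ) * Complex.I)) ^ N‖ₑ ≤ C
  small : ∀ δ : ℝ, 0 < δ → ∃ B, MeasurableSet B ∧ weighted μ w B ≤ ENNReal.ofReal δ ∧ μ B ≠ 0

variable {w τ : X → ℝ} {T : ℂ → Lp ℂ 1 μ →L[ℂ] Lp ℂ 1 μ}

lemma norm_exp_neg_mul (l : ℂ) (t : ℝ) : ‖Complex.exp (-(l * (t : ℂ)))‖ = Real.exp (-(l.re * t)) := by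
  rw [Complex.norm_exp]; simp

/-- Mean value inequality on the convex half-plane, where the derivative of $e^{-z}$ is bounded by
$1$. -/
lemma norm_exp_neg_sub_le {a b : ℂ} (ha : 0 ≤ a.re) (hb : 0 ≤ b.re) :
    ‖Complex.exp (-a) - Complex.exp (-b)‖ ≤ ‖a - b‖ := by
  have h := Convex.norm_image_sub_le_of_norm_hasDerivWithin_le (𝕜 := ℂ) (C := 1)
    (f := fun z => Complex.exp (-z)) (f' := fun z => -Complex.exp (-z)) (s := {z : ℂ | 0 ≤ z.re})
    (x := b) (y := a)
    (fun z _ => by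
      have := ((hasDerivAt_id z).neg.cexp).hasDerivWithinAt (s := {z : ℂ | 0 ≤ z.re})
      simpa using this)
    (fun z hz => by
      rw [norm_neg, Complex.norm_exp]
      exact Real.exp_le_one_iff.2 (by simpa using hz))
    (convex_halfSpace_re_ge 0) hb ha
  simpa using h

namespace IsTransportFamily

variable (hT : IsTransportFamily μ w τ T)
include hT

lemma norm_apply_eq {l : ℂ} (hl : 0 ≤ l.re) (ψ : Lp ℂ 1 μ) :
    ∀ᵐ p ∂μ, ‖T l ψ p‖ = Real.exp (-(l.re * τ p)) * ‖T 0 ψ p‖ := by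
  filter_upwards [hT.formula l hl ψ] with p hp
  rw [hp, norm_mul, norm_exp_neg_mul]

lemma norm_apply_le_zero {l : ℂ} (hl : 0 ≤ l.re) (ψ : Lp ℂ 1 μ) :
    ∀ᵐ p ∂μ, ‖T l ψ p‖ ≤ ‖T 0 ψ p‖ := by
  filter_upwards [hT.norm_apply_eq hl ψ, hT.tau_pos] with p hp h0
  rw [hp]
  refine mul_le_of_le_one_left (norm_nonneg _) (Real.exp_le_one_iff.2 ?_)
  have := mul_nonneg hl h0.le
  linarith

lemma norm_apply_le_modulus {l : ℂ} (hl : 0 ≤ l.re) (ψ : Lp ℂ 1 μ) :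
    ∀ᵐ p ∂μ, ‖T l ψ p‖ ≤ ‖T 0 (modulus ψ) p‖ := by
  filter_upwards [hT.norm_apply_le_zero hl ψ, hT.stoch.le_modulus ψ] with p h1 h2
  exact h1.trans h2

lemma norm_le_one {l : ℂ} (hl : 0 ≤ l.re) : ‖T l‖ ≤ 1 :=
  ContinuousLinearMap.opNorm_le_bound _ zero_le_one fun ψ => by
    rw [one_mul]
    exact (L1_norm_le_of_ae_le (hT.norm_apply_le_zero hl ψ)).trans (hT.stoch.norm_apply_le ψ)

/-- The exponentials differ by at most $|l-l'|\tau$, and the boundedness of $\tau T_0$ absorbs the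
factor $\tau$. -/
lemma exists_lipschitz : ∃ C : ℝ, 0 ≤ C ∧ ∀ l l' : ℂ, 0 ≤ l.re → 0 ≤ l'.re →
    ‖T l - T l'‖ ≤ C * ‖l - l'‖ := by
  obtain ⟨C, hC, h⟩ := hT.gain
  refine ⟨C, hC, fun l l' hl hl' => ContinuousLinearMap.opNorm_le_bound _ (by positivity) fun ψ => ?_⟩
  have h1 : ∀ᵐ p ∂μ, ‖(T l - T l') ψ p‖ ≤ ‖l - l'‖ * (τ p * ‖T 0 ψ p‖) := by
    have e : (T l - T l') ψ = T l ψ - T l' ψ := rfl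
    rw [e]
    filter_upwards [Lp.coeFn_sub (T l ψ) (T l' ψ), hT.formula l hl ψ, hT.formula l' hl' ψ,
      hT.tau_pos] with p h1 h2 h3 h4
    rw [h1, Pi.sub_apply, h2, h3, ← sub_mul, norm_mul, ← mul_assoc]
    gcongr
    refine (norm_exp_neg_sub_le ?_ ?_).trans ?_
    · simpa using mul_nonneg hl h4.le
    · simpa using mul_nonneg hl' h4.le
    · rw [← sub_mul, norm_mul, Complex.norm_real, Real.norm_of_nonneg h4.le]
  calc ‖(T l - T l') ψ‖ = ∫ p, ‖(T l - T l') ψ p‖ ∂μ := L1_norm_eq _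
    _ ≤ ∫ p, ‖l - l'‖ * (τ p * ‖T 0 ψ p‖) ∂μ :=
      integral_mono_ae (L1_integrable _).norm ((h ψ).1.const_mul _) h1
    _ = ‖l - l'‖ * ∫ p, τ p * ‖T 0 ψ p‖ ∂μ := integral_const_mul _ _
    _ ≤ ‖l - l'‖ * (C * ‖ψ‖) := mul_le_mul_of_nonneg_left (h ψ).2 (norm_nonneg _)
    _ = C * ‖l - l'‖ * ‖ψ‖ := by ring

lemma sq_equi {l : ℂ} (hl : 0 ≤ l.re) : IsEquiIntegrable w ((T l).comp (T l)) := by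
  intro η hη
  obtain ⟨δ, hδ, h⟩ := hT.equi η hη
  refine ⟨δ, hδ, fun B hB hBδ ψ => ?_⟩
  have h1 : ∀ᵐ p ∂μ, ‖T l (T l ψ) p‖ ≤ ‖T 0 (T 0 (modulus ψ)) p‖ := by
    filter_upwards [hT.norm_apply_le_zero hl (T l ψ), hT.stoch.dom (T l ψ) (T 0 (modulus ψ))
      (hT.stoch.nonneg _ (isNonneg_modulus ψ)) (hT.norm_apply_le_modulus hl ψ)] with p h1 h2
    exact h1.trans h2
  calc ∫ p in B, ‖(T l).comp (T l) ψ p‖ ∂μ ≤ ∫ p in B, ‖(T 0).comp (T 0) (modulus ψ) p‖ ∂μ :=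
        setIntegral_mono_ae (L1_integrable _).norm.integrableOn (L1_integrable _).norm.integrableOn h1
    _ ≤ η * ‖modulus ψ‖ := h B hB hBδ _
    _ = η * ‖ψ‖ := by rw [norm_modulus]

/-- The exponent is $2+2$: the square is equi-integrable, and a product of two equi-integrable
operators is compact. -/
lemma isCompactOperator_pow [SigmaFinite μ] [MeasurableSpace.CountablyGenerated X] {l : ℂ}
    (hl : 0 ≤ l.re) : IsCompactOperator ((T l ^ 4 : Lp ℂ 1 μ →L[ℂ] Lp ℂ 1 μ)) := by
  have := IsEquiIntegrable.isCompactOperator_comp hT.weight (hT.sq_equi hl) (hT.sq_equi hl)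
  have h : T l ^ 4 = ((T l).comp (T l)).comp ((T l).comp (T l)) := by
    rw [← ContinuousLinearMap.mul_def, ← ContinuousLinearMap.mul_def]
    noncomm_ring
  rw [h]; exact this

lemma measure_ne_zero : μ ≠ 0 := by
  obtain ⟨B, -, -, h⟩ := hT.small 1 one_pos
  rintro rfl
  exact h rfl

/-- If $T_l$ had an inverse $R$, then $w1_B=T_l^2R^2(w1_B)$ would be carried by $B$ entirely, while
equi-integrability of $T_l^2$ bounds its mass there by half its norm once $B$ is small enough. The
constant `K` bounds $\|R\|^2$. -/
lemma zero_mem_spectrum {l : ℂ} (hl : 0 ≤ l.re) : (0 : ℂ) ∈ spectrum ℂ (T l) := by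
  intro hu
  have hu' : IsUnit (T l) := by
    have h := spectrum.mem_resolventSet_iff.1 hu
    rw [map_zero, zero_sub] at h
    simpa using h.neg
  obtain ⟨u, hu⟩ := hu'
  set R : Lp ℂ 1 μ →L[ℂ] Lp ℂ 1 μ := ((u⁻¹ : _) : Lp ℂ 1 μ →L[ℂ] Lp ℂ 1 μ)
  have hR : T l * R = 1 := by rw [← hu]; exact u.mul_inv
  have hR' : ∀ ψ, T l (R ψ) = ψ := fun ψ => congrArg (fun Q : Lp ℂ 1 μ →L[ℂ] Lp ℂ 1 μ => Q ψ) hR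
  set K := ‖R‖ * ‖R‖ + 1 with hK
  have hK0 : 0 < K := by positivity
  obtain ⟨δ, hδ, h⟩ := hT.sq_equi hl (1 / (2 * K)) (by positivity)
  obtain ⟨B, hB, hBδ, hB0⟩ := hT.small δ hδ
  have h1 := h B hB hBδ (R (R (wInd μ w B)))
  have h2 : (T l).comp (T l) (R (R (wInd μ w B))) = wInd μ w B := by
    rw [ContinuousLinearMap.comp_apply, hR', hR']
  rw [h2] at h1
  have h3 : ∫ p in B, ‖wInd μ w B p‖ ∂μ = ‖wInd μ w B‖ := by
    rw [L1_norm_eq, ← integral_indicator hB]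
    refine integral_congr_ae ?_
    filter_upwards [coeFn_wInd hT.weight hB] with p hp
    by_cases hpB : p ∈ B
    · rw [indicator_of_mem hpB]
    · rw [indicator_of_notMem hpB, hp, indicator_of_notMem hpB, norm_zero]
  have h4 : ‖R (R (wInd μ w B))‖ ≤ K * ‖wInd μ w B‖ := by
    calc ‖R (R (wInd μ w B))‖ ≤ ‖R‖ * (‖R‖ * ‖wInd μ w B‖) :=
          (R.le_opNorm _).trans (mul_le_mul_of_nonneg_left (R.le_opNorm _) (norm_nonneg _))
      _ ≤ K * ‖wInd μ w B‖ := by rw [hK]; nlinarith [norm_nonneg (wInd μ w B)]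
  have h5 : ‖wInd μ w B‖ ≤ 1 / 2 * ‖wInd μ w B‖ := by
    rw [← h3]
    refine h1.trans ?_
    rw [h3]
    calc 1 / (2 * K) * ‖R (R (wInd μ w B))‖ ≤ 1 / (2 * K) * (K * ‖wInd μ w B‖) := by gcongr
      _ = 1 / 2 * ‖wInd μ w B‖ := by field_simp
  have h6 : wInd μ w B = 0 := norm_eq_zero.1 (le_antisymm (by linarith) (norm_nonneg _))
  refine hB0 (measure_eq_zero_iff_ae_notMem.2 ?_)
  have h7 : ∀ᵐ p ∂μ, wInd μ w B p = 0 := by rw [h6]; exact Lp.coeFn_zero ℂ 1 μ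
  filter_upwards [h7, coeFn_wInd hT.weight hB] with p h8 h9 hpB
  rw [h8, indicator_of_mem hpB] at h9
  have := hT.weight.pos p
  have h9 : w p = 0 := by exact_mod_cast h9.symm
  linarith

/-! #### The peripheral spectrum -/

/-- If `T (iη)` has a peripheral eigenvalue, the translates of `T` by multiples of `iη` have
peripheral eigenvalues. -/
lemma exists_peripheral {η : ℝ} {z : ℂ} {ψ : Lp ℂ 1 μ} (hz : ‖z‖ = 1)
    (hψ : T (η * Complex.I) ψ = z • ψ) (hfix : T 0 (modulus ψ) = modulus ψ)
    (hne : ∀ᵐ p ∂μ, modulus ψ p ≠ 0) (k : ℕ) :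
    ∃ f : Lp ℂ 1 μ, ‖f‖ = ‖ψ‖ ∧ T ((k * η : ℝ) * Complex.I) f = z ^ k • f := by
  have hz0 : z ≠ 0 := norm_ne_zero_iff.1 (by rw [hz]; exact one_ne_zero)
  set φ := modulus ψ with hφ
  -- the unimodular functions
  set s : X → ℂ := fun p => if ψ p = 0 then 1 else ψ p / ‖ψ p‖ with hs
  have hs1 : ∀ p, ‖s p‖ = 1 := by
    intro p
    by_cases h : ψ p = 0
    · simp [hs, h]
    · have : ‖ψ p‖ ≠ 0 := norm_ne_zero_iff.2 h
      simp only [hs, if_neg h, norm_div, Complex.norm_real, norm_norm]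
      exact div_self this
  have hsm : AEStronglyMeasurable s μ := by
    have h1 := (Lp.stronglyMeasurable ψ).measurable
    exact (Measurable.ite (h1 (measurableSet_singleton 0)) measurable_const
      (h1.div (Complex.measurable_ofReal.comp h1.norm))).aestronglyMeasurable
  have hsφ : ∀ᵐ p ∂μ, ψ p = s p * φ p := by
    filter_upwards [coeFn_modulus ψ, hne] with p h1 h2
    rw [h1] at h2
    have h3 : ψ p ≠ 0 := fun h => h2 (by rw [h]; simp)
    simp only [hs, if_neg h3]
    rw [hφ, h1, div_mul_cancel₀ _ h2]
  set e : X → ℂ := fun p => Complex.exp (-(η * Complex.I * (τ p : ℂ))) with he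
  have he1 : ∀ p, ‖e p‖ = 1 := by
    intro p
    rw [he, norm_exp_neg_mul]; simp
  have hem : AEStronglyMeasurable e μ := by
    have : AEMeasurable e μ := by
      refine Complex.measurable_exp.comp_aemeasurable ?_
      exact ((Complex.measurable_ofReal.comp_aemeasurable hT.tau_meas).const_mul _).neg
    exact this.aestronglyMeasurable
  have hηre : 0 ≤ ((η : ℂ) * Complex.I).re := by simp
  set Ms := mulCLM μ s hsm 1 (ae_of_all _ fun p => (hs1 p).le)
  have hMs : ∀ f, Ms f =ᵐ[μ] fun p => s p * f p := fun f => coeFn_mulCLM hsm _ f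
  set b : X → ℂ := fun p => z⁻¹ * e p * (starRingEnd ℂ) (s p) with hb
  have hb1 : ∀ p, ‖b p‖ = 1 := by
    intro p
    simp only [hb, norm_mul, norm_inv, hz, he1, RCLike.norm_conj, hs1]; norm_num
  have hbm : AEStronglyMeasurable b μ :=
    (hem.const_mul z⁻¹).mul (Complex.continuous_conj.comp_aestronglyMeasurable hsm)
  set Mb := mulCLM μ b hbm 1 (ae_of_all _ fun p => (hb1 p).le)
  have hMb : ∀ f, Mb f =ᵐ[μ] fun p => b p * f p := fun f => coeFn_mulCLM hbm _ f
  -- Wielandt's argument: the conjugate $z^{-1}e\,\bar s\,T_0s$ of $T_0$ by the phase $s$ of $\psi$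
  -- is dominated by $T_0$, and it agrees with $T_0$ at the strictly positive $\varphi$ because
  -- $\psi=s\varphi$ is an eigenvector.
  set R : Lp ℂ 1 μ →L[ℂ] Lp ℂ 1 μ := Mb.comp ((T 0).comp Ms) with hR
  have hRle : ∀ f, IsNonneg f → ∀ᵐ p ∂μ, ‖R f p‖ ≤ ‖T 0 f p‖ := by
    intro f hf
    have h1 := hT.stoch.dom (Ms f) f hf (by
      filter_upwards [hMs f] with p hp
      rw [hp, norm_mul, hs1, one_mul])
    filter_upwards [hMb (T 0 (Ms f)), h1] with p h2 h3
    change ‖Mb (T 0 (Ms f)) p‖ ≤ _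
    rwa [h2, norm_mul, hb1, one_mul]
  have hMsφ : Ms φ = ψ := by
    apply Lp.ext
    filter_upwards [hMs φ, hsφ] with p h1 h2
    rw [h1, h2]
  have hRφ : R φ = φ := by
    apply Lp.ext
    change Mb (T 0 (Ms φ)) =ᵐ[μ] φ
    rw [hMsφ]
    have h0 := hT.formula (η * Complex.I) hηre ψ
    rw [hψ] at h0
    filter_upwards [hMb (T 0 ψ), h0, Lp.coeFn_smul z ψ, hsφ] with p h1 h2 h3 h4
    rw [h3, Pi.smul_apply, smul_eq_mul] at h2
    have h5 : (starRingEnd ℂ) (s p) * s p = 1 := by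
      rw [← Complex.normSq_eq_conj_mul_self, Complex.normSq_eq_norm_sq, hs1]; simp
    rw [h1]
    calc b p * T 0 ψ p = z⁻¹ * (starRingEnd ℂ) (s p) * (e p * T 0 ψ p) := by simp only [hb]; ring
      _ = z⁻¹ * (starRingEnd ℂ) (s p) * (z * ψ p) := by rw [h2]
      _ = z⁻¹ * z * ((starRingEnd ℂ) (s p) * s p) * φ p := by rw [h4]; ring
      _ = φ p := by rw [h5, inv_mul_cancel₀ hz0]; ring
  -- For $0\le f\le\varphi$ both $R$ and $T_0$ send the pieces $f$ and $\varphi-f$ to functions with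
  -- sum $\varphi$. Since $|R\,\cdot|\le T_0\,\cdot$ on each piece, the real parts must agree and
  -- the imaginary parts vanish.
  have hRT : R = T 0 := by
    refine ext_of_nonneg_le (φ := φ) hne fun f hf hfφ => ?_
    have hφn : IsNonneg φ := isNonneg_modulus ψ
    have hg : IsNonneg (φ - f) := by
      filter_upwards [hf, hφn, hfφ, Lp.coeFn_sub φ f] with p h1 h2 h3 h4
      rw [h4, Pi.sub_apply, h1, h2, ← Complex.ofReal_sub, Complex.norm_real,
        Real.norm_of_nonneg (sub_nonneg.2 h3)]
    have h1 : R f + R (φ - f) = φ := by rw [← map_add, add_sub_cancel, hRφ]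
    have h2 : T 0 f + T 0 (φ - f) = φ := by rw [← map_add, add_sub_cancel, hfix]
    apply Lp.ext
    have e1 := Lp.coeFn_add (R f) (R (φ - f))
    have e2 := Lp.coeFn_add (T 0 f) (T 0 (φ - f))
    rw [h1] at e1
    rw [h2] at e2
    have hn1 := hT.stoch.nonneg _ hf
    have hn2 := hT.stoch.nonneg _ hg
    filter_upwards [e1, e2, hRle f hf, hRle _ hg, hn1, hn2] with p h3 h4 h5 h6 h7 h8
    rw [h3, Pi.add_apply, Pi.add_apply, h7, h8] at h4
    have hre := congrArg Complex.re h4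
    simp only [Complex.add_re, Complex.ofReal_re] at hre
    have h9 := Complex.re_le_norm (R f p)
    have h10 := Complex.re_le_norm (R (φ - f) p)
    have h11 : (R f p).re = ‖T 0 f p‖ := by linarith
    have h12 : (R f p).im = 0 := by
      have h13 : ‖R f p‖ ^ 2 ≤ (R f p).re ^ 2 := by
        rw [h11]; exact pow_le_pow_left₀ (norm_nonneg _) h5 2
      rw [← Complex.normSq_eq_norm_sq, Complex.normSq_apply] at h13
      nlinarith
    rw [h7]
    exact Complex.ext (by rw [h11, Complex.ofReal_re]) (by rw [h12, Complex.ofReal_im])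
  -- the intertwining relation
  have hint : ∀ f, ∀ᵐ p ∂μ, e p * T 0 (Ms f) p = z * s p * T 0 f p := by
    intro f
    have h1 : Mb (T 0 (Ms f)) = T 0 f := by
      have := congrArg (fun Q : Lp ℂ 1 μ →L[ℂ] Lp ℂ 1 μ => Q f) hRT
      exact this
    have h2 := hMb (T 0 (Ms f))
    rw [h1] at h2
    filter_upwards [h2] with p h3
    have h5 : s p * (starRingEnd ℂ) (s p) = 1 := by
      rw [Complex.mul_conj, Complex.normSq_eq_norm_sq, hs1]; simp
    rw [h3]
    calc e p * T 0 (Ms f) p = z * z⁻¹ * (s p * (starRingEnd ℂ) (s p)) * (e p * T 0 (Ms f) p) := by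
          rw [h5, mul_inv_cancel₀ hz0]; ring
      _ = z * s p * (b p * T 0 (Ms f) p) := by simp only [hb]; ring
  -- Each application of the intertwining relation gains one factor $e$ and one factor $zs$; since
  -- $e^n=e^{-in\eta\tau}$, the function $s^n\varphi$ is an eigenvector of $T_{in\eta}$ for $z^n$.
  have hiter : ∀ n : ℕ, ‖(Ms ^ n) φ‖ = ‖ψ‖ ∧
      ∀ᵐ p ∂μ, e p ^ n * T 0 ((Ms ^ n) φ) p = z ^ n * (Ms ^ n) φ p := by
    intro n
    induction n with
    | zero =>
      refine ⟨norm_modulus ψ, ?_⟩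
      simp only [pow_zero, one_mul]
      change ∀ᵐ p ∂μ, T 0 φ p = φ p
      rw [hfix]; exact ae_of_all _ fun _ => rfl
    | succ n ih =>
      have h0 : (Ms ^ (n + 1)) φ = Ms ((Ms ^ n) φ) := by rw [pow_succ']; rfl
      rw [h0]
      refine ⟨?_, ?_⟩
      · rw [← ih.1]
        refine L1_norm_congr ?_
        filter_upwards [hMs ((Ms ^ n) φ)] with p hp
        rw [hp, norm_mul, hs1, one_mul]
      · filter_upwards [hint ((Ms ^ n) φ), ih.2, hMs ((Ms ^ n) φ)] with p h1 h2 h3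
        rw [h3]
        calc e p ^ (n + 1) * T 0 (Ms ((Ms ^ n) φ)) p
            = e p ^ n * (e p * T 0 (Ms ((Ms ^ n) φ)) p) := by ring
          _ = z * s p * (e p ^ n * T 0 ((Ms ^ n) φ) p) := by rw [h1]; ring
          _ = z ^ (n + 1) * (s p * (Ms ^ n) φ p) := by rw [h2]; ring
  refine ⟨(Ms ^ k) φ, (hiter k).1, ?_⟩
  apply Lp.ext
  have hk : 0 ≤ (((k * η : ℝ) : ℂ) * Complex.I).re := by simp
  filter_upwards [hT.formula _ hk ((Ms ^ k) φ), (hiter k).2, Lp.coeFn_smul (z ^ k) ((Ms ^ k) φ)]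
    with p h1 h2 h3
  rw [h1, h3, Pi.smul_apply, smul_eq_mul, ← h2, he]
  simp only
  rw [← Complex.exp_nat_mul]
  congr 2
  push_cast; ring

/-- `T (iη)` has no peripheral eigenvalue if `η ≠ 0`. -/
lemma no_peripheral {η : ℝ} (hη : η ≠ 0) {z : ℂ} {ψ : Lp ℂ 1 μ} (hz : ‖z‖ = 1) (hψ0 : ψ ≠ 0)
    (hψ : T (η * Complex.I) ψ = z • ψ) (hfix : T 0 (modulus ψ) = modulus ψ)
    (hne : ∀ᵐ p ∂μ, modulus ψ p ≠ 0) : False := by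
  obtain ⟨N, C, hC⟩ := hT.power
  obtain ⟨L, hL0, hL⟩ := hT.exists_lipschitz
  have hC0 := hC 0 le_rfl
  set F : ℝ → Lp ℂ 1 μ →L[ℂ] Lp ℂ 1 μ := fun t => T (((0 : ℝ) : ℂ) + (t : ℂ) * Complex.I) with hF
  have hFre : ∀ t : ℝ, 0 ≤ (((0 : ℝ) : ℂ) + (t : ℂ) * Complex.I).re := fun t => by simp
  have hFL : ∀ t t' : ℝ, ‖F t - F t'‖ ≤ L * |t - t'| := by
    intro t t'
    refine (hL _ _ (hFre t) (hFre t')).trans (le_of_eq ?_)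
    congr 1
    rw [add_sub_add_left_eq_sub, ← sub_mul, norm_mul, Complex.norm_I, mul_one, ← Complex.ofReal_sub,
      Complex.norm_real, Real.norm_eq_abs]
  have hF1 : ∀ t, ‖F t‖ ≤ 1 := fun t => hT.norm_le_one (hFre t)
  have hFp : ∀ t n, ‖F t ^ n‖ ≤ 1 := by
    intro t n
    induction n with
    | zero => rw [pow_zero]; exact ContinuousLinearMap.norm_id_le
    | succ n ih =>
      rw [pow_succ]
      exact (norm_mul_le _ _).trans (mul_le_one₀ ih (norm_nonneg _) (hF1 t))
  have hpow : ∀ (n : ℕ) (t t' : ℝ), ‖F t ^ n - F t' ^ n‖ ≤ n * (L * |t - t'|) := by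
    intro n t t'
    induction n with
    | zero => simp
    | succ n ih =>
      have : F t ^ (n + 1) - F t' ^ (n + 1) = (F t ^ n - F t' ^ n) * F t + F t' ^ n * (F t - F t') := by
        rw [pow_succ, pow_succ]; noncomm_ring
      rw [this]
      calc _ ≤ ‖F t ^ n - F t' ^ n‖ * ‖F t‖ + ‖F t' ^ n‖ * ‖F t - F t'‖ :=
            (norm_add_le _ _).trans (add_le_add (norm_mul_le _ _) (norm_mul_le _ _))
        _ ≤ n * (L * |t - t'|) * 1 + 1 * (L * |t - t'|) := by
            gcongr
            · exact hF1 t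
            · exact hFp t' n
            · exact hFL t t'
        _ = ((n + 1 : ℕ) : ℝ) * (L * |t - t'|) := by push_cast; ring
  have hlow : ∀ k : ℕ, 1 ≤ ‖F (k * η) ^ N‖ := by
    intro k
    obtain ⟨f, hf, hTf⟩ := hT.exists_peripheral hz hψ hfix hne k
    have h1 : F (k * η) f = z ^ k • f := by
      simp only [hF]
      rw [Complex.ofReal_zero, zero_add]; exact hTf
    have h2 := pow_apply_of_eigen h1 N
    have h3 := (F (k * η) ^ N).le_opNorm f
    rw [h2, norm_smul, norm_pow, norm_pow, hz, one_pow, one_pow, one_mul] at h3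
    have h4 : 0 < ‖f‖ := by rw [hf]; exact norm_pos_iff.2 hψ0
    nlinarith
  -- The first bound keeps the norm of the $N$-th power above $1/2$ within distance $\rho$ of each
  -- $k\eta$, by its Lipschitz constant $NL$; the second makes these intervals disjoint, so that
  -- their total length is infinite.
  set ρ := min (1 / (2 * (N * L + 1))) (|η| / 3) with hρ
  have hρ0 : 0 < ρ := by
    have := abs_pos.2 hη
    positivity
  have hge : ∀ k : ℕ, ∀ t ∈ Metric.closedBall ((k : ℝ) * η) ρ, (1 / 2 : ℝ) ≤ ‖F t ^ N‖ := by
    intro k t ht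
    rw [Metric.mem_closedBall, Real.dist_eq, abs_sub_comm] at ht
    have h1 := hpow N (k * η) t
    have h2 := hlow k
    have h3 : N * (L * |k * η - t|) ≤ 1 / 2 := by
      calc N * (L * |k * η - t|) ≤ N * (L * (1 / (2 * (N * L + 1)))) := by
            gcongr; exact ht.trans (min_le_left _ _)
        _ = (N * L) / (2 * (N * L + 1)) := by ring
        _ ≤ 1 / 2 := by
            rw [div_le_div_iff₀ (by positivity) (by positivity)]; nlinarith
    have h4 := norm_sub_norm_le (F (k * η) ^ N) (F t ^ N)
    linarith
  have hdisj : Pairwise (Function.onFun Disjoint fun k : ℕ => Metric.closedBall ((k : ℝ) * η) ρ) := by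
    intro i j hij
    refine Metric.closedBall_disjoint_closedBall ?_
    rw [Real.dist_eq, ← sub_mul, abs_mul]
    have h1 : (1 : ℝ) ≤ |(i : ℝ) - j| := by
      have : (1 : ℤ) ≤ |(i : ℤ) - j| := Int.one_le_abs (sub_ne_zero.2 (by exact_mod_cast hij))
      exact_mod_cast this
    have h2 : ρ ≤ |η| / 3 := min_le_right _ _
    have h3 := abs_pos.2 hη
    nlinarith
  have hvol : volume (⋃ k : ℕ, Metric.closedBall ((k : ℝ) * η) ρ) = ⊤ := by
    rw [measure_iUnion hdisj fun k => Metric.isClosed_closedBall.measurableSet]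
    simp only [Real.volume_closedBall]
    exact ENNReal.tsum_const_eq_top_of_ne_zero (by simpa using hρ0)
  have h1 : ∫⁻ t in ⋃ k : ℕ, Metric.closedBall ((k : ℝ) * η) ρ, ENNReal.ofReal (1 / 2) ≤
      ∫⁻ t : ℝ, ‖F t ^ N‖ₑ := by
    refine (setLIntegral_mono' (MeasurableSet.iUnion fun k =>
      Metric.isClosed_closedBall.measurableSet) fun t ht => ?_).trans (setLIntegral_le_lintegral _ _)
    obtain ⟨k, hk⟩ := mem_iUnion.1 ht
    rw [← ofReal_norm]
    exact ENNReal.ofReal_le_ofReal (hge k t hk)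
  rw [setLIntegral_const, hvol, ENNReal.mul_top (by simp)] at h1
  exact ENNReal.coe_ne_top (top_le_iff.1 (h1.trans hC0))

/-- The eigenvalues of `T l` are smaller than `1` in modulus if `l ≠ 0`. -/
lemma norm_eigenvalue_lt {l : ℂ} (hl : 0 ≤ l.re) (hl0 : l ≠ 0) {z : ℂ} (hz : IsEigenvalue (T l) z) :
    ‖z‖ < 1 := by
  by_contra hlt
  push Not at hlt
  obtain ⟨ψ, hψ0, hψ⟩ := hz
  have hψn : 0 < ‖ψ‖ := norm_pos_iff.2 hψ0
  have hsm : ∀ᵐ p ∂μ, ‖T l ψ p‖ = ‖z‖ * ‖ψ p‖ := by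
    rw [hψ]
    filter_upwards [Lp.coeFn_smul z ψ] with p hp
    rw [hp, Pi.smul_apply, norm_smul]
  have hz1 : ‖z‖ = 1 := by
    refine le_antisymm ?_ hlt
    have h1 := (T l).le_opNorm ψ
    rw [hψ, norm_smul] at h1
    have := hT.norm_le_one hl
    by_contra hc
    push Not at hc
    nlinarith
  simp only [hz1, one_mul] at hsm
  have hfix : T 0 (modulus ψ) = modulus ψ := hT.stoch.modulus_fixed (by
    filter_upwards [hsm, hT.norm_apply_le_modulus hl ψ] with p h1 h2
    rwa [← h1])
  have hm0 : modulus ψ ≠ 0 := by rw [← norm_ne_zero_iff, norm_modulus]; exact hψn.ne'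
  have hne := hT.stoch.ne_zero_of_irreducible hT.irr (isNonneg_modulus ψ) hm0
    (by rw [hfix]; exact ae_of_all _ fun _ h => h)
  -- Otherwise $|\psi|=|T_l\psi|=e^{-\mathrm{Re}(l)\tau}|T_0\psi|\le
  -- e^{-\mathrm{Re}(l)\tau}|\psi|<|\psi|$ almost everywhere, using $T_0|\psi|=|\psi|>0$ and
  -- $\tau>0$.
  have hre : l.re = 0 := by
    by_contra hre
    have hpos : 0 < l.re := lt_of_le_of_ne hl (Ne.symm hre)
    have h1 : ∀ᵐ p ∂μ, False := by
      have hle := hT.stoch.le_modulus ψ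
      rw [hfix] at hle
      filter_upwards [hsm, hT.norm_apply_eq hl ψ, hle, hne, norm_coeFn_modulus ψ, hT.tau_pos]
        with p h1 h2 h3 h4 h5 h6
      rw [h5] at h3
      have h7 : 0 < ‖ψ p‖ := by rw [← h5]; exact norm_pos_iff.2 h4
      have h8 : Real.exp (-(l.re * τ p)) < 1 :=
        Real.exp_lt_one_iff.2 (by have := mul_pos hpos h6; linarith)
      rw [h1] at h2
      have h9 : 0 < Real.exp (-(l.re * τ p)) := Real.exp_pos _
      nlinarith
    rw [ae_iff] at h1
    exact hT.measure_ne_zero (Measure.measure_univ_eq_zero.1 (by simpa using h1))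
  have hl' : l = (l.im : ℂ) * Complex.I := by apply Complex.ext <;> simp [hre]
  have him : l.im ≠ 0 := fun h => hl0 (by rw [hl', h]; simp)
  rw [hl'] at hψ
  exact hT.no_peripheral him hz1 hψ0 hψ hfix hne

/-- The structure of the spectrum of `T l`. -/
theorem spectrum_structure [SigmaFinite μ] [MeasurableSpace.CountablyGenerated X] {l : ℂ}
    (hl : 0 ≤ l.re) :
    ∃ (J : Set ℕ) (ν : ℕ → ℂ),
      spectrum ℂ (T l) = {0} ∪ ν '' J ∧ InjOn ν J ∧
      (∀ j ∈ J, ν j ≠ 0 ∧ IsEigenvalue (T l) (ν j) ∧ ∃ n : ℕ, IsIsolatedOfAlgMult (T l) (ν j) n) ∧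
      (∀ z : ℂ, AccPt z (𝓟 (ν '' J)) → z = 0) ∧
      (l ≠ 0 → ∀ j ∈ J, ‖ν j‖ < 1) := by
  have hk := hT.isCompactOperator_pow hl
  set S := spectrum ℂ (T l) \ {0} with hS
  have hfin : ∀ r : ℝ, 0 < r → {z : ℂ | r ≤ ‖z‖ ∧ z ∈ S}.Finite := fun r hr =>
    (finite_spectrum_of_norm_ge hk hr).subset fun z hz => ⟨hz.1, hz.2.1⟩
  have hcount : S.Countable := by
    have : S ⊆ ⋃ n : ℕ, {z : ℂ | 1 / ((n : ℝ) + 1) ≤ ‖z‖ ∧ z ∈ S} := by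
      intro z hz
      obtain ⟨n, hn⟩ := exists_nat_one_div_lt (norm_pos_iff.2 hz.2)
      exact mem_iUnion.2 ⟨n, hn.le, hz⟩
    exact (countable_iUnion fun n => (hfin _ (by positivity)).countable).mono this
  obtain ⟨g, hg⟩ := Set.countable_iff_exists_injOn.1 hcount
  classical
  set ν : ℕ → ℂ := Function.invFunOn g S with hν
  have hνg : ∀ z ∈ S, ν (g z) = z := fun z hz => hg.leftInvOn_invFunOn hz
  have himg : ν '' (g '' S) = S := by
    ext z
    constructor
    · rintro ⟨_, ⟨y, hy, rfl⟩, rfl⟩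
      rw [hνg y hy]; exact hy
    · intro hz
      exact ⟨g z, ⟨z, hz, rfl⟩, hνg z hz⟩
  have hmem : ∀ j ∈ g '' S, ν j ∈ S := fun j hj => himg.subset ⟨j, hj, rfl⟩
  refine ⟨g '' S, ν, ?_, ?_, ?_, ?_, ?_⟩
  · rw [himg, hS, union_sdiff_self, union_eq_self_of_subset_left]
    rw [singleton_subset_iff]; exact hT.zero_mem_spectrum hl
  · rintro _ ⟨y, hy, rfl⟩ _ ⟨y', hy', rfl⟩ h
    rw [hνg y hy, hνg y' hy'] at h
    rw [h]
  · intro j hj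
    have h := hmem j hj
    exact ⟨h.2, isEigenvalue_of_mem_spectrum hk h.1 h.2, exists_isIsolatedOfAlgMult hk h.1 h.2⟩
  · intro z hz
    rw [himg] at hz
    by_contra hz0
    have hzn : 0 < ‖z‖ := norm_pos_iff.2 hz0
    have h1 : AccPt z (𝓟 {y : ℂ | ‖z‖ / 2 ≤ ‖y‖ ∧ y ∈ S}) := by
      rw [accPt_iff_frequently] at hz ⊢
      have h2 : ∀ᶠ y in 𝓝 z, ‖z‖ / 2 ≤ ‖y‖ :=
        (continuous_norm.tendsto z).eventually (Ici_mem_nhds (by linarith))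
      exact (hz.and_eventually h2).mono fun y hy => ⟨hy.1.1, hy.2, hy.1.2⟩
    exact Set.Infinite.of_accPt h1 (hfin _ (by positivity))
  · intro hl0 j hj
    have h := hmem j hj
    exact hT.norm_eigenvalue_lt hl hl0 (isEigenvalue_of_mem_spectrum hk h.1 h.2)

end IsTransportFamily

end Family

end

/-! ### Perturbation of the eigenvalue 1 and its derivative -/

section

section Perturbation

lemma tendsto_resolvent {A ι : Type*} [NormedRing A] [NormedAlgebra ℂ A] [CompleteSpace A]
    {F : Filter ι} {a : ι → A} {w : ι → ℂ} {a₀ : A} {w₀ : ℂ} (h : w₀ ∈ resolventSet ℂ a₀)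
    (ha : Tendsto a F (𝓝 a₀)) (hw : Tendsto w F (𝓝 w₀)) :
    Tendsto (fun i => resolvent (a i) (w i)) F (𝓝 (resolvent a₀ w₀)) :=
  Tendsto.comp (g := fun p : A × ℂ => resolvent p.1 p.2) (continuousAt_resolvent h)
    (ha.prodMk_nhds hw)

variable {X : Type*} [MeasurableSpace X] {μ : Measure X} {w τ : X → ℝ}
  {T : ℂ → Lp ℂ 1 μ →L[ℂ] Lp ℂ 1 μ}

namespace IsTransportFamily

variable (hT : IsTransportFamily μ w τ T)
include hT

lemma aestronglyMeasurable_exp (l : ℂ) :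
    AEStronglyMeasurable (fun p => Complex.exp (-(l * (τ p : ℂ)))) μ := by
  have : AEMeasurable (fun p => Complex.exp (-(l * (τ p : ℂ)))) μ := by
    refine Complex.measurable_exp.comp_aemeasurable ?_
    exact ((Complex.measurable_ofReal.comp_aemeasurable hT.tau_meas).const_mul _).neg
  exact this.aestronglyMeasurable

lemma norm_exp_le_one {l : ℂ} (hl : 0 ≤ l.re) :
    ∀ᵐ p ∂μ, ‖Complex.exp (-(l * (τ p : ℂ)))‖ ≤ 1 := by
  filter_upwards [hT.tau_pos] with p hp
  rw [norm_exp_neg_mul, Real.exp_le_one_iff]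
  have := mul_nonneg hl hp.le
  linarith

lemma integrable_tau (ψ : Lp ℂ 1 μ) : Integrable (fun p => (τ p : ℂ) * T 0 ψ p) μ := by
  obtain ⟨C, -, h⟩ := hT.gain
  have hm : AEStronglyMeasurable (fun p => (τ p : ℂ) * T 0 ψ p) μ :=
    (Complex.measurable_ofReal.comp_aemeasurable hT.tau_meas).aestronglyMeasurable.mul
      (Lp.aestronglyMeasurable _)
  refine (integrable_norm_iff hm).1 ((h ψ).1.congr ?_)
  filter_upwards [hT.tau_pos] with p hp
  rw [norm_mul, Complex.norm_real, Real.norm_of_nonneg hp.le]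

/-- The derivative of the family `T`, up to the sign. -/
lemma exists_derivOp : ∃ (D : ℂ → Lp ℂ 1 μ →L[ℂ] Lp ℂ 1 μ) (C : ℝ), 0 ≤ C ∧
    ∀ l : ℂ, 0 ≤ l.re → ‖D l‖ ≤ C ∧
      ∀ ψ, D l ψ =ᵐ[μ] fun p => Complex.exp (-(l * (τ p : ℂ))) * ((τ p : ℂ) * T 0 ψ p) := by
  obtain ⟨C, hC, h⟩ := hT.gain
  have hK : ∀ ψ, ofFun μ (fun p => (τ p : ℂ) * T 0 ψ p) =ᵐ[μ] fun p => (τ p : ℂ) * T 0 ψ p :=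
    fun ψ => coeFn_ofFun (hT.integrable_tau ψ)
  let K : Lp ℂ 1 μ →L[ℂ] Lp ℂ 1 μ := LinearMap.mkContinuous
    { toFun := fun ψ => ofFun μ fun p => (τ p : ℂ) * T 0 ψ p
      map_add' := fun ψ φ => by
        apply Lp.ext
        filter_upwards [hK (ψ + φ), hK ψ, hK φ, Lp.coeFn_add (T 0 ψ) (T 0 φ), Lp.coeFn_add
          (ofFun μ fun p => (τ p : ℂ) * T 0 ψ p) (ofFun μ fun p => (τ p : ℂ) * T 0 φ p)]
          with p h1 h2 h3 h4 h5
        rw [h1, h5, Pi.add_apply, h2, h3, map_add, h4, Pi.add_apply, mul_add]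
      map_smul' := fun c ψ => by
        apply Lp.ext
        filter_upwards [hK (c • ψ), hK ψ, Lp.coeFn_smul c (T 0 ψ), Lp.coeFn_smul c
          (ofFun μ fun p => (τ p : ℂ) * T 0 ψ p)] with p h1 h2 h3 h4
        rw [h1, RingHom.id_apply, h4, Pi.smul_apply, h2, map_smul, h3, Pi.smul_apply]
        simp only [smul_eq_mul]; ring } C fun ψ => by
      change ‖ofFun μ fun p => (τ p : ℂ) * T 0 ψ p‖ ≤ _
      rw [norm_ofFun (hT.integrable_tau ψ)]
      refine (le_of_eq (integral_congr_ae ?_)).trans (h ψ).2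
      filter_upwards [hT.tau_pos] with p hp
      rw [norm_mul, Complex.norm_real, Real.norm_of_nonneg hp.le]
  have hKap : ∀ ψ, K ψ =ᵐ[μ] fun p => (τ p : ℂ) * T 0 ψ p := hK
  -- Outside the closed half-plane the exponential multiplier need not be bounded; the operator is
  -- set to $0$ there.
  refine ⟨fun l => if hl : 0 ≤ l.re then
    (mulCLM μ _ (hT.aestronglyMeasurable_exp l) 1 (hT.norm_exp_le_one hl)).comp K else 0, ‖K‖,
    norm_nonneg _, fun l hl => ⟨?_, fun ψ => ?_⟩⟩
  · simp only [dif_pos hl]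
    refine ContinuousLinearMap.opNorm_le_bound _ (norm_nonneg _) fun ψ => ?_
    refine le_trans (L1_norm_le_of_ae_le ?_) (K.le_opNorm ψ)
    filter_upwards [coeFn_mulCLM (hT.aestronglyMeasurable_exp l) (hT.norm_exp_le_one hl) (K ψ),
      hT.norm_exp_le_one hl] with p h1 h2
    rw [ContinuousLinearMap.comp_apply, h1, norm_mul]
    exact mul_le_of_le_one_left (norm_nonneg _) h2
  · simp only [dif_pos hl]
    filter_upwards [coeFn_mulCLM (hT.aestronglyMeasurable_exp l) (hT.norm_exp_le_one hl) (K ψ),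
      hKap ψ] with p h1 h2
    rw [ContinuousLinearMap.comp_apply, h1, h2]

omit hT in
-- Uncountably many almost everywhere identities cannot be intersected, so the pointwise limit is
-- required of explicit representatives `g i`.
lemma tendsto_L1_of_dominated_filter {ι : Type*} {F : Filter ι} [F.IsCountablyGenerated]
    {G : ι → Lp ℂ 1 μ} {ψ : Lp ℂ 1 μ} {b : X → ℝ} (hb : Integrable b μ)
    (hG : ∀ᶠ i in F, ∀ᵐ p ∂μ, ‖G i p - ψ p‖ ≤ b p)
    {g : ι → X → ℂ} (hg : ∀ᶠ i in F, G i =ᵐ[μ] g i)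
    (hlim : ∀ᵐ p ∂μ, Tendsto (fun i => g i p) F (𝓝 (ψ p))) : Tendsto G F (𝓝 ψ) := by
  rw [tendsto_iff_norm_sub_tendsto_zero]
  have h1 : Tendsto (fun i => ∫ p, ‖g i p - ψ p‖ ∂μ) F (𝓝 (∫ _, (0 : ℝ) ∂μ)) := by
    refine tendsto_integral_filter_of_dominated_convergence b ?_ ?_ hb ?_
    · filter_upwards [hg] with i hi
      exact (((Lp.aestronglyMeasurable (G i)).congr hi).sub (Lp.aestronglyMeasurable ψ)).norm
    · filter_upwards [hG, hg] with i h1 h2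
      filter_upwards [h1, h2] with p h3 h4
      rwa [norm_norm, ← h4]
    · filter_upwards [hlim] with p hp
      have := (hp.sub (tendsto_const_nhds (x := ψ p))).norm
      simpa using this
  rw [integral_zero] at h1
  refine h1.congr' ?_
  filter_upwards [hg] with i hi
  rw [L1_norm_sub_eq]
  exact integral_congr_ae (hi.mono fun p hp => by simp only [hp])

/-- Dominated convergence: difference quotients and limit are each bounded by $\tau|T_0\psi|$, hence
the factor $2$. Differentiability for each fixed $\psi$ suffices, since varying vectors are handled
by the Lipschitz bound. -/
lemma tendsto_derivOp {D : Lp ℂ 1 μ} {l₀ : ℂ} (hl₀ : 0 ≤ l₀.re) (ψ : Lp ℂ 1 μ)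
    (hD : D =ᵐ[μ] fun p => Complex.exp (-(l₀ * (τ p : ℂ))) * ((τ p : ℂ) * T 0 ψ p)) :
    Tendsto (fun l => (l - l₀)⁻¹ • (T l ψ - T l₀ ψ)) (𝓝[closedRHP \ {l₀}] l₀) (𝓝 (-D)) := by
  have hF : ∀ᶠ l in 𝓝[closedRHP \ {l₀}] l₀, l ∈ closedRHP \ {l₀} := eventually_mem_nhdsWithin
  have hval : ∀ l ∈ closedRHP \ {l₀}, (l - l₀)⁻¹ • (T l ψ - T l₀ ψ) =ᵐ[μ] fun p =>
      (l - l₀)⁻¹ * ((Complex.exp (-(l * (τ p : ℂ))) - Complex.exp (-(l₀ * (τ p : ℂ)))) *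
        T 0 ψ p) := by
    intro l hl
    filter_upwards [Lp.coeFn_smul (l - l₀)⁻¹ (T l ψ - T l₀ ψ), Lp.coeFn_sub (T l ψ) (T l₀ ψ),
      hT.formula l hl.1 ψ, hT.formula l₀ hl₀ ψ] with p h1 h2 h3 h4
    rw [h1, Pi.smul_apply, h2, Pi.sub_apply, h3, h4, smul_eq_mul, sub_mul]
  obtain ⟨C, hC, hg⟩ := hT.gain
  refine tendsto_L1_of_dominated_filter ((hg ψ).1.const_mul 2)
    (g := fun l p => (l - l₀)⁻¹ * ((Complex.exp (-(l * (τ p : ℂ))) -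
      Complex.exp (-(l₀ * (τ p : ℂ)))) * T 0 ψ p)) ?_ (hF.mono hval) ?_
  · filter_upwards [hF] with l hl
    have hne : l - l₀ ≠ 0 := sub_ne_zero.2 hl.2
    filter_upwards [hval l hl, Lp.coeFn_neg D, hD, hT.tau_pos, hT.norm_exp_le_one hl₀]
      with p h1 h2 h3 h4 h5
    rw [h1, h2, Pi.neg_apply, h3, sub_neg_eq_add]
    have e1 : ‖(l - l₀)⁻¹ * ((Complex.exp (-(l * (τ p : ℂ))) -
        Complex.exp (-(l₀ * (τ p : ℂ)))) * T 0 ψ p)‖ ≤ τ p * ‖T 0 ψ p‖ := by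
      have h6 := norm_exp_neg_sub_le (a := l * (τ p : ℂ)) (b := l₀ * (τ p : ℂ))
        (by simpa using mul_nonneg hl.1 h4.le) (by simpa using mul_nonneg hl₀ h4.le)
      rw [← sub_mul, norm_mul, Complex.norm_real, Real.norm_of_nonneg h4.le] at h6
      rw [norm_mul, norm_mul, norm_inv, ← mul_assoc]
      refine mul_le_mul_of_nonneg_right ?_ (norm_nonneg _)
      rw [inv_mul_le_iff₀ (norm_pos_iff.2 hne)]
      exact h6
    have e2 : ‖Complex.exp (-(l₀ * (τ p : ℂ))) * ((τ p : ℂ) * T 0 ψ p)‖ ≤ τ p * ‖T 0 ψ p‖ := by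
      rw [norm_mul, norm_mul, Complex.norm_real, Real.norm_of_nonneg h4.le]
      exact mul_le_of_le_one_left (by positivity) h5
    refine (norm_add_le _ _).trans ?_
    linarith
  · filter_upwards [Lp.coeFn_neg D, hD] with p h2 h3
    rw [h2, Pi.neg_apply, h3]
    have hd : HasDerivAt (fun l : ℂ => Complex.exp (-(l * (τ p : ℂ))))
        (-(Complex.exp (-(l₀ * (τ p : ℂ))) * (τ p : ℂ))) l₀ := by
      have := ((hasDerivAt_id l₀).mul_const (τ p : ℂ)).neg.cexp
      simpa using this
    have h4 := (hasDerivAt_iff_tendsto_slope.1 hd).mono_left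
      (nhdsWithin_mono l₀ (show closedRHP \ {l₀} ⊆ {l₀}ᶜ from fun _ h => h.2))
    have h5 := h4.mul_const (T 0 ψ p)
    have e : -(Complex.exp (-(l₀ * (τ p : ℂ))) * ((τ p : ℂ) * T 0 ψ p)) =
        -(Complex.exp (-(l₀ * (τ p : ℂ))) * (τ p : ℂ)) * T 0 ψ p := by ring
    rw [e]
    refine h5.congr fun l => ?_
    rw [slope_def_field, div_eq_inv_mul, mul_assoc]

lemma continuous_derivOp {D : ℂ → Lp ℂ 1 μ} {l₀ : ℂ} (hl₀ : 0 ≤ l₀.re) (ψ : Lp ℂ 1 μ)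
    (hD : ∀ l : ℂ, 0 ≤ l.re →
      D l =ᵐ[μ] fun p => Complex.exp (-(l * (τ p : ℂ))) * ((τ p : ℂ) * T 0 ψ p)) :
    Tendsto D (𝓝[closedRHP] l₀) (𝓝 (D l₀)) := by
  have hF : ∀ᶠ l in 𝓝[closedRHP] l₀, l ∈ closedRHP := eventually_mem_nhdsWithin
  obtain ⟨C, hC, hg⟩ := hT.gain
  refine tendsto_L1_of_dominated_filter ((hg ψ).1.const_mul 2)
    (g := fun l p => Complex.exp (-(l * (τ p : ℂ))) * ((τ p : ℂ) * T 0 ψ p)) ?_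
    (hF.mono fun l hl => hD l hl) ?_
  · filter_upwards [hF] with l hl
    filter_upwards [hD l hl, hD l₀ hl₀, hT.tau_pos, hT.norm_exp_le_one hl₀, hT.norm_exp_le_one hl]
      with p h1 h2 h3 h4 h5
    have e : ∀ c : ℂ, ‖c‖ ≤ 1 → ‖c * ((τ p : ℂ) * T 0 ψ p)‖ ≤ τ p * ‖T 0 ψ p‖ := by
      intro c hc
      rw [norm_mul, norm_mul, Complex.norm_real, Real.norm_of_nonneg h3.le]
      exact mul_le_of_le_one_left (by positivity) hc
    rw [h1, h2]
    refine (norm_sub_le _ _).trans ?_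
    linarith [e _ h4, e _ h5]
  · filter_upwards [hD l₀ hl₀] with p h2
    rw [h2]
    have hc : Continuous fun l : ℂ => Complex.exp (-(l * (τ p : ℂ))) * ((τ p : ℂ) * T 0 ψ p) := by
      fun_prop
    exact (hc.tendsto l₀).mono_left nhdsWithin_le_nhds

set_option maxHeartbeats 2000000 in
/-- The simple eigenvalue near `1` and its derivative. -/
theorem perturbation [SigmaFinite μ] [MeasurableSpace.CountablyGenerated X] :
    ∃ φ₀ : Lp ℂ 1 μ,
      ((∀ᵐ p ∂μ, 0 < (φ₀ p).re ∧ (φ₀ p).im = 0) ∧ T 0 φ₀ = φ₀ ∧ ∫ p, φ₀ p ∂μ = 1) ∧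
      ∃ ε : ℝ, 0 < ε ∧ ∃ δ₀ : ℝ, 0 < δ₀ ∧
      ∃ (ν ν' : ℂ → ℂ) (φ : ℂ → Lp ℂ 1 μ) (φs : ℂ → Lp ℂ ∞ μ),
        (∀ l : ℂ, 0 ≤ l.re → ‖l‖ ≤ δ₀ →
          spectrum ℂ (T l) ∩ {z | ‖z - 1‖ < ε} = {ν l} ∧
          IsIsolatedOfAlgMult (T l) (ν l) 1 ∧
          φ l ≠ 0 ∧ T l (φ l) = ν l • φ l ∧
          φs l ≠ 0 ∧ ∀ ψ : Lp ℂ 1 μ, ∫ p, T l ψ p * φs l p ∂μ = ν l * ∫ p, ψ p * φs l p ∂μ) ∧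
        Tendsto ν (𝓝[closedRHP] 0) (𝓝 1) ∧
        Tendsto (fun l => ‖φ l - φ₀‖) (𝓝[closedRHP] 0) (𝓝 0) ∧
        Tendsto (fun l => ‖φs l - (memLp_top_const (1 : ℂ)).toLp (fun _ => (1 : ℂ))‖)
          (𝓝[closedRHP] 0) (𝓝 0) ∧
        (∀ δ : ℝ, 0 < δ → rect δ ⊆ Metric.ball 0 δ₀ →
          (∀ l ∈ rect δ, HasDerivWithinAt ν (ν' l) (rect δ) l) ∧
          Tendsto ν' (𝓝[rect δ] 0) (𝓝 ((-(∫ p, τ p * (φ₀ p).re ∂μ) : ℝ) : ℂ))) ∧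
        Integrable (fun p => τ p * (φ₀ p).re) μ ∧
        -(∫ p, τ p * (φ₀ p).re ∂μ) < 0 := by
  have hre0 : (0 : ℝ) ≤ (0 : ℂ).re := le_rfl
  obtain ⟨φ₀, hφn, hφne, hfix, hφi⟩ := hT.stoch.exists_fixed hT.irr hT.measure_ne_zero
    (hT.isCompactOperator_pow hre0)
  have hpos : ∀ᵐ p ∂μ, 0 < (φ₀ p).re ∧ (φ₀ p).im = 0 := by
    filter_upwards [hφn, hφne] with p h1 h2
    rw [h1]
    simpa using h2
  refine ⟨φ₀, ⟨hpos, hfix, by rw [← integralCLM_apply]; exact hφi⟩, ?_⟩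
  set ℓ := integralCLM μ with hℓ
  set P := ℓ.smulRight φ₀ with hP
  set S : ℂ → Lp ℂ 1 μ →L[ℂ] Lp ℂ 1 μ := fun l => T l - P with hS
  have hTS : ∀ l, T l = S l + ℓ.smulRight φ₀ := fun l => (sub_add_cancel _ _).symm
  have h1res : (1 : ℂ) ∈ resolventSet ℂ (S 0) :=
    hT.stoch.one_mem_resolventSet hT.irr four_ne_zero (hT.isCompactOperator_pow hre0) hfix hφi
  have hSφ : S 0 φ₀ = 0 := by
    change T 0 φ₀ - ℓ φ₀ • φ₀ = 0
    rw [hfix, hφi, one_smul, sub_self]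
  have hℓS : ∀ ψ, ℓ (S 0 ψ) = 0 := by
    intro ψ
    change ℓ (T 0 ψ - ℓ ψ • φ₀) = 0
    rw [map_sub, hT.stoch.mass, map_smul, hφi, smul_eq_mul, mul_one, sub_self]
  obtain ⟨ε, hε, δ, hδ, K, hres, hg, hex⟩ := exists_eigenvalue_near_one h1res hSφ hφi
  obtain ⟨C, hC, hlip⟩ := hT.exists_lipschitz
  -- The Lipschitz constant `C` may be zero, hence the denominator `C + 1`; the choice ensures
  -- $C\delta_0\le\delta$.
  set δ₀ := δ / (C + 1) with hδ₀
  have hδ₀p : 0 < δ₀ := by positivity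
  set G : Set ℂ := {l | 0 ≤ l.re ∧ ‖l‖ ≤ δ₀} with hG
  have hG0 : (0 : ℂ) ∈ G := ⟨le_rfl, by rw [norm_zero]; exact hδ₀p.le⟩
  have hSd : ∀ l ∈ G, ‖S l - S 0‖ ≤ δ := by
    intro l hl
    have e : S l - S 0 = T l - T 0 := sub_sub_sub_cancel_right _ _ _
    rw [e]
    refine (hlip l 0 hl.1 le_rfl).trans ?_
    rw [sub_zero]
    have h1 : C * ‖l‖ ≤ C * δ₀ := mul_le_mul_of_nonneg_left hl.2 hC
    have h2 : (C + 1) * δ₀ = δ := by rw [hδ₀]; field_simp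
    nlinarith
  have hν : ∀ l, ∃ ν : ℂ, l ∈ G → ‖ν - 1‖ < ε ∧ ℓ (resolvent (S l) ν φ₀) = 1 ∧
      spectrum ℂ (T l) ∩ {z | ‖z - 1‖ < ε} = {ν} ∧ IsIsolatedOfAlgMult (T l) ν 1 := by
    intro l
    by_cases hl : l ∈ G
    · obtain ⟨ν, h1, -, h2, h3, h4⟩ := hex (S l) (hSd l hl)
      rw [← hTS] at h3 h4
      exact ⟨ν, fun _ => ⟨h1, h2, h3, h4⟩⟩
    · exact ⟨0, fun h => absurd h hl⟩
  choose ν hν using hν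
  set B : ℂ → Lp ℂ 1 μ →L[ℂ] Lp ℂ 1 μ := fun l => resolvent (S l) (ν l) with hB
  set φ : ℂ → Lp ℂ 1 μ := fun l => B l φ₀ with hφ
  set L : ℂ → Lp ℂ 1 μ →L[ℂ] ℂ := fun l => ℓ.comp (B l) with hL
  have hBres : ∀ l ∈ G, ν l ∈ resolventSet ℂ (S l) := fun l hl =>
    (hres (S l) (hSd l hl) (ν l) (hν l hl).1).1
  have hBK : ∀ l ∈ G, ‖B l‖ ≤ K := fun l hl => (hres (S l) (hSd l hl) (ν l) (hν l hl).1).2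
  have hK0 : 0 ≤ K := (norm_nonneg _).trans (hBK 0 hG0)
  have hℓφ : ∀ l ∈ G, ℓ (φ l) = 1 := fun l hl => (hν l hl).2.1
  have heig : ∀ l ∈ G, T l (φ l) = ν l • φ l := by
    intro l hl
    rw [hTS]
    exact rankOne_eigen (hBres l hl) (hν l hl).2.1
  have hdual : ∀ l ∈ G, ∀ ψ, L l (T l ψ) = ν l * L l ψ := by
    intro l hl ψ
    rw [hTS]
    exact rankOne_dual_eigen (hBres l hl) (hν l hl).2.1 ψ
  have hLφ : ∀ l ∈ G, ∀ l' ∈ G, ‖L l (φ l') - 1‖ ≤ 1 / 2 := fun l hl l' hl' =>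
    hg (S l) (S l') (hSd l hl) (hSd l' hl') (ν l) (ν l') (hν l hl).1 (hν l' hl').1
  have hLφ' : ∀ l ∈ G, ∀ l' ∈ G, 1 / 2 ≤ ‖L l (φ l')‖ := by
    intro l hl l' hl'
    have h1 := hLφ l hl l' hl'
    have h2 := norm_sub_norm_le (1 : ℂ) (L l (φ l'))
    rw [norm_sub_rev, norm_one] at h2
    linarith
  have hLφne : ∀ l ∈ G, ∀ l' ∈ G, L l (φ l') ≠ 0 := fun l hl l' hl' h => by
    have := hLφ' l hl l' hl'
    rw [h, norm_zero] at this
    linarith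
  -- Pairing the right eigenvector at $l$ with the left eigenvector at $l'$ is the basic identity of
  -- the proof. The factor multiplying the increment of $\nu$ has modulus at least $1/2$, so the
  -- identity yields first the Lipschitz bound and then the derivative.
  have hdiff : ∀ l ∈ G, ∀ l' ∈ G, (ν l - ν l') * L l' (φ l) = L l' (T l (φ l) - T l' (φ l)) := by
    intro l hl l' hl'
    rw [map_sub, heig l hl, map_smul, hdual l' hl', smul_eq_mul, sub_mul]
  have hν0 : ν 0 = 1 := by
    have h1 : (1 : ℂ) ∈ spectrum ℂ (T 0) ∩ {z | ‖z - 1‖ < ε} := by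
      refine ⟨IsEigenvalue.mem_spectrum ⟨φ₀, ?_, by rw [hfix, one_smul]⟩, ?_⟩
      · rintro h
        rw [h, map_zero] at hφi
        exact zero_ne_one hφi
      · change ‖(1 : ℂ) - 1‖ < ε
        rw [sub_self, norm_zero]; exact hε
    rw [(hν 0 hG0).2.2.1] at h1
    exact h1.symm
  have hB0 : B 0 = resolvent (S 0) (1 : ℂ) := by rw [hB, ← hν0]
  have hφ0 : φ 0 = φ₀ := by
    have h1 := resolvent_apply_sub h1res φ₀
    rw [hSφ, sub_zero, one_smul] at h1
    rw [hφ]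
    change B 0 φ₀ = φ₀
    rw [hB0]; exact h1
  -- Conservation of mass gives $\ell\circ S_0=0$, hence $\ell\circ(1-S_0)^{-1}=\ell$: at $l=0$ the
  -- dual eigenfunction is the constant $1$.
  have hL0 : L 0 = ℓ := by
    ext1 ψ
    have h1 := congrArg ℓ (sub_apply_resolvent h1res ψ)
    rw [map_sub, hℓS, sub_zero, one_smul] at h1
    change ℓ (B 0 ψ) = ℓ ψ
    rw [hB0]; exact h1
  -- continuity
  have hνlip : ∀ l ∈ G, ∀ l' ∈ G, ‖ν l - ν l'‖ ≤ 2 * (‖ℓ‖ * K * (C * (K * ‖φ₀‖))) * ‖l - l'‖ := by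
    intro l hl l' hl'
    have h1 := congrArg norm (hdiff l hl l' hl')
    rw [norm_mul] at h1
    have h2 := hLφ' l' hl' l hl
    have h3 : ‖L l' (T l (φ l) - T l' (φ l))‖ ≤ ‖ℓ‖ * K * (C * ‖l - l'‖ * (K * ‖φ₀‖)) := by
      calc ‖L l' (T l (φ l) - T l' (φ l))‖ ≤ ‖L l'‖ * ‖(T l - T l') (φ l)‖ := (L l').le_opNorm _
        _ ≤ ‖ℓ‖ * K * (C * ‖l - l'‖ * (K * ‖φ₀‖)) := by
          gcongr
          · exact (ℓ.opNorm_comp_le (B l')).trans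
              (mul_le_mul_of_nonneg_left (hBK l' hl') (norm_nonneg _))
          · refine ((T l - T l').le_opNorm _).trans ?_
            gcongr
            · exact hlip l l' hl.1 hl'.1
            · exact ((B l).le_opNorm _).trans
                (mul_le_mul_of_nonneg_right (hBK l hl) (norm_nonneg _))
    nlinarith [norm_nonneg (ν l - ν l')]
  have hνc : ∀ l₀ ∈ G, Tendsto ν (𝓝[G] l₀) (𝓝 (ν l₀)) := by
    intro l₀ hl₀
    rw [tendsto_iff_norm_sub_tendsto_zero]
    have h1 : Tendsto (fun l => 2 * (‖ℓ‖ * K * (C * (K * ‖φ₀‖))) * ‖l - l₀‖) (𝓝[G] l₀) (𝓝 0) := by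
      have : Continuous fun l : ℂ => 2 * (‖ℓ‖ * K * (C * (K * ‖φ₀‖))) * ‖l - l₀‖ := by fun_prop
      have := (this.tendsto l₀).mono_left (nhdsWithin_le_nhds (s := G))
      simpa using this
    refine tendsto_of_tendsto_of_tendsto_of_le_of_le' tendsto_const_nhds h1
      (Eventually.of_forall fun _ => norm_nonneg _) ?_
    filter_upwards [eventually_mem_nhdsWithin] with l hl
    exact hνlip l hl l₀ hl₀
  have hSc : ∀ l₀ ∈ G, Tendsto S (𝓝[G] l₀) (𝓝 (S l₀)) := by
    intro l₀ hl₀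
    rw [tendsto_iff_norm_sub_tendsto_zero]
    have h1 : Tendsto (fun l => C * ‖l - l₀‖) (𝓝[G] l₀) (𝓝 0) := by
      have : Continuous fun l : ℂ => C * ‖l - l₀‖ := by fun_prop
      have := (this.tendsto l₀).mono_left (nhdsWithin_le_nhds (s := G))
      simpa using this
    refine tendsto_of_tendsto_of_tendsto_of_le_of_le' tendsto_const_nhds h1
      (Eventually.of_forall fun _ => norm_nonneg _) ?_
    filter_upwards [eventually_mem_nhdsWithin] with l hl
    have e : S l - S l₀ = T l - T l₀ := sub_sub_sub_cancel_right _ _ _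
    rw [e]
    exact hlip l l₀ hl.1 hl₀.1
  have hBc : ∀ l₀ ∈ G, Tendsto B (𝓝[G] l₀) (𝓝 (B l₀)) := by
    intro l₀ hl₀
    exact tendsto_resolvent (hBres l₀ hl₀) (hSc l₀ hl₀) (hνc l₀ hl₀)
  have hφc : ∀ l₀ ∈ G, Tendsto φ (𝓝[G] l₀) (𝓝 (φ l₀)) := fun l₀ hl₀ =>
    ((ContinuousLinearMap.apply ℂ (Lp ℂ 1 μ) φ₀).continuous.tendsto (B l₀)).comp (hBc l₀ hl₀)
  have hLc : ∀ l₀ ∈ G, Tendsto L (𝓝[G] l₀) (𝓝 (L l₀)) := fun l₀ hl₀ =>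
    (((ContinuousLinearMap.compL ℂ (Lp ℂ 1 μ) (Lp ℂ 1 μ) ℂ) ℓ).continuous.tendsto (B l₀)).comp
      (hBc l₀ hl₀)
  have hGnhds : 𝓝[closedRHP] (0 : ℂ) ≤ 𝓝[G] 0 := by
    refine nhdsWithin_le_of_mem ?_
    have h1 : Metric.closedBall (0 : ℂ) δ₀ ∈ 𝓝 (0 : ℂ) := Metric.closedBall_mem_nhds 0 hδ₀p
    filter_upwards [eventually_mem_nhdsWithin, mem_nhdsWithin_of_mem_nhds h1] with l h2 h3
    exact ⟨h2, by simpa using h3⟩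
  obtain ⟨D, CD, hCD, hD⟩ := hT.exists_derivOp
  have hDc : ∀ l₀ ∈ G, Tendsto (fun l => D l (φ l)) (𝓝[G] l₀) (𝓝 (D l₀ (φ l₀))) := by
    intro l₀ hl₀
    have h1 : Tendsto (fun l => D l (φ l₀)) (𝓝[G] l₀) (𝓝 (D l₀ (φ l₀))) :=
      (hT.continuous_derivOp hl₀.1 (φ l₀) (D := fun l => D l (φ l₀))
        fun l hl => (hD l hl).2 _).mono_left (nhdsWithin_mono _ fun l hl => hl.1)
    have h2 : Tendsto (fun l => D l (φ l - φ l₀)) (𝓝[G] l₀) (𝓝 0) := by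
      rw [tendsto_zero_iff_norm_tendsto_zero]
      have h3 : Tendsto (fun l => CD * ‖φ l - φ l₀‖) (𝓝[G] l₀) (𝓝 0) := by
        have := ((tendsto_iff_norm_sub_tendsto_zero.1 (hφc l₀ hl₀)).const_mul CD)
        rwa [mul_zero] at this
      refine tendsto_of_tendsto_of_tendsto_of_le_of_le' tendsto_const_nhds h3
        (Eventually.of_forall fun _ => norm_nonneg _) ?_
      filter_upwards [eventually_mem_nhdsWithin] with l hl
      exact ((D l).le_opNorm _).trans (mul_le_mul_of_nonneg_right (hD l hl.1).1 (norm_nonneg _))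
    have h3 := h1.add h2
    rw [add_zero] at h3
    refine h3.congr fun l => ?_
    rw [← map_add, add_sub_cancel]
  set ν' : ℂ → ℂ := fun l => -(L l (D l (φ l))) / L l (φ l) with hν'
  -- Split $\varphi_l=\varphi_{l_0}+(\varphi_l-\varphi_{l_0})$. The quotient of $T$ converges on the
  -- fixed vector, and on the remainder it is bounded by $C\|\varphi_l-\varphi_{l_0}\|\to0$.
  have hderiv : ∀ l₀ ∈ G, Tendsto (slope ν l₀) (𝓝[G \ {l₀}] l₀) (𝓝 (ν' l₀)) := by
    intro l₀ hl₀
    have hmono : 𝓝[G \ {l₀}] l₀ ≤ 𝓝[G] l₀ := nhdsWithin_mono _ sdiff_subset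
    have h1 := (hT.tendsto_derivOp hl₀.1 (φ l₀) ((hD l₀ hl₀.1).2 _)).mono_left
      (nhdsWithin_mono l₀ (show G \ {l₀} ⊆ closedRHP \ {l₀} from fun l hl => ⟨hl.1.1, hl.2⟩))
    have h2 : Tendsto (fun l => (l - l₀)⁻¹ • (T l (φ l - φ l₀) - T l₀ (φ l - φ l₀)))
        (𝓝[G \ {l₀}] l₀) (𝓝 0) := by
      rw [tendsto_zero_iff_norm_tendsto_zero]
      have h3 : Tendsto (fun l => C * ‖φ l - φ l₀‖) (𝓝[G \ {l₀}] l₀) (𝓝 0) := by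
        have := ((tendsto_iff_norm_sub_tendsto_zero.1 ((hφc l₀ hl₀).mono_left hmono)).const_mul C)
        rwa [mul_zero] at this
      refine tendsto_of_tendsto_of_tendsto_of_le_of_le' tendsto_const_nhds h3
        (Eventually.of_forall fun _ => norm_nonneg _) ?_
      filter_upwards [eventually_mem_nhdsWithin] with l hl
      have hne : 0 < ‖l - l₀‖ := norm_pos_iff.2 (sub_ne_zero.2 hl.2)
      rw [norm_smul, norm_inv, inv_mul_le_iff₀ hne]
      calc ‖T l (φ l - φ l₀) - T l₀ (φ l - φ l₀)‖ = ‖(T l - T l₀) (φ l - φ l₀)‖ := rfl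
        _ ≤ ‖T l - T l₀‖ * ‖φ l - φ l₀‖ := (T l - T l₀).le_opNorm _
        _ ≤ C * ‖l - l₀‖ * ‖φ l - φ l₀‖ :=
          mul_le_mul_of_nonneg_right (hlip l l₀ hl.1.1 hl₀.1) (norm_nonneg _)
        _ = ‖l - l₀‖ * (C * ‖φ l - φ l₀‖) := by ring
    have h3 := h1.add h2
    rw [add_zero] at h3
    have h4 := (((L l₀).continuous.tendsto _).comp h3).div
      (((L l₀).continuous.tendsto _).comp ((hφc l₀ hl₀).mono_left hmono)) (hLφne l₀ hl₀ l₀ hl₀)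
    rw [map_neg] at h4
    refine h4.congr' ?_
    filter_upwards [eventually_mem_nhdsWithin] with l hl
    have h5 := hdiff l hl.1 l₀ hl₀
    simp only [Function.comp_apply, Pi.div_apply]
    rw [← smul_add, map_smul, map_sub, map_sub, slope_def_field, div_eq_iff (hLφne l₀ hl₀ l hl.1),
      div_mul_eq_mul_div, h5, smul_eq_mul, div_eq_inv_mul]
    congr 2
    abel
  have hν'c : Tendsto ν' (𝓝[G] 0) (𝓝 (ν' 0)) := by
    have hap : ∀ f : ℂ → Lp ℂ 1 μ, Tendsto f (𝓝[G] 0) (𝓝 (f 0)) →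
        Tendsto (fun l => L l (f l)) (𝓝[G] 0) (𝓝 (L 0 (f 0))) := fun f hf =>
      (isBoundedBilinearMap_apply.continuous.tendsto (L 0, f 0)).comp
        ((hLc 0 hG0).prodMk_nhds hf)
    exact ((hap _ (hDc 0 hG0)).neg).div (hap _ (hφc 0 hG0)) (hLφne 0 hG0 0 hG0)
  have hint : Integrable (fun p => τ p * (φ₀ p).re) μ := by
    obtain ⟨C', -, h⟩ := hT.gain
    refine (h φ₀).1.congr ?_
    rw [hfix]
    filter_upwards [hφn.re_eq] with p hp
    rw [hp]
  have hν'0 : ν' 0 = ((-(∫ p, τ p * (φ₀ p).re ∂μ) : ℝ) : ℂ) := by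
    have h1 : ℓ (D 0 φ₀) = ((∫ p, τ p * (φ₀ p).re ∂μ : ℝ) : ℂ) := by
      rw [hℓ, integralCLM_apply, ← integral_complex_ofReal]
      refine integral_congr_ae ?_
      filter_upwards [(hD 0 le_rfl).2 φ₀, hφn, hφn.re_eq] with p h1 h2 h3
      rw [h1, hfix, h3, zero_mul, neg_zero, Complex.exp_zero, one_mul, Complex.ofReal_mul]
      congr 1
    simp only [hν']
    rw [hL0, hφ0, h1, hφi, div_one, Complex.ofReal_neg]
  -- the dual eigenfunctions
  choose g hg1 hg2 using fun l => exists_Linf_of_dual (L l - ℓ)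
  set one : Lp ℂ ∞ μ := (memLp_top_const (1 : ℂ)).toLp (fun _ => (1 : ℂ)) with hone
  have hone1 : one =ᵐ[μ] fun _ => (1 : ℂ) := MemLp.coeFn_toLp _
  have hbr : ∀ l ψ, ∫ p, ψ p * (one + g l : Lp ℂ ∞ μ) p ∂μ = L l ψ := by
    intro l ψ
    have h1 : ∫ p, ψ p * (one + g l : Lp ℂ ∞ μ) p ∂μ = ∫ p, (ψ p + ψ p * g l p) ∂μ := by
      refine integral_congr_ae ?_
      filter_upwards [Lp.coeFn_add one (g l), hone1] with p h1 h2
      rw [h1, Pi.add_apply, h2, mul_add, mul_one]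
    have hi : Integrable (fun p => ψ p * g l p) μ := by
      have hb : ∀ᵐ p ∂μ, ‖g l p‖ ≤ ‖g l‖ := by
        filter_upwards [ae_le_eLpNormEssSup (f := g l) (μ := μ)] with p hp
        have h2 : ‖g l p‖ₑ ≤ ‖g l‖ₑ := by
          rw [Lp.enorm_def, eLpNorm_exponent_top]; exact hp
        simpa using ENNReal.toReal_mono (by simp) h2
      refine ((L1_integrable ψ).bdd_mul (Lp.aestronglyMeasurable (g l)) hb).congr ?_
      exact ae_of_all _ fun p => mul_comm _ _
    rw [h1, integral_add (L1_integrable ψ) hi, ← hg1, ← integralCLM_apply]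
    change ℓ ψ + (L l ψ - ℓ ψ) = L l ψ
    ring
  refine ⟨ε, hε, δ₀, hδ₀p, ν, ν', φ, fun l => one + g l, ?_, ?_, ?_, ?_, ?_, hint, ?_⟩
  · intro l hl hlδ
    have hlG : l ∈ G := ⟨hl, hlδ⟩
    refine ⟨(hν l hlG).2.2.1, (hν l hlG).2.2.2, ?_, heig l hlG, ?_, ?_⟩
    · intro h
      have := hℓφ l hlG
      rw [h, map_zero] at this
      exact zero_ne_one this
    · intro h
      have h1 := hbr l (φ l)
      have h : one + g l = 0 := h
      rw [h] at h1
      refine hLφne l hlG l hlG ?_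
      rw [← h1]
      refine integral_eq_zero_of_ae ?_
      filter_upwards [Lp.coeFn_zero ℂ ∞ μ] with p hp
      rw [hp]; simp
    · intro ψ
      rw [hbr, hbr]
      exact hdual l hlG ψ
  · have := (hνc 0 hG0).mono_left hGnhds
    rwa [hν0] at this
  · have := (hφc 0 hG0).mono_left hGnhds
    rw [hφ0] at this
    exact tendsto_iff_norm_sub_tendsto_zero.1 this
  · have h1 := tendsto_iff_norm_sub_tendsto_zero.1 ((hLc 0 hG0).mono_left hGnhds)
    rw [hL0] at h1
    -- The dual eigenfunction is $1$ plus a representative of the functional `L l - ℓ`, whose sup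
    -- norm is at most the norm of that functional.
    refine squeeze_zero (fun l => norm_nonneg _) (fun l => ?_) h1
    rw [add_sub_cancel_left]
    exact hg2 l
  · intro δ' hδ' hsub
    have hrG : rect δ' ⊆ G := fun l hl => ⟨hl.1, by
      have := hsub hl
      rw [Metric.mem_ball, dist_zero_right] at this
      exact this.le⟩
    refine ⟨fun l hl => ?_, ?_⟩
    · rw [hasDerivWithinAt_iff_tendsto_slope]
      exact (hderiv l (hrG hl)).mono_left (nhdsWithin_mono _ (sdiff_subset_sdiff_left hrG))
    · rw [← hν'0]
      exact hν'c.mono_left (nhdsWithin_mono _ hrG)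
  · rw [neg_lt_zero, integral_pos_iff_support_of_nonneg_ae ?_ hint]
    · have h1 : ∀ᵐ p ∂μ, p ∈ Function.support fun p => τ p * (φ₀ p).re := by
        filter_upwards [hT.tau_pos, hpos] with p h1 h2
        exact (mul_pos h1 h2.1).ne'
      rw [pos_iff_ne_zero]
      intro h0
      have h2 : ∀ᵐ p ∂μ, False := by
        filter_upwards [h1, measure_eq_zero_iff_ae_notMem.1 h0] with p h3 h4
        exact h4 h3
      rw [ae_iff] at h2
      exact hT.measure_ne_zero (Measure.measure_univ_eq_zero.1 (by simpa using h2))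
    · filter_upwards [hT.tau_pos, hpos] with p h1 h2
      exact (mul_pos h1 h2.1).le

end IsTransportFamily

end Perturbation

end

section

/-! ### Weak compactness and equi-integrability -/

section WeakCompact

variable {X X' : Type*} [MeasurableSpace X] {μ : Measure X} [MeasurableSpace X'] {μ' : Measure X'}

/-- Integration over a measurable set, as a functional. -/
lemma exists_setIntegralCLM (μ : Measure X) {B : Set X} (hB : MeasurableSet B) :
    ∃ F : Lp ℂ 1 μ →L[ℂ] ℂ, ∀ ψ : Lp ℂ 1 μ, F ψ = ∫ p in B, ψ p ∂μ := by
  have hm : AEStronglyMeasurable (B.indicator fun _ => (1 : ℂ)) μ :=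
    (measurable_const.indicator hB).aestronglyMeasurable
  have hb : ∀ᵐ p ∂μ, ‖B.indicator (fun _ => (1 : ℂ)) p‖ ≤ 1 := ae_of_all _ fun p => by
    by_cases h : p ∈ B <;> simp [h]
  refine ⟨(integralCLM μ).comp (mulCLM μ _ hm 1 hb), fun ψ => ?_⟩
  rw [ContinuousLinearMap.comp_apply, integralCLM_apply, ← integral_indicator hB]
  refine integral_congr_ae ?_
  filter_upwards [coeFn_mulCLM hm hb ψ] with p hp
  rw [hp]
  by_cases h : p ∈ B <;> simp [h]

/-- If it fails, there are nonnegative $f_n$ in the unit ball and sets $B_n$ of weighted measure at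
most $2^{-n}$ on which $MWf_n$ has mass at least $\eta$. By positivity, $\int_{C_n}MWf_k\ge\eta$ for
$k\ge n$, where $C_n=\bigcup_{k\ge n}B_k$. This is a weakly closed linear condition, so a weak
cluster point $g$ of $Wf_k$ satisfies $\mathrm{Re}\int_{C_n}Mg\ge\eta$ for all $n$, although the
$C_n$ decrease to a null set. -/
lemma IsWeaklyCompact.equiIntegrable_comp {w : X → ℝ} (hw : IsWeight μ w)
    {W : Lp ℂ 1 μ →L[ℂ] Lp ℂ 1 μ'} (hW : IsWeaklyCompact W) (M : Lp ℂ 1 μ' →L[ℂ] Lp ℂ 1 μ)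
    (hnn : ∀ f, IsNonneg f → IsNonneg (M (W f)))
    (hdom : ∀ f, ∀ᵐ p ∂μ, ‖M (W f) p‖ ≤ ‖M (W (modulus f)) p‖) :
    IsEquiIntegrable w (M.comp W) := by
  by_contra hne
  rw [IsEquiIntegrable] at hne
  push Not at hne
  obtain ⟨η, hη, hne⟩ := hne
  have hfin := hw.isFiniteMeasure
  choose B hB hBδ ψ hψ using fun n : ℕ => hne ((1 / 2) ^ n) (by positivity)
  have hψ0 : ∀ n, 0 < ‖ψ n‖ := by
    intro n
    refine norm_pos_iff.2 fun h0 => ?_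
    have h1 := hψ n
    rw [h0, map_zero, norm_zero, mul_zero] at h1
    have h2 : ∫ p in B n, ‖(0 : Lp ℂ 1 μ) p‖ ∂μ = 0 := by
      refine integral_eq_zero_of_ae (ae_restrict_of_ae ?_)
      filter_upwards [Lp.coeFn_zero ℂ 1 μ] with p hp
      rw [hp]; simp
    linarith
  -- normalise
  set f : ℕ → Lp ℂ 1 μ := fun n => ((‖ψ n‖⁻¹ : ℝ) : ℂ) • modulus (ψ n) with hf
  have hfn : ∀ n, IsNonneg (f n) := by
    intro n
    filter_upwards [isNonneg_modulus (ψ n), Lp.coeFn_smul ((‖ψ n‖⁻¹ : ℝ) : ℂ) (modulus (ψ n))]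
      with p h1 h2
    rw [h2, Pi.smul_apply, smul_eq_mul, norm_mul, Complex.ofReal_mul, ← h1, Complex.norm_real,
      Real.norm_of_nonneg (by positivity)]
  have hf1 : ∀ n, ‖f n‖ ≤ 1 := by
    intro n
    rw [hf]
    simp only
    rw [norm_smul, Complex.norm_real, Real.norm_of_nonneg (by positivity), norm_modulus,
      inv_mul_cancel₀ (hψ0 n).ne']
  have hfB : ∀ n, η ≤ ∫ p in B n, ‖M (W (f n)) p‖ ∂μ := by
    intro n
    have h1 : ∫ p in B n, ‖M (W (f n)) p‖ ∂μ =
        ‖ψ n‖⁻¹ * ∫ p in B n, ‖M (W (modulus (ψ n))) p‖ ∂μ := by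
      rw [← integral_const_mul]
      refine integral_congr_ae (ae_restrict_of_ae ?_)
      filter_upwards [Lp.coeFn_smul ((‖ψ n‖⁻¹ : ℝ) : ℂ) (M (W (modulus (ψ n))))] with p hp
      simp only [hf]
      rw [map_smul, map_smul, hp, Pi.smul_apply, norm_smul, Complex.norm_real,
        Real.norm_of_nonneg (by positivity)]
    have h2 : ∫ p in B n, ‖M (W (ψ n)) p‖ ∂μ ≤ ∫ p in B n, ‖M (W (modulus (ψ n))) p‖ ∂μ :=
      setIntegral_mono_ae (L1_integrable _).norm.integrableOn (L1_integrable _).norm.integrableOn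
        (hdom _)
    have h3 : η * ‖ψ n‖ < ∫ p in B n, ‖M (W (ψ n)) p‖ ∂μ := hψ n
    rw [h1, le_inv_mul_iff₀ (hψ0 n)]
    linarith
  set C : ℕ → Set X := fun n => ⋃ k, B (n + k) with hC
  have hCm : ∀ n, MeasurableSet (C n) := fun n => MeasurableSet.iUnion fun k => hB _
  have hCν : ∀ n, weighted μ w (C n) ≤ ENNReal.ofReal (2 * (1 / 2) ^ n) := by
    intro n
    refine (measure_iUnion_le _).trans ((ENNReal.tsum_le_tsum fun k => hBδ (n + k)).trans ?_)
    rw [← ENNReal.ofReal_tsum_of_nonneg (fun k => by positivity)]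
    · refine ENNReal.ofReal_le_ofReal (le_of_eq ?_)
      simp only [pow_add]
      rw [tsum_mul_left, tsum_geometric_two, mul_comm]
    · simp only [pow_add]
      exact summable_geometric_two.mul_left _
  have hCanti : Antitone C := by
    intro a b hab p hp
    obtain ⟨k, hk⟩ := mem_iUnion.1 hp
    refine mem_iUnion.2 ⟨b - a + k, ?_⟩
    rwa [show a + (b - a + k) = b + k by omega]
  have hCnull : μ (⋂ n, C n) = 0 := by
    refine absolutelyContinuous_weighted hw ?_
    have h1 : ∀ n, weighted μ w (⋂ n, C n) ≤ ENNReal.ofReal (2 * (1 / 2) ^ n) := fun n =>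
      (measure_mono (iInter_subset _ n)).trans (hCν n)
    have h2 : Tendsto (fun n : ℕ => ENNReal.ofReal (2 * (1 / 2) ^ n)) atTop (𝓝 0) := by
      have h3 : Tendsto (fun n : ℕ => 2 * (1 / 2 : ℝ) ^ n) atTop (𝓝 0) := by
        have := (tendsto_pow_atTop_nhds_zero_of_lt_one (r := (1 / 2 : ℝ)) (by norm_num)
          (by norm_num)).const_mul 2
        rwa [mul_zero] at this
      have := ENNReal.tendsto_ofReal h3
      rwa [ENNReal.ofReal_zero] at this
    exact le_antisymm (ge_of_tendsto' h2 h1) zero_le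
  choose F hF using fun n => exists_setIntegralCLM μ (hCm n)
  have hFf : ∀ n k, n ≤ k → η ≤ (F n (M (W (f k)))).re := by
    intro n k hnk
    have h1 : F n (M (W (f k))) = ((∫ p in C n, ‖M (W (f k)) p‖ ∂μ : ℝ) : ℂ) := by
      rw [hF, ← integral_complex_ofReal]
      exact integral_congr_ae (ae_restrict_of_ae (hnn _ (hfn k)))
    rw [h1, Complex.ofReal_re]
    refine (hfB k).trans (setIntegral_mono_set (L1_integrable _).norm.integrableOn
      (ae_of_all _ fun p => norm_nonneg _) ?_)
    refine (show B k ⊆ C n from fun p hp => mem_iUnion.2 ⟨k - n, ?_⟩).eventuallyLE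
    rwa [Nat.add_sub_cancel' hnk]
  -- a weak cluster point
  obtain ⟨a, -, ha⟩ := hW.exists_mapClusterPt_of_frequently (l := atTop)
    (f := fun n => toWeakSpace ℂ (Lp ℂ 1 μ') (W (f n)))
    (Frequently.of_forall fun n => subset_closure ⟨f n, by simpa using hf1 n, rfl⟩)
  set g : Lp ℂ 1 μ' := (toWeakSpace ℂ (Lp ℂ 1 μ')).symm a with hg
  have hge : ∀ n, η ≤ (F n (M g)).re := by
    intro n
    by_contra hlt
    push Not at hlt
    set Λ : Lp ℂ 1 μ' →L[ℂ] ℂ := (F n).comp M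
    have hcont : Continuous fun x : WeakSpace ℂ (Lp ℂ 1 μ') =>
        (Λ ((toWeakSpace ℂ (Lp ℂ 1 μ')).symm x)).re :=
      Complex.continuous_re.comp (WeakBilin.eval_continuous (topDualPairing ℂ (Lp ℂ 1 μ')).flip Λ)
    have h1 : ∀ᶠ x in 𝓝 a, (Λ ((toWeakSpace ℂ (Lp ℂ 1 μ')).symm x)).re < η :=
      hcont.continuousAt.eventually (gt_mem_nhds hlt)
    have h2 := ha.frequently h1
    obtain ⟨k, hk, hkn⟩ := (h2.and_eventually (eventually_ge_atTop n)).exists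
    rw [LinearEquiv.symm_apply_apply] at hk
    exact absurd (hFf n k hkn) (not_le.2 hk)
  have hlim : Tendsto (fun n => (F n (M g)).re) atTop (𝓝 0) := by
    have h1 : Tendsto (fun n => ∫ p in C n, M g p ∂μ) atTop (𝓝 (∫ p in ⋂ n, C n, M g p ∂μ)) :=
      tendsto_setIntegral_of_antitone hCm hCanti ⟨0, (L1_integrable (M g)).integrableOn⟩
    rw [setIntegral_measure_zero _ hCnull] at h1
    have h2 := (Complex.continuous_re.tendsto _).comp h1
    refine h2.congr fun n => ?_
    rw [Function.comp_apply, hF]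
  have := ge_of_tendsto' hlim hge
  linarith

end WeakCompact

end

section

/-! ### Hausdorff measure under comparison of distances -/

/-- Points of $A$ with equal $g$-values have equal $f$-values, so on $A$ the map $f$ factors through
$g$ by a $K$-Lipschitz map. This form compares images under two maps without exhibiting a map
between them. -/
theorem euclideanHausdorffMeasure_image_le_of_dist_le {α Y Z : Type*}
    [MetricSpace Y] [MeasurableSpace Y] [BorelSpace Y]
    [MetricSpace Z] [MeasurableSpace Z] [BorelSpace Z]
    (k : ℕ) (K : ℝ≥0) (f : α → Y) (g : α → Z) (A : Set α)
    (h : ∀ x ∈ A, ∀ y ∈ A, dist (f x) (f y) ≤ K * dist (g x) (g y)) :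
    (μHE[k] : Measure Y) (f '' A) ≤ (K : ℝ≥0∞) ^ k * (μHE[k] : Measure Z) (g '' A) := by
  rcases A.eq_empty_or_nonempty with rfl | ⟨a, ha⟩
  · simp
  have : Nonempty α := ⟨a⟩
  have key : ∀ x ∈ A, f (Function.invFunOn g A (g x)) = f x := by
    intro x hx
    have h1 : Function.invFunOn g A (g x) ∈ A := Function.invFunOn_mem ⟨x, hx, rfl⟩
    have h2 : g (Function.invFunOn g A (g x)) = g x := Function.invFunOn_eq ⟨x, hx, rfl⟩
    have h3 := h _ h1 x hx
    rw [h2, dist_self, mul_zero] at h3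
    exact dist_le_zero.1 h3
  have hL : LipschitzOnWith K (f ∘ Function.invFunOn g A) (g '' A) := by
    refine LipschitzOnWith.of_dist_le_mul ?_
    rintro _ ⟨x, hx, rfl⟩ _ ⟨y, hy, rfl⟩
    simp only [Function.comp_apply, key x hx, key y hy]
    exact h x hx y hy
  have him : (f ∘ Function.invFunOn g A) '' (g '' A) = f '' A := by
    rw [image_image]
    exact image_congr fun x hx => key x hx
  have := hL.hausdorffMeasure_image_le (d := (k : ℝ)) (Nat.cast_nonneg k)
  rw [him, ENNReal.rpow_natCast] at this
  simp only [Measure.euclideanHausdorffMeasure_def, Measure.smul_apply, ENNReal.smul_def,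
    smul_eq_mul]
  calc _ ≤ _ := mul_le_mul_right this _
    _ = _ := by ring

variable {d : ℕ}

/-! ### Compressions along a direction -/

/-- The linear map multiplying the component along the unit vector `e` by `s`. -/
def compression (e : E d) (s : ℝ) : E d →L[ℝ] E d :=
  ContinuousLinearMap.id ℝ (E d) - (1 - s) • (innerSL ℝ e).smulRight e

theorem compression_apply (e : E d) (s : ℝ) (x : E d) :
    compression e s x = x - ((1 - s) * ⟪e, x⟫) • e := by
  simp [compression, smul_smul]

theorem inner_compression {e : E d} (he : ‖e‖ = 1) (s : ℝ) (x y : E d) :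
    ⟪compression e s x, compression e s y⟫ = ⟪x, y⟫ - (1 - s ^ 2) * (⟪e, x⟫ * ⟪e, y⟫) := by
  have hee : ⟪e, e⟫ = 1 := by rw [real_inner_self_eq_norm_sq, he]; norm_num
  rw [compression_apply, compression_apply]
  simp only [inner_sub_left, inner_sub_right, inner_smul_left, inner_smul_right, hee,
    real_inner_comm e x, conj_trivial]
  ring

theorem norm_sq_compression {e : E d} (he : ‖e‖ = 1) (s : ℝ) (x : E d) :
    ‖compression e s x‖ ^ 2 = ‖x‖ ^ 2 - (1 - s ^ 2) * ⟪e, x⟫ ^ 2 := by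
  rw [← real_inner_self_eq_norm_sq, inner_compression he, real_inner_self_eq_norm_sq]
  ring

theorem norm_compression_le {e : E d} (he : ‖e‖ = 1) {s : ℝ} (hs0 : 0 ≤ s) (hs : s ≤ 1) (x : E d) :
    ‖compression e s x‖ ≤ ‖x‖ := by
  have := norm_sq_compression he s x
  have h2 : 0 ≤ (1 - s ^ 2) * ⟪e, x⟫ ^ 2 := by
    apply mul_nonneg _ (sq_nonneg _); nlinarith
  exact abs_le_of_sq_le_sq' (by linarith) (norm_nonneg _) |>.2

theorem compression_zero_comp {e : E d} (he : ‖e‖ = 1) (s : ℝ) (x : E d) :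
    compression e 0 (compression e s x) = compression e 0 x := by
  have hee : ⟪e, e⟫ = 1 := by rw [real_inner_self_eq_norm_sq, he]; norm_num
  simp only [compression_apply, inner_sub_right, inner_smul_right, hee]
  module

/-- The factor by which the compression changes the volume of the hyperplane orthogonal to `n`. -/
def compressionFactor (e n : E d) (s : ℝ) : ℝ := √(1 - (1 - s ^ 2) * (1 - ⟪e, n⟫ ^ 2))

theorem abs_inner_le_one {e n : E d} (he : ‖e‖ = 1) (hn : ‖n‖ = 1) : |⟪e, n⟫| ≤ 1 := by
  simpa [he, hn] using abs_real_inner_le_norm e n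

theorem inner_sq_le_one {e n : E d} (he : ‖e‖ = 1) (hn : ‖n‖ = 1) : ⟪e, n⟫ ^ 2 ≤ 1 := by
  have := abs_inner_le_one he hn
  rw [← sq_abs]; nlinarith [abs_nonneg ⟪e, n⟫]

theorem compressionFactor_arg_nonneg {e n : E d} (he : ‖e‖ = 1) (hn : ‖n‖ = 1) (s : ℝ) :
    0 ≤ 1 - (1 - s ^ 2) * (1 - ⟪e, n⟫ ^ 2) := by
  nlinarith [inner_sq_le_one he hn, mul_nonneg (sq_nonneg s) (sub_nonneg.2 (inner_sq_le_one he hn)),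
    sq_nonneg ⟪e, n⟫]

theorem compressionFactor_zero (e n : E d) : compressionFactor e n 0 = |⟪e, n⟫| := by
  rw [compressionFactor, ← Real.sqrt_sq_eq_abs]; congr 1; ring

theorem compressionFactor_of_inner_eq_zero {e n : E d} (h : ⟪e, n⟫ = 0) {s : ℝ} (hs : 0 ≤ s) :
    compressionFactor e n s = s := by
  rw [compressionFactor, h]
  rw [show (1 - (1 - s ^ 2) * (1 - (0:ℝ) ^ 2)) = s ^ 2 by ring, Real.sqrt_sq hs]

/-- A vector orthogonal to `n` has a component along `e` controlled by the angle. -/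
theorem inner_sq_le_of_orthogonal {e n u : E d} (he : ‖e‖ = 1) (hn : ‖n‖ = 1) (hu : ⟪n, u⟫ = 0) :
    ⟪e, u⟫ ^ 2 ≤ (1 - ⟪e, n⟫ ^ 2) * ‖u‖ ^ 2 := by
  have hnn : ⟪n, n⟫ = 1 := by rw [real_inner_self_eq_norm_sq, hn]; norm_num
  have hee : ⟪e, e⟫ = 1 := by rw [real_inner_self_eq_norm_sq, he]; norm_num
  have h1 : ⟪e - ⟪e, n⟫ • n, u⟫ = ⟪e, u⟫ := by
    simp [inner_sub_left, inner_smul_left, hu]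
  have h2 : ‖e - ⟪e, n⟫ • n‖ ^ 2 = 1 - ⟪e, n⟫ ^ 2 := by
    rw [← real_inner_self_eq_norm_sq]
    simp only [inner_sub_left, inner_sub_right, inner_smul_left, inner_smul_right, hnn, hee,
      real_inner_comm e n, conj_trivial]
    ring
  rw [← h1, ← h2, ← mul_pow, ← sq_abs]
  gcongr
  exact abs_real_inner_le_norm _ _

theorem compressionFactor_mul_norm_le {e n u : E d} (he : ‖e‖ = 1) (hn : ‖n‖ = 1)
    (hu : ⟪n, u⟫ = 0) {s : ℝ} (hs0 : 0 ≤ s) (hs : s ≤ 1) :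
    compressionFactor e n s * ‖u‖ ≤ ‖compression e s u‖ := by
  apply le_of_sq_le_sq _ (norm_nonneg _)
  rw [mul_pow, compressionFactor, Real.sq_sqrt (compressionFactor_arg_nonneg he hn s),
    norm_sq_compression he]
  have := inner_sq_le_of_orthogonal he hn hu
  have h2 : 0 ≤ 1 - s ^ 2 := by nlinarith
  nlinarith [mul_le_mul_of_nonneg_left this h2]

/-- With $a$ the projection of $e$ to $n^\perp$, one has $f^*f=1-(1-s^2)\,a\otimes a$, whose
determinant is $1-(1-s^2)|a|^2$ with $|a|^2=1-\langle e,n\rangle^2$. -/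
theorem normDet_compression {e n : E d} (he : ‖e‖ = 1) (hn : ‖n‖ = 1) (s : ℝ) :
    ((compression e s).toLinearMap ∘ₗ (ℝ ∙ n)ᗮ.subtype).normDet = compressionFactor e n s := by
  set f := (compression e s).toLinearMap ∘ₗ (ℝ ∙ n)ᗮ.subtype with hf
  have hnn : ⟪n, n⟫ = 1 := by rw [real_inner_self_eq_norm_sq, hn]; norm_num
  have hee : ⟪e, e⟫ = 1 := by rw [real_inner_self_eq_norm_sq, he]; norm_num
  let a : (ℝ ∙ n)ᗮ := ⟨e - ⟪e, n⟫ • n, by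
    rw [Submodule.mem_orthogonal_singleton_iff_inner_right]
    simp [inner_sub_right, inner_smul_right, hn, real_inner_comm]⟩
  have horth : ∀ u : (ℝ ∙ n)ᗮ, ⟪n, (u : E d)⟫ = 0 := fun u =>
    Submodule.mem_orthogonal_singleton_iff_inner_right.1 u.2
  have ha : ∀ u : (ℝ ∙ n)ᗮ, ⟪a, u⟫ = ⟪e, (u : E d)⟫ := by
    intro u
    simp [a, Submodule.coe_inner, inner_sub_left, inner_smul_left, horth u]
  have haa : ⟪a, a⟫ = 1 - ⟪e, n⟫ ^ 2 := by
    rw [ha]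
    simp [a, inner_sub_right, inner_smul_right, he]; ring
  have htr : f.adjoint ∘ₗ f =
      LinearMap.transvection (-(1 - s ^ 2) • (innerSL ℝ a).toLinearMap) a := by
    ext1 u
    refine ext_inner_right ℝ fun w => ?_
    rw [LinearMap.comp_apply, LinearMap.adjoint_inner_left]
    simp only [hf, LinearMap.comp_apply, ContinuousLinearMap.coe_coe, Submodule.subtype_apply]
    rw [inner_compression he]
    simp only [LinearMap.transvection.apply, LinearMap.smul_apply, ContinuousLinearMap.coe_coe,
      innerSL_apply_apply, inner_add_left, inner_smul_left, ha, conj_trivial, smul_eq_mul,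
      Submodule.coe_inner]
    ring
  have hsq : f.normDet ^ 2 = 1 - (1 - s ^ 2) * (1 - ⟪e, n⟫ ^ 2) := by
    have h1 := f.normDet_sq
    rw [htr, LinearMap.transvection.det] at h1
    have h2 : (-(1 - s ^ 2) • (innerSL ℝ a).toLinearMap) a = -(1 - s ^ 2) * ⟪a, a⟫ := by
      simp
    rw [h2, haa] at h1
    have h3 : f.normDet ^ 2 = 1 + -(1 - s ^ 2) * (1 - ⟪e, n⟫ ^ 2) := by exact_mod_cast h1
    rw [h3]; ring
  rw [compressionFactor, ← hsq, Real.sqrt_sq f.normDet_nonneg]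

theorem inner_proj_eq_zero {n : E d} (hn : ‖n‖ = 1) (x : E d) : ⟪n, compression n 0 x⟫ = 0 := by
  rw [compression_apply]
  simp [inner_sub_right, inner_smul_right, hn]

/-- The orthogonal projection onto the hyperplane `nᗮ`. -/
def hyperplaneProj (n : E d) (hn : ‖n‖ = 1) (x : E d) : (ℝ ∙ n)ᗮ :=
  ⟨compression n 0 x,
    Submodule.mem_orthogonal_singleton_iff_inner_right.2 (inner_proj_eq_zero hn x)⟩

theorem finrank_hyperplane {n : E d} (hn : ‖n‖ = 1) :
    Module.finrank ℝ (ℝ ∙ n)ᗮ = d - 1 := by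
  have hn0 : n ≠ 0 := by rintro rfl; simp at hn
  have hd : 0 < d := by
    rcases Nat.eq_zero_or_pos d with rfl | h
    · exact absurd (Subsingleton.elim n 0) hn0
    · exact h
  have : Fact (Module.finrank ℝ (E d) = (d - 1) + 1) := ⟨by simp; omega⟩
  exact Submodule.finrank_orthogonal_span_singleton hn0

theorem measure_proj_image {n : E d} (hn : ‖n‖ = 1) (A : Set (E d)) :
    (μHE[d - 1] : Measure (E d)) ((fun x => compression n 0 x) '' A) =
      (μHE[d - 1] : Measure (ℝ ∙ n)ᗮ) (hyperplaneProj n hn '' A) := by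
  have h1 : (fun x => compression n 0 x) '' A =
      (Subtype.val : (ℝ ∙ n)ᗮ → E d) '' (hyperplaneProj n hn '' A) := by
    rw [image_image]; rfl
  rw [h1]
  exact isometry_subtype_coe.euclideanHausdorffMeasure_image _

/-- The image of a set under the orthogonal projection onto `nᗮ` and the compression. -/
theorem measure_compression_image_proj {e n : E d} (he : ‖e‖ = 1) (hn : ‖n‖ = 1) (s : ℝ)
    (A : Set (E d)) :
    (μHE[d - 1] : Measure (E d)) ((fun x => compression e s (compression n 0 x)) '' A) =
      ENNReal.ofReal (compressionFactor e n s) *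
        (μHE[d - 1] : Measure (E d)) ((fun x => compression n 0 x) '' A) := by
  have h2 : (fun x => compression e s (compression n 0 x)) '' A =
      ((compression e s).toLinearMap ∘ₗ (ℝ ∙ n)ᗮ.subtype) '' (hyperplaneProj n hn '' A) := by
    rw [image_image]; rfl
  have h3 := LinearMap.euclideanHausdorffMeasure_image
    ((compression e s).toLinearMap ∘ₗ (ℝ ∙ n)ᗮ.subtype) (hyperplaneProj n hn '' A)
  rw [finrank_hyperplane hn, normDet_compression he hn] at h3
  rw [measure_proj_image hn, h2, h3]

/-! ### Local comparison for sets which are flat near a point -/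

/-- `S` is flat at `x₀` with normal `n`: it is close to the hyperplane `nᗮ` near `x₀`. -/
def IsFlatAt (S : Set (E d)) (x₀ n : E d) : Prop :=
  ∀ ε : ℝ, 0 < ε → ∃ U ∈ 𝓝 x₀, ∀ x ∈ S ∩ U, ∀ y ∈ S ∩ U, |⟪n, x - y⟫| ≤ ε * ‖x - y‖

theorem norm_proj_ge {n z : E d} (hn : ‖n‖ = 1) {ε : ℝ} (hε0 : 0 ≤ ε) (hε : ε ≤ 1)
    (h : |⟪n, z⟫| ≤ ε * ‖z‖) : (1 - ε) * ‖z‖ ≤ ‖compression n 0 z‖ := by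
  apply le_of_sq_le_sq _ (norm_nonneg _)
  rw [norm_sq_compression hn]
  have h1 : ⟪n, z⟫ ^ 2 ≤ (ε * ‖z‖) ^ 2 := by
    rw [← sq_abs]; gcongr
  have h2 : (1 - ε) ^ 2 ≤ 1 - ε ^ 2 := by nlinarith
  nlinarith [mul_le_mul_of_nonneg_right h2 (sq_nonneg ‖z‖)]

/-- The vector $z$ and its projection differ by at most $\varepsilon\|z\|$, and compression does not
increase lengths, while the compressed projection has length at least $J(1-\varepsilon)\|z\|$. The
relative error is therefore small as long as $J>0$. -/
theorem compression_sub_proj_le {e n z : E d} (he : ‖e‖ = 1) (hn : ‖n‖ = 1) {s : ℝ}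
    (hs0 : 0 ≤ s) (hs : s ≤ 1) (hJ : 0 < compressionFactor e n s) {ε : ℝ} (hε0 : 0 ≤ ε)
    (hε : ε < 1) (h : |⟪n, z⟫| ≤ ε * ‖z‖) :
    |‖compression e s z‖ - ‖compression e s (compression n 0 z)‖| ≤
      ε / ((1 - ε) * compressionFactor e n s) * ‖compression e s (compression n 0 z)‖ := by
  set J := compressionFactor e n s
  have hnn : ⟪n, n⟫ = 1 := by rw [real_inner_self_eq_norm_sq, hn]; norm_num
  have h1 : ‖compression e s z - compression e s (compression n 0 z)‖ ≤ ε * ‖z‖ := by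
    rw [← map_sub]
    refine (norm_compression_le he hs0 hs _).trans ?_
    have : z - compression n 0 z = ⟪n, z⟫ • n := by rw [compression_apply]; simp
    rw [this, norm_smul, hn, mul_one]
    exact h
  have horth := inner_proj_eq_zero hn z
  have h2 := compressionFactor_mul_norm_le he hn horth hs0 hs
  have h3 := norm_proj_ge hn hε0 hε.le h
  refine (abs_norm_sub_norm_le _ _).trans (h1.trans ?_)
  rw [div_mul_eq_mul_div, le_div_iff₀ (mul_pos (by linarith) hJ)]
  calc ε * ‖z‖ * ((1 - ε) * J) = ε * (J * ((1 - ε) * ‖z‖)) := by ring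
    _ ≤ ε * (J * ‖compression n 0 z‖) := by gcongr
    _ ≤ _ := by gcongr

/-- The measure of the compression of a set which is flat near a point. -/
theorem IsFlatAt.measure_compression {S : Set (E d)} {x₀ n e : E d} (hS : IsFlatAt S x₀ n)
    (he : ‖e‖ = 1) (hn : ‖n‖ = 1) {s : ℝ} (hs0 : 0 ≤ s) (hs : s ≤ 1)
    (hJ : 0 < compressionFactor e n s) {η : ℝ} (hη : 0 < η) :
    ∃ U ∈ 𝓝 x₀, ∀ A ⊆ S ∩ U,
      (μHE[d - 1] : Measure (E d)) (compression e s '' A) ≤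
        ENNReal.ofReal ((1 + η) * compressionFactor e n s) * (μHE[d - 1] : Measure (E d)) A ∧
      ENNReal.ofReal (compressionFactor e n s) * (μHE[d - 1] : Measure (E d)) A ≤
        ENNReal.ofReal (1 + η) * (μHE[d - 1] : Measure (E d)) (compression e s '' A) := by
  set J := compressionFactor e n s with hJdef
  set k := d - 1
  -- Flatness at level $\varepsilon$ lets the set be replaced by its projection to the tangent
  -- hyperplane, where the area factor is exactly $J$. The two distortion factors tend to $1$ as
  -- $\varepsilon\to0$.
  have hlim : ∀ᶠ ε in 𝓝[>] (0 : ℝ), ε < 1 ∧ ε / ((1 - ε) * J) < 1 ∧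
      (1 + ε / ((1 - ε) * J)) ^ k ≤ 1 + η ∧
      ((1 - ε)⁻¹ * (1 - ε / ((1 - ε) * J))⁻¹) ^ k ≤ 1 + η := by
    have hc : ContinuousAt (fun ε : ℝ => ε / ((1 - ε) * J)) 0 :=
      ContinuousAt.div (by fun_prop) (by fun_prop) (by simp [hJ.ne'])
    have c1 : ContinuousAt (fun ε : ℝ => (1 + ε / ((1 - ε) * J)) ^ k) 0 :=
      (continuousAt_const.add hc).pow k
    have c2 : ContinuousAt (fun ε : ℝ => ((1 - ε)⁻¹ * (1 - ε / ((1 - ε) * J))⁻¹) ^ k) 0 :=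
      ((ContinuousAt.inv₀ (by fun_prop) (by simp)).mul
        ((continuousAt_const.sub hc).inv₀ (by simp))).pow k
    apply Filter.Eventually.filter_mono nhdsWithin_le_nhds
    have e1 : ∀ᶠ ε in 𝓝 (0:ℝ), ε < 1 := eventually_lt_nhds one_pos
    have e2 := hc.eventually (p := fun y => y < 1) (eventually_lt_nhds (by simp))
    have e3 := c1.eventually (p := fun y => y ≤ 1 + η) (eventually_le_nhds (by simp [hη]))
    have e4 := c2.eventually (p := fun y => y ≤ 1 + η) (eventually_le_nhds (by simp [hη]))
    filter_upwards [e1, e2, e3, e4] with ε a b c f using ⟨a, b, c, f⟩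
  obtain ⟨ε, ⟨hε1, hθ1, hup, hlow⟩, hε0⟩ := (hlim.and self_mem_nhdsWithin).exists
  have hε0 : 0 < ε := hε0
  set θ := ε / ((1 - ε) * J) with hθ
  have h1ε : 0 < 1 - ε := by linarith
  have hθ0 : 0 ≤ θ := by positivity
  obtain ⟨U, hU, hflat⟩ := hS ε hε0
  refine ⟨U, hU, fun A hA => ?_⟩
  have hcmp : ∀ x ∈ A, ∀ y ∈ A,
      |dist (compression e s x) (compression e s y) -
        dist (compression e s (compression n 0 x)) (compression e s (compression n 0 y))| ≤
      θ * dist (compression e s (compression n 0 x)) (compression e s (compression n 0 y)) := by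
    intro x hx y hy
    simp only [dist_eq_norm, ← map_sub]
    exact compression_sub_proj_le he hn hs0 hs hJ hε0.le hε1 (hflat x (hA hx) y (hA hy))
  have hproj : ∀ x ∈ A, ∀ y ∈ A, (1 - ε) * dist x y ≤
      dist (compression n 0 x) (compression n 0 y) := by
    intro x hx y hy
    simp only [dist_eq_norm, ← map_sub]
    exact norm_proj_ge hn hε0.le hε1.le (hflat x (hA hx) y (hA hy))
  have hprojle : ∀ x y : E d, dist (compression n 0 x) (compression n 0 y) ≤ dist x y := by
    intro x y
    simp only [dist_eq_norm, ← map_sub]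
    exact norm_compression_le hn le_rfl zero_le_one _
  have hJm := measure_compression_image_proj he hn s A
  constructor
  · have a1 := euclideanHausdorffMeasure_image_le_of_dist_le k (1 + θ).toNNReal (compression e s)
      (fun x => compression e s (compression n 0 x)) A (by
        intro x hx y hy
        rw [Real.coe_toNNReal _ (by linarith)]
        have := (abs_le.1 (hcmp x hx y hy)).2
        linarith)
    have a2 := euclideanHausdorffMeasure_image_le_of_dist_le k 1 (fun x => compression n 0 x)
      (id : E d → E d) A (by intro x _ y _; simpa using hprojle x y)
    rw [image_id, ENNReal.coe_one, one_pow, one_mul] at a2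
    rw [hJm] at a1
    refine a1.trans ?_
    rw [← mul_assoc]
    refine mul_le_mul' ?_ a2
    rw [ENNReal.ofReal_mul (by linarith)]
    refine mul_le_mul_left ?_ _
    change ENNReal.ofReal (1 + θ) ^ k ≤ _
    rw [← ENNReal.ofReal_pow (by linarith)]
    exact ENNReal.ofReal_le_ofReal hup
  · have a1 := euclideanHausdorffMeasure_image_le_of_dist_le k ((1 - θ)⁻¹).toNNReal
      (fun x => compression e s (compression n 0 x)) (compression e s) A (by
        intro x hx y hy
        rw [Real.coe_toNNReal _ (inv_nonneg.2 (by linarith)), inv_mul_eq_div,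
          le_div_iff₀ (by linarith)]
        have := (abs_le.1 (hcmp x hx y hy)).1
        linarith)
    have a2 := euclideanHausdorffMeasure_image_le_of_dist_le k ((1 - ε)⁻¹).toNNReal
      (id : E d → E d) (fun x => compression n 0 x) A (by
        intro x hx y hy
        rw [Real.coe_toNNReal _ (inv_nonneg.2 (by linarith)), inv_mul_eq_div,
          le_div_iff₀ (by linarith), mul_comm]
        exact hproj x hx y hy)
    rw [image_id] at a2
    rw [hJm] at a1
    calc ENNReal.ofReal J * μHE[k] A
        ≤ ENNReal.ofReal J * (ENNReal.ofReal ((1 - ε)⁻¹) ^ k *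
            μHE[k] ((fun x => compression n 0 x) '' A)) := by gcongr; exact a2
      _ = ENNReal.ofReal ((1 - ε)⁻¹) ^ k * (ENNReal.ofReal J *
            μHE[k] ((fun x => compression n 0 x) '' A)) := by ring
      _ ≤ ENNReal.ofReal ((1 - ε)⁻¹) ^ k * (ENNReal.ofReal ((1 - θ)⁻¹) ^ k *
            μHE[k] (compression e s '' A)) := mul_le_mul_right a1 _
      _ = ENNReal.ofReal (((1 - ε)⁻¹ * (1 - θ)⁻¹) ^ k) * μHE[k] (compression e s '' A) := by
          rw [← mul_assoc, ← mul_pow, ← ENNReal.ofReal_mul (inv_nonneg.2 h1ε.le),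
            ENNReal.ofReal_pow]
          exact mul_nonneg (inv_nonneg.2 h1ε.le) (inv_nonneg.2 (by linarith))
      _ ≤ _ := by gcongr

/-- Flat sets have locally finite measure. -/
theorem IsFlatAt.exists_measure_lt_top {S : Set (E d)} {x₀ n : E d} (hS : IsFlatAt S x₀ n)
    (hn : ‖n‖ = 1) : ∃ U ∈ 𝓝 x₀, (μHE[d - 1] : Measure (E d)) (S ∩ U) < ∞ := by
  obtain ⟨U, hU, hflat⟩ := hS (1 / 2) (by norm_num)
  refine ⟨U ∩ Metric.ball x₀ 1, inter_mem hU (Metric.ball_mem_nhds _ one_pos), ?_⟩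
  set A := S ∩ (U ∩ Metric.ball x₀ 1)
  have a2 := euclideanHausdorffMeasure_image_le_of_dist_le (d - 1) 2
      (id : E d → E d) (fun x => compression n 0 x) A (by
        intro x hx y hy
        have := norm_proj_ge (z := x - y) hn (ε := 1/2) (by norm_num) (by norm_num)
          (hflat x ⟨hx.1, hx.2.1⟩ y ⟨hy.1, hy.2.1⟩)
        simp only [dist_eq_norm, ← map_sub, id]
        push_cast
        linarith)
  rw [image_id] at a2
  refine a2.trans_lt (ENNReal.mul_lt_top (by simp) ?_)
  rw [measure_proj_image hn, ← finrank_hyperplane hn,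
    InnerProductSpace.euclideanHausdorffMeasure_eq_volume]
  refine (Bornology.IsBounded.subset
    (Metric.isBounded_ball (x := hyperplaneProj n hn x₀) (r := 1)) ?_).measure_lt_top
  rintro _ ⟨x, hx, rfl⟩
  rw [Metric.mem_ball, Subtype.dist_eq]
  simp only [hyperplaneProj, dist_eq_norm, ← map_sub]
  refine (norm_compression_le hn le_rfl zero_le_one _).trans_lt ?_
  rw [← dist_eq_norm]; exact hx.2.2

end

section

variable {d : ℕ} {Ω : Set (E d)} {x : E d} {ρ : E d → ℝ}

/-! ### Defining functions and the outward normal -/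

theorem fderiv_eq_inner_gradient (ρ : E d → ℝ) (x v : E d) :
    fderiv ℝ ρ x v = ⟪gradient ρ x, v⟫ := by
  simp [gradient]

theorem frontier_subset_compl (hΩ : IsOpen Ω) (hx : x ∈ frontier Ω) : x ∉ Ω := by
  rw [hΩ.frontier_eq] at hx
  exact hx.2

namespace IsDefiningFunctionAt

theorem eventually (h : IsDefiningFunctionAt Ω x ρ) :
    ContinuousAt (gradient ρ) x ∧ ∀ᶠ y in 𝓝 x, IsDefiningFunctionAt Ω y ρ := by
  obtain ⟨h1, h2, h3⟩ := h
  have hc : ContinuousAt (gradient ρ) x := by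
    have : ContinuousAt (fderiv ℝ ρ) x :=
      (h1.fderiv_right (m := 0) (by norm_num)).continuousAt
    exact (InnerProductSpace.toDual ℝ (E d)).symm.continuous.continuousAt.comp this
  refine ⟨hc, ?_⟩
  filter_upwards [h1.eventually (by simp), hc.eventually_ne h2, h3.eventually_nhds]
    with y a b c using ⟨a, b, c⟩

theorem eq_zero (hΩ : IsOpen Ω) (hx : x ∈ frontier Ω) (h : IsDefiningFunctionAt Ω x ρ) :
    ρ x = 0 := by
  obtain ⟨h1, h2, h3⟩ := h
  have ha : ¬ ρ x < 0 := fun hlt => frontier_subset_compl hΩ hx (h3.self_of_nhds.2 hlt)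
  refine le_antisymm ?_ (not_lt.1 ha)
  by_contra hpos
  have hev := h1.continuousAt.eventually (lt_mem_nhds (not_le.1 hpos))
  have hfr : ∃ᶠ y in 𝓝 x, y ∈ Ω := mem_closure_iff_frequently.1 (frontier_subset_closure hx)
  obtain ⟨y, hy, hy1, hy2⟩ := (hfr.and_eventually (hev.and h3)).exists
  exact absurd (hy2.1 hy) (not_lt.2 (le_of_lt hy1))

theorem eventually_sign (hΩ : IsOpen Ω) (hx : x ∈ frontier Ω) (h : IsDefiningFunctionAt Ω x ρ)
    {v : E d} (hv : 0 < ⟪gradient ρ x, v⟫) :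
    ∀ᶠ t in 𝓝 (0 : ℝ), SignType.sign (ρ (x + t • v)) = SignType.sign t := by
  have hd : HasFDerivAt ρ (fderiv ℝ ρ x) (x + (0 : ℝ) • v) := by
    simpa using (h.1.differentiableAt (by norm_num)).hasFDerivAt
  have hline : HasDerivAt (fun t : ℝ => x + t • v) v 0 := by
    simpa using ((hasDerivAt_id (0 : ℝ)).smul_const v).const_add x
  have := hd.comp_hasDerivAt (0 : ℝ) hline
  have hder : deriv (ρ ∘ fun t : ℝ => x + t • v) 0 > 0 := by
    rw [this.deriv, fderiv_eq_inner_gradient]; exact hv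
  have h0 : (ρ ∘ fun t : ℝ => x + t • v) 0 = 0 := by
    simpa using h.eq_zero hΩ hx
  simpa using eventually_nhdsWithin_sign_eq_of_deriv_pos hder h0

theorem eventually_mem_iff (h : IsDefiningFunctionAt Ω x ρ) (v : E d) :
    ∀ᶠ t in 𝓝 (0 : ℝ), (x + t • v ∈ Ω ↔ ρ (x + t • v) < 0) := by
  have : Tendsto (fun t : ℝ => x + t • v) (𝓝 0) (𝓝 x) := by
    have : Continuous (fun t : ℝ => x + t • v) := by fun_prop
    simpa using this.tendsto 0
  exact this.eventually h.2.2

theorem eventually_mem_iff_neg (hΩ : IsOpen Ω) (hx : x ∈ frontier Ω)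
    (h : IsDefiningFunctionAt Ω x ρ) {v : E d} (hv : 0 < ⟪gradient ρ x, v⟫) :
    ∀ᶠ t in 𝓝 (0 : ℝ), (x + t • v ∈ Ω ↔ t < 0) := by
  filter_upwards [h.eventually_sign hΩ hx hv, h.eventually_mem_iff v] with t h1 h2
  rw [h2, ← sign_eq_neg_one_iff, h1, sign_eq_neg_one_iff]

/-- If the unit gradients $u\ne u'$ differed, the direction $u-u'$ would point outwards according to
$\rho$ and inwards according to $\rho'$, so the same points near $x$ would both belong and not
belong to $\Omega$. -/
theorem normalized_gradient_eq (hΩ : IsOpen Ω) (hx : x ∈ frontier Ω) {ρ' : E d → ℝ}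
    (h : IsDefiningFunctionAt Ω x ρ) (h' : IsDefiningFunctionAt Ω x ρ') :
    ‖gradient ρ x‖⁻¹ • gradient ρ x = ‖gradient ρ' x‖⁻¹ • gradient ρ' x := by
  set g := gradient ρ x
  set g' := gradient ρ' x
  have hg : 0 < ‖g‖ := norm_pos_iff.2 h.2.1
  have hg' : 0 < ‖g'‖ := norm_pos_iff.2 h'.2.1
  set u := ‖g‖⁻¹ • g with hu
  set u' := ‖g'‖⁻¹ • g' with hu'
  have hnu : ‖u‖ = 1 := by rw [hu, norm_smul, norm_inv, norm_norm, inv_mul_cancel₀ hg.ne']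
  have hnu' : ‖u'‖ = 1 := by rw [hu', norm_smul, norm_inv, norm_norm, inv_mul_cancel₀ hg'.ne']
  by_contra hne
  have hlt : ⟪u, u'⟫ < 1 := (inner_lt_one_iff_real_of_norm_eq_one hnu hnu').2 hne
  have e1 : ⟪g, u - u'⟫ = ‖g‖ * (1 - ⟪u, u'⟫) := by
    have : g = ‖g‖ • u := by rw [hu, smul_smul, mul_inv_cancel₀ hg.ne', one_smul]
    have huu : ⟪u, u⟫ = 1 := by rw [real_inner_self_eq_norm_sq, hnu]; norm_num
    conv_lhs => rw [this]
    rw [inner_smul_left, inner_sub_right, huu]; simp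
  have e2 : ⟪g', u' - u⟫ = ‖g'‖ * (1 - ⟪u, u'⟫) := by
    have : g' = ‖g'‖ • u' := by rw [hu', smul_smul, mul_inv_cancel₀ hg'.ne', one_smul]
    have huu : ⟪u', u'⟫ = 1 := by rw [real_inner_self_eq_norm_sq, hnu']; norm_num
    conv_lhs => rw [this]
    rw [inner_smul_left, inner_sub_right, huu, real_inner_comm u u']; simp
  have p1 : 0 < ⟪g, u - u'⟫ := by rw [e1]; exact mul_pos hg (by linarith)
  have p2 : 0 < ⟪g', u' - u⟫ := by rw [e2]; exact mul_pos hg' (by linarith)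
  have hneg : Tendsto (fun t : ℝ => -t) (𝓝 0) (𝓝 0) := by
    simpa using (continuous_neg (G := ℝ)).tendsto 0
  have E1 := h.eventually_mem_iff_neg hΩ hx p1
  have E2 := hneg.eventually (h'.eventually_mem_iff_neg hΩ hx p2)
  obtain ⟨t, ⟨ht1, ht2⟩, ht⟩ :=
    (((E1.and E2).filter_mono nhdsWithin_le_nhds).and
      (self_mem_nhdsWithin : Iio (0 : ℝ) ∈ 𝓝[<] 0)).exists
  have ht' : t < 0 := ht
  have hsame : x + (-t) • (u' - u) = x + t • (u - u') := by module
  rw [hsame] at ht2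
  have := ht2.1 (ht1.2 ht')
  linarith

theorem outerNormal_eq (hΩ : IsOpen Ω) (hx : x ∈ frontier Ω) (h : IsDefiningFunctionAt Ω x ρ) :
    outerNormal Ω x = ‖gradient ρ x‖⁻¹ • gradient ρ x := by
  have hex : x ∈ frontier Ω ∧ ∃ ρ : E d → ℝ, IsDefiningFunctionAt Ω x ρ := ⟨hx, ρ, h⟩
  rw [outerNormal, dif_pos hex]
  exact normalized_gradient_eq hΩ hx hex.2.choose_spec h

end IsDefiningFunctionAt

theorem outerNormal_of_notMem (hx : x ∉ frontier Ω) : outerNormal Ω x = 0 := by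
  rw [outerNormal, dif_neg fun h => hx h.1]

namespace HasC1Boundary

theorem norm_outerNormal (hb : HasC1Boundary Ω) (hΩ : IsOpen Ω) (hx : x ∈ frontier Ω) :
    ‖outerNormal Ω x‖ = 1 := by
  obtain ⟨ρ, h⟩ := hb x hx
  rw [h.outerNormal_eq hΩ hx, norm_smul, norm_inv, norm_norm,
    inv_mul_cancel₀ (norm_ne_zero_iff.2 h.2.1)]

/-- Since the normal does not depend on the defining function, a single one computes it at all
boundary points nearby. -/
theorem continuousOn_outerNormal (hb : HasC1Boundary Ω) (hΩ : IsOpen Ω) :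
    ContinuousOn (outerNormal Ω) (frontier Ω) := by
  intro x hx
  obtain ⟨ρ, h⟩ := hb x hx
  obtain ⟨hc, hev⟩ := h.eventually
  have h1 : ContinuousAt (fun y => ‖gradient ρ y‖⁻¹ • gradient ρ y) x :=
    (hc.norm.inv₀ (norm_ne_zero_iff.2 h.2.1)).smul hc
  refine h1.continuousWithinAt.congr_of_eventuallyEq ?_ (h.outerNormal_eq hΩ hx)
  filter_upwards [hev.filter_mono nhdsWithin_le_nhds, self_mem_nhdsWithin] with y hy hyf
  exact hy.outerNormal_eq hΩ hyf

theorem measurable_outerNormal (hb : HasC1Boundary Ω) (hΩ : IsOpen Ω) :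
    Measurable (outerNormal Ω) := by
  classical
  have h1 : (frontier Ω).piecewise (outerNormal Ω) (fun _ => 0) = outerNormal Ω := by
    funext y
    by_cases hy : y ∈ frontier Ω
    · simp [hy]
    · simp [hy, outerNormal_of_notMem hy]
  rw [← h1]
  exact (hb.continuousOn_outerNormal hΩ).measurable_piecewise continuousOn_const
    isClosed_frontier.measurableSet

/-- Along a direction which is not tangent, the boundary is crossed. -/
theorem eventually_mem_iff_neg (hb : HasC1Boundary Ω) (hΩ : IsOpen Ω)
    (hx : x ∈ frontier Ω) {v : E d} (hv : 0 < ⟪v, outerNormal Ω x⟫) :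
    ∀ᶠ t in 𝓝 (0 : ℝ), (x + t • v ∈ Ω ↔ t < 0) := by
  obtain ⟨ρ, h⟩ := hb x hx
  refine h.eventually_mem_iff_neg hΩ hx ?_
  rw [h.outerNormal_eq hΩ hx, inner_smul_right, real_inner_comm] at hv
  exact pos_of_mul_pos_right hv (inv_nonneg.2 (norm_nonneg _))

/-- Strict differentiability: a defining function vanishes at both boundary points, so its
differential at $x$ applied to their difference is small compared with their distance. -/
theorem isFlatAt (hb : HasC1Boundary Ω) (hΩ : IsOpen Ω) (hx : x ∈ frontier Ω) :
    IsFlatAt (frontier Ω) x (outerNormal Ω x) := by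
  obtain ⟨ρ, h⟩ := hb x hx
  intro ε hε
  have hg : 0 < ‖gradient ρ x‖ := norm_pos_iff.2 h.2.1
  have hs : HasStrictFDerivAt ρ (fderiv ℝ ρ x) x := h.1.hasStrictFDerivAt (by norm_num)
  have hb1 := hs.isLittleO.def (mul_pos hε hg)
  rw [nhds_prod_eq] at hb1
  obtain ⟨U, hU, hUs⟩ := (Filter.eventually_prod_self_iff').1 hb1
  obtain ⟨-, hev⟩ := h.eventually
  refine ⟨U ∩ {y | IsDefiningFunctionAt Ω y ρ}, inter_mem hU hev, ?_⟩
  rintro y ⟨hy, hyU, hyd⟩ z ⟨hz, hzU, hzd⟩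
  have := hUs y hyU z hzU
  simp only [IsDefiningFunctionAt.eq_zero hΩ hy hyd, IsDefiningFunctionAt.eq_zero hΩ hz hzd,
    sub_zero, zero_sub, norm_neg, fderiv_eq_inner_gradient, Real.norm_eq_abs] at this
  rw [h.outerNormal_eq hΩ hx, inner_smul_left, abs_mul]
  simp only [conj_trivial, abs_inv, abs_norm]
  rw [inv_mul_le_iff₀ hg]
  linarith

theorem measure_frontier_lt_top (hb : HasC1Boundary Ω) (hΩ : IsOpen Ω)
    (hbd : Bornology.IsBounded Ω) :
    (μHE[d - 1] : Measure (E d)) (frontier Ω) < ∞ := by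
  have hK : IsCompact (frontier Ω) :=
    Metric.isCompact_of_isClosed_isBounded isClosed_frontier
      (hbd.closure.subset frontier_subset_closure)
  refine hK.measure_lt_top_of_nhdsWithin fun x hx => ?_
  obtain ⟨U, hU, hlt⟩ := (hb.isFlatAt hΩ hx).exists_measure_lt_top (hb.norm_outerNormal hΩ hx)
  exact ⟨frontier Ω ∩ U, inter_mem self_mem_nhdsWithin (mem_nhdsWithin_of_mem_nhds hU), hlt⟩

end HasC1Boundary

end

section

variable {d : ℕ} {Ω : Set (E d)} {x v : E d}

/-! ### Rays and travel times -/

theorem tauMinus_nonneg (Ω : Set (E d)) (p : E d × E d) : 0 ≤ tauMinus Ω p :=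
  Real.sInf_nonneg fun _ hs => hs.1.le

theorem tauMinus_eq_of_exit {T : ℝ} (hT : 0 < T) (hout : x - T • v ∉ Ω)
    (hin : ∀ t ∈ Ioo 0 T, x - t • v ∈ Ω) : tauMinus Ω (x, v) = T := by
  refine IsLeast.csInf_eq ⟨⟨hT, hout⟩, ?_⟩
  rintro s ⟨hs, hsout⟩
  by_contra hlt
  exact hsout (hin s ⟨hs, not_le.1 hlt⟩)

theorem exists_exit (hbd : Bornology.IsBounded Ω) (hv : v ≠ 0) (x : E d) :
    ∃ s : ℝ, 0 < s ∧ x - s • v ∉ Ω := by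
  obtain ⟨R, hR⟩ := hbd.exists_norm_le
  have hv' : 0 < ‖v‖ := norm_pos_iff.2 hv
  have hR' : 0 < |R| + ‖x‖ + 1 := by positivity
  refine ⟨(|R| + ‖x‖ + 1) / ‖v‖, by positivity, fun hmem => ?_⟩
  have h1 := hR _ hmem
  have h2 : ‖((|R| + ‖x‖ + 1) / ‖v‖) • v‖ = |R| + ‖x‖ + 1 := by
    rw [norm_smul, Real.norm_of_nonneg (by positivity), div_mul_cancel₀ _ hv'.ne']
  have h3 := norm_sub_norm_le (((|R| + ‖x‖ + 1) / ‖v‖) • v) x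
  rw [norm_sub_rev, h2] at h3
  have := le_abs_self R
  linarith

/-- A ray which starts inside `Ω` leaves it through the boundary. -/
theorem exit_point (hΩ : IsOpen Ω) (hbd : Bornology.IsBounded Ω) (hv : v ≠ 0)
    (hin : ∀ᶠ t in 𝓝[>] (0 : ℝ), x - t • v ∈ Ω) :
    0 < tauMinus Ω (x, v) ∧ x - tauMinus Ω (x, v) • v ∈ frontier Ω ∧
      ∀ t ∈ Ioo 0 (tauMinus Ω (x, v)), x - t • v ∈ Ω := by
  set T := tauMinus Ω (x, v) with hT
  set Z := {s : ℝ | 0 < s ∧ x - s • v ∉ Ω} with hZ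
  have hTZ : T = sInf Z := rfl
  have hne : Z.Nonempty := exists_exit hbd hv x
  have hbelow : BddBelow Z := ⟨0, fun s hs => hs.1.le⟩
  have hcont : Continuous fun t : ℝ => x - t • v := by fun_prop
  have hlt : ∀ t ∈ Ioo 0 T, x - t • v ∈ Ω := by
    intro t ht
    by_contra hout
    exact absurd (csInf_le hbelow ⟨ht.1, hout⟩) (not_le.2 (hTZ ▸ ht.2))
  obtain ⟨δ, hδ, hδin⟩ := mem_nhdsGT_iff_exists_Ioo_subset.1 hin
  have hδ : 0 < δ := hδ
  have hpos : 0 < T := by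
    refine hδ.trans_le (le_csInf hne ?_)
    rintro s ⟨hs, hsout⟩
    by_contra hlt
    exact hsout (hδin ⟨hs, not_le.1 hlt⟩)
  have hout : x - T • v ∉ Ω := by
    intro hmem
    have hev : ∀ᶠ t in 𝓝 T, x - t • v ∈ Ω := hcont.continuousAt.eventually (hΩ.mem_nhds hmem)
    obtain ⟨r, hr, hball⟩ := Metric.eventually_nhds_iff.1 hev
    have hlow : T + r ≤ sInf Z := by
      refine le_csInf hne ?_
      rintro s ⟨hs, hsout⟩
      by_contra hlt'
      push Not at hlt'
      rcases lt_or_ge s T with h | h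
      · exact hsout (hlt s ⟨hs, h⟩)
      · refine hsout (hball ?_)
        rw [Real.dist_eq, abs_of_nonneg (by linarith)]; linarith
    rw [← hTZ] at hlow
    linarith
  refine ⟨hpos, ?_, hlt⟩
  rw [hΩ.frontier_eq]
  refine ⟨?_, hout⟩
  have htend : Tendsto (fun t : ℝ => x - t • v) (𝓝[<] T) (𝓝 (x - T • v)) :=
    (hcont.tendsto T).mono_left nhdsWithin_le_nhds
  refine mem_closure_of_tendsto htend ?_
  filter_upwards [Ioo_mem_nhdsLT hpos] with t ht using hlt t ht

theorem mem_closure_of_ray (hin : ∀ᶠ t in 𝓝[>] (0 : ℝ), x - t • v ∈ Ω) : x ∈ closure Ω := by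
  have htend : Tendsto (fun t : ℝ => x - t • v) (𝓝[>] 0) (𝓝 x) := by
    have hcont : Continuous fun t : ℝ => x - t • v := by fun_prop
    have := hcont.tendsto 0
    simp only [zero_smul, sub_zero] at this
    exact this.mono_left nhdsWithin_le_nhds
  exact mem_closure_of_tendsto htend hin

theorem tauMinus_mul_norm_le (hΩ : IsOpen Ω) (hbd : Bornology.IsBounded Ω) (hv : v ≠ 0)
    (hin : ∀ᶠ t in 𝓝[>] (0 : ℝ), x - t • v ∈ Ω) :
    tauMinus Ω (x, v) * ‖v‖ ≤ Metric.diam (closure Ω) := by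
  obtain ⟨h1, h2, -⟩ := exit_point hΩ hbd hv hin
  have := Metric.dist_le_diam_of_mem hbd.closure (mem_closure_of_ray hin)
    (frontier_subset_closure h2)
  rwa [dist_eq_norm, sub_sub_cancel, norm_smul, Real.norm_of_nonneg h1.le] at this

theorem ray_of_mem (hΩ : IsOpen Ω) (hx : x ∈ Ω) (v : E d) :
    ∀ᶠ t in 𝓝[>] (0 : ℝ), x - t • v ∈ Ω := by
  have hcont : Continuous fun t : ℝ => x - t • v := by fun_prop
  have := hcont.tendsto 0
  simp only [zero_smul, sub_zero] at this
  exact (this.eventually (hΩ.mem_nhds hx)).filter_mono nhdsWithin_le_nhds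

namespace HasC1Boundary

theorem ray_of_outgoing (hb : HasC1Boundary Ω) (hΩ : IsOpen Ω) (hx : x ∈ frontier Ω)
    (hv : 0 < ⟪v, outerNormal Ω x⟫) : ∀ᶠ t in 𝓝[>] (0 : ℝ), x - t • v ∈ Ω := by
  have h1 := hb.eventually_mem_iff_neg hΩ hx hv
  have hneg : Tendsto (fun t : ℝ => -t) (𝓝 0) (𝓝 0) := by
    simpa using (continuous_neg (G := ℝ)).tendsto 0
  filter_upwards [(hneg.eventually h1).filter_mono nhdsWithin_le_nhds, self_mem_nhdsWithin]
    with t ht htp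
  have htp : 0 < t := htp
  rw [neg_smul, ← sub_eq_add_neg] at ht
  exact ht.2 (by linarith)

/-- At its exit point a backward ray is not outgoing. -/
theorem inner_exit_nonpos (hb : HasC1Boundary Ω) (hΩ : IsOpen Ω) {T : ℝ} (hT : 0 < T)
    (hy : x - T • v ∈ frontier Ω) (hin : ∀ t ∈ Ioo 0 T, x - t • v ∈ Ω) :
    ⟪v, outerNormal Ω (x - T • v)⟫ ≤ 0 := by
  by_contra hpos
  have h1 := (hb.eventually_mem_iff_neg hΩ hy (not_le.1 hpos)).filter_mono
    (nhdsWithin_le_nhds (s := Ioi 0))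
  obtain ⟨t, ht, ht0, htT⟩ := (h1.and (Ioo_mem_nhdsGT hT)).exists
  have h2 := hin (T - t) ⟨by linarith, by linarith⟩
  have h3 : x - T • v + t • v = x - (T - t) • v := by module
  rw [h3] at ht
  linarith [ht.1 h2]

end HasC1Boundary

/-- The set $\{\tau_-<t\}$ is the projection of a countable union of closed sets of triples
$(s,x,v)$ with $0<s<t$, hence σ-compact. To it are added the pairs with $v=0$ and $x\in\Omega$,
where the infimum of the empty set is $0$ by convention. -/
theorem measurable_tauMinus (hΩ : IsOpen Ω) (hbd : Bornology.IsBounded Ω) :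
    Measurable (tauMinus Ω) := by
  refine measurable_of_Iio fun t => ?_
  rcases le_or_gt t 0 with ht | ht
  · have : tauMinus Ω ⁻¹' Iio t = ∅ := by
      ext p
      simp only [mem_preimage, mem_Iio, mem_empty_iff_false, iff_false, not_lt]
      exact ht.trans (tauMinus_nonneg Ω p)
    rw [this]; exact MeasurableSet.empty
  let F : ℕ → Set (ℝ × E d × E d) := fun k =>
    {q | (1 / ((k : ℝ) + 1) ≤ q.1 ∧ q.1 ≤ t - 1 / ((k : ℝ) + 1)) ∧ q.2.1 - q.1 • q.2.2 ∈ Ωᶜ}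
  have hF : ∀ k, MeasurableSet (Prod.snd '' F k) := by
    intro k
    have hcl : IsClosed (F k) := by
      refine IsClosed.inter (IsClosed.inter ?_ ?_) ?_
      · exact isClosed_le continuous_const continuous_fst
      · exact isClosed_le continuous_fst continuous_const
      · exact hΩ.isClosed_compl.preimage (by fun_prop)
    obtain ⟨K, hK, hKU⟩ := (isSigmaCompact_univ.of_isClosed_subset hcl (subset_univ _)).image continuous_snd
    rw [← hKU]
    exact MeasurableSet.iUnion fun i => (hK i).measurableSet
  have hset : tauMinus Ω ⁻¹' Iio t = (Ω ×ˢ {(0 : E d)}) ∪ ⋃ k, Prod.snd '' F k := by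
    ext ⟨x, v⟩
    simp only [mem_preimage, mem_Iio, mem_union, mem_prod, mem_singleton_iff, mem_iUnion,
      mem_image]
    constructor
    · intro hlt
      by_cases hne : {s : ℝ | 0 < s ∧ x - s • v ∉ Ω}.Nonempty
      · right
        obtain ⟨s, ⟨hs0, hsout⟩, hst⟩ := exists_lt_of_csInf_lt hne hlt
        have hm : 0 < min s (t - s) := lt_min hs0 (by linarith)
        obtain ⟨k, hk⟩ := exists_nat_one_div_lt hm
        exact ⟨k, (s, x, v), ⟨⟨(hk.trans_le (min_le_left _ _)).le, by
          have := hk.trans_le (min_le_right _ _)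
          simp only; linarith⟩, hsout⟩, rfl⟩
      · left
        rw [not_nonempty_iff_eq_empty] at hne
        have hv : v = 0 := by
          by_contra hv
          obtain ⟨s, hs⟩ := exists_exit hbd hv x
          have : s ∈ (∅ : Set ℝ) := hne ▸ hs
          exact this
        refine ⟨?_, hv⟩
        by_contra hx
        have : (1 : ℝ) ∈ (∅ : Set ℝ) := hne ▸ ⟨one_pos, by simpa [hv] using hx⟩
        exact this
    · rintro (⟨hx, rfl⟩ | ⟨k, ⟨s, y, w⟩, ⟨⟨h1, h2⟩, h3⟩, heq⟩)
      · have : {s : ℝ | 0 < s ∧ x - s • (0 : E d) ∉ Ω} = ∅ := by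
          ext s; simp [hx]
        rw [tauMinus, this, Real.sInf_empty]; exact ht
      · obtain ⟨rfl, rfl⟩ := Prod.mk.inj heq
        have hk : 0 < 1 / ((k : ℝ) + 1) := by positivity
        simp only at h1 h2
        have hmem : s ∈ {r : ℝ | 0 < r ∧ y - r • w ∉ Ω} := ⟨by linarith, h3⟩
        have hle : tauMinus Ω (y, w) ≤ s := csInf_le ⟨0, fun r hr => hr.1.le⟩ hmem
        linarith
  rw [hset]
  exact (hΩ.measurableSet.prod (measurableSet_singleton 0)).union (MeasurableSet.iUnion hF)

end

/-! ### Countable disjoint covers, and the flux of a fixed velocity -/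

section

/-- The Lindelöf property followed by disjointification; it turns comparisons valid near each point
into sums over countably many pieces. -/
theorem exists_measurable_disjoint_cover {X : Type*} [TopologicalSpace X]
    [SecondCountableTopology X] [MeasurableSpace X] [OpensMeasurableSpace X]
    {N : Set X} {Q : Set X → Prop} (hmono : ∀ A B, A ⊆ B → Q B → Q A) (hempty : Q ∅)
    (hloc : ∀ x ∈ N, ∃ U ∈ 𝓝 x, Q U) :
    ∃ D : ℕ → Set X, (∀ i, MeasurableSet (D i)) ∧ Pairwise (Function.onFun Disjoint D) ∧
      (∀ i, Q (D i)) ∧ N ⊆ ⋃ i, D i := by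
  classical
  choose! U hU hQ using hloc
  obtain ⟨t, htN, htc, hcov⟩ := TopologicalSpace.countable_cover_nhdsWithin
    (f := fun x => interior (U x)) (s := N)
    fun x hx => mem_nhdsWithin_of_mem_nhds (interior_mem_nhds.2 (hU x hx))
  rcases t.eq_empty_or_nonempty with rfl | hne
  · refine ⟨fun _ => ∅, fun _ => MeasurableSet.empty, fun i j _ => disjoint_bot_left,
      fun _ => hempty, ?_⟩
    simpa using hcov
  obtain ⟨f, rfl⟩ := htc.exists_eq_range hne
  refine ⟨disjointed fun i => interior (U (f i)), fun i => ?_, disjoint_disjointed _, fun i => ?_, ?_⟩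
  · exact MeasurableSet.disjointed (fun j => isOpen_interior.measurableSet) i
  · exact hmono _ _ ((disjointed_subset _ i).trans interior_subset) (hQ _ (htN ⟨i, rfl⟩))
  · rw [iUnion_disjointed]
    simpa using hcov

variable {d : ℕ} {Ω : Set (E d)} {x v : E d}

/-! ### The flux through the boundary in a given direction -/

/-- The orthogonal projection along `v`. -/
def shadow (v : E d) : E d →L[ℝ] E d := compression (‖v‖⁻¹ • v) 0

theorem norm_unit (hv : v ≠ 0) : ‖‖v‖⁻¹ • v‖ = 1 := by
  rw [norm_smul, norm_inv, norm_norm, inv_mul_cancel₀ (norm_ne_zero_iff.2 hv)]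

theorem shadow_sub_smul (hv : v ≠ 0) (x : E d) (t : ℝ) : shadow v (x - t • v) = shadow v x := by
  have h0 : shadow v v = 0 := by
    rw [shadow, compression_apply, inner_smul_left, real_inner_self_eq_norm_sq]
    have : ‖v‖ ≠ 0 := norm_ne_zero_iff.2 hv
    rw [smul_smul]
    simp only [conj_trivial]
    have h1 : (1 - 0) * (‖v‖⁻¹ * ‖v‖ ^ 2) * ‖v‖⁻¹ = 1 := by field_simp; norm_num
    rw [h1, one_smul, sub_self]
  rw [map_sub, map_smul, h0, smul_zero, sub_zero]

/-- The flux of the constant velocity field `v` through subsets of the boundary. -/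
def fluxMeasure (Ω : Set (E d)) (v : E d) : Measure (E d) :=
  ((μHE[d - 1] : Measure (E d)).restrict (frontier Ω)).withDensity
    fun x => ENNReal.ofReal |⟪v, outerNormal Ω x⟫|

theorem fluxMeasure_apply {A : Set (E d)} (hA : MeasurableSet A) (hAS : A ⊆ frontier Ω) :
    fluxMeasure Ω v A =
      ∫⁻ x in A, ENNReal.ofReal |⟪v, outerNormal Ω x⟫| ∂(μHE[d - 1] : Measure (E d)) := by
  rw [fluxMeasure, withDensity_apply _ hA, Measure.restrict_restrict hA, inter_eq_left.2 hAS]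

/-- On the subsets of `frontier Ω ∩ U`, the flux of `v` and the measure of the projection along
`v` agree up to the factor `K`. -/
def FluxComparable (Ω : Set (E d)) (v : E d) (K : ℝ) (U : Set (E d)) : Prop :=
  ∀ A ⊆ frontier Ω ∩ U, MeasurableSet A →
    ENNReal.ofReal ‖v‖ * (μHE[d - 1] : Measure (E d)) (shadow v '' A) ≤
      ENNReal.ofReal K * fluxMeasure Ω v A ∧
    fluxMeasure Ω v A ≤
      ENNReal.ofReal K * (ENNReal.ofReal ‖v‖ * (μHE[d - 1] : Measure (E d)) (shadow v '' A))

namespace HasC1Boundary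

/-- The projection along $v$ has area factor $J=|\langle e,n\rangle|$ with $e=v/|v|$, and
$|v|J=|v\cdot n|$. One factor $\kappa=\sqrt K$ pays for the curvature of the boundary, a second one
for the variation of the normal. -/
theorem exists_fluxComparable (hb : HasC1Boundary Ω) (hΩ : IsOpen Ω) (hx : x ∈ frontier Ω)
    (hxv : ⟪v, outerNormal Ω x⟫ ≠ 0) {K : ℝ} (hK : 1 < K) :
    ∃ U ∈ 𝓝 x, FluxComparable Ω v K U := by
  have hv : v ≠ 0 := by rintro rfl; simp at hxv
  have hvn : 0 < ‖v‖ := norm_pos_iff.2 hv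
  set e := ‖v‖⁻¹ • v with he
  have hen : ‖e‖ = 1 := norm_unit hv
  set κ := √K with hκ
  have hκ1 : 1 < κ := Real.lt_sqrt zero_le_one |>.2 (by simpa using hK)
  have hκ0 : 0 ≤ κ := by linarith
  have hκκ : ENNReal.ofReal κ * ENNReal.ofReal κ = ENNReal.ofReal K := by
    rw [← ENNReal.ofReal_mul hκ0, Real.mul_self_sqrt (by linarith)]
  set J := compressionFactor e (outerNormal Ω x) 0 with hJ
  set c := |⟪v, outerNormal Ω x⟫| with hc
  have hc0 : 0 < c := abs_pos.2 hxv
  have hJc : ‖v‖ * J = c := by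
    rw [hJ, compressionFactor_zero, he, inner_smul_left]
    simp only [conj_trivial, abs_mul, abs_inv, abs_norm]
    rw [← mul_assoc, mul_inv_cancel₀ hvn.ne', one_mul]
  have hJ0 : 0 < J := by
    rw [← hJc] at hc0; exact pos_of_mul_pos_right hc0 hvn.le
  obtain ⟨U, hU, hUm⟩ := (hb.isFlatAt hΩ hx).measure_compression hen (hb.norm_outerNormal hΩ hx)
    le_rfl zero_le_one hJ0 (sub_pos.2 hκ1)
  have hcont : ContinuousWithinAt (fun y => |⟪v, outerNormal Ω y⟫|) (frontier Ω) x :=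
    (ContinuousWithinAt.inner continuousWithinAt_const (hb.continuousOn_outerNormal hΩ x hx)).abs
  have hev : ∀ᶠ y in 𝓝[frontier Ω] x, c ≤ κ * |⟪v, outerNormal Ω y⟫| ∧
      |⟪v, outerNormal Ω y⟫| ≤ κ * c := by
    have e1 := hcont.eventually (p := fun t => κ⁻¹ * c < t) (lt_mem_nhds (by
      rw [inv_mul_lt_iff₀ (by linarith)]; nlinarith))
    have e2 := hcont.eventually (p := fun t => t < κ * c) (gt_mem_nhds (by
      change c < κ * c; nlinarith))
    filter_upwards [e1, e2] with y h1 h2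
    refine ⟨?_, h2.le⟩
    rw [inv_mul_lt_iff₀ (by linarith)] at h1
    exact h1.le
  obtain ⟨W, hW, hWs⟩ := mem_nhdsWithin_iff_exists_mem_nhds_inter.1 hev
  refine ⟨U ∩ W, inter_mem hU hW, fun A hA hAm => ?_⟩
  have hAS : A ⊆ frontier Ω := hA.trans inter_subset_left
  have hAb : ∀ y ∈ A, c ≤ κ * |⟪v, outerNormal Ω y⟫| ∧ |⟪v, outerNormal Ω y⟫| ≤ κ * c :=
    fun y hy => hWs ⟨(hA hy).2.2, (hA hy).1⟩
  obtain ⟨m1, m2⟩ := hUm A fun y hy => ⟨(hA hy).1, (hA hy).2.1⟩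
  have hadd : 1 + (κ - 1) = κ := by ring
  rw [hadd] at m1 m2
  rw [fluxMeasure_apply hAm hAS]
  have hmeas : Measurable fun y => ENNReal.ofReal |⟪v, outerNormal Ω y⟫| := by
    have h := hb.measurable_outerNormal hΩ
    fun_prop
  constructor
  · have h1 : ENNReal.ofReal c * (μHE[d - 1] : Measure (E d)) A ≤ ENNReal.ofReal κ *
        ∫⁻ y in A, ENNReal.ofReal |⟪v, outerNormal Ω y⟫| ∂(μHE[d - 1] : Measure (E d)) := by
      rw [← lintegral_const_mul _ hmeas, ← setLIntegral_const]
      refine setLIntegral_mono (hmeas.const_mul _) fun y hy => ?_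
      rw [← ENNReal.ofReal_mul hκ0]
      exact ENNReal.ofReal_le_ofReal (hAb y hy).1
    calc ENNReal.ofReal ‖v‖ * μHE[d - 1] (shadow v '' A)
        ≤ ENNReal.ofReal ‖v‖ * (ENNReal.ofReal (κ * J) * μHE[d - 1] A) := mul_le_mul_right m1 _
      _ = ENNReal.ofReal κ * (ENNReal.ofReal c * μHE[d - 1] A) := by
          rw [← hJc, ENNReal.ofReal_mul hκ0, ENNReal.ofReal_mul hvn.le]; ring
      _ ≤ _ := by
          rw [← hκκ, mul_assoc]
          exact mul_le_mul_right h1 _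
  · calc ∫⁻ y in A, ENNReal.ofReal |⟪v, outerNormal Ω y⟫| ∂(μHE[d - 1] : Measure (E d))
        ≤ ∫⁻ _ in A, ENNReal.ofReal (κ * c) ∂(μHE[d - 1] : Measure (E d)) :=
          setLIntegral_mono measurable_const fun y hy => ENNReal.ofReal_le_ofReal (hAb y hy).2
      _ = ENNReal.ofReal κ * (ENNReal.ofReal ‖v‖ * (ENNReal.ofReal J * μHE[d - 1] A)) := by
          rw [setLIntegral_const, ← hJc, ENNReal.ofReal_mul hκ0, ENNReal.ofReal_mul hvn.le]; ring
      _ ≤ ENNReal.ofReal κ * (ENNReal.ofReal ‖v‖ *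
            (ENNReal.ofReal κ * μHE[d - 1] (shadow v '' A))) :=
          mul_le_mul_right (mul_le_mul_right m2 _) _
      _ = _ := by rw [← hκκ]; ring

theorem exists_cover_fluxComparable (hb : HasC1Boundary Ω) (hΩ : IsOpen Ω) (v : E d) {K : ℝ}
    (hK : 1 < K) :
    ∃ D : ℕ → Set (E d), (∀ i, MeasurableSet (D i)) ∧ Pairwise (Function.onFun Disjoint D) ∧
      (∀ i, FluxComparable Ω v K (D i)) ∧
      {x | x ∈ frontier Ω ∧ ⟪v, outerNormal Ω x⟫ ≠ 0} ⊆ ⋃ i, D i := by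
  refine exists_measurable_disjoint_cover
    (fun A B hAB hB C hC hCm => hB C (hC.trans (inter_subset_inter_right _ hAB)) hCm) ?_
    fun x hx => hb.exists_fluxComparable hΩ hx.1 hx.2 hK
  intro A hA _
  have : A = ∅ := by simpa using hA
  simp [this]

theorem fluxMeasure_eq_zero_iff (hb : HasC1Boundary Ω) (hΩ : IsOpen Ω) (hv : v ≠ 0)
    {A : Set (E d)} (hAm : MeasurableSet A)
    (hA : A ⊆ {x | x ∈ frontier Ω ∧ ⟪v, outerNormal Ω x⟫ ≠ 0}) :
    fluxMeasure Ω v A = 0 ↔ (μHE[d - 1] : Measure (E d)) (shadow v '' A) = 0 := by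
  obtain ⟨D, hDm, -, hDc, hcov⟩ := hb.exists_cover_fluxComparable hΩ v one_lt_two
  have hAU : A = ⋃ i, A ∩ D i := by
    rw [← inter_iUnion, eq_comm, inter_eq_left]; exact hA.trans hcov
  have hcmp := fun i => hDc i (A ∩ D i) (inter_subset_inter_left _ fun x hx => (hA hx).1)
    (hAm.inter (hDm i))
  have hv0 : ENNReal.ofReal ‖v‖ ≠ 0 := by simpa using hv
  constructor
  · intro h
    rw [hAU, image_iUnion, measure_iUnion_null_iff]
    intro i
    have h1 := (hcmp i).1
    rw [measure_mono_null inter_subset_left h, mul_zero, nonpos_iff_eq_zero, mul_eq_zero] at h1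
    exact h1.resolve_left hv0
  · intro h
    rw [hAU, measure_iUnion_null_iff]
    intro i
    have h1 := (hcmp i).2
    rwa [measure_mono_null (image_mono inter_subset_left) h, mul_zero, mul_zero,
      nonpos_iff_eq_zero] at h1

end HasC1Boundary

theorem ENNReal_le_of_forall_one_lt {a b : ℝ≥0∞}
    (h : ∀ K : ℝ, 1 < K → a ≤ ENNReal.ofReal K * (ENNReal.ofReal K * b)) : a ≤ b := by
  have h1 : Tendsto (fun K : ℝ => ENNReal.ofReal K * ENNReal.ofReal K * b) (𝓝[>] 1)
      (𝓝 (ENNReal.ofReal 1 * ENNReal.ofReal 1 * b)) := by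
    have h0 : Tendsto (fun K : ℝ => ENNReal.ofReal K) (𝓝[>] 1) (𝓝 (ENNReal.ofReal 1)) :=
      (ENNReal.continuous_ofReal.tendsto 1).mono_left nhdsWithin_le_nhds
    exact ENNReal.Tendsto.mul_const
      (ENNReal.Tendsto.mul h0 (by simp) h0 (by simp)) (by simp)
  simp only [ENNReal.ofReal_one, one_mul] at h1
  refine ge_of_tendsto h1 ?_
  filter_upwards [self_mem_nhdsWithin] with K hK
  rw [mul_assoc]
  exact h K hK

/-- Sets which are transported into each other along `v` carry the same flux. -/
theorem HasC1Boundary.fluxMeasure_image_eq (hb : HasC1Boundary Ω) (hΩ : IsOpen Ω)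
    {f : E d → E d} (hf : Measurable f) {A : Set (E d)} (hAm : MeasurableSet A)
    (hinj : InjOn f A)
    (hA : A ⊆ {x | x ∈ frontier Ω ∧ ⟪v, outerNormal Ω x⟫ ≠ 0})
    (hfA : MapsTo f A {x | x ∈ frontier Ω ∧ ⟪v, outerNormal Ω x⟫ ≠ 0})
    (hsh : ∀ x ∈ A, shadow v (f x) = shadow v x) :
    fluxMeasure Ω v (f '' A) = fluxMeasure Ω v A := by
  have key : ∀ K : ℝ, 1 < K →
      fluxMeasure Ω v (f '' A) ≤ ENNReal.ofReal K * (ENNReal.ofReal K * fluxMeasure Ω v A) ∧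
      fluxMeasure Ω v A ≤ ENNReal.ofReal K * (ENNReal.ofReal K * fluxMeasure Ω v (f '' A)) := by
    intro K hK
    obtain ⟨D, hDm, hDd, hDc, hcov⟩ := hb.exists_cover_fluxComparable hΩ v hK
    -- On each piece both the set and its image lie in a cell where flux and projected area are
    -- comparable. Their projections coincide, so the fluxes agree up to $K^2$; then $K\to1$.
    let B : ℕ × ℕ → Set (E d) := fun p => A ∩ D p.1 ∩ f ⁻¹' (D p.2)
    have hBA : ∀ p, B p ⊆ A := fun p => inter_subset_left.trans inter_subset_left
    have hBm : ∀ p, MeasurableSet (B p) := fun p => (hAm.inter (hDm _)).inter (hf (hDm _))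
    have hfBm : ∀ p, MeasurableSet (f '' B p) := fun p =>
      (hBm p).image_of_measurable_injOn hf (hinj.mono (hBA p))
    have hBU : ⋃ p, B p = A := by
      refine subset_antisymm (iUnion_subset hBA) fun x hx => ?_
      obtain ⟨i, hi⟩ := mem_iUnion.1 (hcov (hA hx))
      obtain ⟨j, hj⟩ := mem_iUnion.1 (hcov (hfA hx))
      exact mem_iUnion.2 ⟨(i, j), ⟨hx, hi⟩, hj⟩
    have hBd : Pairwise (Function.onFun Disjoint B) := by
      rintro ⟨i, j⟩ ⟨i', j'⟩ hne
      rw [Function.onFun, Set.disjoint_left]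
      rintro x ⟨⟨-, h1⟩, h2⟩ ⟨⟨-, h3⟩, h4⟩
      have e1 : i = i' := by
        by_contra h; exact Set.disjoint_left.1 (hDd h) h1 h3
      have e2 : j = j' := by
        by_contra h; exact Set.disjoint_left.1 (hDd h) h2 h4
      exact hne (by rw [e1, e2])
    have hfBd : Pairwise (Function.onFun Disjoint fun p => f '' B p) := by
      intro p q hne
      rw [Function.onFun, Set.disjoint_left]
      rintro _ ⟨x, hx, rfl⟩ ⟨y, hy, hxy⟩
      have := hinj (hBA q hy) (hBA p hx) hxy
      subst this
      exact Set.disjoint_left.1 (hBd hne) hx hy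
    have s1 : fluxMeasure Ω v A = ∑' p, fluxMeasure Ω v (B p) := by
      rw [← hBU, measure_iUnion hBd hBm]
    have s2 : fluxMeasure Ω v (f '' A) = ∑' p, fluxMeasure Ω v (f '' B p) := by
      rw [← hBU, image_iUnion, measure_iUnion hfBd hfBm]
    have him : ∀ p, shadow v '' (f '' B p) = shadow v '' B p := by
      intro p
      rw [image_image]
      exact image_congr fun x hx => hsh x (hBA p hx)
    have c1 := fun p : ℕ × ℕ => hDc p.1 (B p)
      (fun x hx => ⟨(hA (hBA p hx)).1, hx.1.2⟩) (hBm p)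
    have c2 := fun p : ℕ × ℕ => hDc p.2 (f '' B p)
      (by rintro _ ⟨x, hx, rfl⟩; exact ⟨(hfA (hBA p hx)).1, hx.2⟩) (hfBm p)
    simp only [him] at c2
    rw [s1, s2]
    simp only [← ENNReal.tsum_mul_left]
    exact ⟨ENNReal.tsum_le_tsum fun p => (c2 p).2.trans (mul_le_mul_right (c1 p).1 _),
      ENNReal.tsum_le_tsum fun p => (c1 p).2.trans (mul_le_mul_right (c2 p).1 _)⟩
  exact le_antisymm (ENNReal_le_of_forall_one_lt fun K hK => (key K hK).1)
    (ENNReal_le_of_forall_one_lt fun K hK => (key K hK).2)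

/-! ### Grazing points -/

theorem measure_shadow_le (hv : v ≠ 0) {s : ℝ} (A : Set (E d)) :
    (μHE[d - 1] : Measure (E d)) (shadow v '' A) ≤
      (μHE[d - 1] : Measure (E d)) (compression (‖v‖⁻¹ • v) s '' A) := by
  have h := euclideanHausdorffMeasure_image_le_of_dist_le (d - 1) 1 (shadow v)
    (compression (‖v‖⁻¹ • v) s) A (by
      intro x _ y _
      rw [NNReal.coe_one, one_mul]
      simp only [dist_eq_norm, ← map_sub, shadow]
      rw [← compression_zero_comp (norm_unit hv) s]
      exact norm_compression_le (norm_unit hv) le_rfl zero_le_one _)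
  simpa using h

/-- The projection along `v` of the set of points where `v` is tangent is a null set. -/
theorem HasC1Boundary.measure_shadow_grazing (hb : HasC1Boundary Ω) (hΩ : IsOpen Ω)
    (hbd : Bornology.IsBounded Ω) (hv : v ≠ 0) :
    (μHE[d - 1] : Measure (E d))
      (shadow v '' {x | x ∈ frontier Ω ∧ ⟪v, outerNormal Ω x⟫ = 0}) = 0 := by
  set e := ‖v‖⁻¹ • v with he
  set G := {x | x ∈ frontier Ω ∧ ⟪v, outerNormal Ω x⟫ = 0} with hG
  set π : Measure (E d) := μHE[d - 1]
  have hfin := hb.measure_frontier_lt_top hΩ hbd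
  -- Where $v$ is tangent, compression by $s$ has area factor exactly $s$, so small pieces shrink by
  -- at most $2s$; the full projection shrinks them further. The partial compression is used because
  -- the comparison needs a positive factor, which fails for $s=0$.
  have key : ∀ s : ℝ, 0 < s → s ≤ 1 →
      π (shadow v '' G) ≤ ENNReal.ofReal (2 * s) * π (frontier Ω) := by
    intro s hs hs1
    obtain ⟨D, hDm, hDd, hDc, hcov⟩ := exists_measurable_disjoint_cover (N := G)
      (Q := fun U => ∀ A ⊆ frontier Ω ∩ U, π (compression e s '' A) ≤
        ENNReal.ofReal (2 * s) * π A)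
      (fun A B hAB hB C hC => hB C (hC.trans (inter_subset_inter_right _ hAB)))
      (by intro A hA
          have : A = ∅ := by simpa using hA
          simp [this])
      (by
        intro x hx
        have hxe : ⟪e, outerNormal Ω x⟫ = 0 := by rw [he, inner_smul_left, hx.2, mul_zero]
        have hJ := compressionFactor_of_inner_eq_zero hxe hs.le
        obtain ⟨U, hU, hUm⟩ := (hb.isFlatAt hΩ hx.1).measure_compression (norm_unit hv)
          (hb.norm_outerNormal hΩ hx.1) hs.le hs1 (by rw [hJ]; exact hs) one_pos
        refine ⟨U, hU, fun A hA => (hUm A hA).1.trans_eq ?_⟩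
        rw [hJ, one_add_one_eq_two])
    have hGU : shadow v '' G ⊆ ⋃ i, shadow v '' (frontier Ω ∩ D i) := by
      rw [← image_iUnion, ← inter_iUnion]
      exact image_mono fun x hx => ⟨hx.1, hcov hx⟩
    calc π (shadow v '' G) ≤ ∑' i, π (shadow v '' (frontier Ω ∩ D i)) :=
          (measure_mono hGU).trans (measure_iUnion_le _)
      _ ≤ ∑' i, ENNReal.ofReal (2 * s) * π (frontier Ω ∩ D i) :=
          ENNReal.tsum_le_tsum fun i =>
            (measure_shadow_le hv _).trans (hDc i _ subset_rfl)
      _ = ENNReal.ofReal (2 * s) * ∑' i, π (frontier Ω ∩ D i) := ENNReal.tsum_mul_left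
      _ ≤ _ := by
          refine mul_le_mul_right ?_ _
          rw [← measure_iUnion (fun i j hij => (hDd hij).mono inter_subset_right inter_subset_right)
            fun i => isClosed_frontier.measurableSet.inter (hDm i)]
          exact measure_mono (iUnion_subset fun i => inter_subset_left)
  have hlim : Tendsto (fun s : ℝ => ENNReal.ofReal (2 * s) * π (frontier Ω)) (𝓝[>] 0)
      (𝓝 (ENNReal.ofReal (2 * 0) * π (frontier Ω))) := by
    have h0 : Continuous fun s : ℝ => ENNReal.ofReal (2 * s) :=
      ENNReal.continuous_ofReal.comp (by fun_prop)
    exact ENNReal.Tendsto.mul_const ((h0.tendsto 0).mono_left nhdsWithin_le_nhds)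
      (Or.inr hfin.ne)
  have := ge_of_tendsto hlim (b := π (shadow v '' G)) (by
    filter_upwards [Ioo_mem_nhdsGT one_pos] with s hs using key s hs.1 hs.2.le)
  simpa using this

end

section

variable {d : ℕ} {Ω : Set (E d)} {x v : E d}

/-! ### The ballistic map between the outgoing and the incoming boundary -/

/-- The points of the boundary at which `v` is outgoing. -/
def outgoing (Ω : Set (E d)) (v : E d) : Set (E d) :=
  {x | x ∈ frontier Ω ∧ 0 < ⟪v, outerNormal Ω x⟫}

/-- The points of the boundary at which `v` is incoming. -/
def incoming (Ω : Set (E d)) (v : E d) : Set (E d) :=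
  {x | x ∈ frontier Ω ∧ ⟪v, outerNormal Ω x⟫ < 0}

/-- The point at which the backward ray from `x` in the direction `v` leaves `Ω`. -/
def exitPoint (Ω : Set (E d)) (v x : E d) : E d := x - tauMinus Ω (x, v) • v

theorem measurable_exitPoint (hΩ : IsOpen Ω) (hbd : Bornology.IsBounded Ω) (v : E d) :
    Measurable (exitPoint Ω v) := by
  have h : Measurable fun x : E d => tauMinus Ω (x, v) :=
    (measurable_tauMinus hΩ hbd).comp (by fun_prop)
  exact measurable_id.sub (h.smul_const v)

namespace HasC1Boundary

theorem measurableSet_outgoing (hb : HasC1Boundary Ω) (hΩ : IsOpen Ω) (v : E d) :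
    MeasurableSet (outgoing Ω v) := by
  have h : Measurable fun x => ⟪v, outerNormal Ω x⟫ :=
    measurable_const.inner (hb.measurable_outerNormal hΩ)
  exact isClosed_frontier.measurableSet.inter (measurableSet_lt measurable_const h)

theorem measurableSet_incoming (hb : HasC1Boundary Ω) (hΩ : IsOpen Ω) (v : E d) :
    MeasurableSet (incoming Ω v) := by
  have h : Measurable fun x => ⟪v, outerNormal Ω x⟫ :=
    measurable_const.inner (hb.measurable_outerNormal hΩ)
  exact isClosed_frontier.measurableSet.inter (measurableSet_lt h measurable_const)

theorem exitPoint_spec (hb : HasC1Boundary Ω) (hΩ : IsOpen Ω) (hbd : Bornology.IsBounded Ω)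
    (hv : v ≠ 0) (hx : x ∈ outgoing Ω v) :
    0 < tauMinus Ω (x, v) ∧ exitPoint Ω v x ∈ frontier Ω ∧
      (∀ t ∈ Ioo 0 (tauMinus Ω (x, v)), x - t • v ∈ Ω) ∧
      ⟪v, outerNormal Ω (exitPoint Ω v x)⟫ ≤ 0 := by
  obtain ⟨h1, h2, h3⟩ := exit_point hΩ hbd hv (hb.ray_of_outgoing hΩ hx.1 hx.2)
  exact ⟨h1, h2, h3, hb.inner_exit_nonpos hΩ h1 h2 h3⟩

/-- With a common exit point but different travel times, the starting point of the shorter ray would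
lie on the longer one strictly inside $\Omega$, although it is a boundary point. -/
theorem injOn_exitPoint (hb : HasC1Boundary Ω) (hΩ : IsOpen Ω) (hbd : Bornology.IsBounded Ω)
    (hv : v ≠ 0) : InjOn (exitPoint Ω v) (outgoing Ω v) := by
  have aux : ∀ x ∈ outgoing Ω v, ∀ y ∈ outgoing Ω v, exitPoint Ω v x = exitPoint Ω v y →
      tauMinus Ω (x, v) ≤ tauMinus Ω (y, v) := by
    intro x hx y hy hxy
    by_contra hlt
    push Not at hlt
    obtain ⟨hy0, -, -, -⟩ := hb.exitPoint_spec hΩ hbd hv hy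
    obtain ⟨-, -, hx2, -⟩ := hb.exitPoint_spec hΩ hbd hv hx
    have hmem := hx2 (tauMinus Ω (x, v) - tauMinus Ω (y, v)) ⟨by linarith, by linarith⟩
    have : x - (tauMinus Ω (x, v) - tauMinus Ω (y, v)) • v = y := by
      simp only [exitPoint] at hxy
      rw [sub_smul, ← sub_add, hxy, sub_add_cancel]
    rw [this] at hmem
    exact frontier_subset_compl hΩ hy.1 hmem
  intro x hx y hy hxy
  have ht := le_antisymm (aux x hx y hy hxy) (aux y hy x hx hxy.symm)
  simp only [exitPoint, ht] at hxy
  exact sub_left_injective hxy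

theorem exists_forward_exit (hb : HasC1Boundary Ω) (hΩ : IsOpen Ω)
    (hbd : Bornology.IsBounded Ω) (hv : v ≠ 0) {y : E d}
    (hin : ∀ᶠ t in 𝓝[>] (0 : ℝ), y - t • (-v) ∈ Ω) :
    ∃ T : ℝ, 0 < T ∧ y + T • v ∈ frontier Ω ∧ (∀ t ∈ Ioo 0 T, y + t • v ∈ Ω) ∧
      0 ≤ ⟪v, outerNormal Ω (y + T • v)⟫ := by
  obtain ⟨h1, h2, h3⟩ := exit_point hΩ hbd (neg_ne_zero.2 hv) hin
  have h4 := hb.inner_exit_nonpos hΩ h1 h2 h3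
  simp only [smul_neg, sub_neg_eq_add, inner_neg_left] at h2 h3 h4
  exact ⟨_, h1, h2, h3, by linarith⟩

theorem shadow_subset_grazing_null (hb : HasC1Boundary Ω) (hΩ : IsOpen Ω)
    (hbd : Bornology.IsBounded Ω) (hv : v ≠ 0) {A : Set (E d)} (hAm : MeasurableSet A)
    (hA : A ⊆ {x | x ∈ frontier Ω ∧ ⟪v, outerNormal Ω x⟫ ≠ 0})
    (h : ∀ x ∈ A, ∃ y, y ∈ frontier Ω ∧ ⟪v, outerNormal Ω y⟫ = 0 ∧ shadow v x = shadow v y) :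
    fluxMeasure Ω v A = 0 := by
  rw [hb.fluxMeasure_eq_zero_iff hΩ hv hAm hA]
  refine measure_mono_null ?_ (hb.measure_shadow_grazing hΩ hbd hv)
  rintro _ ⟨x, hx, rfl⟩
  obtain ⟨y, hy1, hy2, hxy⟩ := h x hx
  exact ⟨y, ⟨hy1, hy2⟩, hxy.symm⟩

/-- The ballistic map preserves the flux. -/
theorem fluxMeasure_exitPoint (hb : HasC1Boundary Ω) (hΩ : IsOpen Ω)
    (hbd : Bornology.IsBounded Ω) (hv : v ≠ 0) {B : Set (E d)} (hB : MeasurableSet B) :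
    fluxMeasure Ω v (outgoing Ω v ∩ exitPoint Ω v ⁻¹' B) = fluxMeasure Ω v (incoming Ω v ∩ B) := by
  set f := exitPoint Ω v with hf
  have hfm : Measurable f := measurable_exitPoint hΩ hbd v
  have hout := hb.measurableSet_outgoing hΩ v
  have hinc := hb.measurableSet_incoming hΩ v
  have hnout : outgoing Ω v ⊆ {x | x ∈ frontier Ω ∧ ⟪v, outerNormal Ω x⟫ ≠ 0} :=
    fun x hx => ⟨hx.1, hx.2.ne'⟩
  have hninc : incoming Ω v ⊆ {x | x ∈ frontier Ω ∧ ⟪v, outerNormal Ω x⟫ ≠ 0} :=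
    fun x hx => ⟨hx.1, hx.2.ne⟩
  have hsh : ∀ x, shadow v (f x) = shadow v x := fun x => shadow_sub_smul hv x _
  set A := outgoing Ω v ∩ f ⁻¹' incoming Ω v with hA
  have hAm : MeasurableSet A := hout.inter (hfm hinc)
  have hinj : InjOn f A := (hb.injOn_exitPoint hΩ hbd hv).mono inter_subset_left
  have hfAm : MeasurableSet (f '' A) := hAm.image_of_measurable_injOn hfm hinj
  -- The backward ray of such a point ends at a tangency point with the same projection, so these
  -- points project into a null set.
  have n1 : fluxMeasure Ω v (outgoing Ω v \ A) = 0 := by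
    refine hb.shadow_subset_grazing_null hΩ hbd hv (hout.diff hAm)
      (sdiff_subset.trans hnout) fun x hx => ?_
    obtain ⟨-, h2, -, h4⟩ := hb.exitPoint_spec hΩ hbd hv hx.1
    refine ⟨f x, h2, ?_, (hsh x).symm⟩
    by_contra hne
    exact hx.2 ⟨hx.1, h2, lt_of_le_of_ne h4 hne⟩
  -- Following the ray forward from an incoming point leads either to an outgoing point whose exit
  -- point it is, or to a tangency point.
  have n2 : fluxMeasure Ω v (incoming Ω v \ f '' A) = 0 := by
    refine hb.shadow_subset_grazing_null hΩ hbd hv (hinc.diff hfAm)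
      (sdiff_subset.trans hninc) fun y hy => ?_
    have hray : ∀ᶠ t in 𝓝[>] (0 : ℝ), y - t • (-v) ∈ Ω :=
      hb.ray_of_outgoing hΩ hy.1.1 (by rw [inner_neg_left]; linarith [hy.1.2])
    obtain ⟨T, hT, hfr, hin, hge⟩ := hb.exists_forward_exit hΩ hbd hv hray
    refine ⟨y + T • v, hfr, ?_, ?_⟩
    · by_contra hne
      have hxo : y + T • v ∈ outgoing Ω v := ⟨hfr, lt_of_le_of_ne hge (Ne.symm hne)⟩
      have htau : tauMinus Ω (y + T • v, v) = T := by
        refine tauMinus_eq_of_exit hT ?_ fun t ht => ?_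
        · rw [add_sub_cancel_right]; exact frontier_subset_compl hΩ hy.1.1
        · have := hin (T - t) ⟨by linarith [ht.2], by linarith [ht.1]⟩
          rw [sub_smul, ← add_sub_assoc] at this
          exact this
      have hfx : f (y + T • v) = y := by
        simp only [hf, exitPoint, htau, add_sub_cancel_right]
      exact hy.2 ⟨y + T • v, ⟨hxo, by rw [mem_preimage, hfx]; exact hy.1⟩, hfx⟩
    · have := shadow_sub_smul hv (y + T • v) T
      rw [add_sub_cancel_right] at this
      exact this
  have e1 : fluxMeasure Ω v (outgoing Ω v ∩ f ⁻¹' B) = fluxMeasure Ω v (A ∩ f ⁻¹' B) := by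
    refine le_antisymm ?_ (measure_mono (inter_subset_inter_left _ inter_subset_left))
    have hsub : outgoing Ω v ∩ f ⁻¹' B ⊆ (A ∩ f ⁻¹' B) ∪ (outgoing Ω v \ A) := by
      rintro x ⟨h1, h2⟩
      by_cases hx : x ∈ A
      · exact Or.inl ⟨hx, h2⟩
      · exact Or.inr ⟨h1, hx⟩
    refine (measure_mono hsub).trans ((measure_union_le _ _).trans ?_)
    rw [n1, add_zero]
  have e2 : fluxMeasure Ω v (incoming Ω v ∩ B) = fluxMeasure Ω v (f '' A ∩ B) := by
    have hfA : f '' A ⊆ incoming Ω v := by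
      rintro _ ⟨x, hx, rfl⟩; exact hx.2
    refine le_antisymm ?_ (measure_mono (inter_subset_inter_left _ hfA))
    have hsub : incoming Ω v ∩ B ⊆ (f '' A ∩ B) ∪ (incoming Ω v \ f '' A) := by
      rintro x ⟨h1, h2⟩
      by_cases hx : x ∈ f '' A
      · exact Or.inl ⟨hx, h2⟩
      · exact Or.inr ⟨h1, hx⟩
    refine (measure_mono hsub).trans ((measure_union_le _ _).trans ?_)
    rw [n2, add_zero]
  rw [e1, e2, ← image_inter_preimage]
  refine (hb.fluxMeasure_image_eq hΩ hfm (hAm.inter (hfm hB)) (hinj.mono inter_subset_left)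
    (fun x hx => hnout hx.1.1) (fun x hx => hninc hx.1.2) fun x _ => hsh x).symm

/-- Every direction carries a positive flux through the boundary. -/
theorem fluxMeasure_outgoing_ne_zero (hb : HasC1Boundary Ω) (hΩ : IsOpen Ω)
    (hbd : Bornology.IsBounded Ω) (hne : Ω.Nonempty) (hv : v ≠ 0) :
    fluxMeasure Ω v (outgoing Ω v) ≠ 0 := by
  intro h0
  rw [hb.fluxMeasure_eq_zero_iff hΩ hv (hb.measurableSet_outgoing hΩ v)
    fun x hx => ⟨hx.1, hx.2.ne'⟩] at h0
  -- The forward ray from a point of $\Omega$ leaves at an outgoing or a tangency point. If the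
  -- outgoing part were negligible, the projection of $\Omega$ would be null, but it contains a ball
  -- of the hyperplane.
  have hsub : shadow v '' Ω ⊆ shadow v '' outgoing Ω v ∪
      shadow v '' {x | x ∈ frontier Ω ∧ ⟪v, outerNormal Ω x⟫ = 0} := by
    rintro _ ⟨z, hz, rfl⟩
    obtain ⟨T, hT, hfr, -, hge⟩ := hb.exists_forward_exit hΩ hbd hv (ray_of_mem hΩ hz (-v))
    have hsh : shadow v (z + T • v) = shadow v z := by
      have := shadow_sub_smul hv (z + T • v) T
      rw [add_sub_cancel_right] at this
      exact this.symm
    rcases hge.lt_or_eq with h | h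
    · exact Or.inl ⟨z + T • v, ⟨hfr, h⟩, hsh⟩
    · exact Or.inr ⟨z + T • v, ⟨hfr, h.symm⟩, hsh⟩
  have hnull : (μHE[d - 1] : Measure (E d)) (shadow v '' Ω) = 0 :=
    measure_mono_null hsub (measure_union_null h0 (hb.measure_shadow_grazing hΩ hbd hv))
  set e := ‖v‖⁻¹ • v with he
  have hen : ‖e‖ = 1 := norm_unit hv
  have hnull' : (volume : Measure (ℝ ∙ e)ᗮ) (hyperplaneProj e hen '' Ω) = 0 := by
    rw [← InnerProductSpace.euclideanHausdorffMeasure_eq_volume, finrank_hyperplane hen,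
      ← measure_proj_image hen]
    exact hnull
  obtain ⟨z, hz⟩ := hne
  obtain ⟨r, hr, hball⟩ := Metric.isOpen_iff.1 hΩ z hz
  have hsub : Metric.ball (hyperplaneProj e hen z) r ⊆ hyperplaneProj e hen '' Ω := by
    intro u hu
    rw [Metric.mem_ball, Subtype.dist_eq, dist_eq_norm] at hu
    have hcomp : ∀ w : (ℝ ∙ e)ᗮ, compression e 0 (w : E d) = w := by
      intro w
      rw [compression_apply, Submodule.mem_orthogonal_singleton_iff_inner_right.1 w.2]
      simp
    refine ⟨z + ((u : E d) - hyperplaneProj e hen z), hball ?_, ?_⟩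
    · rw [Metric.mem_ball, dist_eq_norm, add_sub_cancel_left]; exact hu
    · apply Subtype.ext
      change compression e 0 (z + ((u : E d) - hyperplaneProj e hen z)) = u
      rw [map_add, map_sub, hcomp, hcomp]
      simp [hyperplaneProj]
  exact (Metric.measure_ball_pos volume (hyperplaneProj e hen z) hr).ne'
    (measure_mono_null hsub hnull')

end HasC1Boundary

end

section

variable {d : ℕ} {Ω : Set (E d)} {m : Measure (E d)}

/-! ### The measures on the phase space boundary -/

theorem HasC1Boundary.measurable_flux_comp {α : Type*} [MeasurableSpace α]
    (hb : HasC1Boundary Ω) (hΩ : IsOpen Ω) {a b : α → E d} (ha : Measurable a)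
    (hb' : Measurable b) : Measurable fun q => ⟪b q, outerNormal Ω (a q)⟫ :=
  hb'.inner ((hb.measurable_outerNormal hΩ).comp ha)

theorem HasC1Boundary.measurable_fluxDensity_comp {α : Type*} [MeasurableSpace α]
    (hb : HasC1Boundary Ω) (hΩ : IsOpen Ω) {a b : α → E d} (ha : Measurable a)
    (hb' : Measurable b) : Measurable fun q => ENNReal.ofReal |⟪b q, outerNormal Ω (a q)⟫| := by
  have h := hb.measurable_flux_comp hΩ ha hb'
  simp only [← Real.norm_eq_abs]
  exact h.norm.ennreal_ofReal

theorem HasC1Boundary.measurable_flux (hb : HasC1Boundary Ω) (hΩ : IsOpen Ω) :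
    Measurable fun p : E d × E d => ⟪p.2, outerNormal Ω p.1⟫ :=
  hb.measurable_flux_comp hΩ measurable_fst measurable_snd

theorem HasC1Boundary.measurable_fluxDensity (hb : HasC1Boundary Ω) (hΩ : IsOpen Ω) :
    Measurable fun p : E d × E d => ENNReal.ofReal |⟪p.2, outerNormal Ω p.1⟫| :=
  hb.measurable_fluxDensity_comp hΩ measurable_fst measurable_snd

theorem HasC1Boundary.measurableSet_GammaPlus (hb : HasC1Boundary Ω) (hΩ : IsOpen Ω)
    (m : Measure (E d)) : MeasurableSet (GammaPlus Ω m) := by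
  have h1 : MeasurableSet {p : E d × E d | p.1 ∈ frontier Ω} :=
    measurable_fst isClosed_frontier.measurableSet
  have h2 : MeasurableSet {p : E d × E d | p.2 ∈ m.support} :=
    measurable_snd Measure.isClosed_support.measurableSet
  exact h1.inter (h2.inter (measurableSet_lt measurable_const (hb.measurable_flux hΩ)))

theorem HasC1Boundary.measurableSet_GammaMinus (hb : HasC1Boundary Ω) (hΩ : IsOpen Ω)
    (m : Measure (E d)) : MeasurableSet (GammaMinus Ω m) := by
  have h1 : MeasurableSet {p : E d × E d | p.1 ∈ frontier Ω} :=
    measurable_fst isClosed_frontier.measurableSet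
  have h2 : MeasurableSet {p : E d × E d | p.2 ∈ m.support} :=
    measurable_snd Measure.isClosed_support.measurableSet
  exact h1.inter (h2.inter (measurableSet_lt (hb.measurable_flux hΩ) measurable_const))

namespace PhaseSpace

theorem ae_muPlus_mem (h : PhaseSpace Ω m) : ∀ᵐ p ∂(muPlus Ω m), p ∈ GammaPlus Ω m :=
  ae_restrict_mem (h.boundary.measurableSet_GammaPlus h.isOpen m)

theorem ne_zero_of_mem_GammaPlus {p : E d × E d} (hp : p ∈ GammaPlus Ω m) : p.2 ≠ 0 := by
  intro h0
  have := hp.2.2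
  rw [h0, inner_zero_left] at this
  exact lt_irrefl _ this

theorem tauMinus_pos (h : PhaseSpace Ω m) {p : E d × E d} (hp : p ∈ GammaPlus Ω m) :
    0 < tauMinus Ω p :=
  (exit_point h.isOpen h.isBounded (ne_zero_of_mem_GammaPlus hp)
    (h.boundary.ray_of_outgoing h.isOpen hp.1 hp.2.2)).1

theorem tauMinus_mul_le (h : PhaseSpace Ω m) {p : E d × E d} (hp : p ∈ GammaPlus Ω m) :
    tauMinus Ω p * ‖p.2‖ ≤ Metric.diam (closure Ω) :=
  tauMinus_mul_norm_le h.isOpen h.isBounded (ne_zero_of_mem_GammaPlus hp)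
    (h.boundary.ray_of_outgoing h.isOpen hp.1 hp.2.2)

theorem isFiniteMeasure_surface (h : PhaseSpace Ω m) :
    IsFiniteMeasure ((μHE[d - 1] : Measure (E d)).restrict (frontier Ω)) :=
  ⟨by
    rw [Measure.restrict_apply_univ]
    exact h.boundary.measure_frontier_lt_top h.isOpen h.isBounded⟩

theorem ae_muMinus_of_ae_surface (h : PhaseSpace Ω m) {Q : E d → Prop}
    (hQ : ∀ᵐ x ∂(μHE[d - 1] : Measure (E d)).restrict (frontier Ω), Q x) :
    ∀ᵐ p ∂(muMinus Ω m), Q p.1 := by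
  have := h.isFiniteMeasure_surface
  have h1 : ∀ᵐ p ∂(((μHE[d - 1] : Measure (E d)).restrict (frontier Ω)).prod m), Q p.1 :=
    Measure.quasiMeasurePreserving_fst.ae hQ
  exact ae_restrict_of_ae ((withDensity_absolutelyContinuous _ _).ae_le h1)

variable [SigmaFinite m]

theorem sigmaFinite_boundaryMeasure (h : PhaseSpace Ω m) :
    SigmaFinite (boundaryMeasure Ω m) := by
  have := h.isFiniteMeasure_surface
  exact SigmaFinite.withDensity_of_ne_top (ae_of_all _ fun p => ENNReal.ofReal_ne_top)

theorem sigmaFinite_muPlus (h : PhaseSpace Ω m) : SigmaFinite (muPlus Ω m) := by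
  have := h.sigmaFinite_boundaryMeasure
  unfold muPlus
  infer_instance

theorem boundaryMeasure_apply (h : PhaseSpace Ω m) {B : Set (E d × E d)} (hB : MeasurableSet B) :
    boundaryMeasure Ω m B = ∫⁻ v, fluxMeasure Ω v {x | (x, v) ∈ B} ∂m := by
  have := h.isFiniteMeasure_surface
  have hf := h.boundary.measurable_fluxDensity h.isOpen
  rw [boundaryMeasure, withDensity_apply _ hB, ← lintegral_indicator hB,
    lintegral_prod_symm' _ (hf.indicator hB)]
  refine lintegral_congr fun v => ?_
  have hBv : MeasurableSet {x | (x, v) ∈ B} := measurable_prodMk_right hB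
  rw [fluxMeasure, withDensity_apply _ hBv, ← lintegral_indicator hBv]
  rfl

theorem muPlus_apply (h : PhaseSpace Ω m) {B : Set (E d × E d)} (hB : MeasurableSet B) :
    muPlus Ω m B = ∫⁻ v, fluxMeasure Ω v (outgoing Ω v ∩ {x | (x, v) ∈ B}) ∂m := by
  rw [muPlus, Measure.restrict_apply hB,
    h.boundaryMeasure_apply (hB.inter (h.boundary.measurableSet_GammaPlus h.isOpen m))]
  refine lintegral_congr_ae ?_
  filter_upwards [Measure.support_mem_ae] with v hv
  congr 1
  ext x
  simp only [GammaPlus, outgoing, mem_inter_iff, mem_ofPred_eq]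
  tauto

theorem muMinus_apply (h : PhaseSpace Ω m) {B : Set (E d × E d)} (hB : MeasurableSet B) :
    muMinus Ω m B = ∫⁻ v, fluxMeasure Ω v (incoming Ω v ∩ {x | (x, v) ∈ B}) ∂m := by
  rw [muMinus, Measure.restrict_apply hB,
    h.boundaryMeasure_apply (hB.inter (h.boundary.measurableSet_GammaMinus h.isOpen m))]
  refine lintegral_congr_ae ?_
  filter_upwards [Measure.support_mem_ae] with v hv
  congr 1
  ext x
  simp only [GammaMinus, incoming, mem_inter_iff, mem_ofPred_eq]
  tauto

end PhaseSpace

/-- The ballistic map from the outgoing to the incoming part of the boundary. -/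
def ballistic (Ω : Set (E d)) (p : E d × E d) : E d × E d := (p.1 - tauMinus Ω p • p.2, p.2)

namespace PhaseSpace

variable [SigmaFinite m]

/-- The velocity is unchanged along a flight, so the measures are sliced by velocity and each slice
is handled by the flux identity; the slice $v=0$ carries no flux on either side. -/
theorem measurePreserving_ballistic (h : PhaseSpace Ω m) :
    MeasurePreserving (ballistic Ω) (muPlus Ω m) (muMinus Ω m) := by
  have hm : Measurable (ballistic Ω) :=
    (measurable_fst.sub ((measurable_tauMinus h.isOpen h.isBounded).smul measurable_snd)).prodMk
      measurable_snd
  refine ⟨hm, Measure.ext fun B hB => ?_⟩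
  rw [Measure.map_apply hm hB, h.muPlus_apply (hm hB), h.muMinus_apply hB]
  refine lintegral_congr fun v => ?_
  rcases eq_or_ne v 0 with rfl | hv
  · simp [outgoing, incoming]
  · exact h.boundary.fluxMeasure_exitPoint h.isOpen h.isBounded hv
      (B := {x | (x, v) ∈ B}) (measurable_prodMk_right hB)

/-- Slow particles carry a positive flux. -/
theorem muPlus_slow_ne_zero (h : PhaseSpace Ω m) {r : ℝ} (hr : 0 < r) :
    muPlus Ω m {p | ‖p.2‖ < r} ≠ 0 := by
  have hB : MeasurableSet {p : E d × E d | ‖p.2‖ < r} :=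
    measurableSet_lt measurable_snd.norm measurable_const
  have := h.isFiniteMeasure_surface
  rw [muPlus, Measure.restrict_apply hB,
    h.boundaryMeasure_apply (hB.inter (h.boundary.measurableSet_GammaPlus h.isOpen m))]
  intro h0
  have hmeas : Measurable fun v => fluxMeasure Ω v
      {x | (x, v) ∈ {p : E d × E d | ‖p.2‖ < r} ∩ GammaPlus Ω m} := by
    have hBm := hB.inter (h.boundary.measurableSet_GammaPlus h.isOpen m)
    have hf := (h.boundary.measurable_fluxDensity h.isOpen).indicator hBm
    convert hf.lintegral_prod_left'
      (μ := (μHE[d - 1] : Measure (E d)).restrict (frontier Ω)) using 2 with v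
    have hBv : MeasurableSet
        {x | (x, v) ∈ {p : E d × E d | ‖p.2‖ < r} ∩ GammaPlus Ω m} := measurable_prodMk_right hBm
    rw [fluxMeasure, withDensity_apply _ hBv, ← lintegral_indicator hBv]
    rfl
  rw [lintegral_eq_zero_iff hmeas] at h0
  have hne : ∀ᵐ v ∂m, v ≠ 0 := by
    rw [ae_iff]; simpa using h.measure_zero
  have hae : ∀ᵐ v ∂m, v ∉ m.support ∩ Metric.ball 0 r := by
    filter_upwards [h0, hne] with v h1 hv0 hv
    refine h.boundary.fluxMeasure_outgoing_ne_zero h.isOpen h.isBounded h.nonempty hv0 ?_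
    refine measure_mono_null (fun x hx => ?_) h1
    exact ⟨by simpa using hv.2, hx.1, hv.1, hx.2⟩
  have hz : m (m.support ∩ Metric.ball 0 r) = 0 := by
    rw [ae_iff] at hae
    simpa only [not_not, ofPred_mem_eq] using hae
  exact (h.measure_ball_pos r hr).ne' hz

theorem lintegral_muPlus (h : PhaseSpace Ω m) {g : E d × E d → ℝ≥0∞} (hg : Measurable g) :
    ∫⁻ p, g p ∂(muPlus Ω m) = ∫⁻ x in frontier Ω, ∫⁻ v in {v | (x, v) ∈ GammaPlus Ω m},
      g (x, v) * ENNReal.ofReal |⟪v, outerNormal Ω x⟫| ∂m ∂(μHE[d - 1] : Measure (E d)) := by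
  have := h.isFiniteMeasure_surface
  have hf := h.boundary.measurable_fluxDensity h.isOpen
  have hG := h.boundary.measurableSet_GammaPlus h.isOpen m
  rw [muPlus, ← lintegral_indicator hG, boundaryMeasure,
    lintegral_withDensity_eq_lintegral_mul _ hf (hg.indicator hG),
    lintegral_prod _ (hf.mul (hg.indicator hG)).aemeasurable]
  refine lintegral_congr fun x => ?_
  have hGx : MeasurableSet {v | (x, v) ∈ GammaPlus Ω m} := measurable_prodMk_left hG
  rw [← lintegral_indicator hGx]
  refine lintegral_congr fun v => ?_
  by_cases hv : (x, v) ∈ GammaPlus Ω m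
  · simp [hv, mul_comm]
  · simp [hv]

theorem lintegral_muMinus (h : PhaseSpace Ω m) {g : E d × E d → ℝ≥0∞} (hg : Measurable g) :
    ∫⁻ p, g p ∂(muMinus Ω m) = ∫⁻ x in frontier Ω, ∫⁻ v in {v | (x, v) ∈ GammaMinus Ω m},
      g (x, v) * ENNReal.ofReal |⟪v, outerNormal Ω x⟫| ∂m ∂(μHE[d - 1] : Measure (E d)) := by
  have := h.isFiniteMeasure_surface
  have hf := h.boundary.measurable_fluxDensity h.isOpen
  have hG := h.boundary.measurableSet_GammaMinus h.isOpen m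
  rw [muMinus, ← lintegral_indicator hG, boundaryMeasure,
    lintegral_withDensity_eq_lintegral_mul _ hf (hg.indicator hG),
    lintegral_prod _ (hf.mul (hg.indicator hG)).aemeasurable]
  refine lintegral_congr fun x => ?_
  have hGx : MeasurableSet {v | (x, v) ∈ GammaMinus Ω m} := measurable_prodMk_left hG
  rw [← lintegral_indicator hGx]
  refine lintegral_congr fun v => ?_
  by_cases hv : (x, v) ∈ GammaMinus Ω m
  · simp [hv, mul_comm]
  · simp [hv]

/-- A property which holds almost everywhere on `Γ₊` holds on almost all its fibres. -/
theorem ae_fibre_of_ae_muPlus (h : PhaseSpace Ω m) {Q : E d × E d → Prop}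
    (hQ : ∀ᵐ p ∂(muPlus Ω m), Q p) :
    ∀ᵐ x ∂(μHE[d - 1] : Measure (E d)).restrict (frontier Ω),
      ∀ᵐ v ∂m.restrict {v | (x, v) ∈ GammaPlus Ω m}, Q (x, v) := by
  have := h.isFiniteMeasure_surface
  have hf := h.boundary.measurable_fluxDensity h.isOpen
  have hG := h.boundary.measurableSet_GammaPlus h.isOpen m
  rw [muPlus, ae_restrict_iff' hG, boundaryMeasure, ae_withDensity_iff hf] at hQ
  filter_upwards [Measure.ae_ae_of_ae_prod hQ] with x hx
  have hGx : MeasurableSet {v | (x, v) ∈ GammaPlus Ω m} := measurable_prodMk_left hG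
  rw [ae_restrict_iff' hGx]
  filter_upwards [hx] with v hv hmem
  refine hv ?_ hmem
  simpa using hmem.2.2.ne'

end PhaseSpace

end

section

variable {d : ℕ} {Ω : Set (E d)} {m : Measure (E d)} {k : E d → E d → E d → ℝ}

/-! ### Diffuse boundary operators -/

/-- `k` is a stochastic scattering kernel on the boundary. -/
structure IsStochasticKernel (Ω : Set (E d)) (m : Measure (E d)) (k : E d → E d → E d → ℝ) :
    Prop where
  meas : Measurable fun q : E d × E d × E d => k q.1 q.2.1 q.2.2
  nonneg : ∀ x v v', 0 ≤ k x v v'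
  mass : ∀ᵐ p ∂(muPlus Ω m), ∫⁻ v in {v | (p.1, v) ∈ GammaMinus Ω m},
    ENNReal.ofReal (k p.1 v p.2 * |⟪v, outerNormal Ω p.1⟫|) ∂m = 1

/-- The action of a scattering kernel on nonnegative functions. -/
def scatter (Ω : Set (E d)) (m : Measure (E d)) (k : E d → E d → E d → ℝ)
    (g : E d × E d → ℝ≥0∞) (p : E d × E d) : ℝ≥0∞ :=
  ∫⁻ v' in {v' | (p.1, v') ∈ GammaPlus Ω m},
    ENNReal.ofReal (k p.1 p.2 v') * g (p.1, v') * ENNReal.ofReal |⟪v', outerNormal Ω p.1⟫| ∂m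

theorem enorm_complex_ofReal {r : ℝ} (hr : 0 ≤ r) : ‖(r : ℂ)‖ₑ = ENNReal.ofReal r := by
  rw [← ofReal_norm, Complex.norm_real, Real.norm_of_nonneg hr]

theorem IsStochasticKernel.measurable_comp {α : Type*} [MeasurableSpace α]
    (hk : IsStochasticKernel Ω m k) {a b c : α → E d} (ha : Measurable a) (hb : Measurable b)
    (hc : Measurable c) : Measurable fun q => k (a q) (b q) (c q) :=
  hk.meas.comp (ha.prodMk (hb.prodMk hc))

theorem lintegral_enorm_lt_top (ψ : L1plus Ω m) : ∫⁻ p, ‖ψ p‖ₑ ∂(muPlus Ω m) < ∞ :=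
  (L1_integrable ψ).2

theorem measurable_enorm_coe (ψ : L1plus Ω m) : Measurable fun q => ‖ψ q‖ₑ :=
  (Lp.stronglyMeasurable ψ).measurable.enorm

/-- `H` is the integral operator with kernel `k`. -/
def HasKernel (H : L1plus Ω m →L[ℂ] L1minus Ω m) (k : E d → E d → E d → ℝ) : Prop :=
  ∀ ψ : L1plus Ω m, ∀ᵐ p ∂(muMinus Ω m),
    H ψ p = ∫ v' in {v' | (p.1, v') ∈ GammaPlus Ω m},
      (k p.1 p.2 v' : ℂ) * ψ (p.1, v') * ((|⟪v', outerNormal Ω p.1⟫| : ℝ) : ℂ) ∂m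

theorem HasKernel.enorm_le {H : L1plus Ω m →L[ℂ] L1minus Ω m} (hH : HasKernel H k)
    (hk : IsStochasticKernel Ω m k) (ψ : L1plus Ω m) :
    ∀ᵐ p ∂(muMinus Ω m), ‖H ψ p‖ₑ ≤ scatter Ω m k (fun q => ‖ψ q‖ₑ) p := by
  filter_upwards [hH ψ] with p hp
  rw [hp]
  refine (enorm_integral_le_lintegral_enorm _).trans_eq (lintegral_congr fun v' => ?_)
  rw [enorm_mul, enorm_mul, enorm_complex_ofReal (hk.nonneg _ _ _),
    enorm_complex_ofReal (abs_nonneg _)]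

variable [SigmaFinite m] {g g' : E d × E d → ℝ≥0∞}

theorem IsStochasticKernel.measurable_scatter (hk : IsStochasticKernel Ω m k)
    (h : PhaseSpace Ω m) (hg : Measurable g) : Measurable (scatter Ω m k g) := by
  have hG := h.boundary.measurableSet_GammaPlus h.isOpen m
  have hpair : Measurable fun q : (E d × E d) × E d => (q.1.1, q.2) := by fun_prop
  have h1 : Measurable fun q : (E d × E d) × E d => ENNReal.ofReal (k q.1.1 q.1.2 q.2) :=
    (hk.measurable_comp measurable_fst.fst measurable_fst.snd measurable_snd).ennreal_ofReal
  have h2 : Measurable fun q : (E d × E d) × E d => g (q.1.1, q.2) := hg.comp hpair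
  have h3 : Measurable fun q : (E d × E d) × E d =>
      ENNReal.ofReal |⟪q.2, outerNormal Ω q.1.1⟫| :=
    h.boundary.measurable_fluxDensity_comp h.isOpen measurable_fst.fst measurable_snd
  have hS : MeasurableSet {q : (E d × E d) × E d | (q.1.1, q.2) ∈ GammaPlus Ω m} := hpair hG
  have hF := (((h1.mul h2).mul h3).indicator hS).lintegral_prod_right' (ν := m)
  convert hF using 2 with p
  have hGx : MeasurableSet {v' | (p.1, v') ∈ GammaPlus Ω m} := measurable_prodMk_left hG
  rw [scatter, ← lintegral_indicator hGx]
  rfl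

/-- A stochastic kernel preserves the mass. -/
theorem IsStochasticKernel.lintegral_scatter (hk : IsStochasticKernel Ω m k)
    (h : PhaseSpace Ω m) (hg : Measurable g) :
    ∫⁻ p, scatter Ω m k g p ∂(muMinus Ω m) = ∫⁻ p, g p ∂(muPlus Ω m) := by
  rw [h.lintegral_muMinus (hk.measurable_scatter h hg), h.lintegral_muPlus hg]
  refine lintegral_congr_ae ?_
  filter_upwards [h.ae_fibre_of_ae_muPlus hk.mass] with x hx
  have hw : Measurable fun v => ENNReal.ofReal |⟪v, outerNormal Ω x⟫| :=
    h.boundary.measurable_fluxDensity_comp h.isOpen measurable_const measurable_id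
  have hgx : Measurable fun v' => g (x, v') := hg.comp measurable_prodMk_left
  have hkm : Measurable fun q : E d × E d => ENNReal.ofReal (k x q.1 q.2) :=
    (hk.measurable_comp measurable_const measurable_fst measurable_snd).ennreal_ofReal
  have hkv : ∀ v, Measurable fun v' => ENNReal.ofReal (k x v v') := fun v =>
    
    (hk.measurable_comp measurable_const measurable_const measurable_id).ennreal_ofReal
  have hkv' : ∀ v', Measurable fun v => ENNReal.ofReal (k x v v') := fun v' =>
    
    (hk.measurable_comp measurable_const measurable_id measurable_const).ennreal_ofReal
  calc ∫⁻ v in {v | (x, v) ∈ GammaMinus Ω m},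
        scatter Ω m k g (x, v) * ENNReal.ofReal |⟪v, outerNormal Ω x⟫| ∂m
      = ∫⁻ v in {v | (x, v) ∈ GammaMinus Ω m}, ∫⁻ v' in {v' | (x, v') ∈ GammaPlus Ω m},
          ENNReal.ofReal (k x v v') * g (x, v') * ENNReal.ofReal |⟪v', outerNormal Ω x⟫| *
            ENNReal.ofReal |⟪v, outerNormal Ω x⟫| ∂m ∂m := by
        refine lintegral_congr fun v => ?_
        exact (lintegral_mul_const _ (((hkv v).mul hgx).mul hw)).symm
    _ = ∫⁻ v' in {v' | (x, v') ∈ GammaPlus Ω m}, ∫⁻ v in {v | (x, v) ∈ GammaMinus Ω m},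
          ENNReal.ofReal (k x v v') * g (x, v') * ENNReal.ofReal |⟪v', outerNormal Ω x⟫| *
            ENNReal.ofReal |⟪v, outerNormal Ω x⟫| ∂m ∂m := by
        refine lintegral_lintegral_swap (Measurable.aemeasurable ?_)
        exact ((hkm.mul (hgx.comp measurable_snd)).mul
          (h.boundary.measurable_fluxDensity_comp h.isOpen measurable_const measurable_snd)).mul
          (h.boundary.measurable_fluxDensity_comp h.isOpen measurable_const measurable_fst)
    _ = ∫⁻ v' in {v' | (x, v') ∈ GammaPlus Ω m},
          g (x, v') * ENNReal.ofReal |⟪v', outerNormal Ω x⟫| ∂m := by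
        refine lintegral_congr_ae ?_
        filter_upwards [hx] with v' hv'
        simp only [ENNReal.ofReal_mul (hk.nonneg _ _ _)] at hv'
        calc ∫⁻ v in {v | (x, v) ∈ GammaMinus Ω m},
              ENNReal.ofReal (k x v v') * g (x, v') * ENNReal.ofReal |⟪v', outerNormal Ω x⟫| *
                ENNReal.ofReal |⟪v, outerNormal Ω x⟫| ∂m
            = ∫⁻ v in {v | (x, v) ∈ GammaMinus Ω m},
              g (x, v') * ENNReal.ofReal |⟪v', outerNormal Ω x⟫| *
                (ENNReal.ofReal (k x v v') * ENNReal.ofReal |⟪v, outerNormal Ω x⟫|) ∂m :=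
              lintegral_congr fun v => by ring
          _ = g (x, v') * ENNReal.ofReal |⟪v', outerNormal Ω x⟫| *
              ∫⁻ v in {v | (x, v) ∈ GammaMinus Ω m},
                ENNReal.ofReal (k x v v') * ENNReal.ofReal |⟪v, outerNormal Ω x⟫| ∂m :=
              lintegral_const_mul _ ((hkv' v').mul hw)
          _ = _ := by rw [hv', mul_one]

/-- Scattering is local in $x$: it only sees the fibre over the boundary point, and a negligible set
in $\Gamma_+$ meets almost every fibre in a negligible set. -/
theorem scatter_mono_ae (h : PhaseSpace Ω m) (hgg' : ∀ᵐ p ∂(muPlus Ω m), g p ≤ g' p) :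
    ∀ᵐ p ∂(muMinus Ω m), scatter Ω m k g p ≤ scatter Ω m k g' p := by
  filter_upwards [h.ae_muMinus_of_ae_surface (h.ae_fibre_of_ae_muPlus hgg')] with p hp
  refine lintegral_mono_ae ?_
  filter_upwards [hp] with v' hv'
  gcongr

theorem HasKernel.eq_of_isNonneg {H : L1plus Ω m →L[ℂ] L1minus Ω m} (hH : HasKernel H k)
    (hk : IsStochasticKernel Ω m k) (h : PhaseSpace Ω m) {ψ : L1plus Ω m} (hψ : IsNonneg ψ) :
    ∀ᵐ p ∂(muMinus Ω m), H ψ p = ((scatter Ω m k (fun q => ‖ψ q‖ₑ) p).toReal : ℂ) := by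
  filter_upwards [hH ψ, h.ae_muMinus_of_ae_surface (h.ae_fibre_of_ae_muPlus hψ)] with p hp hp'
  have hψm : Measurable fun v' => ψ (p.1, v') :=
    (Lp.stronglyMeasurable ψ).measurable.comp measurable_prodMk_left
  have hw : Measurable fun v' => ⟪v', outerNormal Ω p.1⟫ :=
    h.boundary.measurable_flux_comp h.isOpen measurable_const measurable_id
  have hkm : Measurable fun v' => k p.1 p.2 v' :=
    hk.measurable_comp measurable_const measurable_const measurable_id
  have hint : ∫ v' in {v' | (p.1, v') ∈ GammaPlus Ω m},
      (k p.1 p.2 v' : ℂ) * ψ (p.1, v') * ((|⟪v', outerNormal Ω p.1⟫| : ℝ) : ℂ) ∂m =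
      ∫ v' in {v' | (p.1, v') ∈ GammaPlus Ω m},
        ((k p.1 p.2 v' * ‖ψ (p.1, v')‖ * |⟪v', outerNormal Ω p.1⟫| : ℝ) : ℂ) ∂m := by
    refine integral_congr_ae ?_
    filter_upwards [hp'] with v' hv'
    rw [hv']
    push_cast
    simp
  rw [hp, hint, integral_complex_ofReal, integral_eq_lintegral_of_nonneg_ae
    (ae_of_all _ fun v' => mul_nonneg (mul_nonneg (hk.nonneg _ _ _) (norm_nonneg _))
      (abs_nonneg _))
    (by
      simp only [← Real.norm_eq_abs]
      exact ((hkm.mul hψm.norm).mul hw.norm).aestronglyMeasurable)]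
  congr 2
  refine lintegral_congr fun v' => ?_
  rw [ENNReal.ofReal_mul (mul_nonneg (hk.nonneg _ _ _) (norm_nonneg _)),
    ENNReal.ofReal_mul (hk.nonneg _ _ _), ofReal_norm]

section

variable {H : L1plus Ω m →L[ℂ] L1minus Ω m}

theorem HasKernel.isNonneg (hH : HasKernel H k) (hk : IsStochasticKernel Ω m k)
    (h : PhaseSpace Ω m) {ψ : L1plus Ω m} (hψ : IsNonneg ψ) : IsNonneg (H ψ) := by
  filter_upwards [hH.eq_of_isNonneg hk h hψ] with p hp
  rw [hp, Complex.norm_real, Real.norm_of_nonneg ENNReal.toReal_nonneg]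

/-- The comparison is made for extended nonnegative integrals. Conservation of mass makes the larger
one finite almost everywhere, which allows the return to norms. -/
theorem HasKernel.norm_le_of_le (hH : HasKernel H k) (hk : IsStochasticKernel Ω m k)
    (h : PhaseSpace Ω m) {ψ φ : L1plus Ω m} (hφ : IsNonneg φ)
    (hle : ∀ᵐ p ∂(muPlus Ω m), ‖ψ p‖ ≤ ‖φ p‖) :
    ∀ᵐ p ∂(muMinus Ω m), ‖H ψ p‖ ≤ ‖H φ p‖ := by
  have hle' : ∀ᵐ p ∂(muPlus Ω m), ‖ψ p‖ₑ ≤ ‖φ p‖ₑ := hle.mono fun p hp =>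
    enorm_le_iff_norm_le.2 hp
  have hfin : ∀ᵐ p ∂(muMinus Ω m), scatter Ω m k (fun q => ‖φ q‖ₑ) p < ∞ := by
    refine ae_lt_top (hk.measurable_scatter h (measurable_enorm_coe φ)) ?_
    rw [hk.lintegral_scatter h (measurable_enorm_coe φ)]
    exact (lintegral_enorm_lt_top φ).ne
  filter_upwards [hH.enorm_le hk ψ, scatter_mono_ae (k := k) h hle', hH.eq_of_isNonneg hk h hφ,
    hfin] with p h1 h2 h3 h4
  rw [← enorm_le_iff_norm_le]
  refine h1.trans (h2.trans_eq ?_)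
  rw [h3, enorm_complex_ofReal ENNReal.toReal_nonneg, ENNReal.ofReal_toReal h4.ne]

theorem integral_of_isNonneg {X : Type*} [MeasurableSpace X] {μ : Measure X} {ψ : Lp ℂ 1 μ}
    (hψ : IsNonneg ψ) : ∫ p, ψ p ∂μ = (((∫⁻ p, ‖ψ p‖ₑ ∂μ).toReal : ℝ) : ℂ) := by
  have h1 : ∫ p, ψ p ∂μ = ∫ p, ((‖ψ p‖ : ℝ) : ℂ) ∂μ := integral_congr_ae hψ
  rw [h1, integral_complex_ofReal, integral_norm_eq_lintegral_enorm (L1_integrable ψ).1]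

theorem HasKernel.integral_of_isNonneg (hH : HasKernel H k) (hk : IsStochasticKernel Ω m k)
    (h : PhaseSpace Ω m) {ψ : L1plus Ω m} (hψ : IsNonneg ψ) :
    ∫ p, H ψ p ∂(muMinus Ω m) = ∫ p, ψ p ∂(muPlus Ω m) := by
  have hm := hk.measurable_scatter h (measurable_enorm_coe ψ)
  have hl := hk.lintegral_scatter h (measurable_enorm_coe ψ)
  rw [integral_congr_ae (hH.eq_of_isNonneg hk h hψ), integral_complex_ofReal,
    integral_toReal hm.aemeasurable (ae_lt_top hm (by
      rw [hl]; exact (lintegral_enorm_lt_top ψ).ne)), hl, Kinetic.integral_of_isNonneg hψ]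

/-- Every element of `L¹` is a combination of four nonnegative ones. -/
theorem exists_nonneg_decomposition {X : Type*} [MeasurableSpace X] {μ : Measure X}
    (ψ : Lp ℂ 1 μ) : ∃ a b a' b' : Lp ℂ 1 μ, IsNonneg a ∧ IsNonneg b ∧ IsNonneg a' ∧
      IsNonneg b' ∧ ψ = (a - b) + Complex.I • (a' - b') := by
  have hre : Integrable (fun p => (ψ p).re) μ := (L1_integrable ψ).re
  have him : Integrable (fun p => (ψ p).im) μ := (L1_integrable ψ).im
  have aux : ∀ f : X → ℝ, Integrable f μ → Integrable (fun p => ((max (f p) 0 : ℝ) : ℂ)) μ :=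
    fun f hf => hf.pos_part.ofReal
  have nn : ∀ f : X → ℝ, Integrable f μ → IsNonneg (ofFun μ fun p => ((max (f p) 0 : ℝ) : ℂ)) := by
    intro f hf
    filter_upwards [coeFn_ofFun (aux f hf)] with p hp
    rw [hp, Complex.norm_real, Real.norm_of_nonneg (le_max_right _ _)]
  refine ⟨_, _, _, _, nn _ hre, nn _ hre.neg, nn _ him, nn _ him.neg, ?_⟩
  apply Lp.ext
  filter_upwards [coeFn_ofFun (aux _ hre), coeFn_ofFun (aux _ hre.neg), coeFn_ofFun (aux _ him),
    coeFn_ofFun (aux _ him.neg),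
    Lp.coeFn_add (ofFun μ (fun p => ((max ((ψ p).re) 0 : ℝ) : ℂ)) -
      ofFun μ (fun p => ((max ((-fun p => (ψ p).re) p) 0 : ℝ) : ℂ)))
      (Complex.I • (ofFun μ (fun p => ((max ((ψ p).im) 0 : ℝ) : ℂ)) -
      ofFun μ (fun p => ((max ((-fun p => (ψ p).im) p) 0 : ℝ) : ℂ)))),
    Lp.coeFn_sub (ofFun μ (fun p => ((max ((ψ p).re) 0 : ℝ) : ℂ)))
      (ofFun μ (fun p => ((max ((-fun p => (ψ p).re) p) 0 : ℝ) : ℂ))),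
    Lp.coeFn_sub (ofFun μ (fun p => ((max ((ψ p).im) 0 : ℝ) : ℂ)))
      (ofFun μ (fun p => ((max ((-fun p => (ψ p).im) p) 0 : ℝ) : ℂ))),
    Lp.coeFn_smul Complex.I (ofFun μ (fun p => ((max ((ψ p).im) 0 : ℝ) : ℂ)) -
      ofFun μ (fun p => ((max ((-fun p => (ψ p).im) p) 0 : ℝ) : ℂ)))]
    with p h1 h2 h3 h4 h5 h6 h7 h8
  rw [h5, Pi.add_apply, h8, Pi.smul_apply, h6, h7, Pi.sub_apply, Pi.sub_apply, h1, h2, h3, h4]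
  have hmax : ∀ t : ℝ, max t 0 - max (-t) 0 = t := fun t => by
    rcases le_total 0 t with ht | ht
    · rw [max_eq_left ht, max_eq_right (by linarith)]; ring
    · rw [max_eq_right ht, max_eq_left (by linarith)]; ring
  simp only [Pi.neg_apply, ← Complex.ofReal_sub, hmax, smul_eq_mul]
  rw [mul_comm]
  exact (Complex.re_add_im _).symm

theorem HasKernel.integral_eq (hH : HasKernel H k) (hk : IsStochasticKernel Ω m k)
    (h : PhaseSpace Ω m) (ψ : L1plus Ω m) :
    integralCLM (muMinus Ω m) (H ψ) = integralCLM (muPlus Ω m) ψ := by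
  have key : ∀ φ : L1plus Ω m, IsNonneg φ →
      integralCLM (muMinus Ω m) (H φ) = integralCLM (muPlus Ω m) φ := fun φ hφ => by
    rw [integralCLM_apply, integralCLM_apply]
    exact hH.integral_of_isNonneg hk h hφ
  obtain ⟨a, b, a', b', ha, hb, ha', hb', rfl⟩ := exists_nonneg_decomposition ψ
  simp only [map_add, map_sub, map_smul, key _ ha, key _ hb, key _ ha', key _ hb']

end

end

section

variable {d : ℕ} {Ω : Set (E d)} {m : Measure (E d)} [SigmaFinite m]

/-! ### The flight operators -/

/-- Composition with the measure preserving ballistic map is an isometry of the $L^1$ spaces, and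
the exponential is a multiplier bounded by $1$. -/
theorem PhaseSpace.exists_isFlightOperator (h : PhaseSpace Ω m) {l : ℂ} (hl : 0 ≤ l.re) :
    ∃ M : L1minus Ω m →L[ℂ] L1plus Ω m, IsFlightOperator Ω m l M := by
  have hτ : Measurable fun p => ((tauMinus Ω p : ℝ) : ℂ) :=
    Complex.measurable_ofReal.comp (measurable_tauMinus h.isOpen h.isBounded)
  have hb : AEStronglyMeasurable (fun p => Complex.exp (-(l * (tauMinus Ω p : ℂ))))
      (muPlus Ω m) :=
    (Complex.measurable_exp.comp (hτ.const_mul l).neg).aestronglyMeasurable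
  have hC : ∀ᵐ p ∂(muPlus Ω m), ‖Complex.exp (-(l * (tauMinus Ω p : ℂ)))‖ ≤ 1 := by
    refine ae_of_all _ fun p => ?_
    rw [norm_exp_neg_mul, Real.exp_le_one_iff, neg_nonpos]
    exact mul_nonneg hl (tauMinus_nonneg Ω p)
  refine ⟨(mulCLM (muPlus Ω m) _ hb 1 hC).comp
    (Lp.compMeasurePreservingₗᵢ ℂ (ballistic Ω)
      h.measurePreserving_ballistic).toContinuousLinearMap, fun u => ?_⟩
  filter_upwards [coeFn_mulCLM hb hC
      (Lp.compMeasurePreserving (ballistic Ω) h.measurePreserving_ballistic u),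
    Lp.coeFn_compMeasurePreserving u h.measurePreserving_ballistic] with p h1 h2
  rw [h2] at h1
  exact h1

theorem PhaseSpace.isFlightOperator_flight (h : PhaseSpace Ω m) {l : ℂ} (hl : 0 ≤ l.re) :
    IsFlightOperator Ω m l (flight Ω m l) := by
  have hex := h.exists_isFlightOperator hl
  rw [flight, dif_pos hex]
  exact hex.choose_spec

theorem PhaseSpace.flight_zero_apply (h : PhaseSpace Ω m) (u : L1minus Ω m) :
    ∀ᵐ p ∂(muPlus Ω m), flight Ω m 0 u p = u (ballistic Ω p) := by
  filter_upwards [h.isFlightOperator_flight (l := 0) le_rfl u] with p hp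
  rw [hp, zero_mul, neg_zero, Complex.exp_zero, one_mul]
  rfl

theorem PhaseSpace.isNonneg_flight_zero (h : PhaseSpace Ω m) {u : L1minus Ω m}
    (hu : IsNonneg u) : IsNonneg (flight Ω m 0 u) := by
  filter_upwards [h.flight_zero_apply u,
    h.measurePreserving_ballistic.quasiMeasurePreserving.ae hu] with p h1 h2
  rw [h1]; exact h2

theorem PhaseSpace.norm_flight_zero_le (h : PhaseSpace Ω m) {u u' : L1minus Ω m}
    (hu : ∀ᵐ p ∂(muMinus Ω m), ‖u p‖ ≤ ‖u' p‖) :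
    ∀ᵐ p ∂(muPlus Ω m), ‖flight Ω m 0 u p‖ ≤ ‖flight Ω m 0 u' p‖ := by
  filter_upwards [h.flight_zero_apply u, h.flight_zero_apply u',
    h.measurePreserving_ballistic.quasiMeasurePreserving.ae hu] with p h1 h2 h3
  rw [h1, h2]; exact h3

theorem PhaseSpace.integral_flight_zero (h : PhaseSpace Ω m) (u : L1minus Ω m) :
    integralCLM (muPlus Ω m) (flight Ω m 0 u) = integralCLM (muMinus Ω m) u := by
  have hmp := h.measurePreserving_ballistic
  rw [integralCLM_apply, integralCLM_apply, integral_congr_ae (h.flight_zero_apply u)]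
  have hu : AEStronglyMeasurable u ((muPlus Ω m).map (ballistic Ω)) := by
    rw [hmp.map_eq]; exact (L1_integrable u).1
  rw [← integral_map hmp.measurable.aemeasurable hu, hmp.map_eq]

/-- The sets of slow particles decrease to a null set as the speed bound tends to zero, yet each has
positive measure, because $m$ charges every ball about $0$. -/
theorem PhaseSpace.exists_small_set (h : PhaseSpace Ω m) {w : E d × E d → ℝ}
    (hw : IsWeight (muPlus Ω m) w) {δ : ℝ} (hδ : 0 < δ) :
    ∃ B, MeasurableSet B ∧ weighted (muPlus Ω m) w B ≤ ENNReal.ofReal δ ∧ muPlus Ω m B ≠ 0 := by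
  have := hw.isFiniteMeasure
  let B : ℕ → Set (E d × E d) := fun n => {p | ‖p.2‖ < 1 / ((n : ℝ) + 1)}
  have hB : ∀ n, MeasurableSet (B n) := fun n =>
    measurableSet_lt measurable_snd.norm measurable_const
  have hanti : Antitone B := fun i j hij p hp => by
    have hp : ‖p.2‖ < 1 / ((j : ℝ) + 1) := hp
    refine lt_of_lt_of_le hp ?_
    exact one_div_le_one_div_of_le (by positivity) (by exact_mod_cast Nat.succ_le_succ hij)
  have hnull : weighted (muPlus Ω m) w (⋂ n, B n) = 0 := by
    refine withDensity_absolutelyContinuous _ _ ?_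
    have hae : ∀ᵐ p ∂(muPlus Ω m), p ∉ ⋂ n, B n := by
      filter_upwards [h.ae_muPlus_mem] with p hp hmem
      have hpos : 0 < ‖p.2‖ := norm_pos_iff.2 (PhaseSpace.ne_zero_of_mem_GammaPlus hp)
      obtain ⟨n, hn⟩ := exists_nat_one_div_lt hpos
      exact lt_irrefl _ (lt_trans (mem_iInter.1 hmem n) hn)
    rw [ae_iff] at hae
    simpa only [not_not, ofPred_mem_eq] using hae
  have hlim := tendsto_measure_iInter_atTop (μ := weighted (muPlus Ω m) w)
    (fun n => (hB n).nullMeasurableSet) hanti ⟨0, measure_ne_top _ _⟩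
  rw [hnull] at hlim
  obtain ⟨n, hn⟩ := (hlim.eventually (ge_mem_nhds (ENNReal.ofReal_pos.2 hδ))).exists
  exact ⟨B n, hB n, hn, h.muPlus_slow_ne_zero (by positivity)⟩

/-! ### The boundary operator and its flights as a transport family -/

theorem inv_le_max_one_inv_pow {t : ℝ} (ht : 0 < t) (n : ℕ) :
    t⁻¹ ≤ max 1 ((t ^ (n + 1))⁻¹) := by
  rcases le_or_gt 1 t with h | h
  · exact le_max_of_le_left (inv_le_one_of_one_le₀ h)
  · refine le_max_of_le_right (inv_anti₀ (by positivity) ?_)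
    rw [pow_succ]
    exact mul_le_of_le_one_left ht.le (pow_le_one₀ ht.le h.le)

section

variable {H : L1plus Ω m →L[ℂ] L1minus Ω m}

theorem PhaseSpace.MH_zero_apply (h : PhaseSpace Ω m) (ψ : L1plus Ω m) :
    ∀ᵐ p ∂(muPlus Ω m), MH H 0 ψ p = H ψ (ballistic Ω p) :=
  h.flight_zero_apply (H ψ)

theorem PhaseSpace.MH_apply (h : PhaseSpace Ω m) {l : ℂ} (hl : 0 ≤ l.re) (ψ : L1plus Ω m) :
    ∀ᵐ p ∂(muPlus Ω m),
      MH H l ψ p = Complex.exp (-(l * (tauMinus Ω p : ℂ))) * MH H 0 ψ p := by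
  filter_upwards [h.isFlightOperator_flight hl (H ψ), h.MH_zero_apply (H := H) ψ] with p h1 h2
  rw [h2]
  exact h1

theorem PhaseSpace.isStochastic_MH_zero (h : PhaseSpace Ω m) {k : E d → E d → E d → ℝ}
    (hk : IsStochasticKernel Ω m k) (hH : HasKernel H k) : IsStochastic (MH H 0) where
  nonneg _ hφ := h.isNonneg_flight_zero (hH.isNonneg hk h hφ)
  dom _ _ hφ hle := h.norm_flight_zero_le (hH.norm_le_of_le hk h hφ hle)
  mass ψ := (h.integral_flight_zero (H ψ)).trans (hH.integral_eq hk h ψ)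

/-- A flight lasts at most $\mathrm{diam}/|v|$, and $|v|^{-1}\le\max(1,|v|^{-n-1})$ for every
$n\ge0$. As the velocity is unchanged by the flight, the weighted bound on $\Gamma_-$ transfers to
$\Gamma_+$. -/
theorem PhaseSpace.integrable_tauMinus_mul (h : PhaseSpace Ω m) {n : ℕ}
    (hY : MapsBoundedlyToY H (n + 1)) :
    ∃ C : ℝ, 0 ≤ C ∧ ∀ ψ : L1plus Ω m,
      Integrable (fun p => tauMinus Ω p * ‖MH H 0 ψ p‖) (muPlus Ω m) ∧
      ∫ p, tauMinus Ω p * ‖MH H 0 ψ p‖ ∂(muPlus Ω m) ≤ C * ‖ψ‖ := by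
  obtain ⟨C, hC⟩ := hY
  set D := Metric.diam (closure Ω) with hD
  have hD0 : 0 ≤ D := Metric.diam_nonneg
  refine ⟨D * C, by positivity, fun ψ => ?_⟩
  have hτ := measurable_tauMinus h.isOpen h.isBounded
  have hnn : ∀ p, 0 ≤ tauMinus Ω p * ‖MH H 0 ψ p‖ := fun p =>
    mul_nonneg (tauMinus_nonneg Ω p) (norm_nonneg _)
  have hm : Measurable fun p => tauMinus Ω p * ‖MH H 0 ψ p‖ :=
    hτ.mul (Lp.stronglyMeasurable _).measurable.norm
  have hY : Measurable fun p : E d × E d =>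
      ENNReal.ofReal (max 1 ((‖p.2‖ ^ (n + 1))⁻¹)) * ‖H ψ p‖ₑ :=
    (measurable_const.max (measurable_snd.norm.pow_const _).inv).ennreal_ofReal.mul
      (Lp.stronglyMeasurable _).measurable.enorm
  have hle : ∫⁻ p, ENNReal.ofReal (tauMinus Ω p * ‖MH H 0 ψ p‖) ∂(muPlus Ω m) ≤
      ENNReal.ofReal D * (C * ‖ψ‖ₑ) := by
    calc ∫⁻ p, ENNReal.ofReal (tauMinus Ω p * ‖MH H 0 ψ p‖) ∂(muPlus Ω m)
        ≤ ∫⁻ p, ENNReal.ofReal D *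
            (ENNReal.ofReal (max 1 ((‖(ballistic Ω p).2‖ ^ (n + 1))⁻¹)) *
              ‖H ψ (ballistic Ω p)‖ₑ) ∂(muPlus Ω m) := by
          refine lintegral_mono_ae ?_
          filter_upwards [h.ae_muPlus_mem, h.MH_zero_apply (H := H) ψ] with p hp h2
          have hpos : 0 < ‖p.2‖ := norm_pos_iff.2 (PhaseSpace.ne_zero_of_mem_GammaPlus hp)
          rw [h2, ENNReal.ofReal_mul (tauMinus_nonneg Ω p), ofReal_norm, ← mul_assoc,
            ← ENNReal.ofReal_mul hD0]
          refine mul_le_mul_left (ENNReal.ofReal_le_ofReal ?_) _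
          calc tauMinus Ω p ≤ D * ‖p.2‖⁻¹ := by
                rw [← div_eq_mul_inv, le_div_iff₀ hpos]; exact h.tauMinus_mul_le hp
            _ ≤ _ := mul_le_mul_of_nonneg_left (inv_le_max_one_inv_pow hpos n) hD0
      _ = ENNReal.ofReal D * ∫⁻ p, ENNReal.ofReal (max 1 ((‖p.2‖ ^ (n + 1))⁻¹)) *
            ‖H ψ p‖ₑ ∂(muMinus Ω m) := by
          rw [← h.measurePreserving_ballistic.lintegral_comp hY]
          exact lintegral_const_mul _ (hY.comp h.measurePreserving_ballistic.measurable)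
      _ ≤ _ := mul_le_mul_right (hC ψ) _
  have hfin : ENNReal.ofReal D * (C * ‖ψ‖ₑ) ≠ ∞ :=
    ENNReal.mul_ne_top ENNReal.ofReal_ne_top (ENNReal.mul_ne_top ENNReal.coe_ne_top enorm_ne_top)
  refine ⟨⟨hm.aestronglyMeasurable, ?_⟩, ?_⟩
  · rw [hasFiniteIntegral_iff_ofReal (ae_of_all _ hnn)]
    exact hle.trans_lt hfin.lt_top
  · rw [integral_eq_lintegral_of_nonneg_ae (ae_of_all _ hnn) hm.aestronglyMeasurable]
    refine (ENNReal.toReal_mono hfin hle).trans_eq ?_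
    rw [ENNReal.toReal_mul, ENNReal.toReal_mul, ENNReal.toReal_ofReal hD0, ENNReal.coe_toReal,
      toReal_enorm, mul_assoc]

/-- The operators `M_l H` form a transport family. -/
theorem BoundaryAssumptions.exists_isTransportFamily (h : PhaseSpace Ω m)
    (hH : BoundaryAssumptions H) :
    ∃ w, IsTransportFamily (muPlus Ω m) w (tauMinus Ω) (MH H) := by
  have := h.sigmaFinite_muPlus
  obtain ⟨w, hw0, hwm, hwi⟩ := exists_weight (muPlus Ω m)
  have hw : IsWeight (muPlus Ω m) w := ⟨hw0, hwm, hwi⟩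
  obtain ⟨k, hkm, hk0, hk1, hkH⟩ := hH.diffuse
  have hst := h.isStochastic_MH_zero (H := H) ⟨hkm, hk0, hk1⟩ hkH
  obtain ⟨n, hn⟩ := hH.gain
  refine ⟨w, hw, (measurable_tauMinus h.isOpen h.isBounded).aemeasurable,
    h.ae_muPlus_mem.mono fun p hp => h.tauMinus_pos hp, fun l hl ψ => h.MH_apply hl ψ, hst,
    hH.irreducible, h.integrable_tauMinus_mul hn, ?_, hH.power_integrable,
    fun δ hδ => h.exists_small_set hw hδ⟩
  -- Regrouping puts the weakly compact operator on the right; the remaining flight is bounded,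
  -- hence weakly continuous.
  have hcomp : (MH H 0).comp (MH H 0) = (flight Ω m 0).comp (H.comp (MH H 0)) := by
    rw [MH, ContinuousLinearMap.comp_assoc]
  have happ : ∀ f, flight Ω m 0 ((H.comp (MH H 0)) f) = MH H 0 (MH H 0 f) := fun f => by
    rw [← ContinuousLinearMap.comp_apply, ← hcomp, ContinuousLinearMap.comp_apply]
  rw [hcomp]
  refine IsWeaklyCompact.equiIntegrable_comp hw hH.weakly_compact (flight Ω m 0)
    (fun f hf => ?_) fun f => ?_
  · rw [happ]
    exact hst.nonneg _ (hst.nonneg _ hf)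
  rw [happ, happ]
  refine hst.dom (MH H 0 f) (MH H 0 (modulus f)) (hst.nonneg _ (isNonneg_modulus f)) ?_
  refine hst.dom f (modulus f) (isNonneg_modulus f) ?_
  exact (norm_coeFn_modulus f).mono fun p hp => hp.ge

end

end

end Kinetic

end

/-! ### The main theorem -/

open Kinetic in
theorem proposition4p6 {d : ℕ} (Ω : Set (E d)) (m : Measure (E d)) [SigmaFinite m]
    (hΩ : PhaseSpace Ω m) (H : L1plus Ω m →L[ℂ] L1minus Ω m) (hH : BoundaryAssumptions H) :
    -- the spectrum of `M_l H` on the closed right half-plane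
    (∀ l : ℂ, 0 ≤ l.re →
      ∃ (J : Set ℕ) (ν : ℕ → ℂ),
        spectrum ℂ (MH H l) = {0} ∪ ν '' J ∧
        InjOn ν J ∧
        (∀ j ∈ J, ν j ≠ 0 ∧ IsEigenvalue (MH H l) (ν j) ∧
          ∃ n : ℕ, IsIsolatedOfAlgMult (MH H l) (ν j) n) ∧
        (∀ z : ℂ, AccPt z (𝓟 (ν '' J)) → z = 0) ∧
        (l ≠ 0 → ∀ j ∈ J, ‖ν j‖ < 1)) ∧
    -- the normalised positive eigenfunction of `M_0 H`
    ∃ φ₀ : L1plus Ω m,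
      ((∀ᵐ p ∂(muPlus Ω m), 0 < (φ₀ p).re ∧ (φ₀ p).im = 0) ∧
        MH H 0 φ₀ = φ₀ ∧ ∫ p, φ₀ p ∂(muPlus Ω m) = 1) ∧
      -- the simple eigenvalue near `1`, with its eigenfunctions
      ∃ ε : ℝ, 0 < ε ∧ ∃ δ₀ : ℝ, 0 < δ₀ ∧
      ∃ (ν ν' : ℂ → ℂ) (φ : ℂ → L1plus Ω m) (φs : ℂ → LinfPlus Ω m),
        (∀ l : ℂ, 0 ≤ l.re → ‖l‖ ≤ δ₀ →
          spectrum ℂ (MH H l) ∩ {z | ‖z - 1‖ < ε} = {ν l} ∧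
          IsIsolatedOfAlgMult (MH H l) (ν l) 1 ∧
          φ l ≠ 0 ∧ MH H l (φ l) = ν l • φ l ∧
          φs l ≠ 0 ∧ ∀ ψ : L1plus Ω m, bracket (MH H l ψ) (φs l) = ν l * bracket ψ (φs l)) ∧
        Tendsto ν (𝓝[closedRHP] 0) (𝓝 1) ∧
        Tendsto (fun l => ‖φ l - φ₀‖) (𝓝[closedRHP] 0) (𝓝 0) ∧
        Tendsto (fun l => ‖φs l - onePlus Ω m‖) (𝓝[closedRHP] 0) (𝓝 0) ∧
        -- the derivative of the eigenvalue
        (∀ δ : ℝ, 0 < δ → rect δ ⊆ Metric.ball 0 δ₀ →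
          (∀ l ∈ rect δ, HasDerivWithinAt ν (ν' l) (rect δ) l) ∧
          Tendsto ν' (𝓝[rect δ] 0)
            (𝓝 ((-(∫ p, tauMinus Ω p * (φ₀ p).re ∂(muPlus Ω m)) : ℝ) : ℂ))) ∧
        Integrable (fun p => tauMinus Ω p * (φ₀ p).re) (muPlus Ω m) ∧
        -(∫ p, tauMinus Ω p * (φ₀ p).re ∂(muPlus Ω m)) < 0 := by
  have := hΩ.sigmaFinite_muPlus
  obtain ⟨w, hT⟩ := hH.exists_isTransportFamily hΩ
  exact ⟨fun l hl => hT.spectrum_structure hl, hT.perturbation⟩
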